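/- Let $D=(0,2\pi)^2$ with coordinates $(x,y)$, let $g\in\mathbb R$, $\vec g=(g,0,0)$, and let $\rho_0=\rho_0(x)$ be smooth on $[0,2\pi]$ with $\rho_0\ge c>0$. All fields depend on $(t,x,y)$ and are $2\pi$-periodic in $y$. Put $\|f\|_s^2=\sum_{|\alpha|\le s}\iint_D\rho_0|\partial^\alpha f|^2\,dx\,dy$ ($\alpha$ a multi-index in $(x,y)$, $s\in\mathbb N_0$), and $\|(\sigma,v,B)\|_s^2=\|\sigma\|_s^2+\sum_{i=1}^3\|v_i\|_s^2+\sum_{i=1}^3\|B_i\|_s^2$. Consider the linearized ideal MHD system around the steady state $(\rho_0,0,B_0)$, $$\sigma_t+\nabla\cdot(\rho_0v)=0,\quad \rho_0v_t=(\nabla\times B_0)\times B+(\nabla\times B)\times B_0-\nabla p+\sigma\vec g,\quad B_t=\nabla\times(v\times B_0),\quad \nabla\cdot B=0,$$ in one of the following three cases. In each, $\Lambda^2$ and $\lambda_k^2$ ($k=1,2,\dots$) are suprema over nonzero functions, and the $H^1,H^2$ spaces consist of periodic functions. 1. Incompressible, $B_0=(0,0,B_0(x))$ with $B_0(x)$ smooth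 on $[0,2\pi]$: $\nabla\cdot v=0$; $$\Lambda^2=\sup_{w\in L^2(D)}\frac{\iint_D-g\rho_0'w^2}{\iint_D\rho_0w^2},\qquad \lambda_k^2=\sup_{u\in H^1(0,2\pi)}\frac{\int_0^{2\pi}-g\rho_0'u^2}{\int_0^{2\pi}\rho_0(u^2+u'^2/k^2)}.$$ 2. Compressible, $B_0=(0,0,B_0(x))$ with $B_0(x)$ smooth on $[0,2\pi]$: pressure law $P(\rho)=K\rho^\gamma$ with $K,\gamma>0$, $p_0=P(\rho_0)$, $(p_0+\frac12B_0^2)'=g\rho_0$ on $(0,2\pi)$, and $p=P'(\rho_0)\sigma$; with $a=\gamma p_0+B_0^2$ and $h=g^2\rho_0^2/a-g\rho_0'$, $$\Lambda^2=\sup_{w\in L^2(D)}\frac{\iint_D h\,w^2}{\iint_D\rho_0w^2},\qquad \lambda_k^2=\sup_{u_1\in H^1,\,u_2\in L^2}\frac{\int_0^{2\pi}\big[-a\,(u_1'+ku_2+\tfrac{g\rho_0}{a}u_1)^2+h\,u_1^2\big]}{\int_0^{2\pi}\rho_0(u_1^2+u_2^2)}.$$ 3. Incompressible, $B_0=(b,0,0)$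 with $b$ constant: $\nabla\cdot v=0$, $v_3=B_3=0$; $$\Lambda^2=\sup_{w\in H^1(D)}\frac{\iint_D(-g\rho_0'w^2-b^2w_x^2)}{\iint_D\rho_0w^2},\qquad \lambda_k^2=\sup_{u\in H^2(0,2\pi)}\frac{\int_0^{2\pi}\big[-b^2u''^2/k^2-g\rho_0'u^2-b^2u'^2\big]}{\int_0^{2\pi}\rho_0(u^2+u'^2/k^2)}.$$ The conditions in $x$ on a solution are: in cases 1 and 2, $v_1$ and the total pressure perturbation $p+B_0\cdot B$ take the same values at $x=0$ and $x=2\pi$; in case 3, $v$, $B$ and $p$ do. In each case, if $\Lambda^2>0$, then $$\Lambda^2=\sup_{k\ge1}\lambda_k^2=\lim_{k\to\infty}\lambda_k^2,$$ and for every integer $s\ge0$ there is a constant $C$, depending only on the steady state (including $g$ and the pressure law) and on $s$, such that every solution $(\sigma,v,B)\in C([0,\infty);H^{s+2}(D))$ (time derivatives taken in $L^2(D)$, and, in cases 1 and 3, with some pressure $p(t)\in H^1(D)$) satisfies, with $\Lambda=\sqrt{\Lambda^2}$, $$\|(\sigma,v,B)(t)\|_s\le C\,e^{\Lambda t}\,\|(\sigma,v,B)(0)\|_{s+2}\qquad\text{for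 all }t\ge0.$$ -/

import Mathlib

open Set Filter Topology MeasureTheory
open scoped ContDiff Matrix

noncomputable section

namespace MHD

/-! ### The periodic cell and its test functions

All fields depend on `(x, y)` only (and on time); `ℝ × ℝ` carries them, and only their values on the
cell `(0, 2π) × (0, 2π)` matter. -/

/-- The open cell `D = (0, 2π) × (0, 2π)`. -/
def cell : Set (ℝ × ℝ) := Ioo 0 (2 * Real.pi) ×ˢ Ioo 0 (2 * Real.pi)

/-- Lebesgue measure on the cell. -/
def cellMeasure : Measure (ℝ × ℝ) := volume.restrict cell

/-- Lebesgue measure on the interval `(0, 2π)`. -/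
def intervalMeasure : Measure ℝ := volume.restrict (Ioo 0 (2 * Real.pi))

/-- Classical partial derivative in `x`. -/
def partialX (φ : ℝ × ℝ → ℝ) : ℝ × ℝ → ℝ := fun z => deriv (fun x => φ (x, z.2)) z.1

/-- Classical partial derivative in `y`. -/
def partialY (φ : ℝ × ℝ → ℝ) : ℝ × ℝ → ℝ := fun z => deriv (fun y => φ (z.1, y)) z.2

/-- Test functions on the cell: smooth, `2π`-periodic in `y`, and vanishing near the two sides
`x = 0` and `x = 2π`. -/
def IsInteriorTest (φ : ℝ × ℝ → ℝ) : Prop :=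
  ContDiff ℝ ∞ φ ∧ (∀ x y, φ (x, y + 2 * Real.pi) = φ (x, y)) ∧
    ∃ ε > 0, ∀ x y, x < ε ∨ 2 * Real.pi - ε < x → φ (x, y) = 0

/-- Test functions on the torus: smooth and `2π`-periodic in `x` and in `y`. -/
def IsTorusTest (φ : ℝ × ℝ → ℝ) : Prop :=
  ContDiff ℝ ∞ φ ∧ (∀ x y, φ (x + 2 * Real.pi, y) = φ (x, y)) ∧
    (∀ x y, φ (x, y + 2 * Real.pi) = φ (x, y))

/-! ### Weak derivatives and Sobolev norms on the cell -/

/-- `h` is the weak derivative `∂ₓⁱ ∂ᵧʲ f` in `L²(D)`. The test functions are periodic in `y`, so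
this includes the periodicity of `f` in `y`; nothing is said about the sides `x = 0, 2π`. -/
def IsWeakDeriv (i j : ℕ) (f h : ℝ × ℝ → ℝ) : Prop :=
  MemLp f 2 cellMeasure ∧ MemLp h 2 cellMeasure ∧
    ∀ φ, IsInteriorTest φ →
      ∫ z, f z * (partialX^[i] (partialY^[j] φ)) z ∂cellMeasure =
        (-1) ^ (i + j) * ∫ z, h z * φ z ∂cellMeasure

open Classical in
/-- The weak derivative `∂ₓⁱ ∂ᵧʲ f`, where it exists. -/
def weakDeriv (i j : ℕ) (f : ℝ × ℝ → ℝ) : ℝ × ℝ → ℝ :=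
  if h : ∃ k, IsWeakDeriv i j f k then Classical.choose h else 0

/-- `f ∈ Hᵐ(D)` (and periodic in `y`). -/
def MemH (m : ℕ) (f : ℝ × ℝ → ℝ) : Prop :=
  ∀ i j : ℕ, i + j ≤ m → ∃ h, IsWeakDeriv i j f h

/-- Equality of the traces of `f ∈ H¹(D)` on the sides `x = 0` and `x = 2π`: the weak `x`-derivative
of `f` is also its weak derivative on the torus. -/
def IsPeriodicX (f : ℝ × ℝ → ℝ) : Prop :=
  ∀ φ, IsTorusTest φ →
    ∫ z, f z * partialX φ z ∂cellMeasure = - ∫ z, weakDeriv 1 0 f z * φ z ∂cellMeasure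

/-- `‖f‖ₛ² = ∑_{|α| ≤ s} ∬_D ρ₀ |∂^α f|²`. -/
def sobolevSq (ρ₀ : ℝ → ℝ) (s : ℕ) (f : ℝ × ℝ → ℝ) : ℝ :=
  ∑ n ∈ Finset.range (s + 1), ∑ α ∈ Finset.HasAntidiagonal.antidiagonal n,
    ∫ z, ρ₀ z.1 * (weakDeriv α.1 α.2 f z) ^ 2 ∂cellMeasure

/-! ### Vector calculus for fields that do not depend on the third coordinate -/

/-- The divergence of a vector field. -/
def divergence (F : ℝ × ℝ → Fin 3 → ℝ) : ℝ × ℝ → ℝ := fun z =>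
  weakDeriv 1 0 (fun w => F w 0) z + weakDeriv 0 1 (fun w => F w 1) z

/-- The curl of a vector field. -/
def curl (F : ℝ × ℝ → Fin 3 → ℝ) : ℝ × ℝ → Fin 3 → ℝ := fun z =>
  ![weakDeriv 0 1 (fun w => F w 2) z,
    - weakDeriv 1 0 (fun w => F w 2) z,
    weakDeriv 1 0 (fun w => F w 1) z - weakDeriv 0 1 (fun w => F w 0) z]

/-- The gradient of a function. -/
def gradient (p : ℝ × ℝ → ℝ) : ℝ × ℝ → Fin 3 → ℝ := fun z =>
  ![weakDeriv 1 0 p z, weakDeriv 0 1 p z, 0]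

/-! ### Time-dependent fields -/

/-- The curve `f` has the derivative `h` at time `t ≥ 0`, as a curve in `L²(D)` on `[0, ∞)`. -/
def HasTimeDeriv (f : ℝ → ℝ × ℝ → ℝ) (h : ℝ × ℝ → ℝ) (t : ℝ) : Prop :=
  Tendsto (fun τ => eLpNorm (fun z => (f τ z - f t z) / (τ - t) - h z) 2 cellMeasure)
    (𝓝[Ici 0 \ {t}] t) (𝓝 0)

/-- `f ∈ C([0, ∞); Hᵐ(D))`. -/
def ContInH (m : ℕ) (f : ℝ → ℝ × ℝ → ℝ) : Prop :=
  (∀ t, 0 ≤ t → MemH m (f t)) ∧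
    ∀ i j : ℕ, i + j ≤ m → ∀ t, 0 ≤ t →
      Tendsto (fun τ => eLpNorm (weakDeriv i j (f τ) - weakDeriv i j (f t)) 2 cellMeasure)
        (𝓝[Ici 0] t) (𝓝 0)

/-- The perturbation of density, velocity and magnetic field at one time. -/
structure Perturbation where
  /-- density -/
  σ : ℝ × ℝ → ℝ
  /-- velocity -/
  v : ℝ × ℝ → Fin 3 → ℝ
  /-- magnetic field -/
  B : ℝ × ℝ → Fin 3 → ℝ

/-- The weighted Sobolev norm `‖(σ, v, B)‖ₛ`. -/
def Perturbation.norm (ρ₀ : ℝ → ℝ) (s : ℕ) (U : Perturbation) : ℝ :=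
  Real.sqrt (sobolevSq ρ₀ s U.σ + ∑ i, sobolevSq ρ₀ s (fun z => U.v z i) +
    ∑ i, sobolevSq ρ₀ s (fun z => U.B z i))

/-- The linearized ideal MHD system around the density `ρ₀(x)`, zero velocity and the magnetic field
`B₀`, with gravity `(g, 0, 0)`, for a perturbation `U = (σ, v, B) ∈ C([0, ∞); Hᵐ(D))` with pressure
perturbation `p`:
`σₜ + ∇·(ρ₀v) = 0`, `ρ₀vₜ = (∇×B₀)×B + (∇×B)×B₀ - ∇p + σ(g,0,0)`, `Bₜ = ∇×(v×B₀)`, `∇·B = 0`. -/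
structure LinearizedMHD (g : ℝ) (ρ₀ : ℝ → ℝ) (B₀ : ℝ × ℝ → Fin 3 → ℝ) (m : ℕ)
    (U : ℝ → Perturbation) (p : ℝ → ℝ × ℝ → ℝ) : Prop where
  contσ : ContInH m (fun t => (U t).σ)
  contv : ∀ i, ContInH m (fun t z => (U t).v z i)
  contB : ∀ i, ContInH m (fun t z => (U t).B z i)
  memp : ∀ t, 0 ≤ t → MemH 1 (p t)
  mass : ∀ t, 0 ≤ t →
    HasTimeDeriv (fun t => (U t).σ) (fun z => - divergence (fun w => ρ₀ w.1 • (U t).v w) z) t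
  momentum : ∀ t, 0 ≤ t → ∃ a : ℝ × ℝ → Fin 3 → ℝ,
    (∀ i, HasTimeDeriv (fun t z => (U t).v z i) (fun z => a z i) t) ∧
    ∀ᵐ z ∂cellMeasure, ρ₀ z.1 • a z =
      (curl B₀ z) ⨯₃ ((U t).B z) + (curl (U t).B z) ⨯₃ (B₀ z) - gradient (p t) z
        + (U t).σ z • ![g, 0, 0]
  faraday : ∀ t, 0 ≤ t → ∀ i,
    HasTimeDeriv (fun t z => (U t).B z i) (fun z => curl (fun w => (U t).v w ⨯₃ B₀ w) z i) t
  solenoidal : ∀ t, 0 ≤ t → ∀ᵐ z ∂cellMeasure, divergence (U t).B z = 0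

/-- The magnetic field `(0, 0, β(x))`, orthogonal to gravity. -/
def perpField (β : ℝ → ℝ) : ℝ × ℝ → Fin 3 → ℝ := fun z => ![0, 0, β z.1]

/-- The constant magnetic field `(b, 0, 0)`, parallel to gravity. -/
def parField (b : ℝ) : ℝ × ℝ → Fin 3 → ℝ := fun _ => ![b, 0, 0]

/-- Periodicity in `x` for a field orthogonal to gravity: the normal velocity `v₁` and the total
pressure perturbation `p + B₀ · B` agree on the sides `x = 0` and `x = 2π`. -/
def PerpBoundary (β : ℝ → ℝ) (U : ℝ → Perturbation) (p : ℝ → ℝ × ℝ → ℝ) : Prop :=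
  ∀ t, 0 ≤ t → IsPeriodicX (fun z => (U t).v z 0) ∧
    IsPeriodicX (fun z => p t z + β z.1 * (U t).B z 2)

/-- Periodicity in `x` for a field parallel to gravity: `v`, `B` and `p` agree on the sides `x = 0`
and `x = 2π`. -/
def ParBoundary (U : ℝ → Perturbation) (p : ℝ → ℝ × ℝ → ℝ) : Prop :=
  ∀ t, 0 ≤ t → (∀ i, IsPeriodicX (fun z => (U t).v z i)) ∧
    (∀ i, IsPeriodicX (fun z => (U t).B z i)) ∧ IsPeriodicX (p t)

/-- Solutions in `C([0, ∞); Hᵐ(D))`: incompressible fluid, `B₀ = (0, 0, β(x))`. -/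
def IsSolutionPerpIncompressible (g : ℝ) (ρ₀ β : ℝ → ℝ) (m : ℕ) (U : ℝ → Perturbation) : Prop :=
  ∃ p : ℝ → ℝ × ℝ → ℝ, LinearizedMHD g ρ₀ (perpField β) m U p ∧ PerpBoundary β U p ∧
    ∀ t, 0 ≤ t → ∀ᵐ z ∂cellMeasure, divergence (U t).v z = 0

/-- Solutions in `C([0, ∞); Hᵐ(D))`: compressible fluid with the pressure law `P(ρ) = K ρ^γ`, so that
`p = P'(ρ₀) σ`, and `B₀ = (0, 0, β(x))`. -/
def IsSolutionPerpCompressible (g K γ : ℝ) (ρ₀ β : ℝ → ℝ) (m : ℕ) (U : ℝ → Perturbation) : Prop :=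
  ∃ p : ℝ → ℝ × ℝ → ℝ, LinearizedMHD g ρ₀ (perpField β) m U p ∧ PerpBoundary β U p ∧
    ∀ t, 0 ≤ t → ∀ᵐ z ∂cellMeasure, p t z = K * γ * ρ₀ z.1 ^ (γ - 1) * (U t).σ z

/-- Solutions in `C([0, ∞); Hᵐ(D))`: incompressible fluid, `B₀ = (b, 0, 0)`, with `v₃ = B₃ = 0`. -/
def IsSolutionParIncompressible (g b : ℝ) (ρ₀ : ℝ → ℝ) (m : ℕ) (U : ℝ → Perturbation) : Prop :=
  ∃ p : ℝ → ℝ × ℝ → ℝ, LinearizedMHD g ρ₀ (parField b) m U p ∧ ParBoundary U p ∧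
    (∀ t, 0 ≤ t → ∀ᵐ z ∂cellMeasure, divergence (U t).v z = 0) ∧
    ∀ t, 0 ≤ t → ∀ᵐ z ∂cellMeasure, (U t).v z 2 = 0 ∧ (U t).B z 2 = 0

/-! ### The growth rate `Λ`: Rayleigh quotients on the cell -/

/-- `Λ²` for a potential energy `H(w) = h(x) w²` without derivatives:
the supremum over `w ∈ L²(D)`, `w ≠ 0`, of `∬ h w² / ∬ ρ₀ w²`. -/
def LambdaSqL2 (ρ₀ h : ℝ → ℝ) : ℝ :=
  sSup {r | ∃ w : ℝ × ℝ → ℝ, MemLp w 2 cellMeasure ∧ 0 < ∫ z, ρ₀ z.1 * w z ^ 2 ∂cellMeasure ∧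
    r = (∫ z, h z.1 * w z ^ 2 ∂cellMeasure) / ∫ z, ρ₀ z.1 * w z ^ 2 ∂cellMeasure}

/-- `Λ²`, incompressible fluid, `B₀ = (0, 0, β(x))`: `H(w) = - g ρ₀' w²`. -/
def LambdaSqPerpIncompressible (g : ℝ) (ρ₀ : ℝ → ℝ) : ℝ :=
  LambdaSqL2 ρ₀ (fun x => - g * deriv ρ₀ x)

/-- The coefficient `γ p₀ + B₀²`, with `p₀ = K ρ₀^γ` and `B₀ = (0, 0, β(x))`. -/
def stiffness (K γ : ℝ) (ρ₀ β : ℝ → ℝ) (x : ℝ) : ℝ := γ * (K * ρ₀ x ^ γ) + β x ^ 2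

/-- The coefficient `g² ρ₀² / (γ p₀ + B₀²) - g ρ₀'`. -/
def potentialCompressible (g K γ : ℝ) (ρ₀ β : ℝ → ℝ) (x : ℝ) : ℝ :=
  g ^ 2 * ρ₀ x ^ 2 / stiffness K γ ρ₀ β x - g * deriv ρ₀ x

/-- `Λ²`, compressible fluid, `B₀ = (0, 0, β(x))`: `H(w) = (g² ρ₀² / (γ p₀ + B₀²) - g ρ₀') w²`. -/
def LambdaSqPerpCompressible (g K γ : ℝ) (ρ₀ β : ℝ → ℝ) : ℝ :=
  LambdaSqL2 ρ₀ (potentialCompressible g K γ ρ₀ β)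

/-- `Λ²`, incompressible fluid, `B₀ = (b, 0, 0)`: the supremum over periodic `w ∈ H¹(D)`, `w ≠ 0`, of
`∬ (- g ρ₀' w² - b² wₓ²) / ∬ ρ₀ w²`. -/
def LambdaSqParIncompressible (g b : ℝ) (ρ₀ : ℝ → ℝ) : ℝ :=
  sSup {r | ∃ w : ℝ × ℝ → ℝ, MemH 1 w ∧ IsPeriodicX w ∧
    0 < ∫ z, ρ₀ z.1 * w z ^ 2 ∂cellMeasure ∧
    r = (∫ z, (- g * deriv ρ₀ z.1 * w z ^ 2 - b ^ 2 * weakDeriv 1 0 w z ^ 2) ∂cellMeasure) /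
      ∫ z, ρ₀ z.1 * w z ^ 2 ∂cellMeasure}

/-! ### The growth rates `λₖ` of normal modes: Rayleigh quotients on the interval -/

/-- `h` is the `n`-th weak derivative in `L²` of the `2π`-periodic function `u`, both given on
`(0, 2π)`. -/
def IsPeriodicWeakDeriv (n : ℕ) (u h : ℝ → ℝ) : Prop :=
  MemLp u 2 intervalMeasure ∧ MemLp h 2 intervalMeasure ∧
    ∀ ψ : ℝ → ℝ, ContDiff ℝ ∞ ψ → (∀ x, ψ (x + 2 * Real.pi) = ψ x) →
      ∫ x, u x * iteratedDeriv n ψ x ∂intervalMeasure =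
        (-1) ^ n * ∫ x, h x * ψ x ∂intervalMeasure

/-- `λₖ²`, incompressible fluid, `B₀ = (0, 0, β(x))`: the supremum over `u ∈ H¹`, `u ≠ 0`, of
`∫ - g ρ₀' u² / ∫ ρ₀ (u² + u'²/k²)`. -/
def lambdaSqPerpIncompressible (g : ℝ) (ρ₀ : ℝ → ℝ) (k : ℕ) : ℝ :=
  sSup {r | ∃ u u' : ℝ → ℝ, IsPeriodicWeakDeriv 1 u u' ∧
    0 < ∫ x, ρ₀ x * (u x ^ 2 + u' x ^ 2 / k ^ 2) ∂intervalMeasure ∧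
    r = (∫ x, - g * deriv ρ₀ x * u x ^ 2 ∂intervalMeasure) /
      ∫ x, ρ₀ x * (u x ^ 2 + u' x ^ 2 / k ^ 2) ∂intervalMeasure}

/-- `λₖ²`, compressible fluid, `B₀ = (0, 0, β(x))`: the supremum over `u₁ ∈ H¹`, `u₂ ∈ L²`,
`(u₁, u₂) ≠ 0`, of
`∫ [- a (u₁' + k u₂ + g ρ₀ u₁ / a)² + (g² ρ₀² / a - g ρ₀') u₁²] / ∫ ρ₀ (u₁² + u₂²)`, where
`a = γ p₀ + B₀²`. -/
def lambdaSqPerpCompressible (g K γ : ℝ) (ρ₀ β : ℝ → ℝ) (k : ℕ) : ℝ :=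
  sSup {r | ∃ u₁ u₁' u₂ : ℝ → ℝ, IsPeriodicWeakDeriv 1 u₁ u₁' ∧ MemLp u₂ 2 intervalMeasure ∧
    0 < ∫ x, ρ₀ x * (u₁ x ^ 2 + u₂ x ^ 2) ∂intervalMeasure ∧
    r = (∫ x, (- stiffness K γ ρ₀ β x *
          (u₁' x + k * u₂ x + g * ρ₀ x / stiffness K γ ρ₀ β x * u₁ x) ^ 2
          + potentialCompressible g K γ ρ₀ β x * u₁ x ^ 2) ∂intervalMeasure) /
      ∫ x, ρ₀ x * (u₁ x ^ 2 + u₂ x ^ 2) ∂intervalMeasure}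

/-- `λₖ²`, incompressible fluid, `B₀ = (b, 0, 0)`: the supremum over `u ∈ H²`, `u ≠ 0`, of
`∫ [- b² u''²/k² - g ρ₀' u² - b² u'²] / ∫ ρ₀ (u² + u'²/k²)`. -/
def lambdaSqParIncompressible (g b : ℝ) (ρ₀ : ℝ → ℝ) (k : ℕ) : ℝ :=
  sSup {r | ∃ u u' u'' : ℝ → ℝ, IsPeriodicWeakDeriv 1 u u' ∧ IsPeriodicWeakDeriv 2 u u'' ∧
    0 < ∫ x, ρ₀ x * (u x ^ 2 + u' x ^ 2 / k ^ 2) ∂intervalMeasure ∧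
    r = (∫ x, (- b ^ 2 * (u'' x ^ 2 / k ^ 2) - g * deriv ρ₀ x * u x ^ 2 - b ^ 2 * u' x ^ 2)
          ∂intervalMeasure) /
      ∫ x, ρ₀ x * (u x ^ 2 + u' x ^ 2 / k ^ 2) ∂intervalMeasure}

/-- `Λ²` is the least upper bound and the limit of the discrete rates `λₖ²`, `k = 1, 2, …`. -/
def IsSupremumOfModes (lamSq : ℕ → ℝ) (LamSq : ℝ) : Prop :=
  IsLUB (lamSq '' Ici 1) LamSq ∧ Tendsto lamSq atTop (𝓝 LamSq)

end MHD

end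

open Set Filter Topology MeasureTheory
open scoped ContDiff Matrix

noncomputable section

namespace MHD

/-! ### The Hilbert space `L²(D)` -/

/-! Normal modes. A function of `x` alone is a function on the cell, and the extra terms of the
`k`-th quotient only lower the numerator or, because `Λ² ≥ 0`, raise the right side of the form
inequality; hence `λₖ² ≤ Λ²` (`form_fst`). Conversely, let `μ < Λ²`. Density supplies a smooth torus
function whose quotient exceeds `μ`. The form contains no `y`-derivative, so by Fubini some slice
`u(x)` already exceeds `μ` (`exists_slice`). Inserted in the `k`-th quotient, this fixed `u`
produces only errors of order `1/k²`; in the compressible case `u₂ = -(u' + g ρ₀ u / a) / k`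
annihilates the square. Therefore `λₖ² > μ` for all large `k`.

Growth. Let `V` be the time antiderivative of a solution, so that its velocity components are a
displacement. The equations for density and magnetic field integrate in time and express these
fields through the displacement, up to constants of integration. Taking time difference quotients of
solution and antiderivative removes the constants and costs no regularity. For these quotients the
sum of kinetic, magnetic or compressive, and potential energy is conserved. The definition of `Λ`
bounds the destabilizing potential energy by `Λ² ∫ ρ₀ |V|²`, so conservation becomes `‖V'‖ ≤ Λ ‖V‖ +
K` in the weighted norm, and Grönwall gives the sharp rate `exp (Λ t)`. Letting the time step tend
to zero bounds the time derivative of the solution, and integration in time bounds the solution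
itself. Initially the time derivative costs one space derivative.

Higher norms. The coefficients depend on `x` only, so difference quotients in `y` and in `t` are
again solutions. By induction on `n` (`IsEvolution.growth`), a bound in `Hⁿ` for all solutions gives
bounds in `Hⁿ` for the solution, its `y`-derivative and its time derivative. The missing
`x`-derivatives come from the equations: the divergence constraints or the continuity equation, the
curl of the momentum equation (free of pressure), the momentum equation, and transport equations
integrated in time.

The two incompressible cases are one system with parameters `b` and `β`, one of which vanishes. The
compressible case uses the total pressure and two combinations of the unknowns that obey equations
without derivatives. All statements are made in `L²(D)` with weak derivatives; translations replace
mollification. -/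

/-- The Hilbert space `L²(D)`. -/
abbrev CellL2 : Type := Lp ℝ 2 cellMeasure

instance : IsFiniteMeasure cellMeasure := by
  constructor
  rw [cellMeasure, Measure.restrict_apply MeasurableSet.univ, univ_inter, cell,
    Measure.volume_eq_prod, Measure.prod_prod]
  exact ENNReal.mul_lt_top measure_Ioo_lt_top measure_Ioo_lt_top

instance : IsFiniteMeasure intervalMeasure := by
  constructor
  rw [intervalMeasure, Measure.restrict_apply MeasurableSet.univ, univ_inter]
  exact measure_Ioo_lt_top

theorem cellMeasure_eq_prod : cellMeasure = intervalMeasure.prod intervalMeasure := by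
  rw [cellMeasure, cell, intervalMeasure, Measure.prod_restrict, Measure.volume_eq_prod]

theorem measurableSet_cell : MeasurableSet cell := measurableSet_Ioo.prod measurableSet_Ioo

theorem isOpen_cell : IsOpen cell := isOpen_Ioo.prod isOpen_Ioo

theorem ae_mem_cell : ∀ᵐ z ∂cellMeasure, z ∈ cell := ae_restrict_mem measurableSet_cell

open Classical in
/-- The class in `L²(D)` of a square integrable function (and `0` for other functions). -/
def toL2 (f : ℝ × ℝ → ℝ) : CellL2 := if h : MemLp f 2 cellMeasure then h.toLp f else 0

theorem toL2_eq {f : ℝ × ℝ → ℝ} (hf : MemLp f 2 cellMeasure) : toL2 f = hf.toLp f := dif_pos hf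

theorem coe_toL2 {f : ℝ × ℝ → ℝ} (hf : MemLp f 2 cellMeasure) : toL2 f =ᵐ[cellMeasure] f := by
  rw [toL2_eq hf]; exact hf.coeFn_toLp

theorem toL2_coe (F : CellL2) : toL2 F = F := by
  rw [toL2_eq (Lp.memLp F), Lp.toLp_coeFn]

theorem toL2_congr {f h : ℝ × ℝ → ℝ} (hfh : f =ᵐ[cellMeasure] h) : toL2 f = toL2 h := by
  by_cases hf : MemLp f 2 cellMeasure
  · have hh := (memLp_congr_ae hfh).1 hf
    rw [toL2_eq hf, toL2_eq hh]
    exact (MemLp.toLp_eq_toLp_iff hf hh).2 hfh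
  · have hh := mt (memLp_congr_ae hfh).2 hf
    rw [toL2, toL2, dif_neg hf, dif_neg hh]

theorem ae_eq_of_toL2_eq {f h : ℝ × ℝ → ℝ} (hf : MemLp f 2 cellMeasure)
    (hh : MemLp h 2 cellMeasure) (e : toL2 f = toL2 h) : f =ᵐ[cellMeasure] h := by
  rw [toL2_eq hf, toL2_eq hh] at e
  exact (MemLp.toLp_eq_toLp_iff hf hh).1 e

theorem toL2_add {f h : ℝ × ℝ → ℝ} (hf : MemLp f 2 cellMeasure) (hh : MemLp h 2 cellMeasure) :
    toL2 (fun z => f z + h z) = toL2 f + toL2 h := by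
  rw [toL2_eq hf, toL2_eq hh, ← MemLp.toLp_add]; exact toL2_eq (hf.add hh)

theorem toL2_sub {f h : ℝ × ℝ → ℝ} (hf : MemLp f 2 cellMeasure) (hh : MemLp h 2 cellMeasure) :
    toL2 (fun z => f z - h z) = toL2 f - toL2 h := by
  rw [toL2_eq hf, toL2_eq hh, ← MemLp.toLp_sub]; exact toL2_eq (hf.sub hh)

theorem toL2_const_mul {f : ℝ × ℝ → ℝ} (hf : MemLp f 2 cellMeasure) (c : ℝ) :
    toL2 (fun z => c * f z) = c • toL2 f := by
  rw [toL2_eq hf, ← MemLp.toLp_const_smul, toL2_eq (hf.const_mul c)]; rfl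

theorem toL2_neg {f : ℝ × ℝ → ℝ} (hf : MemLp f 2 cellMeasure) :
    toL2 (fun z => - f z) = - toL2 f := by
  rw [toL2_eq hf, ← MemLp.toLp_neg]; exact toL2_eq hf.neg

theorem inner_eq_integral (F H : CellL2) : inner ℝ F H = ∫ z, F z * H z ∂cellMeasure := by
  rw [L2.inner_def]
  exact integral_congr_ae (Eventually.of_forall fun z => by simp [mul_comm])

theorem inner_toL2 {f h : ℝ × ℝ → ℝ} (hf : MemLp f 2 cellMeasure) (hh : MemLp h 2 cellMeasure) :
    inner ℝ (toL2 f) (toL2 h) = ∫ z, f z * h z ∂cellMeasure := by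
  rw [inner_eq_integral]
  refine integral_congr_ae ?_
  filter_upwards [coe_toL2 hf, coe_toL2 hh] with z h1 h2
  rw [h1, h2]

theorem norm_toL2_sq {f : ℝ × ℝ → ℝ} (hf : MemLp f 2 cellMeasure) :
    ‖toL2 f‖ ^ 2 = ∫ z, f z ^ 2 ∂cellMeasure := by
  rw [← real_inner_self_eq_norm_sq, inner_toL2 hf hf]
  simp only [pow_two]

theorem norm_toL2 {f : ℝ × ℝ → ℝ} (hf : MemLp f 2 cellMeasure) :
    ‖toL2 f‖ = (eLpNorm f 2 cellMeasure).toReal := by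
  rw [toL2_eq hf, Lp.norm_toLp]

theorem measureReal_cell_le : (cellMeasure.real univ) ^ (1 / 2 : ℝ) = 2 * Real.pi := by
  have : cellMeasure.real univ = (2 * Real.pi) ^ (2 : ℝ) := by
    rw [cellMeasure_eq_prod, ← univ_prod_univ, measureReal_prod_prod]
    have : intervalMeasure.real univ = 2 * Real.pi := by
      simp [intervalMeasure, measureReal_def, Real.pi_pos.le]
    rw [this]; norm_cast; ring
  rw [this, ← Real.rpow_mul (by positivity)]; norm_num

theorem norm_toL2_le {f : ℝ × ℝ → ℝ} (hf : AEStronglyMeasurable f cellMeasure) {C : ℝ}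
    (hC : 0 ≤ C) (hb : ∀ z ∈ cell, |f z| ≤ C) : ‖toL2 f‖ ≤ C * (2 * Real.pi) := by
  have hb' : ∀ᵐ z ∂cellMeasure, ‖f z‖ ≤ C := ae_mem_cell.mono fun z hz => hb z hz
  have hm : MemLp f 2 cellMeasure := MemLp.of_bound hf C hb'
  rw [norm_toL2 hm]
  have := eLpNorm_le_of_ae_bound (p := 2) hb'
  refine ENNReal.toReal_le_of_le_ofReal (by positivity) (this.trans ?_)
  rw [← measureReal_cell_le, mul_comm C, ENNReal.ofReal_mul (by positivity)]
  gcongr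
  rw [← ENNReal.ofReal_rpow_of_nonneg measureReal_nonneg (by positivity), measureReal_def,
    ENNReal.ofReal_toReal (measure_ne_top _ _)]
  norm_num

theorem memLp_of_continuous {f : ℝ × ℝ → ℝ} (hf : Continuous f) (p : ENNReal) :
    MemLp f p cellMeasure := by
  have hK : IsCompact (Icc (0 : ℝ) (2 * Real.pi) ×ˢ Icc (0 : ℝ) (2 * Real.pi)) :=
    isCompact_Icc.prod isCompact_Icc
  obtain ⟨C, hC⟩ := hK.exists_bound_of_continuousOn hf.continuousOn
  refine MemLp.of_bound hf.aestronglyMeasurable C (ae_mem_cell.mono fun z hz => hC z ?_)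
  exact ⟨Ioo_subset_Icc_self hz.1, Ioo_subset_Icc_self hz.2⟩

/-! ### Partial derivatives of smooth functions -/

theorem partialX_eq {φ : ℝ × ℝ → ℝ} (h : Differentiable ℝ φ) :
    partialX φ = fun z => fderiv ℝ φ z (1, 0) := by
  funext z
  have h1 : HasDerivAt (fun x : ℝ => (x, z.2)) ((1 : ℝ), (0 : ℝ)) z.1 :=
    (hasDerivAt_id _).prodMk (hasDerivAt_const _ _)
  exact ((h (z.1, z.2)).hasFDerivAt.comp_hasDerivAt z.1 h1).deriv

theorem partialY_eq {φ : ℝ × ℝ → ℝ} (h : Differentiable ℝ φ) :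
    partialY φ = fun z => fderiv ℝ φ z (0, 1) := by
  funext z
  have h1 : HasDerivAt (fun y : ℝ => (z.1, y)) ((0 : ℝ), (1 : ℝ)) z.2 :=
    (hasDerivAt_const _ _).prodMk (hasDerivAt_id _)
  exact ((h (z.1, z.2)).hasFDerivAt.comp_hasDerivAt z.2 h1).deriv

theorem hasDerivAt_partialX {φ : ℝ × ℝ → ℝ} (h : Differentiable ℝ φ) (x y : ℝ) :
    HasDerivAt (fun x => φ (x, y)) (partialX φ (x, y)) x := by
  have : DifferentiableAt ℝ (fun x => φ (x, y)) x := by fun_prop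
  exact this.hasDerivAt

theorem hasDerivAt_partialY {φ : ℝ × ℝ → ℝ} (h : Differentiable ℝ φ) (x y : ℝ) :
    HasDerivAt (fun y => φ (x, y)) (partialY φ (x, y)) y := by
  have : DifferentiableAt ℝ (fun y => φ (x, y)) y := by fun_prop
  exact this.hasDerivAt

theorem contDiff_partialX {φ : ℝ × ℝ → ℝ} (h : ContDiff ℝ ∞ φ) : ContDiff ℝ ∞ (partialX φ) := by
  rw [partialX_eq (h.differentiable (by simp))]
  exact (h.fderiv_right (m := ∞) (by simp)).clm_apply contDiff_const

theorem contDiff_partialY {φ : ℝ × ℝ → ℝ} (h : ContDiff ℝ ∞ φ) : ContDiff ℝ ∞ (partialY φ) := by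
  rw [partialY_eq (h.differentiable (by simp))]
  exact (h.fderiv_right (m := ∞) (by simp)).clm_apply contDiff_const

theorem partialX_partialY_comm {φ : ℝ × ℝ → ℝ} (h : ContDiff ℝ ∞ φ) :
    partialX (partialY φ) = partialY (partialX φ) := by
  have hd : Differentiable ℝ φ := h.differentiable (by simp)
  have h2 : Differentiable ℝ (fderiv ℝ φ) :=
    (h.fderiv_right (m := ∞) (by simp)).differentiable (by simp)
  rw [partialX_eq ((contDiff_partialY h).differentiable (by simp)),
    partialY_eq ((contDiff_partialX h).differentiable (by simp)), partialX_eq hd, partialY_eq hd]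
  funext z
  have key : ∀ v w : ℝ × ℝ, fderiv ℝ (fun z => fderiv ℝ φ z v) z w
      = fderiv ℝ (fderiv ℝ φ) z w v := fun v w => by
    rw [fderiv_clm_apply (h2 z) (differentiableAt_const v)]; simp
  rw [key, key]
  have hs : IsSymmSndFDerivAt ℝ φ z := h.contDiffAt.isSymmSndFDerivAt (by
    rw [minSmoothness_of_isRCLikeNormedField]; exact WithTop.coe_le_coe.2 (le_top : (2 : ℕ∞) ≤ ⊤))
  exact hs.eq _ _

namespace IsInteriorTest

variable {φ ψ : ℝ × ℝ → ℝ}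

theorem partialX (h : IsInteriorTest φ) : IsInteriorTest (partialX φ) := by
  obtain ⟨h1, h2, ε, hε, h3⟩ := h
  refine ⟨contDiff_partialX h1, fun x y => ?_, ε, hε, fun x y hx => ?_⟩
  · simp only [MHD.partialX, h2]
  · have : (fun x => φ (x, y)) =ᶠ[𝓝 x] fun _ => 0 := by
      have : {x : ℝ | x < ε ∨ 2 * Real.pi - ε < x} ∈ 𝓝 x :=
        (isOpen_Iio.union isOpen_Ioi).mem_nhds hx
      filter_upwards [this] with x' hx' using h3 x' y hx'
    simp only [MHD.partialX]
    rw [this.deriv_eq, deriv_const]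

theorem partialY (h : IsInteriorTest φ) : IsInteriorTest (partialY φ) := by
  obtain ⟨h1, h2, ε, hε, h3⟩ := h
  refine ⟨contDiff_partialY h1, fun x y => ?_, ε, hε, fun x y hx => ?_⟩
  · have : (fun y => φ (x, y)) = fun y => φ (x, y + 2 * Real.pi) := funext fun y => (h2 x y).symm
    simp only [MHD.partialY]
    conv_rhs => rw [this]
    rw [deriv_comp_add_const (f := fun y => φ (x, y))]
  · simp only [MHD.partialY]
    rw [show (fun y => φ (x, y)) = fun _ => 0 from funext fun y => h3 x y hx, deriv_const]

theorem continuous (h : IsInteriorTest φ) : Continuous φ := h.1.continuous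

theorem differentiable (h : IsInteriorTest φ) : Differentiable ℝ φ := h.1.differentiable (by simp)

theorem memLp (h : IsInteriorTest φ) : MemLp φ 2 cellMeasure := memLp_of_continuous h.continuous 2

theorem shift (h : IsInteriorTest φ) (a : ℝ) : IsInteriorTest fun z => φ (z.1, z.2 + a) := by
  obtain ⟨h1, h2, ε, hε, h3⟩ := h
  refine ⟨by fun_prop, fun x y => ?_, ε, hε, fun x y hx => h3 x _ hx⟩
  simp only
  rw [add_right_comm, h2]

theorem iterate (h : IsInteriorTest φ) (i j : ℕ) :
    IsInteriorTest (MHD.partialX^[i] (MHD.partialY^[j] φ)) := by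
  have hy : IsInteriorTest (MHD.partialY^[j] φ) := by
    induction j with
    | zero => exact h
    | succ j ih => rw [Function.iterate_succ_apply']; exact ih.partialY
  induction i with
  | zero => exact hy
  | succ i ih => rw [Function.iterate_succ_apply']; exact ih.partialX

end IsInteriorTest

namespace IsTorusTest

variable {φ ψ : ℝ × ℝ → ℝ}

theorem partialX (h : IsTorusTest φ) : IsTorusTest (partialX φ) := by
  obtain ⟨h1, h2, h3⟩ := h
  refine ⟨contDiff_partialX h1, fun x y => ?_, fun x y => ?_⟩
  · have : (fun x => φ (x, y)) = fun x => φ (x + 2 * Real.pi, y) := funext fun x => (h2 x y).symm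
    simp only [MHD.partialX]
    conv_rhs => rw [this]
    rw [deriv_comp_add_const (f := fun x => φ (x, y))]
  · simp only [MHD.partialX, h3]

theorem continuous (h : IsTorusTest φ) : Continuous φ := h.1.continuous

theorem differentiable (h : IsTorusTest φ) : Differentiable ℝ φ := h.1.differentiable (by simp)

theorem memLp (h : IsTorusTest φ) : MemLp φ 2 cellMeasure := memLp_of_continuous h.continuous 2

theorem shiftX (h : IsTorusTest φ) (a : ℝ) : IsTorusTest fun z => φ (z.1 + a, z.2) := by
  obtain ⟨h1, h2, h3⟩ := h
  refine ⟨by fun_prop, fun x y => ?_, fun x y => h3 _ _⟩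
  simp only
  rw [add_right_comm, h2]

end IsTorusTest

/-! ### Smooth coefficients -/

/-- Coefficients depending on `x` only, smooth on `[0, 2π]`. -/
abbrev Coef : Type := {c : ℝ → ℝ // ContDiffOn ℝ ∞ c (Icc 0 (2 * Real.pi))}

namespace Coef

instance : CoeFun Coef fun _ => ℝ → ℝ := ⟨Subtype.val⟩

theorem uniqueDiffOn : UniqueDiffOn ℝ (Icc (0 : ℝ) (2 * Real.pi)) :=
  uniqueDiffOn_Icc (by positivity)

/-- The derivative of a coefficient. -/
def d (c : Coef) : Coef :=
  ⟨derivWithin c (Icc 0 (2 * Real.pi)), c.2.derivWithin uniqueDiffOn (by simp)⟩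

theorem hasDerivAt (c : Coef) {x : ℝ} (hx : x ∈ Ioo 0 (2 * Real.pi)) :
    HasDerivAt c (c.d x) x := by
  have h : DifferentiableWithinAt ℝ c (Icc 0 (2 * Real.pi)) x :=
    c.2.differentiableOn (by simp) x (Ioo_subset_Icc_self hx)
  exact h.hasDerivWithinAt.hasDerivAt (Icc_mem_nhds hx.1 hx.2)

theorem deriv_eq (c : Coef) {x : ℝ} (hx : x ∈ Ioo 0 (2 * Real.pi)) : deriv c x = c.d x :=
  (c.hasDerivAt hx).deriv

theorem d_eq (c : Coef) {x d' : ℝ} (hx : x ∈ Ioo 0 (2 * Real.pi)) (h : HasDerivAt c d' x) :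
    c.d x = d' := (c.hasDerivAt hx).unique h

theorem contDiffAt (c : Coef) {x : ℝ} (hx : x ∈ Ioo 0 (2 * Real.pi)) : ContDiffAt ℝ ∞ c x :=
  c.2.contDiffAt (Icc_mem_nhds hx.1 hx.2)

theorem exists_bound (c : Coef) : ∃ C, 0 ≤ C ∧ ∀ x ∈ Icc 0 (2 * Real.pi), |c x| ≤ C := by
  obtain ⟨C, hC⟩ := isCompact_Icc.exists_bound_of_continuousOn c.2.continuousOn
  exact ⟨max C 0, le_max_right _ _, fun x hx => (hC x hx).trans (le_max_left _ _)⟩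

/-- A bound for a coefficient. -/
def bound (c : Coef) : ℝ := Classical.choose c.exists_bound

theorem bound_nonneg (c : Coef) : 0 ≤ c.bound := (Classical.choose_spec c.exists_bound).1

theorem abs_le_bound (c : Coef) {x : ℝ} (hx : x ∈ Icc 0 (2 * Real.pi)) : |c x| ≤ c.bound :=
  (Classical.choose_spec c.exists_bound).2 x hx

/-- The product of two coefficients. -/
def mul (c e : Coef) : Coef := ⟨fun x => c x * e x, c.2.mul e.2⟩

/-- The sum of two coefficients. -/
def add (c e : Coef) : Coef := ⟨fun x => c x + e x, c.2.add e.2⟩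

/-- A constant multiple of a coefficient. -/
def smul (r : ℝ) (c : Coef) : Coef := ⟨fun x => r * c x, contDiffOn_const.mul c.2⟩

/-- The inverse of a positive coefficient. -/
def inv (c : Coef) (hc : ∀ x ∈ Icc 0 (2 * Real.pi), 0 < c x) : Coef :=
  ⟨fun x => (c x)⁻¹, c.2.inv fun x hx => (hc x hx).ne'⟩

/-- The square root of a positive coefficient. -/
def sqrt (c : Coef) (hc : ∀ x ∈ Icc 0 (2 * Real.pi), 0 < c x) : Coef :=
  ⟨fun x => Real.sqrt (c x), c.2.sqrt fun x hx => (hc x hx).ne'⟩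

theorem aestronglyMeasurable (c : Coef) :
    AEStronglyMeasurable (fun z : ℝ × ℝ => c z.1) cellMeasure := by
  refine ContinuousOn.aestronglyMeasurable ?_ measurableSet_cell
  exact c.2.continuousOn.comp continuousOn_fst fun z hz => Ioo_subset_Icc_self hz.1

theorem memLp_mul (c : Coef) {f : ℝ × ℝ → ℝ} (hf : MemLp f 2 cellMeasure) :
    MemLp (fun z => c z.1 * f z) 2 cellMeasure := by
  refine MemLp.of_le_mul (c := c.bound) hf (c.aestronglyMeasurable.mul hf.1) ?_
  filter_upwards [ae_mem_cell] with z hz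
  rw [norm_mul]
  gcongr
  exact c.abs_le_bound (Ioo_subset_Icc_self hz.1)

theorem memLp (c : Coef) : MemLp (fun z : ℝ × ℝ => c z.1) 2 cellMeasure := by
  simpa using c.memLp_mul (memLp_const (1 : ℝ))

theorem norm_toL2_mul_le (c : Coef) (F : CellL2) :
    ‖toL2 fun z => c z.1 * F z‖ ≤ c.bound * ‖F‖ := by
  rw [toL2_eq (c.memLp_mul (Lp.memLp F))]
  refine Lp.norm_le_mul_norm_of_ae_le_mul ?_
  filter_upwards [ae_mem_cell, (c.memLp_mul (Lp.memLp F)).coeFn_toLp] with z hz h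
  rw [h, norm_mul]
  gcongr
  exact c.abs_le_bound (Ioo_subset_Icc_self hz.1)

/-- Multiplication by a coefficient. -/
def op (c : Coef) : CellL2 →L[ℝ] CellL2 :=
  LinearMap.mkContinuous
    { toFun := fun F => toL2 fun z => c z.1 * F z
      map_add' := fun F H => by
        rw [← toL2_add (c.memLp_mul (Lp.memLp F)) (c.memLp_mul (Lp.memLp H))]
        refine toL2_congr ?_
        filter_upwards [Lp.coeFn_add F H] with z h
        rw [h, Pi.add_apply]; ring
      map_smul' := fun r F => by
        rw [RingHom.id_apply, ← toL2_const_mul (c.memLp_mul (Lp.memLp F))]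
        refine toL2_congr ?_
        filter_upwards [Lp.coeFn_smul r F] with z h
        rw [h, Pi.smul_apply, smul_eq_mul]; ring } c.bound c.norm_toL2_mul_le

theorem op_apply (c : Coef) (F : CellL2) : c.op F = toL2 fun z => c z.1 * F z := rfl

theorem norm_op_le (c : Coef) (F : CellL2) : ‖c.op F‖ ≤ c.bound * ‖F‖ := c.norm_toL2_mul_le F

theorem op_toL2 (c : Coef) {f : ℝ × ℝ → ℝ} (hf : MemLp f 2 cellMeasure) :
    c.op (toL2 f) = toL2 fun z => c z.1 * f z := by
  rw [op_apply]
  refine toL2_congr ?_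
  filter_upwards [coe_toL2 hf] with z h
  rw [h]

theorem op_congr {c e : Coef} (h : ∀ x ∈ Ioo 0 (2 * Real.pi), c x = e x) (F : CellL2) :
    c.op F = e.op F := by
  rw [op_apply, op_apply]
  refine toL2_congr ?_
  filter_upwards [ae_mem_cell] with z hz
  rw [h z.1 hz.1]

theorem op_op (c e : Coef) (F : CellL2) : c.op (e.op F) = (c.mul e).op F := by
  rw [op_apply e, op_toL2 c (e.memLp_mul (Lp.memLp F)), op_apply]
  simp only [mul, mul_assoc]

theorem op_add (c e : Coef) (F : CellL2) : (c.add e).op F = c.op F + e.op F := by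
  rw [op_apply, op_apply, op_apply, ← toL2_add (c.memLp_mul (Lp.memLp F)) (e.memLp_mul (Lp.memLp F))]
  simp only [add, add_mul]

theorem op_smul (r : ℝ) (c : Coef) (F : CellL2) : (c.smul r).op F = r • c.op F := by
  rw [op_apply, op_apply, ← toL2_const_mul (c.memLp_mul (Lp.memLp F))]
  simp only [smul, mul_assoc]

theorem inv_op_op (c : Coef) (hc : ∀ x ∈ Icc 0 (2 * Real.pi), 0 < c x) (F : CellL2) :
    (c.inv hc).op (c.op F) = F := by
  rw [op_op, op_apply]
  conv_rhs => rw [← toL2_coe F]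
  refine toL2_congr ?_
  filter_upwards [ae_mem_cell] with z hz
  simp [mul, inv, (hc z.1 (Ioo_subset_Icc_self hz.1)).ne']

theorem inner_op_toL2 (c : Coef) {f h : ℝ × ℝ → ℝ} (hf : MemLp f 2 cellMeasure)
    (hh : MemLp h 2 cellMeasure) :
    inner ℝ (c.op (toL2 f)) (toL2 h) = ∫ z, c z.1 * f z * h z ∂cellMeasure := by
  rw [op_toL2 c hf, inner_toL2 (c.memLp_mul hf) hh]

theorem inner_op (c : Coef) (F H : CellL2) : inner ℝ (c.op F) H = inner ℝ F (c.op H) := by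
  rw [← toL2_coe F, ← toL2_coe H, op_toL2 c (Lp.memLp F), op_toL2 c (Lp.memLp H),
    inner_toL2 (c.memLp_mul (Lp.memLp F)) (Lp.memLp H),
    inner_toL2 (Lp.memLp F) (c.memLp_mul (Lp.memLp H))]
  congr 1; funext z; ring

theorem inner_op_self (c : Coef) (F : CellL2) :
    inner ℝ (c.op F) F = ∫ z, c z.1 * F z ^ 2 ∂cellMeasure := by
  conv_lhs => rw [← toL2_coe F]
  rw [inner_op_toL2 c (Lp.memLp F) (Lp.memLp F)]
  congr 1; funext z; ring

/-- Weighted quadratic forms become squares of an ordinary Hilbert norm, to which Grönwall's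
inequality for vectors applies. -/
theorem norm_sqrt_op_sq (c : Coef) (hc : ∀ x ∈ Icc 0 (2 * Real.pi), 0 < c x) (F : CellL2) :
    ‖(c.sqrt hc).op F‖ ^ 2 = inner ℝ (c.op F) F := by
  rw [← real_inner_self_eq_norm_sq, inner_op, op_op, real_inner_comm]
  congr 1
  refine op_congr (fun x hx => ?_) F
  exact Real.mul_self_sqrt (hc x (Ioo_subset_Icc_self hx)).le

theorem integrable_op_sq (c : Coef) {f : ℝ × ℝ → ℝ} (hf : MemLp f 2 cellMeasure) :
    Integrable (fun z => c z.1 * f z ^ 2) cellMeasure := by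
  have := (c.memLp_mul hf).integrable_mul hf
  refine this.congr (Eventually.of_forall fun z => ?_)
  simp only [Pi.mul_apply]; ring

/-- Nothing is known about `c` outside `[0, 2π]`, nor about its smoothness as a function on `ℝ` at
the endpoints. This is harmless since the test vanishes near every point whose first coordinate is
outside `(0, 2π)`. -/
theorem isInteriorTest_mul (c : Coef) {φ : ℝ × ℝ → ℝ} (h : IsInteriorTest φ) :
    IsInteriorTest fun z => c z.1 * φ z := by
  obtain ⟨h1, h2, ε, hε, h3⟩ := h
  refine ⟨contDiff_iff_contDiffAt.2 fun z => ?_, fun x y => by simp only [h2], ε, hε,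
    fun x y hx => by simp only [h3 x y hx, mul_zero]⟩
  by_cases hz : z.1 ∈ Ioo 0 (2 * Real.pi)
  · exact ((c.contDiffAt hz).comp z contDiffAt_fst).mul h1.contDiffAt
  · have : {w : ℝ × ℝ | w.1 < ε ∨ 2 * Real.pi - ε < w.1} ∈ 𝓝 z := by
      refine ((isOpen_lt continuous_fst continuous_const).union
        (isOpen_lt continuous_const continuous_fst)).mem_nhds ?_
      by_contra hcon
      simp only [mem_union, mem_ofPred_eq, not_or, not_lt] at hcon
      exact hz ⟨by linarith, by linarith⟩
    have h0 : (fun w : ℝ × ℝ => c w.1 * φ w) =ᶠ[𝓝 z] fun _ => 0 := by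
      filter_upwards [this] with w hw
      rw [show φ w = φ (w.1, w.2) from rfl, h3 w.1 w.2 hw, mul_zero]
    exact contDiffAt_const.congr_of_eventuallyEq h0

theorem partialX_mul (c : Coef) {φ : ℝ × ℝ → ℝ} (h : IsInteriorTest φ) {z : ℝ × ℝ}
    (hz : z ∈ cell) : partialX (fun z => c z.1 * φ z) z
      = c.d z.1 * φ z + c z.1 * partialX φ z :=
  ((c.hasDerivAt hz.1).mul (hasDerivAt_partialX h.differentiable z.1 z.2)).deriv

theorem partialY_mul (c : Coef) {φ : ℝ × ℝ → ℝ} (h : IsInteriorTest φ) (z : ℝ × ℝ) :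
    partialY (fun z => c z.1 * φ z) z = c z.1 * partialY φ z :=
  ((hasDerivAt_partialY h.differentiable z.1 z.2).const_mul (c z.1)).deriv

end Coef

/-! ### Weak derivatives generated by a group of translations -/

section Abstract

variable {H : Type*} [NormedAddCommGroup H] [InnerProductSpace ℝ H]
  {τ : Type*} [AddCommGroup τ] [Module ℝ τ]

-- By density the hypothesis extends to all vectors, and it can then be evaluated at `x` itself.
omit [AddCommGroup τ] [Module ℝ τ] in
theorem norm_le_of_dense_test {e : τ → H} (he : DenseRange e) {x : H} {M : ℝ} (hM : 0 ≤ M)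
    (h : ∀ φ, inner ℝ x (e φ) ≤ M * ‖e φ‖) : ‖x‖ ≤ M := by
  have hx := he.induction_on (p := fun y => inner ℝ x y ≤ M * ‖y‖) x
    (isClosed_le (by fun_prop) (by fun_prop)) h
  rw [real_inner_self_eq_norm_sq, pow_two] at hx
  rcases (norm_nonneg x).eq_or_lt with h0 | h0
  · rwa [← h0]
  · exact le_of_mul_le_mul_right hx h0

-- A bounded family that converges against a dense set converges weakly: the error of approximating
-- `y` by a test is uniform in the family.
omit [AddCommGroup τ] [Module ℝ τ] in
theorem tendsto_inner_of_dense {e : τ → H} (he : DenseRange e) {ι : Type*} {l : Filter ι}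
    {F : ι → H} {f : H} {M : ℝ} (hM : ∀ᶠ i in l, ‖F i‖ ≤ M)
    (h : ∀ φ, Tendsto (fun i => inner ℝ (F i) (e φ)) l (𝓝 (inner ℝ f (e φ)))) (y : H) :
    Tendsto (fun i => inner ℝ (F i) y) l (𝓝 (inner ℝ f y)) := by
  rw [Metric.tendsto_nhds]
  intro ε hε
  set K := |M| + ‖f‖ + 1 with hK
  have hK0 : 0 < K := by positivity
  obtain ⟨φ, hφ⟩ := he.exists_dist_lt y (show 0 < ε / (2 * K) by positivity)
  have hφ' : ‖y - e φ‖ < ε / (2 * K) := by rwa [← dist_eq_norm]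
  filter_upwards [hM, Metric.tendsto_nhds.1 (h φ) (ε / 2) (by positivity)] with i h1 h2
  rw [Real.dist_eq] at h2 ⊢
  have e1 : inner ℝ (F i) y - inner ℝ f y =
      (inner ℝ (F i) (e φ) - inner ℝ f (e φ)) + inner ℝ (F i - f) (y - e φ) := by
    simp only [inner_sub_left, inner_sub_right]; ring
  have e2 : |inner ℝ (F i - f) (y - e φ)| ≤ K * ‖y - e φ‖ := by
    refine (abs_real_inner_le_norm _ _).trans ?_
    gcongr
    refine (norm_sub_le _ _).trans ?_
    linarith [le_abs_self M]
  have e3 : K * ‖y - e φ‖ < ε / 2 := by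
    calc K * ‖y - e φ‖ < K * (ε / (2 * K)) := by gcongr
      _ = ε / 2 := by field_simp
  rw [e1]
  exact (abs_add_le _ _).trans_lt (by linarith)

/-- A family of test vectors `e φ` with a derivative `d`, which generates the group of isometries
`T`. -/
structure TranslationGroup (H τ : Type*) [NormedAddCommGroup H] [InnerProductSpace ℝ H]
    [AddCommGroup τ] [Module ℝ τ] where
  /-- the test vectors -/
  e : τ →ₗ[ℝ] H
  /-- the derivative of tests -/
  d : τ →ₗ[ℝ] τ
  /-- the shift of tests -/
  sh : ℝ → τ → τ
  /-- the translations -/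
  T : ℝ → H →ₗᵢ[ℝ] H
  dense : DenseRange e
  T_e : ∀ a φ, T a (e φ) = e (sh a φ)
  adj : ∀ a f h, inner ℝ (T a f) h = inner ℝ f (T (-a) h)
  sh_add : ∀ a b φ, sh (a + b) φ = sh a (sh b φ)
  hasDerivAt_zero : ∀ φ, HasDerivAt (fun a => e (sh a φ)) (e (d φ)) 0

namespace TranslationGroup

variable (G : TranslationGroup H τ) {f f' h h' : H}

/-- `f'` is the weak derivative of `f`. -/
def Weak (f f' : H) : Prop := ∀ φ, inner ℝ f (G.e (G.d φ)) = - inner ℝ f' (G.e φ)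

/-- Difference quotients. -/
def quot (a : ℝ) (f : H) : H := a⁻¹ • (G.T a f - f)

theorem hasDerivAt (φ : τ) (a : ℝ) :
    HasDerivAt (fun a => G.e (G.sh a φ)) (G.e (G.d (G.sh a φ))) a := by
  have h0 := G.hasDerivAt_zero (G.sh a φ)
  have h1 : HasDerivAt (fun b => b - a) (1 : ℝ) a := (hasDerivAt_id a).sub_const a
  have h2 := HasDerivAt.scomp (h := fun b => b - a) a (by simpa using! h0) h1
  simp only [one_smul] at h2
  refine h2.congr_of_eventuallyEq (Eventually.of_forall fun b => ?_)
  simp only [Function.comp, ← G.sh_add, sub_add_cancel]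

/-- The shift by `0` is not assumed to be the identity. Additivity makes `T 0` idempotent on tests,
and an injective idempotent is the identity. -/
theorem sh_zero (φ : τ) : G.e (G.sh 0 φ) = G.e φ := by
  have h2 : G.T 0 (G.T 0 (G.e φ)) = G.T 0 (G.e φ) := by
    rw [G.T_e, G.T_e, ← G.sh_add, add_zero]
  rw [← G.T_e]
  exact (G.T 0).injective h2

/-- The pairing of `f` with a moving test has derivative `-⟨f', e (sh s φ)⟩`, which is at most `‖f'‖
‖e φ‖` because translations are isometric. The mean value inequality concludes. -/
theorem abs_inner_quot_le (hf : G.Weak f f') (a : ℝ) (φ : τ) :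
    |inner ℝ (G.T a f - f) (G.e φ)| ≤ |a| * ‖f'‖ * ‖G.e φ‖ := by
  rw [inner_sub_left, G.adj, G.T_e]
  have hd : ∀ s ∈ (univ : Set ℝ), HasDerivWithinAt (fun s => inner ℝ f (G.e (G.sh s φ)))
      (inner ℝ f (G.e (G.d (G.sh s φ)))) univ s := fun s _ => by
    have := ((innerSL ℝ f).hasFDerivAt.comp_hasDerivAt s (G.hasDerivAt φ s))
    exact this.hasDerivWithinAt
  have hb : ∀ s ∈ (univ : Set ℝ), ‖inner ℝ f (G.e (G.d (G.sh s φ)))‖ ≤ ‖f'‖ * ‖G.e φ‖ := by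
    intro s _
    rw [hf, norm_neg, ← G.T_e, ← (G.T s).norm_map (G.e φ)]
    exact norm_inner_le_norm _ _
  have := convex_univ.norm_image_sub_le_of_norm_hasDerivWithin_le hd hb (mem_univ 0) (mem_univ (-a))
  rw [G.sh_zero] at this
  simpa [mul_comm, mul_assoc, mul_left_comm] using! this

theorem norm_quot_le (hf : G.Weak f f') (a : ℝ) : ‖G.quot a f‖ ≤ ‖f'‖ := by
  rcases eq_or_ne a 0 with rfl | ha
  · simp [quot]
  rw [quot, norm_smul, norm_inv, Real.norm_eq_abs, inv_mul_le_iff₀ (by positivity)]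
  exact norm_le_of_dense_test G.dense (by positivity) fun φ =>
    (le_abs_self _).trans (G.abs_inner_quot_le hf a φ)

/-- Discrete integration by parts: the adjoint of a translation is the opposite translation. -/
theorem inner_quot (a : ℝ) : inner ℝ (G.quot a f) h = - inner ℝ f (G.quot (-a) h) := by
  simp only [quot, inner_smul_left, inner_smul_right, inner_sub_left, inner_sub_right, G.adj,
    conj_trivial, inv_neg]
  ring

theorem tendsto_quot_test (φ : τ) :
    Tendsto (fun a => G.quot a (G.e φ)) (𝓝[≠] 0) (𝓝 (G.e (G.d φ))) := by
  have h1 := (hasDerivAt_iff_tendsto_slope_zero.1 (G.hasDerivAt_zero φ))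
  simpa only [zero_add, G.sh_zero, quot, G.T_e] using h1

theorem tendsto_neg_punctured : Tendsto (fun a : ℝ => -a) (𝓝[≠] 0) (𝓝[≠] 0) := by
  refine tendsto_nhdsWithin_iff.2 ⟨?_, ?_⟩
  · have : Tendsto (fun a : ℝ => -a) (𝓝 0) (𝓝 (-0)) := (continuous_neg (G := ℝ)).tendsto 0
    rw [neg_zero] at this
    exact this.mono_left nhdsWithin_le_nhds
  · filter_upwards [self_mem_nhdsWithin] with a ha using neg_ne_zero.2 ha

/-- Difference quotients converge to the weak derivative on tests, if only distributionally. -/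
theorem tendsto_inner_quot_test (f : H) (φ : τ) :
    Tendsto (fun a => inner ℝ (G.quot a f) (G.e φ)) (𝓝[≠] 0) (𝓝 (- inner ℝ f (G.e (G.d φ)))) := by
  simp only [G.inner_quot]
  exact ((((innerSL ℝ f).continuous.tendsto _).comp
    ((G.tendsto_quot_test φ).comp tendsto_neg_punctured))).neg

theorem tendsto_inner_quot (hf : G.Weak f f') (y : H) :
    Tendsto (fun a => inner ℝ (G.quot a f) y) (𝓝[≠] 0) (𝓝 (inner ℝ f' y)) := by
  refine tendsto_inner_of_dense G.dense (Eventually.of_forall (G.norm_quot_le hf)) (fun φ => ?_) y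
  have := G.tendsto_inner_quot_test f φ
  rwa [hf, neg_neg] at this

/-- Integration by parts. -/
theorem inner_weak (hf : G.Weak f f') (hh : G.Weak h h') : inner ℝ f' h = - inner ℝ f h' := by
  have h1 := G.tendsto_inner_quot hf h
  -- Both sides of the discrete identity converge weakly, so no approximation by smooth functions is
  -- needed.
  have h2 : Tendsto (fun a => inner ℝ (G.quot a f) h) (𝓝[≠] 0) (𝓝 (- inner ℝ f h')) := by
    simp only [G.inner_quot]
    simp only [real_inner_comm _ f]
    exact ((G.tendsto_inner_quot hh f).comp tendsto_neg_punctured).neg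
  exact tendsto_nhds_unique h1 h2

end TranslationGroup

/-- The Riesz representation of a functional bounded on a dense family of tests. -/
theorem exists_inner_eq_of_bound [CompleteSpace H] {e : τ →ₗ[ℝ] H} (he : DenseRange e)
    (L : τ →ₗ[ℝ] ℝ) {M : ℝ} (h : ∀ φ, L φ ≤ M * ‖e φ‖) :
    ∃ x : H, ∀ φ, inner ℝ x (e φ) = L φ := by
  have h' : ∀ φ, ‖L φ‖ ≤ M * ‖e φ‖ := fun φ => by
    rw [Real.norm_eq_abs, abs_le']
    refine ⟨h φ, ?_⟩
    have := h (-φ)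
    rwa [map_neg, map_neg, norm_neg] at this
  refine ⟨(InnerProductSpace.toDual ℝ H).symm (L.extendOfNorm e), fun φ => ?_⟩
  rw [InnerProductSpace.toDual_symm_apply, LinearMap.extendOfNorm_eq he ⟨M, h'⟩]

end Abstract

/-! ### Translations of the torus -/

/-- Translation by `a` on the circle `(0, 2π]`. -/
def rot (a x : ℝ) : ℝ := toIocMod Real.two_pi_pos 0 (x + a)

theorem rot_eq (a x : ℝ) : ∃ n : ℤ, rot a x = x + a - n * (2 * Real.pi) :=
  ⟨toIocDiv Real.two_pi_pos 0 (x + a), by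
    rw [rot, ← self_sub_toIocDiv_zsmul Real.two_pi_pos 0 (x + a), zsmul_eq_mul]⟩

theorem intervalMeasure_eq_Ioc : intervalMeasure = volume.restrict (Ioc 0 (0 + 2 * Real.pi)) := by
  rw [intervalMeasure, zero_add]; exact restrict_Ioo_eq_restrict_Ioc

/-- The map is the projection to the circle, followed by a rotation and by the choice of the
representative in `(0, 2π]`. Each of the three preserves measure. -/
theorem measurePreserving_rot (a : ℝ) : MeasurePreserving (rot a) intervalMeasure intervalMeasure := by
  have : Fact (0 < 2 * Real.pi) := ⟨Real.two_pi_pos⟩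
  rw [intervalMeasure_eq_Ioc]
  have h1 := AddCircle.measurePreserving_mk (2 * Real.pi) 0
  have h2 : MeasurePreserving (fun x : AddCircle (2 * Real.pi) => x + (a : AddCircle (2 * Real.pi)))
      volume volume := measurePreserving_add_right _ _
  have h3 := AddCircle.measurePreserving_equivIoc (2 * Real.pi) (a := 0)
  have h4 : MeasurePreserving (Subtype.val : Ioc (0 : ℝ) (0 + 2 * Real.pi) → ℝ)
      (Measure.comap Subtype.val volume) (volume.restrict (Ioc 0 (0 + 2 * Real.pi))) :=
    measurePreserving_subtype_coe measurableSet_Ioc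
  exact h4.comp (h3.comp (h2.comp h1))

theorem rot_neg_rot (a : ℝ) {x : ℝ} (hx : x ∈ Ioo 0 (2 * Real.pi)) : rot (-a) (rot a x) = x := by
  obtain ⟨n, hn⟩ := rot_eq a x
  have : rot (-a) (rot a x) = toIocMod Real.two_pi_pos 0 (x - n • (2 * Real.pi)) := by
    rw [rot, hn, zsmul_eq_mul]; congr 1; ring
  rw [this, toIocMod_sub_zsmul, toIocMod_eq_self, zero_add]
  exact ⟨hx.1, hx.2.le⟩

theorem measurePreserving_rotY (a : ℝ) :
    MeasurePreserving (fun z : ℝ × ℝ => (z.1, rot a z.2)) cellMeasure cellMeasure := by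
  rw [cellMeasure_eq_prod]
  exact (MeasurePreserving.id intervalMeasure).prod (measurePreserving_rot a)

theorem measurePreserving_rotX (a : ℝ) :
    MeasurePreserving (fun z : ℝ × ℝ => (rot a z.1, z.2)) cellMeasure cellMeasure := by
  rw [cellMeasure_eq_prod]
  exact (measurePreserving_rot a).prod (MeasurePreserving.id intervalMeasure)

/-- The translation in `y`. -/
def transY (a : ℝ) : CellL2 →ₗᵢ[ℝ] CellL2 :=
  Lp.compMeasurePreservingₗᵢ ℝ _ (measurePreserving_rotY a)

/-- The translation in `x`. -/
def transX (a : ℝ) : CellL2 →ₗᵢ[ℝ] CellL2 :=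
  Lp.compMeasurePreservingₗᵢ ℝ _ (measurePreserving_rotX a)

theorem transY_toL2 (a : ℝ) {f : ℝ × ℝ → ℝ} (hf : MemLp f 2 cellMeasure) :
    transY a (toL2 f) = toL2 fun z => f (z.1, rot a z.2) := by
  rw [toL2_eq hf]
  exact (toL2_eq (hf.comp_measurePreserving (measurePreserving_rotY a))).symm

theorem transX_toL2 (a : ℝ) {f : ℝ × ℝ → ℝ} (hf : MemLp f 2 cellMeasure) :
    transX a (toL2 f) = toL2 fun z => f (rot a z.1, z.2) := by
  rw [toL2_eq hf]
  exact (toL2_eq (hf.comp_measurePreserving (measurePreserving_rotX a))).symm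

theorem transY_transY_neg (a : ℝ) (F : CellL2) : transY a (transY (-a) F) = F := by
  have h := Lp.memLp F
  have h' := h.comp_measurePreserving (measurePreserving_rotY (-a))
  conv_lhs => rw [← toL2_coe F, transY_toL2 _ h]
  refine (transY_toL2 a h').trans ?_
  conv_rhs => rw [← toL2_coe F]
  refine toL2_congr ?_
  filter_upwards [ae_mem_cell] with z hz
  simp only [Function.comp, rot_neg_rot a hz.2]

theorem transX_transX_neg (a : ℝ) (F : CellL2) : transX a (transX (-a) F) = F := by
  have h := Lp.memLp F
  have h' := h.comp_measurePreserving (measurePreserving_rotX (-a))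
  conv_lhs => rw [← toL2_coe F, transX_toL2 _ h]
  refine (transX_toL2 a h').trans ?_
  conv_rhs => rw [← toL2_coe F]
  refine toL2_congr ?_
  filter_upwards [ae_mem_cell] with z hz
  simp only [Function.comp, rot_neg_rot a hz.1]

theorem transY_adj (a : ℝ) (F H : CellL2) :
    inner ℝ (transY a F) H = inner ℝ F (transY (-a) H) := by
  conv_lhs => rw [← transY_transY_neg a H]
  exact (transY a).inner_map_map _ _

theorem transX_adj (a : ℝ) (F H : CellL2) :
    inner ℝ (transX a F) H = inner ℝ F (transX (-a) H) := by
  conv_lhs => rw [← transX_transX_neg a H]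
  exact (transX a).inner_map_map _ _

/-- This is the reason why the linear systems are invariant under translations in `y`: coefficients
see only `x`. -/
theorem transY_op (a : ℝ) (c : Coef) (F : CellL2) : transY a (c.op F) = c.op (transY a F) := by
  conv_rhs => rw [← toL2_coe F, transY_toL2 a (Lp.memLp F)]
  rw [Coef.op_apply, transY_toL2 a (c.memLp_mul (Lp.memLp F)), Coef.op_toL2]
  exact (Lp.memLp F).comp_measurePreserving (measurePreserving_rotY a)

theorem periodic_rot {f : ℝ → ℝ} (hf : ∀ x, f (x + 2 * Real.pi) = f x) (a x : ℝ) :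
    f (rot a x) = f (x + a) := by
  obtain ⟨n, hn⟩ := rot_eq a x
  rw [hn]
  exact Function.Periodic.sub_int_mul_eq hf n

/-! ### Test functions as elements of `L²(D)` -/

/-- The space of interior test functions. -/
def interiorTests : Submodule ℝ (ℝ × ℝ → ℝ) where
  carrier := {φ | IsInteriorTest φ}
  zero_mem' := ⟨contDiff_const, fun _ _ => rfl, 1, one_pos, fun _ _ _ => rfl⟩
  add_mem' := by
    rintro φ ψ ⟨h1, h2, ε, hε, h3⟩ ⟨k1, k2, δ, hδ, k3⟩
    refine ⟨h1.add k1, fun x y => ?_, min ε δ, lt_min hε hδ, fun x y hx => ?_⟩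
    · simp only [Pi.add_apply, h2, k2]
    · have e1 : x < ε ∨ 2 * Real.pi - ε < x :=
        hx.imp (fun h => h.trans_le (min_le_left _ _)) fun h => by linarith [min_le_left ε δ]
      have e2 : x < δ ∨ 2 * Real.pi - δ < x :=
        hx.imp (fun h => h.trans_le (min_le_right _ _)) fun h => by linarith [min_le_right ε δ]
      simp only [Pi.add_apply, h3 x y e1, k3 x y e2, add_zero]
  smul_mem' := by
    rintro c φ ⟨h1, h2, ε, hε, h3⟩
    refine ⟨contDiff_const.mul h1, fun x y => ?_, ε, hε, fun x y hx => ?_⟩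
    · simp only [Pi.smul_apply, h2]
    · simp only [Pi.smul_apply, h3 x y hx, smul_zero]

/-- The space of test functions on the torus. -/
def torusTests : Submodule ℝ (ℝ × ℝ → ℝ) where
  carrier := {φ | IsTorusTest φ}
  zero_mem' := ⟨contDiff_const, fun _ _ => rfl, fun _ _ => rfl⟩
  add_mem' := by
    rintro φ ψ ⟨h1, h2, h3⟩ ⟨k1, k2, k3⟩
    exact ⟨h1.add k1, fun x y => by simp only [Pi.add_apply, h2, k2],
      fun x y => by simp only [Pi.add_apply, h3, k3]⟩
  smul_mem' := by
    rintro c φ ⟨h1, h2, h3⟩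
    exact ⟨contDiff_const.mul h1, fun x y => by simp only [Pi.smul_apply, h2],
      fun x y => by simp only [Pi.smul_apply, h3]⟩

theorem partialX_add {φ ψ : ℝ × ℝ → ℝ} (h : Differentiable ℝ φ) (k : Differentiable ℝ ψ) :
    partialX (φ + ψ) = partialX φ + partialX ψ := by
  funext z
  exact ((hasDerivAt_partialX h z.1 z.2).add (hasDerivAt_partialX k z.1 z.2)).deriv

theorem partialY_add {φ ψ : ℝ × ℝ → ℝ} (h : Differentiable ℝ φ) (k : Differentiable ℝ ψ) :
    partialY (φ + ψ) = partialY φ + partialY ψ := by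
  funext z
  exact ((hasDerivAt_partialY h z.1 z.2).add (hasDerivAt_partialY k z.1 z.2)).deriv

theorem partialX_smul {φ : ℝ × ℝ → ℝ} (h : Differentiable ℝ φ) (c : ℝ) :
    partialX (c • φ) = c • partialX φ := by
  funext z
  exact ((hasDerivAt_partialX h z.1 z.2).const_mul c).deriv

theorem partialY_smul {φ : ℝ × ℝ → ℝ} (h : Differentiable ℝ φ) (c : ℝ) :
    partialY (c • φ) = c • partialY φ := by
  funext z
  exact ((hasDerivAt_partialY h z.1 z.2).const_mul c).deriv

/-- An interior test as an element of `L²(D)`. -/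
def testI : interiorTests →ₗ[ℝ] CellL2 where
  toFun φ := toL2 φ
  map_add' φ ψ := toL2_add φ.2.memLp ψ.2.memLp
  map_smul' c φ := toL2_const_mul φ.2.memLp c

/-- A torus test as an element of `L²(D)`. -/
def testT : torusTests →ₗ[ℝ] CellL2 where
  toFun φ := toL2 φ
  map_add' φ ψ := toL2_add φ.2.memLp ψ.2.memLp
  map_smul' c φ := toL2_const_mul φ.2.memLp c

/-- The `x`-derivative of an interior test. -/
def dXI : interiorTests →ₗ[ℝ] interiorTests where
  toFun φ := ⟨partialX φ, φ.2.partialX⟩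
  map_add' φ ψ := Subtype.ext (partialX_add φ.2.differentiable ψ.2.differentiable)
  map_smul' c φ := Subtype.ext (partialX_smul φ.2.differentiable c)

/-- The `y`-derivative of an interior test. -/
def dYI : interiorTests →ₗ[ℝ] interiorTests where
  toFun φ := ⟨partialY φ, φ.2.partialY⟩
  map_add' φ ψ := Subtype.ext (partialY_add φ.2.differentiable ψ.2.differentiable)
  map_smul' c φ := Subtype.ext (partialY_smul φ.2.differentiable c)

/-- The `x`-derivative of a torus test. -/
def dXT : torusTests →ₗ[ℝ] torusTests where
  toFun φ := ⟨partialX φ, φ.2.partialX⟩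
  map_add' φ ψ := Subtype.ext (partialX_add φ.2.differentiable ψ.2.differentiable)
  map_smul' c φ := Subtype.ext (partialX_smul φ.2.differentiable c)

theorem dXI_dYI (φ : interiorTests) : dXI (dYI φ) = dYI (dXI φ) :=
  Subtype.ext (partialX_partialY_comm φ.2.1)

/-- A second order Taylor estimate. -/
theorem abs_taylor_le {f f' f'' : ℝ → ℝ} (h1 : ∀ x, HasDerivAt f (f' x) x)
    (h2 : ∀ x, HasDerivAt f' (f'' x) x) {C a x : ℝ} (ha : |a| ≤ 1)
    (hC : ∀ s, |s| ≤ 1 → |f'' (x + s)| ≤ C) : |f (x + a) - f x - a * f' x| ≤ C * a ^ 2 := by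
  have hI : Convex ℝ (Metric.closedBall (0 : ℝ) |a|) := convex_closedBall _ _
  have hmem : ∀ s ∈ Metric.closedBall (0 : ℝ) |a|, |s| ≤ |a| := fun s hs => by simpa using hs
  have hC0 : 0 ≤ C := (abs_nonneg _).trans (hC 0 (by simp))
  have hsh : ∀ (F F' : ℝ → ℝ), (∀ x, HasDerivAt F (F' x) x) → ∀ s,
      HasDerivAt (fun s => F (x + s)) (F' (x + s)) s := fun F F' hF s => by
    simpa using (hF (x + s)).comp_const_add x s
  have b1 : ∀ s ∈ Metric.closedBall (0 : ℝ) |a|, ‖f' (x + s) - f' x‖ ≤ C * |a| := fun s hs => by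
    have := hI.norm_image_sub_le_of_norm_hasDerivWithin_le (C := C)
      (fun s _ => (hsh f' f'' h2 s).hasDerivWithinAt)
      (fun s hs => hC s ((hmem s hs).trans ha)) (Metric.mem_closedBall_self (abs_nonneg a)) hs
    simp only [add_zero, sub_zero] at this
    refine this.trans ?_
    gcongr
    exact hmem s hs
  have := hI.norm_image_sub_le_of_norm_hasDerivWithin_le (C := C * |a|)
      (fun s _ => ((hsh f f' h1 s).sub ((hasDerivAt_id s).mul_const (f' x))).hasDerivWithinAt)
      (fun s hs => by simpa using b1 s hs) (Metric.mem_closedBall_self (abs_nonneg a))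
      (show a ∈ Metric.closedBall (0 : ℝ) |a| by simp)
  simp only [Pi.sub_apply, id, add_zero, zero_mul, sub_zero, Real.norm_eq_abs] at this
  calc |f (x + a) - f x - a * f' x| = |f (x + a) - a * f' x - f x| := by congr 1; ring
    _ ≤ C * |a| * |a| := this
    _ = C * a ^ 2 := by rw [mul_assoc, abs_mul_abs_self, pow_two]

/-- Difference quotients with a uniform quadratic remainder are derivatives in `L²(D)`. -/
theorem hasDerivAt_toL2 {F : ℝ → ℝ × ℝ → ℝ} {F' : ℝ × ℝ → ℝ} (hF : ∀ a, Continuous (F a))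
    (hF' : Continuous F') {C : ℝ}
    (h : ∀ a, |a| ≤ 1 → ∀ z ∈ cell, |F a z - F 0 z - a * F' z| ≤ C * a ^ 2) :
    HasDerivAt (fun a => toL2 (F a)) (toL2 F') 0 := by
  rw [hasDerivAt_iff_isLittleO_nhds_zero]
  have hb : ∀ᶠ a in 𝓝 (0 : ℝ), ‖toL2 (F (0 + a)) - toL2 (F 0) - a • toL2 F'‖
      ≤ (|C| * (2 * Real.pi)) * ‖a ^ 2‖ := by
    filter_upwards [Metric.closedBall_mem_nhds (0 : ℝ) one_pos] with a ha
    have ha : |a| ≤ 1 := by simpa using ha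
    have m1 := fun a => memLp_of_continuous (hF a) 2
    have m2 := memLp_of_continuous hF' 2
    have m3 : MemLp (fun z => F a z - F 0 z) 2 cellMeasure := (m1 a).sub (m1 0)
    rw [zero_add, ← toL2_sub (m1 a) (m1 0), ← toL2_const_mul m2, ← toL2_sub m3 (m2.const_mul a)]
    have := norm_toL2_le (f := fun z => F a z - F 0 z - a * F' z)
      (m3.sub (m2.const_mul a)).1 (C := |C| * a ^ 2) (by positivity)
      (fun z hz => (h a ha z hz).trans (by gcongr; exact le_abs_self C))
    rw [Real.norm_eq_abs, abs_of_nonneg (sq_nonneg a)]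
    linarith
  refine (Asymptotics.IsBigO.of_bound _ hb).trans_isLittleO ?_
  exact Asymptotics.isLittleO_pow_id one_lt_two

theorem exists_abs_le_on_strip {φ : ℝ × ℝ → ℝ} (h : Continuous φ) :
    ∃ C, ∀ x ∈ Icc (-1 : ℝ) (2 * Real.pi + 1), ∀ y ∈ Icc (-1 : ℝ) (2 * Real.pi + 1),
      |φ (x, y)| ≤ C := by
  obtain ⟨C, hC⟩ := (isCompact_Icc.prod isCompact_Icc).exists_bound_of_continuousOn
    (s := Icc (-1 : ℝ) (2 * Real.pi + 1) ×ˢ Icc (-1 : ℝ) (2 * Real.pi + 1)) h.continuousOn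
  exact ⟨C, fun x hx y hy => hC (x, y) ⟨hx, hy⟩⟩

theorem hasDerivAt_shiftY {φ : ℝ × ℝ → ℝ} (h : ContDiff ℝ ∞ φ) :
    HasDerivAt (fun a => toL2 fun z => φ (z.1, z.2 + a)) (toL2 (partialY φ)) 0 := by
  obtain ⟨C, hC⟩ := exists_abs_le_on_strip (contDiff_partialY (contDiff_partialY h)).continuous
  refine hasDerivAt_toL2 (C := C) (F := fun a z => φ (z.1, z.2 + a))
    (fun a => h.continuous.comp (by fun_prop))
    (contDiff_partialY h).continuous fun a ha z hz => ?_
  have := abs_taylor_le (f := fun y => φ (z.1, y))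
    (fun y => hasDerivAt_partialY (h.differentiable (by simp)) z.1 y)
    (fun y => hasDerivAt_partialY ((contDiff_partialY h).differentiable (by simp)) z.1 y)
    (C := C) (x := z.2) ha fun s hs => ?_
  · simpa using this
  · have := abs_le.1 hs
    exact hC _ ⟨by linarith [hz.1.1], by linarith [hz.1.2]⟩ _
      ⟨by linarith [hz.2.1], by linarith [hz.2.2]⟩

theorem hasDerivAt_shiftX {φ : ℝ × ℝ → ℝ} (h : ContDiff ℝ ∞ φ) :
    HasDerivAt (fun a => toL2 fun z => φ (z.1 + a, z.2)) (toL2 (partialX φ)) 0 := by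
  obtain ⟨C, hC⟩ := exists_abs_le_on_strip (contDiff_partialX (contDiff_partialX h)).continuous
  refine hasDerivAt_toL2 (C := C) (F := fun a z => φ (z.1 + a, z.2))
    (fun a => h.continuous.comp (by fun_prop))
    (contDiff_partialX h).continuous fun a ha z hz => ?_
  have := abs_taylor_le (f := fun x => φ (x, z.2))
    (fun x => hasDerivAt_partialX (h.differentiable (by simp)) x z.2)
    (fun x => hasDerivAt_partialX ((contDiff_partialX h).differentiable (by simp)) x z.2)
    (C := C) (x := z.1) ha fun s hs => ?_
  · simpa using this
  · have := abs_le.1 hs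
    exact hC _ ⟨by linarith [hz.1.1], by linarith [hz.1.2]⟩ _
      ⟨by linarith [hz.2.1], by linarith [hz.2.2]⟩

/-! ### Periodization and density of tests -/

/-- Periodization of a smooth function which vanishes near the sides of the period strip. -/
theorem exists_periodize {φ : ℝ × ℝ → ℝ} (h : ContDiff ℝ ∞ φ) {ε : ℝ} (hε : 0 < ε)
    (h0 : ∀ x y, y < ε ∨ 2 * Real.pi - ε < y → φ (x, y) = 0) :
    ∃ ψ : ℝ × ℝ → ℝ, ContDiff ℝ ∞ ψ ∧ (∀ x y, ψ (x, y + 2 * Real.pi) = ψ (x, y)) ∧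
      (∀ x, ∀ y ∈ Ico 0 (2 * Real.pi), ψ (x, y) = φ (x, y)) ∧
      ∀ x y, ∃ y', ψ (x, y) = φ (x, y') := by
  have hp := Real.two_pi_pos
  set ψ : ℝ × ℝ → ℝ := fun z => φ (z.1, toIcoMod hp 0 z.2) with hψ
  have hmod : ∀ (n : ℤ) (y : ℝ), y ∈ Ico (n * (2 * Real.pi)) (n * (2 * Real.pi) + 2 * Real.pi) →
      toIcoMod hp 0 y = y - n * (2 * Real.pi) := fun n y hy => by
    rw [toIcoMod_eq_iff]
    exact ⟨⟨by linarith [hy.1], by linarith [hy.2]⟩, n, by rw [zsmul_eq_mul]; ring⟩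
  have hper : ∀ x y, ψ (x, y + 2 * Real.pi) = ψ (x, y) := fun x y => by
    simp only [hψ, toIcoMod_add_right]
  refine ⟨ψ, contDiff_iff_contDiffAt.2 fun z => ?_, hper, fun x y hy => ?_, fun x y => ⟨_, rfl⟩⟩
  · set n := toIcoDiv hp 0 z.2 with hn
    have hz := toIcoMod_mem_Ico' hp z.2
    rw [← self_sub_toIcoDiv_zsmul, ← hn, zsmul_eq_mul] at hz
    have hnear : ψ =ᶠ[𝓝 z] fun w => φ (w.1, w.2 - n * (2 * Real.pi)) := by
      have hε' : 0 < min ε Real.pi := lt_min hε Real.pi_pos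
      have : {w : ℝ × ℝ | w.2 ∈ Ioo (n * (2 * Real.pi) - min ε Real.pi)
          (n * (2 * Real.pi) + 2 * Real.pi)} ∈ 𝓝 z :=
        (isOpen_Ioo.preimage continuous_snd).mem_nhds ⟨by linarith [hz.1], by linarith [hz.2]⟩
      filter_upwards [this] with w hw
      rcases le_or_gt (n * (2 * Real.pi)) w.2 with hle | hlt
      · simp only [hψ]
        rw [hmod n w.2 ⟨hle, hw.2⟩]
      -- Just below the edge of a strip the representative jumps by a period. The original function
      -- vanishes near both ends of the period, so a single translate still describes `ψ` there.
      · have e1 : toIcoMod hp 0 w.2 = w.2 - ((n - 1 : ℤ) : ℝ) * (2 * Real.pi) := by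
          refine hmod (n - 1) w.2 ?_
          push_cast
          exact ⟨by linarith [hw.1, min_le_right ε Real.pi], by linarith⟩
        simp only [hψ]
        rw [e1, h0 _ _ (Or.inr ?_), h0 _ _ (Or.inl (by linarith))]
        push_cast
        linarith [hw.1, min_le_left ε Real.pi]
    refine ContDiffAt.congr_of_eventuallyEq ?_ hnear
    exact (h.comp (by fun_prop : ContDiff ℝ ∞ fun w : ℝ × ℝ =>
      (w.1, w.2 - n * (2 * Real.pi)))).contDiffAt
  · simp only [hψ]
    rw [(toIcoMod_eq_self hp).2 (by simpa using hy)]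

/-- An interior test agrees on the cell with a test on the torus. -/
theorem IsInteriorTest.exists_torusTest {φ : ℝ × ℝ → ℝ} (h : IsInteriorTest φ) :
    ∃ ψ, IsTorusTest ψ ∧ ∀ z ∈ cell, ψ z = φ z := by
  obtain ⟨h1, h2, ε, hε, h3⟩ := h
  have hs : ContDiff ℝ ∞ fun z : ℝ × ℝ => φ (z.2, z.1) :=
    h1.comp (by fun_prop : ContDiff ℝ ∞ fun z : ℝ × ℝ => (z.2, z.1))
  obtain ⟨ψ, k1, k2, k3, k4⟩ := exists_periodize hs hε fun x y hy => h3 y x hy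
  refine ⟨fun z => ψ (z.2, z.1), ⟨k1.comp (by fun_prop : ContDiff ℝ ∞ fun z : ℝ × ℝ => (z.2, z.1)),
    fun x y => k2 y x, fun x y => ?_⟩, fun z hz => k3 z.2 z.1 ⟨hz.1.1.le, hz.1.2⟩⟩
  have hp := k2
  set n := toIcoDiv Real.two_pi_pos 0 x
  have hx := toIcoMod_mem_Ico' Real.two_pi_pos x
  rw [← self_sub_toIcoDiv_zsmul, zsmul_eq_mul] at hx
  have hper : ∀ y, ψ (y, x) = ψ (y, x - n * (2 * Real.pi)) := fun y =>
    (Function.Periodic.sub_int_mul_eq (f := fun x => ψ (y, x)) (k2 y) n).symm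
  simp only
  rw [hper, hper, k3 _ _ hx, k3 _ _ hx, h2]

/-- The compact support has a positive distance from the boundary of the cell, so the bump can be
repeated periodically in `y` without losing smoothness. -/
theorem exists_interiorTest {φ : ℝ × ℝ → ℝ} (h : ContDiff ℝ ∞ φ) (hc : HasCompactSupport φ)
    (hs : tsupport φ ⊆ cell) : ∃ ψ, IsInteriorTest ψ ∧ ∀ z ∈ cell, ψ z = φ z := by
  obtain ⟨ε, hε, hd⟩ := hc.isCompact.exists_thickening_subset_open isOpen_cell hs
  have key : ∀ x y, φ (x, y) ≠ 0 → (ε / 2 ≤ x ∧ x ≤ 2 * Real.pi - ε / 2) ∧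
      (ε / 2 ≤ y ∧ y ≤ 2 * Real.pi - ε / 2) := fun x y hne => by
    have hin : ∀ a b : ℝ, |a| ≤ ε / 2 → |b| ≤ ε / 2 → (x + a, y + b) ∈ cell := fun a b ha hb => by
      refine hd (Metric.mem_thickening_iff.2 ⟨(x, y), subset_tsupport _ hne, ?_⟩)
      rw [Prod.dist_eq, max_lt_iff]
      simp only [Real.dist_eq, add_sub_cancel_left]
      constructor <;> linarith
    have hε2 : |ε / 2| ≤ ε / 2 := (abs_of_pos (by positivity)).le
    have h1 := hin (ε / 2) (ε / 2) hε2 hε2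
    have h2 := hin (-(ε / 2)) (-(ε / 2)) (by rwa [abs_neg]) (by rwa [abs_neg])
    simp only [cell, mem_prod, mem_Ioo] at h1 h2
    exact ⟨⟨by linarith, by linarith⟩, ⟨by linarith, by linarith⟩⟩
  obtain ⟨ψ, k1, k2, k3, k4⟩ := exists_periodize h (half_pos hε) fun x y hy => by
    by_contra hne
    have := (key x y hne).2
    rcases hy with hy | hy <;> linarith
  refine ⟨ψ, ⟨k1, k2, ε / 2, half_pos hε, fun x y hx => ?_⟩,
    fun z hz => k3 z.1 z.2 ⟨hz.2.1.le, hz.2.2⟩⟩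
  obtain ⟨y', hy'⟩ := k4 x y
  rw [hy']
  by_contra hne
  have := (key x y' hne).1
  rcases hx with hx | hx <;> linarith

/-- The fundamental lemma of the calculus of variations, applied to bumps supported in the cell. It
yields uniqueness of weak derivatives and the density of both kinds of tests. -/
theorem eq_zero_of_inner_testI {F : CellL2} (h : ∀ φ, inner ℝ F (testI φ) = 0) : F = 0 := by
  have hF : LocallyIntegrableOn F cell volume := by
    have : Integrable F cellMeasure := (Lp.memLp F).integrable (by norm_num)
    exact IntegrableOn.locallyIntegrableOn this
  have := isOpen_cell.ae_eq_zero_of_integral_contDiff_smul_eq_zero hF fun φ h1 h2 h3 => by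
    obtain ⟨ψ, hψ, he⟩ := exists_interiorTest h1 h2 h3
    have e1 := h ⟨ψ, hψ⟩
    change inner ℝ F (toL2 ψ) = 0 at e1
    rw [← toL2_coe F, inner_toL2 (Lp.memLp F) hψ.memLp] at e1
    rw [← setIntegral_eq_integral_of_forall_compl_eq_zero (s := cell), ← e1]
    · refine setIntegral_congr_fun measurableSet_cell fun z hz => ?_
      simp only [smul_eq_mul]; rw [he z hz, mul_comm]
    · intro z hz
      rw [image_eq_zero_of_notMem_tsupport fun hz' => hz (h3 hz'), zero_smul]
  refine Lp.ext ?_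
  have h2 : ∀ᵐ z ∂cellMeasure, F z = 0 := (ae_restrict_iff' measurableSet_cell).2 this
  filter_upwards [h2, Lp.coeFn_zero ℝ 2 cellMeasure] with z h3 h4
  rw [h3, h4]; rfl

theorem denseRange_of_orthogonal {τ : Type*} [AddCommGroup τ] [Module ℝ τ] (e : τ →ₗ[ℝ] CellL2)
    (h : ∀ F : CellL2, (∀ φ, inner ℝ F (e φ) = 0) → F = 0) : DenseRange e := by
  have h1 : (LinearMap.range e)ᗮ = ⊥ := by
    rw [Submodule.eq_bot_iff]
    exact fun F hF => h F fun φ =>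
      Submodule.inner_left_of_mem_orthogonal (LinearMap.mem_range_self e φ) hF
  have h2 := (Submodule.topologicalClosure_eq_top_iff).2 h1
  rw [DenseRange, ← LinearMap.coe_range]
  exact Submodule.dense_iff_topologicalClosure_eq_top.2 h2

theorem dense_testI : DenseRange testI := denseRange_of_orthogonal _ fun _ => eq_zero_of_inner_testI

/-- Interior tests are restrictions of torus tests, and the derivatives agree because the cell is
open. Hence a weak derivative on the torus is one in the cell. -/
theorem exists_testT_eq (φ : interiorTests) : ∃ ψ : torusTests, testT ψ = testI φ ∧
    testT (dXT ψ) = testI (dXI φ) := by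
  obtain ⟨ψ, hψ, he⟩ := IsInteriorTest.exists_torusTest φ.2
  refine ⟨⟨ψ, hψ⟩, toL2_congr (ae_mem_cell.mono he), toL2_congr (ae_mem_cell.mono fun z hz => ?_)⟩
  refine Filter.EventuallyEq.deriv_eq ?_
  have : {x : ℝ | (x, z.2) ∈ cell} ∈ 𝓝 z.1 :=
    (isOpen_cell.preimage (by fun_prop : Continuous fun x : ℝ => (x, z.2))).mem_nhds hz
  filter_upwards [this] with x hx using he _ hx

theorem dense_testT : DenseRange testT := denseRange_of_orthogonal _ fun F hF =>
  eq_zero_of_inner_testI fun φ => by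
    obtain ⟨ψ, h1, -⟩ := exists_testT_eq φ
    rw [← h1, hF]

/-- Interior tests with the translations in `y`. -/
def groupY : TranslationGroup CellL2 interiorTests where
  e := testI
  d := dYI
  sh a φ := ⟨fun z => φ.1 (z.1, z.2 + a), φ.2.shift a⟩
  T := transY
  dense := dense_testI
  T_e a φ := by
    refine (transY_toL2 a φ.2.memLp).trans (toL2_congr (Eventually.of_forall fun z => ?_))
    exact periodic_rot (f := fun y => φ.1 (z.1, y)) (φ.2.2.1 z.1) a z.2
  adj := transY_adj
  sh_add a b φ := Subtype.ext (funext fun z => by simp only [add_assoc])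
  hasDerivAt_zero φ := hasDerivAt_shiftY φ.2.1

/-- Torus tests with the translations in `x`. -/
def groupX : TranslationGroup CellL2 torusTests where
  e := testT
  d := dXT
  sh a φ := ⟨fun z => φ.1 (z.1 + a, z.2), φ.2.shiftX a⟩
  T := transX
  dense := dense_testT
  T_e a φ := by
    refine (transX_toL2 a φ.2.memLp).trans (toL2_congr (Eventually.of_forall fun z => ?_))
    exact periodic_rot (f := fun x => φ.1 (x, z.2)) (fun x => φ.2.2.1 x z.2) a z.1
  adj := transX_adj
  sh_add a b φ := Subtype.ext (funext fun z => by simp only [add_assoc])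
  hasDerivAt_zero φ := hasDerivAt_shiftX φ.2.1

/-! ### Weak derivatives in `L²(D)` -/

/-- `fx` is the weak `x`-derivative of `f` in the cell. -/
def WX (f fx : CellL2) : Prop := ∀ φ, inner ℝ f (testI (dXI φ)) = - inner ℝ fx (testI φ)

/-- `fy` is the weak `y`-derivative of `f`. -/
def WY (f fy : CellL2) : Prop := ∀ φ, inner ℝ f (testI (dYI φ)) = - inner ℝ fy (testI φ)

/-- `fx` is the weak `x`-derivative of `f` on the torus. -/
def TX (f fx : CellL2) : Prop := ∀ φ, inner ℝ f (testT (dXT φ)) = - inner ℝ fx (testT φ)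

/-- Multiplication of a test by a coefficient. -/
def Coef.mulTest (c : Coef) (φ : interiorTests) : interiorTests := ⟨_, c.isInteriorTest_mul φ.2⟩

theorem testI_mulTest (c : Coef) (φ : interiorTests) :
    testI (c.mulTest φ) = c.op (testI φ) := (c.op_toL2 φ.2.memLp).symm

theorem testI_dXI_mulTest (c : Coef) (φ : interiorTests) :
    testI (dXI (c.mulTest φ)) = c.d.op (testI φ) + c.op (testI (dXI φ)) := by
  have h1 : c.op (testI (dXI φ)) = _ := c.op_toL2 (dXI φ).2.memLp
  have h2 : c.d.op (testI φ) = _ := c.d.op_toL2 φ.2.memLp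
  rw [h1, h2, ← toL2_add (c.d.memLp_mul φ.2.memLp) (c.memLp_mul (dXI φ).2.memLp)]
  exact toL2_congr (ae_mem_cell.mono fun z hz => c.partialX_mul φ.2 hz)

theorem testI_dYI_mulTest (c : Coef) (φ : interiorTests) :
    testI (dYI (c.mulTest φ)) = c.op (testI (dYI φ)) := by
  have h1 : c.op (testI (dYI φ)) = _ := c.op_toL2 (dYI φ).2.memLp
  rw [h1]
  exact toL2_congr (Eventually.of_forall fun z => c.partialY_mul φ.2 z)

/-- Translation of an interior test in `y`. -/
def shiftI (a : ℝ) (φ : interiorTests) : interiorTests := groupY.sh a φ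

theorem transY_testI (a : ℝ) (φ : interiorTests) : transY a (testI φ) = testI (shiftI a φ) :=
  groupY.T_e a φ

theorem dXI_shiftI (a : ℝ) (φ : interiorTests) : dXI (shiftI a φ) = shiftI a (dXI φ) := rfl

theorem dYI_shiftI (a : ℝ) (φ : interiorTests) : dYI (shiftI a φ) = shiftI a (dYI φ) :=
  Subtype.ext (funext fun z => deriv_comp_add_const (f := fun y => φ.1 (z.1, y)) a z.2)

/-- The group in `y` is built on interior tests; this supplement lets translations in `y` preserve
equality of the traces on the sides. -/
theorem exists_transY_testT (a : ℝ) (φ : torusTests) :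
    ∃ ψ, transY a (testT φ) = testT ψ ∧ transY a (testT (dXT φ)) = testT (dXT ψ) := by
  have hψ : IsTorusTest fun z => φ.1 (z.1, z.2 + a) := by
    obtain ⟨h1, h2, h3⟩ := φ.2
    refine ⟨by fun_prop, fun x y => h2 _ _, fun x y => ?_⟩
    simp only
    rw [add_right_comm, h3]
  refine ⟨⟨_, hψ⟩, ?_, ?_⟩
  · refine (transY_toL2 a φ.2.memLp).trans (toL2_congr (Eventually.of_forall fun z => ?_))
    exact periodic_rot (f := fun y => φ.1 (z.1, y)) (φ.2.2.2 z.1) a z.2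
  · refine (transY_toL2 a (dXT φ).2.memLp).trans (toL2_congr (Eventually.of_forall fun z => ?_))
    have h := (φ.2.2.2)
    refine periodic_rot (f := fun y => partialX φ.1 (z.1, y)) (fun y => ?_) a z.2
    simp only [partialX, h]

/-! ### Calculus of weak derivatives: products, translations, integration by parts. -/

section Calculus

variable {f fx fy h hx hy : CellL2}

theorem TX.wx (hf : TX f fx) : WX f fx := fun φ => by
  obtain ⟨ψ, h1, h2⟩ := exists_testT_eq φ
  rw [← h1, ← h2, hf]

theorem ext_testI (e : ∀ φ, inner ℝ f (testI φ) = inner ℝ h (testI φ)) : f = h :=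
  sub_eq_zero.1 (eq_zero_of_inner_testI fun φ => by rw [inner_sub_left, e, sub_self])

theorem WX.unique (hf : WX f fx) (hf' : WX f hx) : fx = hx :=
  ext_testI fun φ => by linarith [hf φ, hf' φ]

theorem WY.unique (hf : WY f fy) (hf' : WY f hy) : fy = hy :=
  ext_testI fun φ => by linarith [hf φ, hf' φ]

theorem WX.add (hf : WX f fx) (hh : WX h hx) : WX (f + h) (fx + hx) := fun φ => by
  rw [inner_add_left, inner_add_left, hf, hh]; ring

theorem WY.add (hf : WY f fy) (hh : WY h hy) : WY (f + h) (fy + hy) := fun φ => by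
  rw [inner_add_left, inner_add_left, hf, hh]; ring

theorem TX.add (hf : TX f fx) (hh : TX h hx) : TX (f + h) (fx + hx) := fun φ => by
  rw [inner_add_left, inner_add_left, hf, hh]; ring

theorem WX.smul (c : ℝ) (hf : WX f fx) : WX (c • f) (c • fx) := fun φ => by
  rw [real_inner_smul_left, real_inner_smul_left, hf]; ring

theorem WY.smul (c : ℝ) (hf : WY f fy) : WY (c • f) (c • fy) := fun φ => by
  rw [real_inner_smul_left, real_inner_smul_left, hf]; ring

theorem TX.smul (c : ℝ) (hf : TX f fx) : TX (c • f) (c • fx) := fun φ => by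
  rw [real_inner_smul_left, real_inner_smul_left, hf]; ring

theorem WX.neg (hf : WX f fx) : WX (-f) (-fx) := by simpa using hf.smul (-1)

theorem WY.neg (hf : WY f fy) : WY (-f) (-fy) := by simpa using hf.smul (-1)

theorem TX.neg (hf : TX f fx) : TX (-f) (-fx) := by simpa using hf.smul (-1)

theorem WX.sub (hf : WX f fx) (hh : WX h hx) : WX (f - h) (fx - hx) := by
  simpa [sub_eq_add_neg] using hf.add hh.neg

theorem WY.sub (hf : WY f fy) (hh : WY h hy) : WY (f - h) (fy - hy) := by
  simpa [sub_eq_add_neg] using hf.add hh.neg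

theorem TX.sub (hf : TX f fx) (hh : TX h hx) : TX (f - h) (fx - hx) := by
  simpa [sub_eq_add_neg] using hf.add hh.neg

theorem WX.zero : WX 0 0 := fun φ => by simp

theorem WY.zero : WY 0 0 := fun φ => by simp

/-- The coefficient is moved onto the test, where the product rule is classical. -/
theorem WX.op (c : Coef) (hf : WX f fx) : WX (c.op f) (c.d.op f + c.op fx) := fun φ => by
  have h1 := hf (c.mulTest φ)
  rw [testI_dXI_mulTest, testI_mulTest, inner_add_right] at h1
  rw [Coef.inner_op, inner_add_left, Coef.inner_op, Coef.inner_op]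
  linarith

theorem WY.op (c : Coef) (hf : WY f fy) : WY (c.op f) (c.op fy) := fun φ => by
  have h1 := hf (c.mulTest φ)
  rw [testI_dYI_mulTest, testI_mulTest] at h1
  rw [Coef.inner_op, Coef.inner_op, h1]

theorem WX.transY (a : ℝ) (hf : WX f fx) : WX (transY a f) (transY a fx) := fun φ => by
  rw [transY_adj, transY_adj, transY_testI, transY_testI, ← dXI_shiftI, hf]

theorem WY.transY (a : ℝ) (hf : WY f fy) : WY (transY a f) (transY a fy) := fun φ => by
  rw [transY_adj, transY_adj, transY_testI, transY_testI, ← dYI_shiftI, hf]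

theorem TX.transY (a : ℝ) (hf : TX f fx) : TX (transY a f) (transY a fx) := fun φ => by
  obtain ⟨ψ, h1, h2⟩ := exists_transY_testT (-a) φ
  rw [transY_adj, transY_adj, h1, h2, hf]

/-- Integration by parts in `y`. -/
theorem WY.inner_eq (hf : WY f fy) (hh : WY h hy) : inner ℝ fy h = - inner ℝ f hy :=
  groupY.inner_weak hf hh

/-- Integration by parts in `x`, for functions with equal traces on the two sides. -/
theorem TX.inner_eq (hf : TX f fx) (hh : TX h hx) : inner ℝ fx h = - inner ℝ f hx :=
  groupX.inner_weak hf hh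

/-- The difference quotient in `y`. -/
def quotY (a : ℝ) (f : CellL2) : CellL2 := a⁻¹ • (transY a f - f)

theorem WX.quotY (a : ℝ) (hf : WX f fx) : WX (quotY a f) (quotY a fx) :=
  ((hf.transY a).sub hf).smul _

theorem WY.quotY (a : ℝ) (hf : WY f fy) : WY (quotY a f) (quotY a fy) :=
  ((hf.transY a).sub hf).smul _

theorem TX.quotY (a : ℝ) (hf : TX f fx) : TX (quotY a f) (quotY a fx) :=
  ((hf.transY a).sub hf).smul _

/-- `⟨∂ₓ f, ∂ᵧ h⟩ = ⟨∂ᵧ f, ∂ₓ h⟩`. -/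
theorem inner_dX_dY_comm (hf : TX f fx) (hf' : WY f fy) (hh : TX h hx) (hh' : WY h hy) :
    inner ℝ fx hy = inner ℝ fy hx := by
  -- Second derivatives need not exist. The `y`-derivatives are therefore approximated by difference
  -- quotients, which keep equality of traces in `x`, and the `x`-derivative is moved across before
  -- the limit.
  have h1 : Tendsto (fun a => inner ℝ (MHD.quotY a h) fx) (𝓝[≠] 0) (𝓝 (inner ℝ hy fx)) :=
    groupY.tendsto_inner_quot hh' fx
  have h2 : Tendsto (fun a => inner ℝ (MHD.quotY (-a) f) hx) (𝓝[≠] 0) (𝓝 (inner ℝ fy hx)) :=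
    (groupY.tendsto_inner_quot hf' hx).comp TranslationGroup.tendsto_neg_punctured
  rw [real_inner_comm]
  refine tendsto_nhds_unique h1 (h2.congr fun a => ?_)
  have e1 := (hh.quotY a).inner_eq hf
  have e2 : inner ℝ (MHD.quotY a hx) f = - inner ℝ hx (MHD.quotY (-a) f) := groupY.inner_quot a
  rw [real_inner_comm]
  linarith

/-- Riesz representation: a distributional derivative bounded in the `L²`-norm of the test is a
function in `L²`, with the same bound. -/
theorem exists_WX_of_bound {M : ℝ} (hM : 0 ≤ M)
    (h : ∀ φ, - inner ℝ f (testI (dXI φ)) ≤ M * ‖testI φ‖) : ∃ fx, WX f fx ∧ ‖fx‖ ≤ M := by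
  obtain ⟨fx, hfx⟩ := exists_inner_eq_of_bound dense_testI
    (L := -((innerSL ℝ f).toLinearMap ∘ₗ testI ∘ₗ dXI)) h
  have hfx : ∀ φ, inner ℝ fx (testI φ) = - inner ℝ f (testI (dXI φ)) := hfx
  exact ⟨fx, fun φ => by rw [hfx, neg_neg],
    norm_le_of_dense_test dense_testI hM fun φ => by rw [hfx]; exact h φ⟩

theorem exists_WY_of_bound {M : ℝ} (hM : 0 ≤ M)
    (h : ∀ φ, - inner ℝ f (testI (dYI φ)) ≤ M * ‖testI φ‖) : ∃ fy, WY f fy ∧ ‖fy‖ ≤ M := by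
  obtain ⟨fy, hfy⟩ := exists_inner_eq_of_bound dense_testI
    (L := -((innerSL ℝ f).toLinearMap ∘ₗ testI ∘ₗ dYI)) h
  have hfy : ∀ φ, inner ℝ fy (testI φ) = - inner ℝ f (testI (dYI φ)) := hfy
  exact ⟨fy, fun φ => by rw [hfy, neg_neg],
    norm_le_of_dense_test dense_testI hM fun φ => by rw [hfy]; exact h φ⟩

end Calculus

/-! ### Sobolev bounds -/

/-- `f ∈ Hᵐ(D)`, and all weak derivatives of order at most `m` have `L²`-norm at most `M`. -/
def SobolevBound : ℕ → CellL2 → ℝ → Prop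
  | 0, f, M => ‖f‖ ≤ M
  | m + 1, f, M => ‖f‖ ≤ M ∧ ∃ fx fy, WX f fx ∧ WY f fy ∧ SobolevBound m fx M ∧ SobolevBound m fy M

namespace SobolevBound

variable {m : ℕ} {f h : CellL2} {M N : ℝ}

theorem norm_le (hf : SobolevBound m f M) : ‖f‖ ≤ M := by
  cases m with
  | zero => exact hf
  | succ m => exact hf.1

theorem nonneg (hf : SobolevBound m f M) : 0 ≤ M := (norm_nonneg f).trans hf.norm_le

theorem mono (hf : SobolevBound m f M) (hMN : M ≤ N) : SobolevBound m f N := by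
  induction m generalizing f with
  | zero => exact le_trans (show ‖f‖ ≤ M from hf) hMN
  | succ m ih =>
    obtain ⟨h0, fx, fy, h1, h2, h3, h4⟩ := hf
    exact ⟨h0.trans hMN, fx, fy, h1, h2, ih h3, ih h4⟩

theorem of_succ (hf : SobolevBound (m + 1) f M) : SobolevBound m f M := by
  induction m generalizing f with
  | zero => exact hf.1
  | succ m ih =>
    obtain ⟨h0, fx, fy, h1, h2, h3, h4⟩ := hf
    exact ⟨h0, fx, fy, h1, h2, ih h3, ih h4⟩

theorem of_le {n : ℕ} (hf : SobolevBound n f M) (hmn : m ≤ n) : SobolevBound m f M := by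
  induction n, hmn using Nat.le_induction with
  | base => exact hf
  | succ n _ ih => exact ih hf.of_succ

theorem add (hf : SobolevBound m f M) (hh : SobolevBound m h N) :
    SobolevBound m (f + h) (M + N) := by
  induction m generalizing f h with
  | zero => exact (norm_add_le _ _).trans (add_le_add hf.norm_le hh.norm_le)
  | succ m ih =>
    obtain ⟨h0, fx, fy, h1, h2, h3, h4⟩ := hf
    obtain ⟨k0, hx, hy, k1, k2, k3, k4⟩ := hh
    exact ⟨(norm_add_le _ _).trans (add_le_add h0 k0), _, _, h1.add k1, h2.add k2, ih h3 k3,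
      ih h4 k4⟩

theorem smul (c : ℝ) (hf : SobolevBound m f M) : SobolevBound m (c • f) (|c| * M) := by
  have key : ∀ {f : CellL2}, ‖f‖ ≤ M → ‖c • f‖ ≤ |c| * M := fun hf => by
    rw [norm_smul, Real.norm_eq_abs]; gcongr
  induction m generalizing f with
  | zero => exact key hf.norm_le
  | succ m ih =>
    obtain ⟨h0, fx, fy, h1, h2, h3, h4⟩ := hf
    exact ⟨key h0, _, _, h1.smul c, h2.smul c, ih h3, ih h4⟩

theorem neg (hf : SobolevBound m f M) : SobolevBound m (-f) M := by
  simpa using hf.smul (-1)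

theorem sub (hf : SobolevBound m f M) (hh : SobolevBound m h N) :
    SobolevBound m (f - h) (M + N) := by
  simpa [sub_eq_add_neg] using hf.add hh.neg

theorem zero (hM : 0 ≤ M) : SobolevBound m 0 M := by
  induction m with
  | zero => simpa [SobolevBound] using hM
  | succ m ih => exact ⟨by simpa using hM, 0, 0, WX.zero, WY.zero, ih, ih⟩

theorem transY (a : ℝ) (hf : SobolevBound m f M) : SobolevBound m (transY a f) M := by
  induction m generalizing f with
  | zero => exact (LinearIsometry.norm_map _ _).trans_le hf
  | succ m ih =>
    obtain ⟨h0, fx, fy, h1, h2, h3, h4⟩ := hf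
    exact ⟨(LinearIsometry.norm_map _ _).trans_le h0, _, _, h1.transY a, h2.transY a, ih h3, ih h4⟩

/-- One order is spent on a bound that is uniform in the step `a`, so that the limit `a → 0` can be
taken. -/
theorem quotY (a : ℝ) (hf : SobolevBound (m + 1) f M) : SobolevBound m (quotY a f) M := by
  induction m generalizing f with
  | zero =>
    obtain ⟨h0, fx, fy, h1, h2, h3, h4⟩ := hf
    exact (groupY.norm_quot_le h2 a).trans h4
  | succ m ih =>
    have hf' := hf
    obtain ⟨h0, fx, fy, h1, h2, h3, h4⟩ := hf
    exact ⟨(groupY.norm_quot_le h2 a).trans h4.norm_le, _, _, h1.quotY a, h2.quotY a, ih h3, ih h4⟩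

end SobolevBound

/-- The constant in the estimate of the product with a coefficient. -/
def Coef.opConst : ℕ → Coef → ℝ
  | 0, c => c.bound
  | m + 1, c => c.bound + (opConst m c.d + opConst m c)

theorem Coef.opConst_nonneg (m : ℕ) (c : Coef) : 0 ≤ c.opConst m := by
  induction m generalizing c with
  | zero => exact c.bound_nonneg
  | succ m ih => exact add_nonneg c.bound_nonneg (add_nonneg (ih _) (ih _))

namespace SobolevBound

variable {m : ℕ} {f h : CellL2} {M N : ℝ}

theorem op (c : Coef) (hf : SobolevBound m f M) : SobolevBound m (c.op f) (c.opConst m * M) := by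
  have key : ∀ {c : Coef} {f : CellL2}, ‖f‖ ≤ M → ‖c.op f‖ ≤ c.bound * M := fun {c f} hf =>
    (c.norm_op_le f).trans (by gcongr; exact c.bound_nonneg)
  have hM := hf.nonneg
  induction m generalizing f c with
  | zero => exact key hf.norm_le
  | succ m ih =>
    obtain ⟨h0, fx, fy, h1, h2, h3, h4⟩ := hf
    have hf : SobolevBound m f M := SobolevBound.of_succ ⟨h0, fx, fy, h1, h2, h3, h4⟩
    have p1 := mul_nonneg c.bound_nonneg hM
    have p2 := mul_nonneg (c.d.opConst_nonneg m) hM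
    have p3 := mul_nonneg (c.opConst_nonneg m) hM
    refine ⟨(key h0).trans ?_, _, _, h1.op c, h2.op c, ((ih c.d hf).add (ih c h3)).mono ?_,
      (ih c h4).mono ?_⟩ <;> simp only [Coef.opConst, add_mul] <;> linarith

/-- Weak lower semicontinuity. Convergence against tests passes to all distributional derivatives;
the uniform bounds turn these limits into `L²` functions, and the argument repeats for each first
derivative. -/
theorem of_tendsto {ι : Type*} {l : Filter ι} [l.NeBot] {F : ι → CellL2}
    (hF : ∀ φ, Tendsto (fun i => inner ℝ (F i) (testI φ)) l (𝓝 (inner ℝ f (testI φ))))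
    (hb : ∀ᶠ i in l, SobolevBound m (F i) M) : SobolevBound m f M := by
  have hM : 0 ≤ M := by
    obtain ⟨i, hi⟩ := hb.exists
    exact hi.nonneg
  have hnorm : ∀ {F : ι → CellL2} {f : CellL2},
      (∀ φ, Tendsto (fun i => inner ℝ (F i) (testI φ)) l (𝓝 (inner ℝ f (testI φ)))) →
      (∀ᶠ i in l, ‖F i‖ ≤ M) → ‖f‖ ≤ M := fun {F f} hF hb =>
    norm_le_of_dense_test dense_testI hM fun φ => le_of_tendsto (hF φ) (hb.mono fun i hi =>
      (real_inner_le_norm _ _).trans (by gcongr))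
  induction m generalizing f F with
  | zero => exact hnorm hF hb
  | succ m ih =>
    have hex : ∀ i, ∃ fx fy, SobolevBound (m + 1) (F i) M → WX (F i) fx ∧ WY (F i) fy ∧
        SobolevBound m fx M ∧ SobolevBound m fy M := fun i => by
      by_cases h : SobolevBound (m + 1) (F i) M
      · obtain ⟨_, fx, fy, h'⟩ := h
        exact ⟨fx, fy, fun _ => h'⟩
      · exact ⟨0, 0, fun h' => absurd h' h⟩
    choose Fx Fy hFxy using hex
    have tx : ∀ φ, Tendsto (fun i => inner ℝ (Fx i) (testI φ)) l
        (𝓝 (- inner ℝ f (testI (dXI φ)))) := fun φ =>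
      (hF (dXI φ)).neg.congr' (hb.mono fun i hi => by rw [(hFxy i hi).1, neg_neg])
    have ty : ∀ φ, Tendsto (fun i => inner ℝ (Fy i) (testI φ)) l
        (𝓝 (- inner ℝ f (testI (dYI φ)))) := fun φ =>
      (hF (dYI φ)).neg.congr' (hb.mono fun i hi => by rw [(hFxy i hi).2.1, neg_neg])
    obtain ⟨fx, h1, -⟩ := exists_WX_of_bound hM fun φ => le_of_tendsto (tx φ) (hb.mono fun i hi =>
      (real_inner_le_norm _ _).trans (by gcongr; exact (hFxy i hi).2.2.1.norm_le))
    obtain ⟨fy, h2, -⟩ := exists_WY_of_bound hM fun φ => le_of_tendsto (ty φ) (hb.mono fun i hi =>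
      (real_inner_le_norm _ _).trans (by gcongr; exact (hFxy i hi).2.2.2.norm_le))
    refine ⟨hnorm hF (hb.mono fun i hi => hi.norm_le), fx, fy, h1, h2, ih (F := Fx) (fun φ => ?_)
      (hb.mono fun i hi => (hFxy i hi).2.2.1), ih (F := Fy) (fun φ => ?_)
      (hb.mono fun i hi => (hFxy i hi).2.2.2)⟩
    · have := tx φ; rwa [h1, neg_neg] at this
    · have := ty φ; rwa [h2, neg_neg] at this

theorem of_tendsto_norm {ι : Type*} {l : Filter ι} [l.NeBot] {F : ι → CellL2}
    (hF : Tendsto F l (𝓝 f)) (hb : ∀ᶠ i in l, SobolevBound m (F i) M) : SobolevBound m f M :=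
  of_tendsto (fun φ => (Continuous.tendsto (by fun_prop :
    Continuous fun f : CellL2 => inner ℝ f (testI φ)) f).comp hF) hb

/-- A function whose difference quotients in `y` are bounded in `Hᵐ` has its `y`-derivative
in `Hᵐ`. -/
theorem exists_WY_of_quotY (hb : ∀ a, SobolevBound m (MHD.quotY a f) M) :
    ∃ fy, WY f fy ∧ SobolevBound m fy M := by
  have hM : 0 ≤ M := (hb 0).nonneg
  obtain ⟨fy, h, -⟩ := exists_WY_of_bound hM fun φ =>
    le_of_tendsto (groupY.tendsto_inner_quot_test f φ) (Eventually.of_forall fun a =>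
      (real_inner_le_norm _ (testI φ)).trans (by gcongr; exact (hb a).norm_le))
  refine ⟨fy, h, of_tendsto (l := 𝓝[≠] (0 : ℝ)) (F := fun a => MHD.quotY a f) (fun φ => ?_)
    (Eventually.of_forall hb)⟩
  exact (neg_eq_iff_eq_neg.2 (h φ)) ▸ groupY.tendsto_inner_quot_test f φ

/-- A bound for the time derivative can be integrated. -/
theorem integrate {F G : ℝ → CellL2} {T : ℝ} {B B' : ℝ → ℝ}
    (hd : ∀ t ∈ Icc 0 T, ∀ φ, HasDerivWithinAt (fun t => inner ℝ (F t) (testI φ))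
      (inner ℝ (G t) (testI φ)) (Icc 0 T) t)
    (h0 : SobolevBound m (F 0) M) (hB : ∀ t, HasDerivAt B (B' t) t)
    (hG : ∀ t ∈ Icc 0 T, SobolevBound m (G t) (B' t)) {t : ℝ} (ht : t ∈ Icc 0 T) :
    SobolevBound m (F t) (M + (B t - B 0)) := by
  have hBmono : ∀ t ∈ Icc 0 T, B 0 ≤ B t := fun t ht => by
    refine (monotoneOn_of_deriv_nonneg (convex_Icc 0 T)
      (fun s _ => (hB s).continuousAt.continuousWithinAt)
      (fun s _ => (hB s).differentiableAt.differentiableWithinAt) fun s hs => ?_)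
      (left_mem_Icc.2 (ht.1.trans ht.2)) ht ht.1
    rw [(hB s).deriv]
    exact (hG s (interior_subset hs)).nonneg
  -- One-dimensional comparison, applied to the pairing with one test at a time. The time derivative
  -- of `F` is needed only in the weak sense.
  have scalar : ∀ (p p' : ℝ → ℝ) (N : ℝ), (∀ t ∈ Icc 0 T, HasDerivWithinAt p (p' t) (Icc 0 T) t) →
      p 0 ≤ M * N → (∀ t ∈ Icc 0 T, p' t ≤ B' t * N) → ∀ t ∈ Icc 0 T,
      p t ≤ (M + (B t - B 0)) * N := fun p p' N hp hp0 hb t ht => by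
    refine image_le_of_deriv_right_le_deriv_boundary
      (B := fun t => (M + (B t - B 0)) * N) (B' := fun t => B' t * N)
      (fun s hs => (hp s hs).continuousWithinAt)
      (fun s hs => (hp s (Ico_subset_Icc_self hs)).mono_of_mem_nhdsWithin
        (mem_of_superset (Icc_mem_nhdsGE hs.2) (Icc_subset_Icc_left hs.1)))
      (by simpa using hp0) (fun s hs => ?_)
      (fun s _ => (((hB s).sub_const _).const_add M |>.mul_const N).hasDerivWithinAt)
      (fun s hs => hb s (Ico_subset_Icc_self hs)) ht
    exact ((((hB s).sub_const _).const_add M).mul_const N).continuousAt.continuousWithinAt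
  induction m generalizing F G t with
  | zero =>
    refine norm_le_of_dense_test dense_testI (add_nonneg h0.nonneg (sub_nonneg.2 (hBmono t ht)))
      fun φ => ?_
    refine scalar _ _ ‖testI φ‖ (fun s hs => hd s hs φ) ?_ (fun s hs => ?_) t ht
    · exact (real_inner_le_norm _ _).trans (by gcongr; exact h0.norm_le)
    · exact (real_inner_le_norm _ _).trans (by gcongr; exact (hG s hs).norm_le)
  | succ m ih =>
    have hex : ∀ s, ∃ gx gy, s ∈ Icc 0 T → WX (G s) gx ∧ WY (G s) gy ∧
        SobolevBound m gx (B' s) ∧ SobolevBound m gy (B' s) := fun s => by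
      by_cases h : s ∈ Icc 0 T
      · obtain ⟨_, gx, gy, h'⟩ := hG s h
        exact ⟨gx, gy, fun _ => h'⟩
      · exact ⟨0, 0, fun h' => absurd h' h⟩
    choose Gx Gy hGxy using hex
    have h0' := h0
    obtain ⟨-, f0x, f0y, k1, k2, k3, k4⟩ := h0
    have hM := fun t ht => add_nonneg h0'.nonneg (sub_nonneg.2 (hBmono t ht))
    -- Differentiability of `F t` in `x` is not assumed for positive times. The pairing with `∂ₓφ`
    -- obeys the comparison because `G` has an `x`-derivative, and Riesz then produces the
    -- derivative of `F t`.
    have bx : ∀ t ∈ Icc 0 T, ∃ fx, WX (F t) fx ∧ ‖fx‖ ≤ M + (B t - B 0) := fun t ht =>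
      exists_WX_of_bound (hM t ht) fun φ => by
        refine scalar (fun t => - inner ℝ (F t) (testI (dXI φ))) _ ‖testI φ‖
          (fun s hs => (hd s hs (dXI φ)).neg) ?_ (fun s hs => ?_) t ht
        · rw [k1, neg_neg]
          exact (real_inner_le_norm _ _).trans (by gcongr; exact k3.norm_le)
        · rw [(hGxy s hs).1, neg_neg]
          exact (real_inner_le_norm _ _).trans (by gcongr; exact (hGxy s hs).2.2.1.norm_le)
    have bY : ∀ t ∈ Icc 0 T, ∃ fy, WY (F t) fy ∧ ‖fy‖ ≤ M + (B t - B 0) := fun t ht =>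
      exists_WY_of_bound (hM t ht) fun φ => by
        refine scalar (fun t => - inner ℝ (F t) (testI (dYI φ))) _ ‖testI φ‖
          (fun s hs => (hd s hs (dYI φ)).neg) ?_ (fun s hs => ?_) t ht
        · rw [k2, neg_neg]
          exact (real_inner_le_norm _ _).trans (by gcongr; exact k4.norm_le)
        · rw [(hGxy s hs).2.1, neg_neg]
          exact (real_inner_le_norm _ _).trans (by gcongr; exact (hGxy s hs).2.2.2.norm_le)
    have hnorm := ih (F := F) (G := G) hd h0'.of_succ (fun s hs => (hG s hs).of_succ) ht
    have hexF : ∀ s, ∃ fx fy, (s ∈ Icc 0 T → WX (F s) fx ∧ WY (F s) fy) := fun s => by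
      by_cases h : s ∈ Icc 0 T
      · obtain ⟨fx, h1, -⟩ := bx s h
        obtain ⟨fy, h2, -⟩ := bY s h
        exact ⟨fx, fy, fun _ => ⟨h1, h2⟩⟩
      · exact ⟨0, 0, fun h' => absurd h' h⟩
    choose Fx Fy hFxy using hexF
    have hT : (0 : ℝ) ∈ Icc 0 T := left_mem_Icc.2 (ht.1.trans ht.2)
    -- The space derivatives of `F` satisfy the same weak evolution with the space derivatives of
    -- `G`, so the induction hypothesis applies to them.
    refine ⟨hnorm.norm_le, Fx t, Fy t, (hFxy t ht).1, (hFxy t ht).2,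
      ih (F := Fx) (G := Gx) (fun s hs φ => ?_) ?_ (fun s hs => (hGxy s hs).2.2.1) ht,
      ih (F := Fy) (G := Gy) (fun s hs φ => ?_) ?_ (fun s hs => (hGxy s hs).2.2.2) ht⟩
    · have := (hd s hs (dXI φ)).neg
      rw [(hGxy s hs).1, neg_neg] at this
      exact this.congr_of_mem (fun r hr => by rw [Pi.neg_apply, (hFxy r hr).1, neg_neg]) hs
    · rwa [(hFxy 0 hT).1.unique k1]
    · have := (hd s hs (dYI φ)).neg
      rw [(hGxy s hs).2.1, neg_neg] at this
      exact this.congr_of_mem (fun r hr => by rw [Pi.neg_apply, (hFxy r hr).2, neg_neg]) hs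
    · rwa [(hFxy 0 hT).2.unique k2]

end SobolevBound

/-! ### Linear evolution equations in Sobolev spaces -/

/-- The components `(σ, v, B)` of a perturbation, as elements of `L²(D)`. -/
abbrev State : Type := Fin 7 → CellL2

/-- All components are bounded in `Hᵐ`. -/
def StateBound (m : ℕ) (u : State) (M : ℝ) : Prop := ∀ i, SobolevBound m (u i) M

/-- A linear relation between states and their time derivatives which is invariant under
translations in `y`. -/
structure IsGenerator (R : State → State → Prop) : Prop where
  diff : ∀ {u u' w w' : State} (c : ℝ), R u u' → R w w' → R (c • (u - w)) (c • (u' - w'))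
  trans : ∀ {u u' : State} (a : ℝ), R u u' →
    R (fun i => transY a (u i)) (fun i => transY a (u' i))

/-- The curve `f` has the right-sided or two-sided derivative `f'` at `t`, on `[0, ∞)`. -/
def TimeDeriv (u : ℝ → State) (u' : State) (t : ℝ) : Prop :=
  ∀ i, HasDerivWithinAt (fun t => u t i) (u' i) (Ici 0) t

/-- Solutions in `C([0, ∞); Hᵐ)` of an evolution equation. -/
structure IsEvolution (R : State → State → Prop) (m : ℕ) (u : ℝ → State) : Prop where
  mem : ∀ t, 0 ≤ t → ∀ i, ∃ M, SobolevBound m (u t i) M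
  cont : ∀ t, 0 ≤ t → ∀ i, ∀ ε > 0, ∀ᶠ s in 𝓝[Ici 0] t, SobolevBound m (u s i - u t i) ε
  evol : ∀ t, 0 ≤ t → ∃ u', R (u t) u' ∧ TimeDeriv u u' t

/-- Difference quotients in time. -/
def timeQuot (r : ℝ) (u : ℝ → State) : ℝ → State := fun t => r⁻¹ • (u (t + r) - u t)

theorem tendsto_add_nhdsWithin {t r : ℝ} (hr : 0 ≤ r) :
    Tendsto (fun s => s + r) (𝓝[Ici 0] t) (𝓝[Ici 0] (t + r)) := by
  refine tendsto_nhdsWithin_iff.2 ⟨?_, ?_⟩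
  · exact ((continuous_add_const r).tendsto t).mono_left nhdsWithin_le_nhds
  · filter_upwards [self_mem_nhdsWithin] with s hs using add_nonneg hs hr

theorem TimeDeriv.shift {u : ℝ → State} {u' : State} {t r : ℝ} (hr : 0 ≤ r)
    (h : TimeDeriv u u' (t + r)) : TimeDeriv (fun t => u (t + r)) u' t := fun i => by
  have h1 : HasDerivWithinAt (fun s : ℝ => s + r) 1 (Ici 0) t :=
    ((hasDerivAt_id t).add_const r).hasDerivWithinAt
  have h2 := (h i).scomp t h1 fun s hs => add_nonneg hs hr
  simpa using! h2

theorem TimeDeriv.diff {u w : ℝ → State} {u' w' : State} {t : ℝ} (c : ℝ) (h : TimeDeriv u u' t)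
    (k : TimeDeriv w w' t) : TimeDeriv (fun t => c • (u t - w t)) (c • (u' - w')) t := fun i =>
  ((h i).sub (k i)).const_smul c

theorem TimeDeriv.map {u : ℝ → State} {u' : State} {t : ℝ} (L : CellL2 →L[ℝ] CellL2)
    (h : TimeDeriv u u' t) : TimeDeriv (fun t i => L (u t i)) (fun i => L (u' i)) t := fun i =>
  L.hasFDerivAt.comp_hasDerivWithinAt t (h i)

theorem TimeDeriv.tendsto_timeQuot {u : ℝ → State} {u' : State} {t : ℝ} (ht : 0 ≤ t)
    (h : TimeDeriv u u' t) (i : Fin 7) :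
    Tendsto (fun r => timeQuot r u t i) (𝓝[>] 0) (𝓝 (u' i)) := by
  have h1 : HasDerivWithinAt (fun t => u t i) (u' i) (Ioi t) t :=
    (h i).mono fun s hs => ht.trans (le_of_lt hs)
  have h2 := (hasDerivWithinAt_iff_tendsto_slope' self_notMem_Ioi).1 h1
  have h3 : Tendsto (fun r => t + r) (𝓝[>] 0) (𝓝[>] t) := by
    refine tendsto_nhdsWithin_iff.2 ⟨?_, ?_⟩
    · have : Tendsto (fun r => t + r) (𝓝 0) (𝓝 (t + 0)) := (continuous_const_add t).tendsto 0
      rw [add_zero] at this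
      exact this.mono_left nhdsWithin_le_nhds
    · filter_upwards [self_mem_nhdsWithin] with r hr
      simpa using hr
  refine (h2.comp h3).congr fun r => ?_
  simp [slope, timeQuot]

namespace IsEvolution

variable {R : State → State → Prop} {m : ℕ} {u w : ℝ → State}

theorem of_le {n : ℕ} (hu : IsEvolution R n u) (hmn : m ≤ n) : IsEvolution R m u :=
  ⟨fun t ht i => (hu.mem t ht i).imp fun _ h => h.of_le hmn,
    fun t ht i ε hε => (hu.cont t ht i ε hε).mono fun _ h => h.of_le hmn, hu.evol⟩

theorem diff (hR : IsGenerator R) (hu : IsEvolution R m u) (hw : IsEvolution R m w) (c : ℝ) :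
    IsEvolution R m fun t => c • (u t - w t) := by
  refine ⟨fun t ht i => ?_, fun t ht i ε hε => ?_, fun t ht => ?_⟩
  · obtain ⟨M, hM⟩ := hu.mem t ht i
    obtain ⟨N, hN⟩ := hw.mem t ht i
    exact ⟨_, (hM.sub hN).smul c⟩
  · have hδ : 0 < ε / (2 * (|c| + 1)) := by positivity
    filter_upwards [hu.cont t ht i _ hδ, hw.cont t ht i _ hδ] with s h1 h2
    have h3 := (h1.sub h2).smul c
    have e : (c • (u s - w s)) i - (c • (u t - w t)) i
        = c • ((u s i - u t i) - (w s i - w t i)) := by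
      simp only [Pi.smul_apply, Pi.sub_apply]; module
    rw [e]
    refine h3.mono ?_
    have : |c| * (ε / (2 * (|c| + 1)) + ε / (2 * (|c| + 1))) = |c| / (|c| + 1) * ε := by
      field_simp; ring
    rw [this]
    have : |c| / (|c| + 1) ≤ 1 := by
      rw [div_le_one (by positivity)]; linarith
    nlinarith
  · obtain ⟨u', h1, h2⟩ := hu.evol t ht
    obtain ⟨w', k1, k2⟩ := hw.evol t ht
    exact ⟨_, hR.diff c h1 k1, h2.diff c k2⟩

theorem trans (hR : IsGenerator R) (hu : IsEvolution R m u) (a : ℝ) :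
    IsEvolution R m fun t i => transY a (u t i) := by
  refine ⟨fun t ht i => ?_, fun t ht i ε hε => ?_, fun t ht => ?_⟩
  · obtain ⟨M, hM⟩ := hu.mem t ht i
    exact ⟨M, hM.transY a⟩
  · filter_upwards [hu.cont t ht i ε hε] with s h
    rw [← map_sub]
    exact h.transY a
  · obtain ⟨u', h1, h2⟩ := hu.evol t ht
    exact ⟨_, hR.trans a h1, h2.map (transY a).toContinuousLinearMap⟩

theorem shift (hu : IsEvolution R m u) {r : ℝ} (hr : 0 ≤ r) :
    IsEvolution R m fun t => u (t + r) := by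
  refine ⟨fun t ht i => hu.mem _ (add_nonneg ht hr) i, fun t ht i ε hε => ?_, fun t ht => ?_⟩
  · exact (tendsto_add_nhdsWithin hr).eventually (hu.cont _ (add_nonneg ht hr) i ε hε)
  · obtain ⟨u', h1, h2⟩ := hu.evol _ (add_nonneg ht hr)
    exact ⟨u', h1, h2.shift hr⟩

/-- Difference quotients in `y`, and likewise in time, are solutions of the same regularity. Every
estimate valid for all solutions thus bounds derivatives of a given one. -/
theorem quotY (hR : IsGenerator R) (hu : IsEvolution R m u) (a : ℝ) :
    IsEvolution R m fun t i => quotY a (u t i) :=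
  diff hR (hu.trans hR a) hu a⁻¹

theorem timeQuot (hR : IsGenerator R) (hu : IsEvolution R m u) {r : ℝ} (hr : 0 ≤ r) :
    IsEvolution R m (timeQuot r u) :=
  diff hR (hu.shift hr) hu r⁻¹

theorem continuousWithinAt (hu : IsEvolution R m u) {t : ℝ} (ht : 0 ≤ t) (i : Fin 7) :
    ContinuousWithinAt (fun t => u t i) (Ici 0) t := by
  obtain ⟨u', -, h⟩ := hu.evol t ht
  exact (h i).continuousWithinAt

end IsEvolution

/-- Produces the displacement, the quantity whose potential energy enters the energy law. -/
theorem exists_antiderivative {f : ℝ → CellL2}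
    (hf : ∀ t, 0 ≤ t → ContinuousWithinAt f (Ici 0) t) :
    ∃ Y : ℝ → CellL2, ∀ t, 0 ≤ t → HasDerivWithinAt Y (f t) (Ici 0) t := by
  -- The curve is frozen at its initial value for negative times, which makes it continuous on the
  -- whole line.
  have hc : Continuous fun t => f (max 0 t) := by
    have h1 : ContinuousOn f (Ici 0) := fun t ht => hf t ht
    exact h1.comp_continuous (by fun_prop) fun t => le_max_left 0 t
  refine ⟨fun t => ∫ s in (0 : ℝ)..t, f (max 0 s), fun t ht => ?_⟩
  have := (hc.integral_hasStrictDerivAt 0 t).hasDerivAt.hasDerivWithinAt (s := Ici 0)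
  rwa [max_eq_right ht] at this

/-- Bounds for the time derivative of a curve give bounds for the curve. -/
theorem SobolevBound.of_timeDeriv {m : ℕ} {F G : ℝ → CellL2} {T M : ℝ} {B B' : ℝ → ℝ}
    (hd : ∀ t ∈ Icc 0 T, HasDerivWithinAt F (G t) (Ici 0) t)
    (h0 : SobolevBound m (F 0) M) (hB : ∀ t, HasDerivAt B (B' t) t)
    (hG : ∀ t ∈ Icc 0 T, SobolevBound m (G t) (B' t)) {t : ℝ} (ht : t ∈ Icc 0 T) :
    SobolevBound m (F t) (M + (B t - B 0)) := by
  refine SobolevBound.integrate (G := G) (fun s hs φ => ?_) h0 hB hG ht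
  have h1 : HasDerivWithinAt F (G s) (Icc 0 T) s := (hd s hs).mono Icc_subset_Ici_self
  have h2 := ((innerSL ℝ (testI φ)).hasFDerivAt.comp_hasDerivWithinAt s h1)
  simp only [Function.comp_def, innerSL_apply_apply] at h2
  simpa only [real_inner_comm] using h2

theorem hasDerivAt_exp_mul {Λ : ℝ} (hΛ : 0 < Λ) (K t : ℝ) :
    HasDerivAt (fun t => K / Λ * Real.exp (Λ * t)) (K * Real.exp (Λ * t)) t := by
  have h := (((hasDerivAt_id t).const_mul Λ).exp).const_mul (K / Λ)
  simp only [id, mul_one] at h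
  convert! h using 1
  field_simp

/-- Exponential bounds for the derivative in the sense of distributions can be integrated. -/
theorem SobolevBound.integrate_exp {m : ℕ} {F G : ℝ → CellL2} {M Λ : ℝ} (hΛ : 0 < Λ)
    (hd : ∀ t, 0 ≤ t → ∀ φ, HasDerivWithinAt (fun t => inner ℝ (F t) (testI φ))
      (inner ℝ (G t) (testI φ)) (Ici 0) t)
    (h0 : SobolevBound m (F 0) M)
    (hG : ∀ t, 0 ≤ t → SobolevBound m (G t) (M * Real.exp (Λ * t))) {t : ℝ} (ht : 0 ≤ t) :
    SobolevBound m (F t) ((1 + 1 / Λ) * M * Real.exp (Λ * t)) := by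
  have h := SobolevBound.integrate (T := t)
    (fun s hs φ => (hd s hs.1 φ).mono Icc_subset_Ici_self) h0 (hasDerivAt_exp_mul hΛ M)
    (fun s hs => hG s hs.1) (right_mem_Icc.2 ht)
  refine h.mono ?_
  have hM := h0.nonneg
  have h1 : 1 ≤ Real.exp (Λ * t) := Real.one_le_exp (by positivity)
  have h2 : M * 1 ≤ M * Real.exp (Λ * t) := by gcongr
  have h3 : 0 ≤ M / Λ := by positivity
  simp only [mul_zero, Real.exp_zero, mul_one] at h2 ⊢
  have : (1 + 1 / Λ) * M * Real.exp (Λ * t) = M * Real.exp (Λ * t) + M / Λ * Real.exp (Λ * t) := by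
    ring
  linarith

theorem SobolevBound.of_timeDeriv_exp {m : ℕ} {F G : ℝ → CellL2} {M Λ : ℝ} (hΛ : 0 < Λ)
    (hd : ∀ t, 0 ≤ t → HasDerivWithinAt F (G t) (Ici 0) t)
    (h0 : SobolevBound m (F 0) M)
    (hG : ∀ t, 0 ≤ t → SobolevBound m (G t) (M * Real.exp (Λ * t))) {t : ℝ} (ht : 0 ≤ t) :
    SobolevBound m (F t) ((1 + 1 / Λ) * M * Real.exp (Λ * t)) := by
  refine SobolevBound.integrate_exp hΛ (fun s hs φ => ?_) h0 hG ht
  have h2 := ((innerSL ℝ (testI φ)).hasFDerivAt.comp_hasDerivWithinAt s (hd s hs))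
  simp only [Function.comp_def, innerSL_apply_apply] at h2
  simpa only [real_inner_comm] using h2

/-- The time derivative of a solution loses one derivative. -/
def LosesOneDerivative (R : State → State → Prop) : Prop :=
  ∀ m, ∃ C, ∀ (u : ℝ → State) (t : ℝ), 0 ≤ t → IsEvolution R (m + 1) u → ∀ M,
    StateBound (m + 1) (u t) M → ∀ u', R (u t) u' → TimeDeriv u u' t → StateBound m u' (C * M)

/-- Exponential bound for the time difference quotients of a solution `u`, whose antiderivative is
`Y`, by their initial values. -/
def HasEnergyBound (R : State → State → Prop) (Λ : ℝ) : Prop :=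
  ∃ C, ∀ (u Y : ℝ → State) (r : ℝ), 0 < r → IsEvolution R 2 u →
    (∀ t, 0 ≤ t → TimeDeriv Y (u t) t) → ∀ M,
    (∀ i, ‖timeQuot r u 0 i‖ ≤ M) → (∀ i, ‖timeQuot r Y 0 i‖ ≤ M) →
    ∀ t, 0 ≤ t → ∀ i, ‖timeQuot r u t i‖ ≤ C * M * Real.exp (Λ * t)

/-- One more `x`-derivative of a solution is controlled by its `y`-derivative and its time
derivative. -/
def ControlsNormalDerivative (R : State → State → Prop) (Λ : ℝ) : Prop :=
  ∀ n, ∃ C, ∀ u : ℝ → State, IsEvolution R (n + 2) u → ∀ M, StateBound (n + 1) (u 0) M →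
    (∀ t, 0 ≤ t → StateBound n (u t) (M * Real.exp (Λ * t))) →
    (∀ t, 0 ≤ t → ∀ i, ∃ uy, WY (u t i) uy ∧ SobolevBound n uy (M * Real.exp (Λ * t))) →
    (∀ t, 0 ≤ t → ∃ u', R (u t) u' ∧ TimeDeriv u u' t ∧ StateBound n u' (M * Real.exp (Λ * t))) →
    ∀ t, 0 ≤ t → StateBound (n + 1) (u t) (C * M * Real.exp (Λ * t))

/-! ### The growth estimate from the loss, energy and normal derivative properties. -/

section Growth

variable {R : State → State → Prop} {u : ℝ → State} {m : ℕ} {M Λ : ℝ}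

/-- Time quotients at `0` look slightly into the future, so the initial bound must survive for a
short time. That time depends on the solution, but the constant `2` does not. -/
theorem IsEvolution.eventually_bound (hu : IsEvolution R m u) (hM : 0 < M)
    (h0 : StateBound m (u 0) M) : ∃ T > 0, ∀ t ∈ Icc 0 T, StateBound m (u t) (2 * M) := by
  have h1 : ∀ᶠ s in 𝓝[Ici 0] (0 : ℝ), ∀ i, SobolevBound m (u s i - u 0 i) M :=
    eventually_all.2 fun i => hu.cont 0 le_rfl i M hM
  obtain ⟨T, hT, h⟩ := mem_nhdsGE_iff_exists_Icc_subset.1 h1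
  refine ⟨T, hT, fun t ht i => ?_⟩
  have := (h ht i).add (h0 i)
  rw [sub_add_cancel] at this
  exact this.mono (by linarith)

/-- The quotient at `0` is the average over `[0, r]` of the time derivative and inherits its bound.
-/
theorem timeQuot_bound {Y : ℝ → State} {u : ℝ → State} {T K : ℝ}
    (hY : ∀ t, 0 ≤ t → TimeDeriv Y (u t) t) (hu : ∀ t ∈ Icc 0 T, StateBound m (u t) K) {r : ℝ}
    (hr : r ∈ Ioc 0 T) : StateBound m (timeQuot r Y 0) K := fun i => by
  have hK : 0 ≤ K := (hu 0 ⟨le_rfl, hr.1.le.trans hr.2⟩ i).nonneg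
  have h := SobolevBound.of_timeDeriv (F := fun t => Y t i - Y 0 i) (G := fun t => u t i) (T := T)
    (M := 0) (B := fun t => K * t) (B' := fun _ => K)
    (fun t ht => (hY t ht.1 i).sub_const _) (by
      simpa using SobolevBound.zero le_rfl) (fun t => by simpa using (hasDerivAt_id t).const_mul K)
    (fun t ht => hu t ht i) ⟨hr.1.le, hr.2⟩
  have h2 := h.smul r⁻¹
  simp only [timeQuot, zero_add, Pi.smul_apply, Pi.sub_apply]
  refine h2.mono (le_of_eq ?_)
  rw [abs_of_pos (inv_pos.2 hr.1)]
  have := hr.1.ne'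
  field_simp; ring

/-- Bounds the initial data of the solution formed by the time quotient, at the cost of one space
derivative. Only small steps matter, so it is harmless that `T` depends on the solution. -/
theorem IsEvolution.timeQuot_zero_bound {C : ℝ}
    (hC : ∀ (u : ℝ → State) (t : ℝ), 0 ≤ t → IsEvolution R (m + 1) u → ∀ M,
      StateBound (m + 1) (u t) M → ∀ u', R (u t) u' → TimeDeriv u u' t → StateBound m u' (C * M))
    (hu : IsEvolution R (m + 1) u) (hM : 0 < M) (h0 : StateBound (m + 1) (u 0) M) :
    ∃ T > 0, ∀ r ∈ Ioc 0 T, StateBound m (MHD.timeQuot r u 0) (C * (2 * M)) := by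
  obtain ⟨T, hT, h⟩ := hu.eventually_bound hM h0
  have hex : ∀ t, ∃ u', 0 ≤ t → R (u t) u' ∧ TimeDeriv u u' t := fun t => by
    by_cases ht : 0 ≤ t
    · obtain ⟨u', h'⟩ := hu.evol t ht
      exact ⟨u', fun _ => h'⟩
    · exact ⟨0, fun h' => absurd h' ht⟩
  choose u' hu' using hex
  refine ⟨T, hT, fun r hr => timeQuot_bound (u := u') (fun t ht => (hu' t ht).2) (T := T)
    (fun t ht => ?_) hr⟩
  exact hC u t ht.1 hu _ (h t ht) _ (hu' t ht.1).1 (hu' t ht.1).2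

/-- The start of the induction. The energy bound for time quotients becomes a bound for the time
derivative as the step tends to zero, and integration in time recovers the solution. -/
theorem IsEvolution.base_bound (hΛ : 0 < Λ) (hloss : LosesOneDerivative R)
    (henergy : HasEnergyBound R Λ) :
    ∃ C, ∀ u, IsEvolution R 2 u → ∀ M, 0 < M → StateBound 1 (u 0) M → ∀ t, 0 ≤ t →
      StateBound 0 (u t) (C * M * Real.exp (Λ * t)) := by
  obtain ⟨C₁, hC₁⟩ := hloss 0
  obtain ⟨C₂, hC₂⟩ := henergy
  -- The first entry bounds the initial quotient of the solution, the second that of its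
  -- antiderivative; both carry the factor `2` of the short-time bound.
  set K : ℝ := max (2 * C₁) 2 with hK
  refine ⟨(1 + 1 / Λ) * max 1 (C₂ * K), fun u hu M hM h0 t ht i => ?_⟩
  have hu1 : IsEvolution R (0 + 1) u := hu.of_le (by norm_num)
  obtain ⟨T, hT, h1⟩ := hu1.timeQuot_zero_bound hC₁ hM h0
  obtain ⟨T', hT', h2⟩ := hu1.eventually_bound hM h0
  have hY : ∀ i, ∃ Y : ℝ → CellL2, ∀ t, 0 ≤ t → HasDerivWithinAt Y (u t i) (Ici 0) t := fun i =>
    exists_antiderivative fun t ht => hu.continuousWithinAt ht i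
  choose Y hY using hY
  have hY' : ∀ t, 0 ≤ t → TimeDeriv (fun t i => Y i t) (u t) t := fun t ht i => hY i t ht
  have hex : ∀ t, ∃ u', 0 ≤ t → R (u t) u' ∧ TimeDeriv u u' t := fun t => by
    by_cases ht : 0 ≤ t
    · obtain ⟨u', h'⟩ := hu.evol t ht
      exact ⟨u', fun _ => h'⟩
    · exact ⟨0, fun h' => absurd h' ht⟩
  choose u' hu' using hex
  have hb : ∀ t, 0 ≤ t → ∀ i, ‖u' t i‖ ≤ C₂ * (K * M) * Real.exp (Λ * t) := fun t ht i => by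
    refine le_of_tendsto ((hu' t ht).2.tendsto_timeQuot ht i).norm ?_
    filter_upwards [Ioc_mem_nhdsGT (lt_min hT hT')] with r hr
    refine hC₂ u _ r hr.1 hu hY' (K * M) (fun j => ?_) (fun j => ?_) t ht i
    · have := (h1 r ⟨hr.1, hr.2.trans (min_le_left _ _)⟩ j).norm_le
      refine this.trans ?_
      have : 2 * C₁ * M ≤ K * M := by gcongr; exact le_max_left _ _
      linarith
    · have := (timeQuot_bound hY' (fun t ht => fun j => (h2 t ht j).of_succ) (m := 0)
        ⟨hr.1, hr.2.trans (min_le_right _ _)⟩ j).norm_le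
      refine this.trans ?_
      gcongr; exact le_max_right _ _
  have := SobolevBound.of_timeDeriv_exp (m := 0) (F := fun t => u t i) (G := fun t => u' t i)
    (M := max 1 (C₂ * K) * M) hΛ (fun t ht => (hu' t ht).2 i)
    ((h0 i).of_succ.mono (by nlinarith [le_max_left 1 (C₂ * K)])) (fun t ht => ?_) ht
  · exact this.mono (le_of_eq (by ring))
  · refine (hb t ht i).trans ?_
    have : C₂ * (K * M) ≤ max 1 (C₂ * K) * M := by
      rw [← mul_assoc]; gcongr; exact le_max_right _ _
    gcongr

theorem WY.tendsto_quotY {f fy : CellL2} (h : WY f fy) (φ : interiorTests) :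
    Tendsto (fun a => inner ℝ (MHD.quotY a f) (testI φ)) (𝓝[≠] 0) (𝓝 (inner ℝ fy (testI φ))) :=
  groupY.tendsto_inner_quot h (testI φ)

/-- Solutions grow at most like `exp (Λ t)`, with the loss of one derivative. -/
theorem IsEvolution.growth (hR : IsGenerator R) (hΛ : 0 < Λ) (hloss : LosesOneDerivative R)
    (henergy : HasEnergyBound R Λ) (hnormal : ControlsNormalDerivative R Λ) (n : ℕ) :
    ∃ C, ∀ u, IsEvolution R (n + 2) u → ∀ M, 0 < M → StateBound (n + 1) (u 0) M → ∀ t, 0 ≤ t →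
      StateBound n (u t) (C * M * Real.exp (Λ * t)) := by
  induction n with
  | zero => exact IsEvolution.base_bound hΛ hloss henergy
  | succ n ih =>
    obtain ⟨C, hC⟩ := ih
    obtain ⟨C₁, hC₁⟩ := hloss (n + 1)
    obtain ⟨C₂, hC₂⟩ := hnormal n
    -- The initial `Hⁿ⁺¹` size of the time quotients is at most `2 * C₁ * M`; the maximum with `1`
    -- keeps the bound positive, as the induction hypothesis requires.
    set L : ℝ := max (2 * C₁) 1 with hL
    have hL1 : 1 ≤ L := le_max_right _ _
    set K : ℝ := max 1 (|C| * L) with hK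
    refine ⟨C₂ * K, fun u hu M hM h0 t ht => ?_⟩
    have hCK : ∀ t, C * M * Real.exp (Λ * t) ≤ K * M * Real.exp (Λ * t) := fun t => by
      gcongr
      calc C ≤ |C| * 1 := by rw [mul_one]; exact le_abs_self C
        _ ≤ |C| * L := by gcongr
        _ ≤ K := le_max_right _ _
    have hCL : ∀ t, C * (L * M) * Real.exp (Λ * t) ≤ K * M * Real.exp (Λ * t) := fun t => by
      rw [← mul_assoc]
      gcongr
      calc C * L ≤ |C| * L := by gcongr; exact le_abs_self C
        _ ≤ K := le_max_right _ _
    have hu2 : IsEvolution R (n + 2) u := hu.of_le (by omega)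
    have h0' : StateBound (n + 1) (u 0) M := fun i => (h0 i).of_succ
    have hM' : StateBound (n + 1) (u 0) (K * M) := fun i =>
      (h0' i).mono (by nlinarith [le_max_left 1 (|C| * L)])
    obtain ⟨T, hT, hTb⟩ := IsEvolution.timeQuot_zero_bound (m := n + 1) hC₁
      (hu.of_le (by omega)) hM h0
    have key := hC₂ u hu2 (K * M) hM'
      (fun t ht i => (hC u hu2 M hM h0' t ht i).mono (hCK t)) (fun t ht i => ?_) (fun t ht => ?_)
      t ht
    · exact fun i => (key i).mono (le_of_eq (by ring))
    -- The `y`-derivative: its difference quotients are solutions whose data lose one order, and the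
    -- induction hypothesis bounds them uniformly in the step.
    · obtain ⟨N, hN⟩ := hu.mem t ht i
      obtain ⟨-, -, uy, -, h, -, -⟩ := hN
      refine ⟨uy, h, SobolevBound.of_tendsto h.tendsto_quotY (Eventually.of_forall fun a => ?_)⟩
      exact (hC _ (hu2.quotY hR a) M hM (fun j => (h0 j).quotY a) t ht i).mono (hCK t)
    -- The time derivative: the same argument with time quotients, whose initial data are bounded by
    -- the loss property.
    · obtain ⟨u', h1, h2⟩ := hu.evol t ht
      refine ⟨u', h1, h2, fun i => ?_⟩
      refine SobolevBound.of_tendsto_norm (h2.tendsto_timeQuot ht i) ?_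
      filter_upwards [Ioc_mem_nhdsGT hT] with r hr
      refine (hC _ (hu2.timeQuot hR hr.1.le) (L * M) (by positivity) (fun j => ?_) t ht i).mono
        (hCL t)
      refine (hTb r hr j).mono ?_
      have : 2 * C₁ * M ≤ L * M := by gcongr; exact le_max_left _ _
      linarith

end Growth

/-! ### Auxiliary facts for the energy estimates -/

/-- The quotients of a test converge strongly to its derivative and distributionally to its weak
derivative; comparing the limits is integration by parts for tests. -/
theorem TranslationGroup.weak_e {H τ : Type*} [NormedAddCommGroup H] [InnerProductSpace ℝ H]
    [AddCommGroup τ] [Module ℝ τ] (G : TranslationGroup H τ) (φ : τ) :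
    G.Weak (G.e φ) (G.e (G.d φ)) := fun ψ => by
  have h1 := G.tendsto_inner_quot_test (G.e φ) ψ
  have h2 : Tendsto (fun a => inner ℝ (G.quot a (G.e φ)) (G.e ψ)) (𝓝[≠] 0)
      (𝓝 (inner ℝ (G.e (G.d φ)) (G.e ψ))) := by
    simp only [real_inner_comm (G.e ψ)]
    exact ((innerSL ℝ (G.e ψ)).continuous.tendsto _).comp (G.tendsto_quot_test φ)
  linarith [tendsto_nhds_unique h1 h2]

theorem TX_testT (φ : torusTests) : TX (testT φ) (testT (dXT φ)) := groupX.weak_e φ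

theorem eq_of_hasDerivWithinAt_zero {H : Type*} [NormedAddCommGroup H] [NormedSpace ℝ H]
    {F : ℝ → H} (h : ∀ t, 0 ≤ t → HasDerivWithinAt F 0 (Ici 0) t) {t : ℝ} (ht : 0 ≤ t) :
    F t = F 0 :=
  constant_of_has_deriv_right_zero (a := 0) (b := t)
    (fun s hs => ((h s hs.1).continuousWithinAt).mono Icc_subset_Ici_self)
    (fun s hs => (h s hs.1).mono (Ici_subset_Ici.2 hs.1)) t ⟨ht, le_rfl⟩

theorem hasDerivWithinAt_inner_const {F : ℝ → CellL2} {F' : CellL2} {s : Set ℝ} {t : ℝ}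
    (h : HasDerivWithinAt F F' s t) (y : CellL2) :
    HasDerivWithinAt (fun t => inner ℝ (F t) y) (inner ℝ F' y) s t := by
  have h2 := (innerSL ℝ y).hasFDerivAt.comp_hasDerivWithinAt t h
  simp only [Function.comp_def, innerSL_apply_apply] at h2
  simpa only [real_inner_comm] using h2

/-- A linear constraint which holds at all times holds for the time derivative. -/
theorem inner_add_inner_deriv_eq_zero {F H : ℝ → CellL2} {F' H' x y : CellL2} {t : ℝ} (ht : 0 ≤ t)
    (hF : HasDerivWithinAt F F' (Ici 0) t) (hH : HasDerivWithinAt H H' (Ici 0) t)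
    (h : ∀ s, 0 ≤ s → inner ℝ (F s) x + inner ℝ (H s) y = 0) :
    inner ℝ F' x + inner ℝ H' y = 0 := by
  have h1 := (hasDerivWithinAt_inner_const hF x).add (hasDerivWithinAt_inner_const hH y)
  have h2 : HasDerivWithinAt (fun _ : ℝ => (0 : ℝ)) 0 (Ici 0) t := hasDerivWithinAt_const _ _ _
  have h3 := h2.congr_of_mem (f₁ := fun s => inner ℝ (F s) x + inner ℝ (H s) y)
    (fun s hs => h s hs) (show t ∈ Ici 0 from ht)
  exact (uniqueDiffOn_Ici 0 t ht).eq_deriv _ h1 h3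

theorem Coef.hasDerivWithinAt_inner_op (c : Coef) {F : ℝ → CellL2} {F' : CellL2} {s : Set ℝ} {t : ℝ}
    (h : HasDerivWithinAt F F' s t) :
    HasDerivWithinAt (fun t => inner ℝ (c.op (F t)) (F t)) (2 * inner ℝ (c.op F') (F t)) s t := by
  have h1 := (c.op.hasFDerivAt.comp_hasDerivWithinAt t h).inner ℝ h
  have e : inner ℝ (c.op (F t)) F' = inner ℝ (c.op F') (F t) := by
    rw [c.inner_op F', real_inner_comm]
  simp only [Function.comp_def] at h1
  rw [e] at h1
  convert! h1 using 1
  ring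

theorem hasDerivWithinAt_inner_self {F : ℝ → CellL2} {F' : CellL2} {s : Set ℝ} {t : ℝ}
    (h : HasDerivWithinAt F F' s t) :
    HasDerivWithinAt (fun t => inner ℝ (F t) (F t)) (2 * inner ℝ F' (F t)) s t := by
  have h1 := h.inner ℝ h
  rw [real_inner_comm] at h1
  convert! h1 using 1
  rw [real_inner_comm]; ring

theorem Coef.abs_inner_op_le (c : Coef) (F : CellL2) :
    |inner ℝ (c.op F) F| ≤ c.bound * ‖F‖ ^ 2 := by
  refine (abs_real_inner_le_norm _ _).trans ?_
  rw [pow_two, ← mul_assoc]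
  gcongr
  exact c.norm_op_le F

/-- Positivity of a coefficient on `[0, 2π]`. -/
def Coef.Pos (c : Coef) : Prop := ∀ x ∈ Icc 0 (2 * Real.pi), 0 < c x

theorem Coef.Pos.inner_op_nonneg {c : Coef} (hc : c.Pos) (F : CellL2) :
    0 ≤ inner ℝ (c.op F) F := by
  rw [← c.norm_sqrt_op_sq hc]; positivity

/-- The weighted norm controls the plain one, since `1/√c` is a bounded coefficient. The added `1`
only makes the constant positive. -/
theorem Coef.Pos.exists_norm_sq_le {c : Coef} (hc : c.Pos) :
    ∃ κ > 0, ∀ F : CellL2, ‖F‖ ^ 2 ≤ κ * inner ℝ (c.op F) F := by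
  have hs : ∀ x ∈ Icc 0 (2 * Real.pi), 0 < c.sqrt hc x := fun x hx => Real.sqrt_pos.2 (hc x hx)
  set i := (c.sqrt hc).inv hs
  refine ⟨i.bound ^ 2 + 1, by positivity, fun F => ?_⟩
  rw [← c.norm_sqrt_op_sq hc]
  have h1 : ‖F‖ ≤ i.bound * ‖(c.sqrt hc).op F‖ := by
    conv_lhs => rw [← (c.sqrt hc).inv_op_op hs F]
    exact i.norm_op_le _
  calc ‖F‖ ^ 2 ≤ (i.bound * ‖(c.sqrt hc).op F‖) ^ 2 := by gcongr
    _ = i.bound ^ 2 * ‖(c.sqrt hc).op F‖ ^ 2 := by ring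
    _ ≤ _ := by gcongr; linarith

/-- Growth of a curve `(V₁, V₂)` whose derivative `(W₁, W₂)` obeys an energy inequality. -/
theorem energy_growth {ρ : Coef} (hρ : ρ.Pos) {Λ K M : ℝ} (hΛ : 0 < Λ) (hK : 0 ≤ K)
    {V₁ V₂ W₁ W₂ : ℝ → CellL2} (h₁ : ∀ t, 0 ≤ t → HasDerivWithinAt V₁ (W₁ t) (Ici 0) t)
    (h₂ : ∀ t, 0 ≤ t → HasDerivWithinAt V₂ (W₂ t) (Ici 0) t)
    (hE : ∀ t, 0 ≤ t → inner ℝ (ρ.op (W₁ t)) (W₁ t) + inner ℝ (ρ.op (W₂ t)) (W₂ t) ≤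
      K ^ 2 + Λ ^ 2 * (inner ℝ (ρ.op (V₁ t)) (V₁ t) + inner ℝ (ρ.op (V₂ t)) (V₂ t)))
    (hM₁ : ‖V₁ 0‖ ≤ M) (hM₂ : ‖V₂ 0‖ ≤ M) {t : ℝ} (ht : 0 ≤ t) :
    inner ℝ (ρ.op (V₁ t)) (V₁ t) + inner ℝ (ρ.op (V₂ t)) (V₂ t) ≤
      ((2 * (ρ.sqrt hρ).bound * M + K / Λ) * Real.exp (Λ * t)) ^ 2 := by
  set r := ρ.sqrt hρ with hr
  have hr0 := r.bound_nonneg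
  have hM0 : 0 ≤ M := (norm_nonneg _).trans hM₁
  -- In the variables `√ρ V₁`, `√ρ V₂` the hypothesis reads `‖X'‖² ≤ K² + Λ² ‖X‖²`, hence `‖X'‖ ≤ Λ
  -- ‖X‖ + K`. Grönwall then gives the rate `Λ` without loss.
  set X : ℝ → WithLp 2 (CellL2 × CellL2) := fun t => WithLp.toLp 2 (r.op (V₁ t), r.op (V₂ t))
  set X' : ℝ → WithLp 2 (CellL2 × CellL2) := fun t => WithLp.toLp 2 (r.op (W₁ t), r.op (W₂ t))
  have hX : ∀ t, ‖X t‖ ^ 2 = inner ℝ (ρ.op (V₁ t)) (V₁ t) + inner ℝ (ρ.op (V₂ t)) (V₂ t) :=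
    fun t => by
      rw [WithLp.prod_norm_sq_eq_of_L2]
      exact congrArg₂ _ (ρ.norm_sqrt_op_sq hρ _) (ρ.norm_sqrt_op_sq hρ _)
  have hX' : ∀ t, ‖X' t‖ ^ 2 = inner ℝ (ρ.op (W₁ t)) (W₁ t) + inner ℝ (ρ.op (W₂ t)) (W₂ t) :=
    fun t => by
      rw [WithLp.prod_norm_sq_eq_of_L2]
      exact congrArg₂ _ (ρ.norm_sqrt_op_sq hρ _) (ρ.norm_sqrt_op_sq hρ _)
  have hd : ∀ t, 0 ≤ t → HasDerivWithinAt X (X' t) (Ici 0) t := fun t ht => by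
    have h3 := (r.op.hasFDerivAt.comp_hasDerivWithinAt t (h₁ t ht)).prodMk
      (r.op.hasFDerivAt.comp_hasDerivWithinAt t (h₂ t ht))
    exact (WithLp.prodContinuousLinearEquiv 2 ℝ CellL2 CellL2).symm.hasFDerivAt.comp_hasDerivWithinAt
      t h3
  have hb : ∀ t, 0 ≤ t → ‖X' t‖ ≤ Λ * ‖X t‖ + K := fun t ht => by
    refine abs_le_of_sq_le_sq' ?_ (by positivity) |>.2
    rw [hX']
    refine (hE t ht).trans ?_
    rw [← hX]
    nlinarith [mul_nonneg (mul_nonneg hΛ.le (norm_nonneg (X t))) hK]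
  have h0 : ‖X 0‖ ≤ 2 * r.bound * M := by
    refine abs_le_of_sq_le_sq' ?_ (by positivity) |>.2
    rw [WithLp.prod_norm_sq_eq_of_L2]
    have e1 : ‖r.op (V₁ 0)‖ ≤ r.bound * M := (r.norm_op_le _).trans (by gcongr)
    have e2 : ‖r.op (V₂ 0)‖ ≤ r.bound * M := (r.norm_op_le _).trans (by gcongr)
    change ‖r.op (V₁ 0)‖ ^ 2 + ‖r.op (V₂ 0)‖ ^ 2 ≤ _
    have e3 : ‖r.op (V₁ 0)‖ ^ 2 ≤ (r.bound * M) ^ 2 := by gcongr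
    have e4 : ‖r.op (V₂ 0)‖ ^ 2 ≤ (r.bound * M) ^ 2 := by gcongr
    nlinarith [sq_nonneg (r.bound * M)]
  have := norm_le_gronwallBound_of_norm_deriv_right_le (f := X) (f' := X') (a := 0) (b := t)
    (fun s hs => ((hd s hs.1).continuousWithinAt).mono Icc_subset_Ici_self)
    (fun s hs => (hd s hs.1).mono (Ici_subset_Ici.2 hs.1)) h0 (fun s hs => hb s hs.1) t ⟨ht, le_rfl⟩
  rw [gronwallBound_of_K_ne_0 hΛ.ne', sub_zero] at this
  rw [← hX]
  have h1 : 0 ≤ K / Λ := by positivity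
  gcongr
  nlinarith

theorem timeDeriv_timeQuot {u Y : ℝ → State} (hY : ∀ t, 0 ≤ t → TimeDeriv Y (u t) t) {r : ℝ}
    (hr : 0 ≤ r) {t : ℝ} (ht : 0 ≤ t) : TimeDeriv (timeQuot r Y) (timeQuot r u t) t :=
  TimeDeriv.diff r⁻¹ (TimeDeriv.shift hr (hY _ (add_nonneg ht hr))) (hY t ht)

/-- A linear equation between `u'` and `u` holds between difference quotients of `u` and of its
antiderivative. -/
theorem timeQuot_eq_op {u Y : ℝ → State} (hY : ∀ t, 0 ≤ t → TimeDeriv Y (u t) t) {i j : Fin 7}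
    (L : CellL2 →L[ℝ] CellL2)
    (h : ∀ t, 0 ≤ t → HasDerivWithinAt (fun t => u t i) (L (u t j)) (Ici 0) t) {r : ℝ}
    (hr : 0 ≤ r) {t : ℝ} (ht : 0 ≤ t) : timeQuot r u t i = L (timeQuot r Y t j) := by
  -- The difference of the field and the operator applied to the antiderivative is constant in time,
  -- and this constant cancels in the quotient.
  have hz : ∀ t, 0 ≤ t → HasDerivWithinAt (fun t => u t i - L (Y t j)) 0 (Ici 0) t := fun t ht => by
    have h1 := (h t ht).sub (L.hasFDerivAt.comp_hasDerivWithinAt t (hY t ht j))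
    rw [sub_self] at h1
    exact h1
  have e1 := eq_of_hasDerivWithinAt_zero hz ht
  have e2 := eq_of_hasDerivWithinAt_zero hz (add_nonneg ht hr)
  have e3 : u (t + r) i - u t i = L (Y (t + r) j) - L (Y t j) := by
    rw [← e1] at e2
    have : u (t + r) i - L (Y (t + r) j) = u t i - L (Y t j) := e2
    rw [sub_eq_sub_iff_add_eq_add] at this ⊢
    rw [this]; abel
  simp only [timeQuot, Pi.smul_apply, Pi.sub_apply, map_smul, map_sub, e3]

theorem SobolevBound.exists_WX {m : ℕ} {f fx : CellL2} {M : ℝ} (h : SobolevBound (m + 1) f M)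
    (hx : WX f fx) : SobolevBound m fx M := by
  obtain ⟨-, gx, gy, h1, -, h3, -⟩ := h
  rwa [hx.unique h1]

theorem SobolevBound.exists_WY {m : ℕ} {f fy : CellL2} {M : ℝ} (h : SobolevBound (m + 1) f M)
    (hy : WY f fy) : SobolevBound m fy M := by
  obtain ⟨-, gx, gy, -, h2, -, h4⟩ := h
  rwa [hy.unique h2]

theorem SobolevBound.of_derivs {m : ℕ} {f fx fy : CellL2} {M : ℝ} (h : SobolevBound m f M)
    (hx : WX f fx) (hy : WY f fy) (kx : SobolevBound m fx M) (ky : SobolevBound m fy M) :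
    SobolevBound (m + 1) f M := ⟨h.norm_le, fx, fy, hx, hy, kx, ky⟩

theorem SobolevBound.mono_mul {m : ℕ} {f : CellL2} {C D M : ℝ} (h : SobolevBound m f (C * M))
    (hCD : C ≤ D) (hM : 0 ≤ M) : SobolevBound m f (D * M) := h.mono (by gcongr)

/-- The curl equation yields the derivative of the momentum `ρ f`; division by `ρ` yields that of
`f`. -/
theorem WX.of_op {ρ : Coef} (hρ : ρ.Pos) {f h : CellL2} (H : WX (ρ.op f) h) :
    WX f ((ρ.inv hρ).d.op (ρ.op f) + (ρ.inv hρ).op h) := by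
  have := H.op (ρ.inv hρ)
  rwa [ρ.inv_op_op hρ] at this

/-! ### The incompressible system -/

/-- The linearized incompressible system for `u = (σ, v, B)`, with time derivative `u'` and total
pressure `Q`; `b` is the constant field parallel to gravity and `β` the field orthogonal to
gravity. -/
structure IncompressibleData (g b : ℝ) (ρ β : Coef) (u u' : State)
    (Q Qx Qy v₁x v₂x B₁x B₂x : CellL2) : Prop where
  pressX : TX Q Qx
  pressY : WY Q Qy
  vel₁X : TX (u 1) v₁x
  vel₂X : WX (u 2) v₂x
  vel₂Y : WY (u 2) (-v₁x)
  mag₁X : WX (u 4) B₁x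
  mag₂X : WX (u 5) B₂x
  mag₂Y : WY (u 5) (-B₁x)
  periodic : b ≠ 0 → TX (u 2) v₂x ∧ TX (u 4) B₁x ∧ TX (u 5) B₂x
  dens : u' 0 = -(ρ.d.op (u 1))
  mom₁ : ρ.op (u' 1) = b • B₁x - Qx + g • u 0
  mom₂ : ρ.op (u' 2) = b • B₂x - Qy
  mom₃ : ρ.op (u' 3) = β.d.op (u 4)
  far₁ : u' 4 = b • v₁x
  far₂ : u' 5 = b • v₂x
  far₃ : u' 6 = -(β.d.op (u 1))

/-- The linearized incompressible system as a relation between states and their time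
derivatives. -/
def Incompressible (g b : ℝ) (ρ β : Coef) (u u' : State) : Prop :=
  ∃ Q Qx Qy v₁x v₂x B₁x B₂x, IncompressibleData g b ρ β u u' Q Qx Qy v₁x v₂x B₁x B₂x

theorem isGenerator_incompressible (g b : ℝ) (ρ β : Coef) :
    IsGenerator (Incompressible g b ρ β) where
  diff := by
    rintro u u' w w' c ⟨Q, Qx, Qy, a, d, e, f, h⟩ ⟨P, Px, Py, i, j, k, l, h'⟩
    refine ⟨c • (Q - P), c • (Qx - Px), c • (Qy - Py), c • (a - i), c • (d - j), c • (e - k),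
      c • (f - l), ?_⟩
    constructor
    · exact (h.pressX.sub h'.pressX).smul c
    · exact (h.pressY.sub h'.pressY).smul c
    · exact (h.vel₁X.sub h'.vel₁X).smul c
    · exact (h.vel₂X.sub h'.vel₂X).smul c
    · convert! (h.vel₂Y.sub h'.vel₂Y).smul c using 1; module
    · exact (h.mag₁X.sub h'.mag₁X).smul c
    · exact (h.mag₂X.sub h'.mag₂X).smul c
    · convert! (h.mag₂Y.sub h'.mag₂Y).smul c using 1; module
    · intro hb
      obtain ⟨h1, h2, h3⟩ := h.periodic hb
      obtain ⟨k1, k2, k3⟩ := h'.periodic hb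
      exact ⟨(h1.sub k1).smul c, (h2.sub k2).smul c, (h3.sub k3).smul c⟩
    all_goals simp only [Pi.smul_apply, Pi.sub_apply, map_smul, map_sub]
    · rw [h.dens, h'.dens]; module
    · rw [h.mom₁, h'.mom₁]; module
    · rw [h.mom₂, h'.mom₂]; module
    · rw [h.mom₃, h'.mom₃]
    · rw [h.far₁, h'.far₁]; module
    · rw [h.far₂, h'.far₂]; module
    · rw [h.far₃, h'.far₃]; module
  trans := by
    rintro u u' s ⟨Q, Qx, Qy, a, d, e, f, h⟩
    refine ⟨transY s Q, transY s Qx, transY s Qy, transY s a, transY s d, transY s e,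
      transY s f, ?_⟩
    constructor
    · exact h.pressX.transY s
    · exact h.pressY.transY s
    · exact h.vel₁X.transY s
    · exact h.vel₂X.transY s
    · rw [← map_neg]; exact h.vel₂Y.transY s
    · exact h.mag₁X.transY s
    · exact h.mag₂X.transY s
    · rw [← map_neg]; exact h.mag₂Y.transY s
    · intro hb
      obtain ⟨h1, h2, h3⟩ := h.periodic hb
      exact ⟨h1.transY s, h2.transY s, h3.transY s⟩
    all_goals simp only [← transY_op, ← map_smul, ← map_sub, ← map_add]
    · rw [h.dens, map_neg]
    · rw [h.mom₁]
    · rw [h.mom₂]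
    · rw [h.mom₃]
    · rw [h.far₁]
    · rw [h.far₂]
    · rw [h.far₃, map_neg]

namespace IncompressibleData

variable {g b : ℝ} {ρ β : Coef} {u u' : State} {Q Qx Qy v₁x v₂x B₁x B₂x : CellL2}

/-- A divergence-free field whose normal component has equal traces is orthogonal to gradients of
functions with equal traces. This eliminates the pressure. -/
theorem inner_gradient (h : IncompressibleData g b ρ β u u' Q Qx Qy v₁x v₂x B₁x B₂x)
    {P Px Py : CellL2} (hx : TX P Px) (hy : WY P Py) :
    inner ℝ (u 1) Px + inner ℝ (u 2) Py = 0 := by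
  have h1 := h.vel₁X.inner_eq hx
  have h2 := h.vel₂Y.inner_eq hy
  rw [inner_neg_left] at h2
  linarith

theorem inner_test (h : IncompressibleData g b ρ β u u' Q Qx Qy v₁x v₂x B₁x B₂x)
    (φ : interiorTests) :
    inner ℝ (u 1) (testI (dXI φ)) + inner ℝ (u 2) (testI (dYI φ)) = 0 := by
  rw [h.vel₁X.wx, h.vel₂Y, inner_neg_left]; ring

/-- The curl of the momentum equation. -/
theorem curl (h : IncompressibleData g b ρ β u u' Q Qx Qy v₁x v₂x B₁x B₂x) (φ : interiorTests) :
    inner ℝ (ρ.op (u' 2)) (testI (dXI φ)) - inner ℝ (ρ.op (u' 1)) (testI (dYI φ)) =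
      b * inner ℝ B₂x (testI (dXI φ)) - b * inner ℝ B₁x (testI (dYI φ))
        - g * inner ℝ (u 0) (testI (dYI φ)) := by
  have h1 : inner ℝ Qy (testI (dXI φ)) = inner ℝ Qx (testI (dYI φ)) := by
    have e1 := h.pressY (dXI φ)
    have e2 := h.pressX.wx (dYI φ)
    rw [dXI_dYI] at e2
    linarith
  rw [h.mom₁, h.mom₂]
  simp only [inner_add_left, inner_sub_left, real_inner_smul_left]
  linarith

/-- The curl equation solved for its one term with a normal derivative of the acceleration; the
pressure has dropped out. -/
theorem wx_momentum₂ (h : IncompressibleData g b ρ β u u' Q Qx Qy v₁x v₂x B₁x B₂x)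
    {a₁y σy B₁xy B₂xx : CellL2} (h1 : WY (u' 1) a₁y) (h2 : WY (u 0) σy) (h3 : WY B₁x B₁xy)
    (h4 : WX B₂x B₂xx) :
    WX (ρ.op (u' 2)) (ρ.op a₁y + b • B₂xx - b • B₁xy - g • σy) := fun φ => by
  have h5 := h.curl φ
  rw [h1.op ρ, h2, h3, h4] at h5
  simp only [inner_add_left, inner_sub_left, real_inner_smul_left]
  linarith

end IncompressibleData

/-! ### Incompressible system: the time derivative loses one derivative. -/

section Loss

variable {g b : ℝ} {ρ β : Coef}

/-- The acceleration is divergence-free, as the time derivative of divergence-free fields, hence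
orthogonal to the pressure gradient. Testing the momentum equation with it bounds it without
knowledge of the pressure. For higher orders, `y`-derivatives come from difference quotients, `∂ₓ`
of the first component from the divergence, and `∂ₓ` of the second from the curl. -/
theorem incompressible_acceleration_bound (g b : ℝ) (β : Coef) (hρ : ρ.Pos) (m : ℕ) :
    ∃ C, 0 ≤ C ∧ ∀ (u : ℝ → State) (t : ℝ), 0 ≤ t →
      IsEvolution (Incompressible g b ρ β) (m + 1) u → ∀ M, StateBound (m + 1) (u t) M →
      ∀ u', Incompressible g b ρ β (u t) u' → TimeDeriv u u' t →
        SobolevBound m (u' 1) (C * M) ∧ SobolevBound m (u' 2) (C * M) := by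
  induction m with
  | zero =>
    obtain ⟨κ, hκ, hκρ⟩ := hρ.exists_norm_sq_le
    refine ⟨2 * κ * (|b| + |g|), by positivity, fun u t ht hu M hM u' h hd => ?_⟩
    obtain ⟨Q, Qx, Qy, v₁x, v₂x, B₁x, B₂x, h⟩ := h
    -- The pressure at the fixed time `t` is tested against the velocity at all times, and this
    -- constraint is differentiated in time.
    have horth : inner ℝ (u' 1) Qx + inner ℝ (u' 2) Qy = 0 :=
      inner_add_inner_deriv_eq_zero ht (hd 1) (hd 2) fun s hs => by
        obtain ⟨w', ⟨P, Px, Py, _, _, _, _, h'⟩, -⟩ := hu.evol s hs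
        exact h'.inner_gradient h.pressX h.pressY
    have hM0 : 0 ≤ M := (hM 0).nonneg
    have n0 : ‖u t 0‖ ≤ M := (hM 0).norm_le
    have n4 : ‖B₁x‖ ≤ M := ((hM 4).exists_WX h.mag₁X).norm_le
    have n5 : ‖B₂x‖ ≤ M := ((hM 5).exists_WX h.mag₂X).norm_le
    set x := ‖u' 1‖
    set y := ‖u' 2‖
    have hx : 0 ≤ x := norm_nonneg _
    have hy : 0 ≤ y := norm_nonneg _
    have e1 : inner ℝ (ρ.op (u' 1)) (u' 1) + inner ℝ (ρ.op (u' 2)) (u' 2) =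
        b * inner ℝ B₁x (u' 1) + g * inner ℝ (u t 0) (u' 1) + b * inner ℝ B₂x (u' 2) := by
      rw [h.mom₁, h.mom₂]
      simp only [inner_add_left, inner_sub_left, real_inner_smul_left]
      rw [real_inner_comm Qx, real_inner_comm Qy] at horth
      linarith
    have bd : ∀ (c : ℝ) (F H : CellL2), ‖F‖ ≤ M → c * inner ℝ F H ≤ |c| * (M * ‖H‖) :=
      fun c F H hF => (le_abs_self _).trans (by
        rw [abs_mul]
        gcongr
        exact (abs_real_inner_le_norm _ _).trans (by gcongr))
    have e2 := bd b B₁x (u' 1) n4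
    have e3 := bd g (u t 0) (u' 1) n0
    have e4 := bd b B₂x (u' 2) n5
    have e5 := hκρ (u' 1)
    have e6 := hκρ (u' 2)
    have e7 : x ^ 2 + y ^ 2 ≤ κ * ((|b| + |g|) * M * (x + y)) := by
      calc x ^ 2 + y ^ 2 ≤ κ * (inner ℝ (ρ.op (u' 1)) (u' 1) + inner ℝ (ρ.op (u' 2)) (u' 2)) := by
            linarith
        _ ≤ _ := by
            rw [e1]
            gcongr
            have : 0 ≤ |g| * (M * y) := by positivity
            linarith
    -- The factor `2` stems from `(x + y)² ≤ 2 (x² + y²)`, after which one factor `x + y` cancels.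
    have e8 : x + y ≤ 2 * κ * (|b| + |g|) * M := by
      rcases (add_nonneg hx hy).eq_or_lt with h0 | h0
      · rw [← h0]; positivity
      · refine le_of_mul_le_mul_right ?_ h0
        nlinarith [sq_nonneg (x - y)]
    exact ⟨show x ≤ _ by linarith, show y ≤ _ by linarith⟩
  | succ m ih =>
    obtain ⟨C, hC0, hC⟩ := ih
    set i := ρ.inv hρ with hi
    have p1 := ρ.opConst_nonneg m
    have p2 := ρ.opConst_nonneg (m + 1)
    have p3 := i.opConst_nonneg m
    have p4 := i.d.opConst_nonneg m
    refine ⟨C + (i.d.opConst m * (ρ.opConst m * C) +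
      i.opConst m * (ρ.opConst m * C + |b| + |b| + |g|)), by positivity,
      fun u t ht hu M hM u' h hd => ?_⟩
    have hM0 : 0 ≤ M := (hM 0).nonneg
    have hR := isGenerator_incompressible g b ρ β
    have hu' : IsEvolution (Incompressible g b ρ β) (m + 1) u := hu.of_le (by omega)
    have key := hC u t ht hu' M (fun j => (hM j).of_succ) u' h hd
    -- The lower order estimate for the quotient solution bounds the quotients of the acceleration
    -- uniformly, so its `y`-derivatives exist.
    have keyq : ∀ a, SobolevBound m (quotY a (u' 1)) (C * M) ∧
        SobolevBound m (quotY a (u' 2)) (C * M) := fun a =>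
      hC _ t ht (hu'.quotY hR a) M (fun j => (hM j).quotY a) (fun j => quotY a (u' j))
        (hR.diff a⁻¹ (hR.trans a h) h)
        ((hd.map (transY a).toContinuousLinearMap).diff a⁻¹ hd)
    obtain ⟨a₁y, h1, k1⟩ := SobolevBound.exists_WY_of_quotY fun a => (keyq a).1
    obtain ⟨a₂y, h2, k2⟩ := SobolevBound.exists_WY_of_quotY fun a => (keyq a).2
    obtain ⟨Q, Qx, Qy, v₁x, v₂x, B₁x, B₂x, h⟩ := h
    -- The divergence constraint differentiated in time gives the normal derivative of the first
    -- component.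
    have hx1 : WX (u' 1) (-a₂y) := fun φ => by
      have := inner_add_inner_deriv_eq_zero (x := testI (dXI φ)) (y := testI (dYI φ)) ht (hd 1)
        (hd 2) fun s hs => by
        obtain ⟨w', ⟨P, Px, Py, _, _, _, _, h'⟩, -⟩ := hu.evol s hs
        exact h'.inner_test φ
      rw [h2 φ] at this
      rw [inner_neg_left]
      linarith
    obtain ⟨-, -, σy, -, q1, -, r1⟩ := hM 0
    have s4 := (hM 4).exists_WX h.mag₁X
    have s5 := (hM 5).exists_WX h.mag₂X
    obtain ⟨-, -, B₁xy, -, q2, -, r2⟩ := s4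
    obtain ⟨-, B₂xx, -, q3, -, r3, -⟩ := s5
    have hx2 := (h.wx_momentum₂ h1 q1 q2 q3).of_op hρ
    have s1 := ((((k1.op ρ).add (r3.smul b)).sub (r2.smul b)).sub (r1.of_succ.smul g)).op i
    have s2 := (key.2.op ρ).op i.d
    have s3 := s2.add s1
    have pC : C ≤ C + (i.d.opConst m * (ρ.opConst m * C) +
      i.opConst m * (ρ.opConst m * C + |b| + |b| + |g|)) := le_add_of_nonneg_right (by positivity)
    refine ⟨(key.1.mono_mul pC hM0).of_derivs hx1 h1 (k2.neg.mono_mul pC hM0)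
      (k1.mono_mul pC hM0), (key.2.mono_mul pC hM0).of_derivs hx2 h2 (s3.mono ?_)
      (k2.mono_mul pC hM0)⟩
    have : 0 ≤ C * M := by positivity
    linarith

theorem losesOneDerivative_incompressible (g b : ℝ) (β : Coef) (hρ : ρ.Pos) :
    LosesOneDerivative (Incompressible g b ρ β) := fun m => by
  obtain ⟨C, hC0, hC⟩ := incompressible_acceleration_bound g b β hρ m
  set i := ρ.inv hρ with hi
  have p1 := ρ.d.opConst_nonneg m
  have p2 := β.d.opConst_nonneg m
  have p3 := i.opConst_nonneg m
  refine ⟨C + ρ.d.opConst m + β.d.opConst m + i.opConst m * β.d.opConst m + |b|,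
    fun u t ht hu M hM u' h hd => ?_⟩
  obtain ⟨c1, c2⟩ := hC u t ht hu M hM u' h hd
  obtain ⟨Q, Qx, Qy, v₁x, v₂x, B₁x, B₂x, h⟩ := h
  have hM0 : 0 ≤ M := (hM 0).nonneg
  have p4 : 0 ≤ i.opConst m * β.d.opConst m := by positivity
  have p5 := abs_nonneg b
  have key : ∀ j, SobolevBound m (u t j) M := fun j => (hM j).of_succ
  intro j
  fin_cases j
  · change SobolevBound m (u' 0) _
    rw [h.dens]
    exact ((key 1).op ρ.d).neg.mono_mul (by linarith) hM0
  · exact c1.mono_mul (by linarith) hM0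
  · exact c2.mono_mul (by linarith) hM0
  · change SobolevBound m (u' 3) _
    have e : u' 3 = i.op (β.d.op (u t 4)) := by rw [← h.mom₃, hi, ρ.inv_op_op hρ]
    rw [e]
    exact (((key 4).op β.d).op i).mono (by rw [← mul_assoc]; gcongr; linarith)
  · change SobolevBound m (u' 4) _
    rw [h.far₁]
    exact (((hM 1).exists_WX h.vel₁X.wx).smul b).mono_mul (by linarith) hM0
  · change SobolevBound m (u' 5) _
    rw [h.far₂]
    exact (((hM 2).exists_WX h.vel₂X).smul b).mono_mul (by linarith) hM0
  · change SobolevBound m (u' 6) _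
    rw [h.far₃]
    exact ((key 1).op β.d).neg.mono_mul (by linarith) hM0

end Loss

/-! ### Incompressible system: conservation of energy and the rate `Λ`. -/

section Energy

variable {g b : ℝ} {ρ β : Coef} {Λ : ℝ}

/-- The quadratic form of the incompressible system is bounded by `Λ²`. -/
def IncompressibleForm (g b : ℝ) (ρ : Coef) (Λ : ℝ) : Prop :=
  ∀ w wx : CellL2, TX w wx →
    -g * inner ℝ (ρ.d.op w) w - b ^ 2 * ‖wx‖ ^ 2 ≤ Λ ^ 2 * inner ℝ (ρ.op w) w

/-- Without the derivative term the form is continuous on `L²`, so it extends from tests. No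
`x`-derivative of the displacement is then required. -/
theorem IncompressibleForm.of_zero (h : IncompressibleForm g b ρ Λ) (hb : b = 0) (w : CellL2) :
    -g * inner ℝ (ρ.d.op w) w ≤ Λ ^ 2 * inner ℝ (ρ.op w) w :=
  dense_testT.induction_on (p := fun w => -g * inner ℝ (ρ.d.op w) w ≤ Λ ^ 2 * inner ℝ (ρ.op w) w) w
    (isClosed_le (by fun_prop) (by fun_prop)) fun φ => by
      simpa [hb] using h _ _ (TX_testT φ)

variable {u Y : ℝ → State} {r : ℝ}

/-- The density is carried by the displacement; on quotients this is an exact identity. It turns the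
work of gravity into the derivative of a potential energy. -/
theorem incompressible_timeQuot_density (hu : IsEvolution (Incompressible g b ρ β) 2 u)
    (hY : ∀ t, 0 ≤ t → TimeDeriv Y (u t) t) (hr : 0 ≤ r) {t : ℝ} (ht : 0 ≤ t) :
    timeQuot r u t 0 = -(ρ.d.op (timeQuot r Y t 1)) :=
  timeQuot_eq_op (i := 0) (j := 1) hY (-ρ.d.op) (fun t ht => by
    obtain ⟨u', ⟨_, _, _, _, _, _, _, h⟩, hd⟩ := hu.evol t ht
    have := hd 0
    rwa [h.dens] at this) hr ht

theorem incompressible_timeQuot_far₃ (hu : IsEvolution (Incompressible g b ρ β) 2 u)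
    (hY : ∀ t, 0 ≤ t → TimeDeriv Y (u t) t) (hr : 0 ≤ r) {t : ℝ} (ht : 0 ≤ t) :
    timeQuot r u t 6 = -(β.d.op (timeQuot r Y t 1)) :=
  timeQuot_eq_op (i := 6) (j := 1) hY (-β.d.op) (fun t ht => by
    obtain ⟨u', ⟨_, _, _, _, _, _, _, h⟩, hd⟩ := hu.evol t ht
    have := hd 6
    rwa [h.far₃] at this) hr ht

theorem incompressible_timeQuot_vel₃ (hρ : ρ.Pos) (hu : IsEvolution (Incompressible g b ρ β) 2 u)
    (hY : ∀ t, 0 ≤ t → TimeDeriv Y (u t) t) (hr : 0 ≤ r) {t : ℝ} (ht : 0 ≤ t) :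
    timeQuot r u t 3 = (ρ.inv hρ).op (β.d.op (timeQuot r Y t 4)) :=
  timeQuot_eq_op (i := 3) (j := 4) hY ((ρ.inv hρ).op.comp β.d.op) (fun t ht => by
    obtain ⟨u', ⟨_, _, _, _, _, _, _, h⟩, hd⟩ := hu.evol t ht
    have := hd 3
    rwa [← ρ.inv_op_op hρ (u' 3), h.mom₃] at this) hr ht

/-- Conservation of energy for time difference quotients. -/
theorem incompressible_energy (hu : IsEvolution (Incompressible g b ρ β) 2 u)
    (hY : ∀ t, 0 ≤ t → TimeDeriv Y (u t) t) (hr : 0 ≤ r) {t : ℝ} (ht : 0 ≤ t) :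
    let e := fun t => inner ℝ (ρ.op (timeQuot r u t 1)) (timeQuot r u t 1) +
      inner ℝ (ρ.op (timeQuot r u t 2)) (timeQuot r u t 2) +
      inner ℝ (timeQuot r u t 4) (timeQuot r u t 4) +
      inner ℝ (timeQuot r u t 5) (timeQuot r u t 5) +
      g * inner ℝ (ρ.d.op (timeQuot r Y t 1)) (timeQuot r Y t 1)
    e t = e 0 := by
  intro e
  refine eq_of_hasDerivWithinAt_zero (fun t ht => ?_) ht
  obtain ⟨w', ⟨Q, Qx, Qy, v₁x, v₂x, B₁x, B₂x, h⟩, hd⟩ :=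
    (hu.timeQuot (isGenerator_incompressible g b ρ β) hr).evol t ht
  have hV := timeDeriv_timeQuot hY hr ht
  have hW0 := incompressible_timeQuot_density hu hY hr ht
  have horth := h.inner_gradient h.pressX h.pressY
  set W := timeQuot r u
  set V := timeQuot r Y
  have key := ((((ρ.hasDerivWithinAt_inner_op (hd 1)).add (ρ.hasDerivWithinAt_inner_op (hd 2))).add
    (hasDerivWithinAt_inner_self (hd 4))).add (hasDerivWithinAt_inner_self (hd 5))).add
    ((ρ.d.hasDerivWithinAt_inner_op (hV 1)).const_mul g)
  refine HasDerivWithinAt.congr_deriv key ?_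
  have s1 : inner ℝ (ρ.d.op (V t 1)) (W t 1) = inner ℝ (ρ.d.op (W t 1)) (V t 1) := by
    rw [ρ.d.inner_op (W t 1), real_inner_comm]
  rw [h.mom₁, h.mom₂, h.far₁, h.far₂, hW0]
  simp only [inner_add_left, inner_sub_left, real_inner_smul_left, inner_neg_left]
  rw [s1]
  rw [real_inner_comm Qx, real_inner_comm Qy] at horth
  -- Exchange between kinetic and magnetic energy. Equality of traces is available exactly when `b ≠
  -- 0`, that is, when these terms are present.
  have hB : b * inner ℝ B₁x (W t 1) + b * inner ℝ v₁x (W t 4) + b * inner ℝ B₂x (W t 2) +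
      b * inner ℝ v₂x (W t 5) = 0 := by
    by_cases hb : b = 0
    · simp [hb]
    · obtain ⟨k2, k4, k5⟩ := h.periodic hb
      rw [k4.inner_eq h.vel₁X, k5.inner_eq k2, real_inner_comm v₁x, real_inner_comm v₂x]
      ring
  linarith

/-- For `b ≠ 0`, Faraday's law integrated in time reads `B₁ = b ∂ₓ(displacement)` on quotients. The
stabilizing term `b² ‖∂ₓ V₁‖²` of the form is thus the magnetic energy `‖W₄‖²`. -/
theorem incompressible_form_timeQuot (hq : IncompressibleForm g b ρ Λ)
    (hu : IsEvolution (Incompressible g b ρ β) 2 u)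
    (hY : ∀ t, 0 ≤ t → TimeDeriv Y (u t) t) (hr : 0 ≤ r) {t : ℝ} (ht : 0 ≤ t) :
    -g * inner ℝ (ρ.d.op (timeQuot r Y t 1)) (timeQuot r Y t 1) ≤
      Λ ^ 2 * inner ℝ (ρ.op (timeQuot r Y t 1)) (timeQuot r Y t 1) +
        inner ℝ (timeQuot r u t 4) (timeQuot r u t 4) := by
  by_cases hb : b = 0
  · have := hq.of_zero hb (timeQuot r Y t 1)
    have h2 : 0 ≤ inner ℝ (timeQuot r u t 4) (timeQuot r u t 4) := real_inner_self_nonneg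
    linarith
  -- The derivative of the displacement is found weakly: the two pairings with a torus test combine
  -- to a constant in time, which the difference quotient removes.
  · have hx : TX (timeQuot r Y t 1) (b⁻¹ • timeQuot r u t 4) := fun φ => by
      have hz : ∀ s, 0 ≤ s → HasDerivWithinAt (fun s => inner ℝ (Y s 1) (testT (dXT φ)) +
          b⁻¹ * inner ℝ (u s 4) (testT φ)) 0 (Ici 0) s := fun s hs => by
        obtain ⟨u', ⟨_, _, _, _, _, _, _, h⟩, hd⟩ := hu.evol s hs
        refine ((hasDerivWithinAt_inner_const (hY s hs 1) _).add
          ((hasDerivWithinAt_inner_const (hd 4) (testT φ)).const_mul b⁻¹)).congr_deriv ?_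
        rw [h.vel₁X, h.far₁, real_inner_smul_left]
        field_simp
        ring
      have e1 := eq_of_hasDerivWithinAt_zero hz ht
      have e2 := eq_of_hasDerivWithinAt_zero hz (add_nonneg ht hr)
      rw [← e1] at e2
      simp only [timeQuot, Pi.smul_apply, Pi.sub_apply, real_inner_smul_left, inner_sub_left]
      have e3 : inner ℝ (Y (t + r) 1) (testT (dXT φ)) - inner ℝ (Y t 1) (testT (dXT φ)) =
          -(b⁻¹ * (inner ℝ (u (t + r) 4) (testT φ) - inner ℝ (u t 4) (testT φ))) := by linarith
      rw [e3]; ring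
    have h2 := hq _ _ hx
    rw [norm_smul, mul_pow, norm_inv, inv_pow, Real.norm_eq_abs, sq_abs, ← mul_assoc,
      mul_inv_cancel₀ (pow_ne_zero 2 hb), one_mul, ← real_inner_self_eq_norm_sq] at h2
    linarith

/-- Energy conservation and the form inequality give a differential inequality for the displacement,
and Grönwall gives the rate `Λ`. The energy identity then bounds the in-plane velocity and magnetic
field, and the remaining components follow from the displacement and from `B₁` by the integrated
equations. -/
theorem hasEnergyBound_incompressible (hρ : ρ.Pos) (hΛ : 0 < Λ)
    (hq : IncompressibleForm g b ρ Λ) (β : Coef) :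
    HasEnergyBound (Incompressible g b ρ β) Λ := by
  obtain ⟨κ, hκ, hκρ⟩ := hρ.exists_norm_sq_le
  set rb := (ρ.sqrt hρ).bound with hrb
  have rb0 : 0 ≤ rb := Coef.bound_nonneg _
  have ρ0 := ρ.bound_nonneg
  have d0 := ρ.d.bound_nonneg
  have β0 := β.d.bound_nonneg
  have i0 := (ρ.inv hρ).bound_nonneg
  have g0 := abs_nonneg g
  -- `K * M` bounds the square root of the initial energy: two velocity terms, two magnetic terms
  -- and the potential energy.
  set K : ℝ := Real.sqrt (2 * ρ.bound + 2 + |g| * ρ.d.bound) with hK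
  have hK0 : 0 ≤ K := Real.sqrt_nonneg _
  have hKsq : K ^ 2 = 2 * ρ.bound + 2 + |g| * ρ.d.bound := Real.sq_sqrt (by positivity)
  set K₁ : ℝ := 2 * rb + K / Λ with hK₁
  have hK₁0 : 0 ≤ K₁ := by positivity
  -- The energy constant once the potential energy is estimated by the exponential bound already
  -- obtained for the displacement.
  set K₂ : ℝ := Real.sqrt (K ^ 2 + |g| * ρ.d.bound * κ * K₁ ^ 2) with hK₂
  have hK₂0 : 0 ≤ K₂ := Real.sqrt_nonneg _
  have hK₂sq : K₂ ^ 2 = K ^ 2 + |g| * ρ.d.bound * κ * K₁ ^ 2 := Real.sq_sqrt (by positivity)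
  refine ⟨(κ + 1) * K₁ * (ρ.d.bound + β.d.bound) + (κ + 1) * K₂ + K₂ +
    (ρ.inv hρ).bound * β.d.bound * ((1 + 1 / Λ) * (1 + K₂)), fun u Y r hr hu hY M hW0 hV0 t ht => ?_⟩
  have hM : 0 ≤ M := (norm_nonneg _).trans (hW0 0)
  have hE := fun t ht => incompressible_energy hu hY hr.le (t := t) ht
  have hF := fun t ht => incompressible_form_timeQuot hq hu hY hr.le (t := t) ht
  have hV := fun t ht => timeDeriv_timeQuot hY hr.le (t := t) ht
  have eq0 := incompressible_timeQuot_density hu hY hr.le ht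
  have eq6 := incompressible_timeQuot_far₃ hu hY hr.le ht
  have eq3 := incompressible_timeQuot_vel₃ hρ hu hY hr.le ht
  simp only at hE
  set W := timeQuot r u
  set V := timeQuot r Y
  have sqle : ∀ F : CellL2, ‖F‖ ≤ M → ‖F‖ ^ 2 ≤ M ^ 2 := fun F hF => by gcongr
  have hE0 : inner ℝ (ρ.op (W 0 1)) (W 0 1) + inner ℝ (ρ.op (W 0 2)) (W 0 2) +
      inner ℝ (W 0 4) (W 0 4) + inner ℝ (W 0 5) (W 0 5) +
      g * inner ℝ (ρ.d.op (V 0 1)) (V 0 1) ≤ (K * M) ^ 2 := by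
    have q1 := (le_abs_self _).trans (ρ.abs_inner_op_le (W 0 1))
    have q2 := (le_abs_self _).trans (ρ.abs_inner_op_le (W 0 2))
    have q3 : g * inner ℝ (ρ.d.op (V 0 1)) (V 0 1) ≤ |g| * (ρ.d.bound * ‖V 0 1‖ ^ 2) :=
      (le_abs_self _).trans (by rw [abs_mul]; gcongr; exact ρ.d.abs_inner_op_le _)
    have r1 := mul_le_mul_of_nonneg_left (sqle _ (hW0 1)) ρ0
    have r2 := mul_le_mul_of_nonneg_left (sqle _ (hW0 2)) ρ0
    have r3 := mul_le_mul_of_nonneg_left (sqle _ (hV0 1)) (mul_nonneg g0 d0)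
    rw [real_inner_self_eq_norm_sq, real_inner_self_eq_norm_sq, mul_pow, hKsq]
    linarith [sqle _ (hW0 4), sqle _ (hW0 5)]
  have growth : ∀ t, 0 ≤ t → inner ℝ (ρ.op (V t 1)) (V t 1) + inner ℝ (ρ.op (V t 2)) (V t 2) ≤
      (K₁ * M * Real.exp (Λ * t)) ^ 2 := fun t ht => by
    have := energy_growth hρ hΛ (K := K * M) (M := M) (by positivity) (fun t ht => hV t ht 1)
      (fun t ht => hV t ht 2) (fun t ht => ?_) (hV0 1) (hV0 2) ht
    · refine this.trans (le_of_eq ?_)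
      rw [hK₁]; ring
    -- The magnetic energy `‖W₄‖²` given up in the form inequality is precisely the one present in
    -- the energy, so the two cancel and only the rate `Λ` remains.
    · have e1 := hE t ht
      have e2 := hF t ht
      have e3 : 0 ≤ inner ℝ (W t 5) (W t 5) := real_inner_self_nonneg
      have e4 : 0 ≤ Λ ^ 2 * inner ℝ (ρ.op (V t 2)) (V t 2) :=
        mul_nonneg (sq_nonneg _) (hρ.inner_op_nonneg _)
      linarith
  have hV1 : ∀ t, 0 ≤ t → ‖V t 1‖ ^ 2 ≤ κ * (K₁ * M * Real.exp (Λ * t)) ^ 2 := fun t ht =>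
    (hκρ _).trans (by gcongr; linarith [growth t ht, hρ.inner_op_nonneg (V t 2)])
  have total : ∀ t, 0 ≤ t → inner ℝ (ρ.op (W t 1)) (W t 1) + inner ℝ (ρ.op (W t 2)) (W t 2) +
      ‖W t 4‖ ^ 2 + ‖W t 5‖ ^ 2 ≤ (K₂ * M * Real.exp (Λ * t)) ^ 2 := fun t ht => by
    have e1 := hE t ht
    have q3 : -(g * inner ℝ (ρ.d.op (V t 1)) (V t 1)) ≤ |g| * (ρ.d.bound * ‖V t 1‖ ^ 2) :=
      (neg_le_abs _).trans (by rw [abs_mul]; gcongr; exact ρ.d.abs_inner_op_le _)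
    have q4 := mul_le_mul_of_nonneg_left (hV1 t ht) (mul_nonneg g0 d0)
    have q5 : (K * M) ^ 2 * 1 ≤ (K * M) ^ 2 * Real.exp (Λ * t) ^ 2 := by
      gcongr
      exact one_le_pow₀ (Real.one_le_exp (by positivity))
    rw [← real_inner_self_eq_norm_sq, ← real_inner_self_eq_norm_sq]
    calc _ ≤ (K * M) ^ 2 * Real.exp (Λ * t) ^ 2 +
          |g| * ρ.d.bound * (κ * (K₁ * M * Real.exp (Λ * t)) ^ 2) := by linarith
      _ = _ := by rw [mul_pow (K₂ * M), mul_pow K₂, hK₂sq]; ring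
  have sqrt_le : ∀ {x y : ℝ}, 0 ≤ y → x ^ 2 ≤ κ * y ^ 2 → x ≤ (κ + 1) * y := fun {x y} hy h =>
    (abs_le_of_sq_le_sq' (by nlinarith [mul_nonneg hκ.le (sq_nonneg y), sq_nonneg (κ * y)])
      (by positivity)).2
  have nV1 : ‖V t 1‖ ≤ (κ + 1) * (K₁ * M * Real.exp (Λ * t)) :=
    sqrt_le (by positivity) (hV1 t ht)
  have nW : ∀ t, 0 ≤ t → ‖W t 1‖ ≤ (κ + 1) * (K₂ * M * Real.exp (Λ * t)) ∧
      ‖W t 2‖ ≤ (κ + 1) * (K₂ * M * Real.exp (Λ * t)) ∧ ‖W t 4‖ ≤ K₂ * M * Real.exp (Λ * t) ∧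
      ‖W t 5‖ ≤ K₂ * M * Real.exp (Λ * t) := fun t ht => by
    have e0 := total t ht
    have e1 := hρ.inner_op_nonneg (W t 1)
    have e2 := hρ.inner_op_nonneg (W t 2)
    have e4 := sq_nonneg ‖W t 4‖
    have e5 := sq_nonneg ‖W t 5‖
    refine ⟨sqrt_le (by positivity) ((hκρ _).trans (by gcongr; linarith)),
      sqrt_le (by positivity) ((hκρ _).trans (by gcongr; linarith)),
      (abs_le_of_sq_le_sq' (by linarith) (by positivity)).2,
      (abs_le_of_sq_le_sq' (by linarith) (by positivity)).2⟩
  -- The third velocity component is driven by the antiderivative of `B₁`, which the energy does not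
  -- contain; it is bounded by integrating `B₁` in time.
  have nV4 : ‖V t 4‖ ≤ (1 + 1 / Λ) * ((1 + K₂) * M) * Real.exp (Λ * t) :=
    SobolevBound.of_timeDeriv_exp (m := 0) (F := fun t => V t 4) (G := fun t => W t 4)
      (M := (1 + K₂) * M) hΛ (fun t ht => hV t ht 4)
      ((hV0 4).trans (by nlinarith))
      (fun t ht => (nW t ht).2.2.1.trans (by gcongr; linarith)) ht
  obtain ⟨n1, n2, n4, n5⟩ := nW t ht
  have E0 := (Real.exp_pos (Λ * t)).le
  set E := Real.exp (Λ * t)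
  have ME : 0 ≤ M * E := by positivity
  have t1 : 0 ≤ (κ + 1) * K₁ * ρ.d.bound := by positivity
  have t2 : 0 ≤ (κ + 1) * K₁ * β.d.bound := by positivity
  have t3 : 0 ≤ (κ + 1) * K₂ := by positivity
  have t4 : 0 ≤ (ρ.inv hρ).bound * β.d.bound * ((1 + 1 / Λ) * (1 + K₂)) := by positivity
  have fin : ∀ {x c : ℝ}, x ≤ c * (M * E) → c ≤ (κ + 1) * K₁ * (ρ.d.bound + β.d.bound) +
      (κ + 1) * K₂ + K₂ + (ρ.inv hρ).bound * β.d.bound * ((1 + 1 / Λ) * (1 + K₂)) →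
      x ≤ ((κ + 1) * K₁ * (ρ.d.bound + β.d.bound) +
      (κ + 1) * K₂ + K₂ + (ρ.inv hρ).bound * β.d.bound * ((1 + 1 / Λ) * (1 + K₂))) * M * E :=
    fun h1 h2 => by
      rw [mul_assoc _ M E]
      exact h1.trans (mul_le_mul_of_nonneg_right h2 ME)
  intro j
  fin_cases j
  · change ‖W t 0‖ ≤ _
    rw [eq0, norm_neg]
    refine fin (c := ρ.d.bound * ((κ + 1) * K₁)) ((ρ.d.norm_op_le _).trans ?_) (by linarith)
    rw [mul_assoc]
    gcongr
    linarith
  · exact fin (c := (κ + 1) * K₂) (n1.trans (by linarith)) (by linarith)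
  · exact fin (c := (κ + 1) * K₂) (n2.trans (by linarith)) (by linarith)
  · change ‖W t 3‖ ≤ _
    rw [eq3]
    refine fin (c := (ρ.inv hρ).bound * β.d.bound * ((1 + 1 / Λ) * (1 + K₂)))
      (((ρ.inv hρ).norm_op_le _).trans ?_) (by linarith)
    rw [mul_assoc, mul_assoc]
    gcongr
    refine (β.d.norm_op_le _).trans ?_
    gcongr
    linarith
  · exact fin (c := K₂) (n4.trans (by linarith)) (by linarith)
  · exact fin (c := K₂) (n5.trans (by linarith)) (by linarith)
  · change ‖W t 6‖ ≤ _
    rw [eq6, norm_neg]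
    refine fin (c := β.d.bound * ((κ + 1) * K₁)) ((β.d.norm_op_le _).trans ?_) (by linarith)
    rw [mul_assoc]
    gcongr
    linarith

end Energy

/-! ### Incompressible system: recovery of the normal derivatives. -/

section Normal

variable {g b : ℝ} {ρ β : Coef} {Λ : ℝ}

theorem SobolevBound.of_timeDeriv_exp_mul {m : ℕ} {F G : ℝ → CellL2} {c M : ℝ} (hΛ : 0 < Λ)
    (hc : 0 ≤ c) (hd : ∀ t, 0 ≤ t → HasDerivWithinAt F (G t) (Ici 0) t)
    (h0 : SobolevBound m (F 0) M)
    (hG : ∀ t, 0 ≤ t → SobolevBound m (G t) (c * M * Real.exp (Λ * t))) {t : ℝ} (ht : 0 ≤ t) :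
    SobolevBound m (F t) ((1 + 1 / Λ) * (1 + c) * (M * Real.exp (Λ * t))) := by
  have hM := h0.nonneg
  refine (SobolevBound.of_timeDeriv_exp (M := (1 + c) * M) hΛ hd (h0.mono (by nlinarith))
    (fun t ht => (hG t ht).mono ?_) ht).mono (le_of_eq (by ring))
  gcongr
  linarith

/-- The normal derivative of the second velocity component is controlled by the curl of the
momentum, if the latter is driven by gravity only. -/
theorem curl_momentum_bound (hρ : ρ.Pos) (hΛ : 0 < Λ) (g : ℝ) (n : ℕ) :
    ∃ C, 0 ≤ C ∧ ∀ (v₁ v₂ σ : ℝ → CellL2) (M : ℝ),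
      SobolevBound (n + 1) (v₁ 0) M → SobolevBound (n + 1) (v₂ 0) M →
      (∀ t, 0 ≤ t → ∀ φ, HasDerivWithinAt (fun t => inner ℝ (ρ.op (v₂ t)) (testI (dXI φ)) -
        inner ℝ (ρ.op (v₁ t)) (testI (dYI φ))) (-(g * inner ℝ (σ t) (testI (dYI φ)))) (Ici 0) t) →
      (∀ t, 0 ≤ t → ∃ v₂x, WX (v₂ t) v₂x) →
      (∀ t, 0 ≤ t → SobolevBound n (v₂ t) (M * Real.exp (Λ * t))) →
      (∀ t, 0 ≤ t → ∃ v₁y, WY (v₁ t) v₁y ∧ SobolevBound n v₁y (M * Real.exp (Λ * t))) →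
      (∀ t, 0 ≤ t → ∃ v₂y, WY (v₂ t) v₂y ∧ SobolevBound n v₂y (M * Real.exp (Λ * t))) →
      (∀ t, 0 ≤ t → ∃ σy, WY (σ t) σy ∧ SobolevBound n σy (M * Real.exp (Λ * t))) →
      ∀ t, 0 ≤ t → SobolevBound (n + 1) (v₂ t) (C * (M * Real.exp (Λ * t))) := by
  set i := ρ.inv hρ with hi
  have p1 := ρ.opConst_nonneg n
  have p2 := ρ.d.opConst_nonneg n
  have p3 := i.opConst_nonneg n
  have p4 := i.d.opConst_nonneg n
  set c₀ := ρ.d.opConst n + ρ.opConst n + ρ.opConst n with hc₀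
  have c₀0 : 0 ≤ c₀ := by positivity
  set c₁ := (1 + 1 / Λ) * (1 + (c₀ + |g|)) with hc₁
  have c₁0 : 0 ≤ c₁ := by positivity
  refine ⟨1 + (i.d.opConst n * ρ.opConst n + i.opConst n * (c₁ + ρ.opConst n)), by positivity,
    fun v₁ v₂ σ M h₁ h₂ hd hx hv₂ hy₁ hy₂ hσ t ht => ?_⟩
  have hM : 0 ≤ M := h₁.nonneg
  have E0 : ∀ t, 0 ≤ M * Real.exp (Λ * t) := fun t => by positivity
  have hex : ∀ t, ∃ vort v₁y σy v₂x, 0 ≤ t → WX (v₂ t) v₂x ∧ WY (v₁ t) v₁y ∧ WY (σ t) σy ∧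
      SobolevBound n v₁y (M * Real.exp (Λ * t)) ∧ SobolevBound n σy (M * Real.exp (Λ * t)) ∧
      vort = ρ.d.op (v₂ t) + ρ.op v₂x - ρ.op v₁y := fun t => by
    by_cases ht : 0 ≤ t
    · obtain ⟨v₂x, k1⟩ := hx t ht
      obtain ⟨v₁y, k2, k3⟩ := hy₁ t ht
      obtain ⟨σy, k4, k5⟩ := hσ t ht
      exact ⟨_, v₁y, σy, v₂x, fun _ => ⟨k1, k2, k4, k3, k5, rfl⟩⟩
    · exact ⟨0, 0, 0, 0, fun h => absurd h ht⟩
  choose vort v₁y σy v₂x hvort using hex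
  have htest : ∀ t, 0 ≤ t → ∀ φ, inner ℝ (vort t) (testI φ) =
      -(inner ℝ (ρ.op (v₂ t)) (testI (dXI φ)) - inner ℝ (ρ.op (v₁ t)) (testI (dYI φ))) :=
    fun t ht φ => by
      obtain ⟨k1, k2, -, -, -, k6⟩ := hvort t ht
      rw [k1.op ρ, k2.op ρ, k6, inner_sub_left]
      ring
  obtain ⟨k1, k2, k3, k4, k5, k6⟩ := hvort t ht
  have hvort0 : SobolevBound n (vort 0) (c₀ * M) := by
    obtain ⟨k1, k2, k3, k4, k5, k6⟩ := hvort 0 le_rfl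
    rw [k6]
    refine (((h₂.of_succ.op ρ.d).add ((h₂.exists_WX k1).op ρ)).sub
      ((h₁.exists_WY k2).op ρ)).mono (le_of_eq ?_)
    rw [hc₀]; ring
  -- The vorticity of the momentum obeys `ω_t = -g σ_y` in the weak sense. The right side involves a
  -- tangential derivative only, so integration in time costs nothing.
  have hvortt : SobolevBound n (vort t) (c₁ * (M * Real.exp (Λ * t))) := by
    refine (SobolevBound.integrate_exp (M := (1 + (c₀ + |g|)) * M) (G := fun t => -(g • σy t)) hΛ
      (fun s hs φ => ?_) (hvort0.mono ?_) (fun s hs => ?_) ht).mono (le_of_eq ?_)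
    · have h := (hd s hs φ).neg
      refine (h.congr_of_mem (fun r hr => htest r hr φ) hs).congr_deriv ?_
      rw [(hvort s hs).2.2.1, inner_neg_left, real_inner_smul_left]; ring
    · gcongr; linarith [abs_nonneg g]
    · refine ((hvort s hs).2.2.2.2.1.smul g).neg.mono ?_
      rw [mul_assoc]
      have := E0 s
      gcongr
      linarith
    · rw [hc₁]; ring
  -- By definition of the vorticity, the normal derivative of `ρ v₂` is the vorticity plus a
  -- tangential derivative.
  have hρx : WX (ρ.op (v₂ t)) (vort t + ρ.op (v₁y t)) := by
    have := k1.op ρ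
    rwa [k6, sub_add_cancel]
  have hfin := hρx.of_op hρ
  obtain ⟨v₂y, k7, k8⟩ := hy₂ t ht
  have s1 := (((hv₂ t ht).op ρ).op i.d).add ((hvortt.add (k4.op ρ)).op i)
  have c2 : 1 ≤ 1 + (i.d.opConst n * ρ.opConst n + i.opConst n * (c₁ + ρ.opConst n)) :=
    le_add_of_nonneg_right (by positivity)
  have c3 : ∀ {f}, SobolevBound n f (M * Real.exp (Λ * t)) → SobolevBound n f
      ((1 + (i.d.opConst n * ρ.opConst n + i.opConst n * (c₁ + ρ.opConst n))) *
        (M * Real.exp (Λ * t))) := fun h => by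
    refine SobolevBound.mono_mul (C := 1) ?_ c2 (E0 t)
    rwa [one_mul]
  refine (c3 (hv₂ t ht)).of_derivs hfin k7 (s1.mono ?_) (c3 k8)
  have := E0 t
  linarith

/-- The pressure and `∂ₓB₂` are unknown together in the second momentum equation. Swapping
derivatives, `⟨∂ₓB₂, Q_y⟩ = ⟨∂ᵧB₂, Q_x⟩`, where `∂ᵧB₂` is tangential and `Q_x` is known from the
first momentum equation; this bounds `Q_y` and hence `∂ₓB₂`. Higher orders use quotients in `y` and
the curl equation. -/
theorem incompressible_magnetic_bound (hb : b ≠ 0) (g : ℝ) (ρ β : Coef) (n : ℕ) :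
    ∃ C, 0 ≤ C ∧ ∀ (u : ℝ → State) (t : ℝ), 0 ≤ t →
      IsEvolution (Incompressible g b ρ β) (n + 1) u → ∀ (M : ℝ) (u' : State),
      Incompressible g b ρ β (u t) u' → TimeDeriv u u' t → StateBound n (u t) M →
      (∀ i, ∃ uy, WY (u t i) uy ∧ SobolevBound n uy M) → StateBound n u' M →
      ∀ B₂x, WX (u t 5) B₂x → SobolevBound n B₂x (C * M) := by
  have b0 := abs_nonneg b
  have g0 := abs_nonneg g
  have bp : 0 < |b| := abs_pos.2 hb
  induction n with
  | zero =>
    have r0 := ρ.bound_nonneg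
    set A := |b| + |g| + ρ.bound with hA
    have A0 : 0 ≤ A := by positivity
    -- Chosen so that the quadratic inequality `‖Q_y‖² ≤ |b| A M² + ρ.bound M ‖Q_y‖` forces `‖Q_y‖ ≤
    -- S M`.
    set S := |b| * A + ρ.bound + 1 with hS
    have S1 : 1 ≤ S := by rw [hS]; linarith [mul_nonneg b0 A0]
    refine ⟨|b|⁻¹ * (ρ.bound + S), by positivity,
      fun u t ht hu M u' h hd hM hy hM' B₂x' hB₂x' => ?_⟩
    obtain ⟨Q, Qx, Qy, v₁x, v₂x, B₁x, B₂x, h⟩ := h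
    obtain rfl := hB₂x'.unique h.mag₂X
    have hM0 : 0 ≤ M := (hM 0).nonneg
    have n0 : ‖u t 0‖ ≤ M := hM 0
    have n1 : ‖ρ.op (u' 1)‖ ≤ ρ.bound * M :=
      (ρ.norm_op_le _).trans (mul_le_mul_of_nonneg_left (hM' 1).norm_le r0)
    have n2 : ‖ρ.op (u' 2)‖ ≤ ρ.bound * M :=
      (ρ.norm_op_le _).trans (mul_le_mul_of_nonneg_left (hM' 2).norm_le r0)
    have n4 : ‖B₁x‖ ≤ M := by
      obtain ⟨uy, k1, k2⟩ := hy 5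
      rw [← norm_neg, ← k1.unique h.mag₂Y]
      exact k2
    have nQx : ‖Qx‖ ≤ A * M := by
      have e : Qx = b • B₁x + g • u t 0 - ρ.op (u' 1) := by rw [h.mom₁]; abel
      rw [e]
      refine (norm_sub_le _ _).trans ((add_le_add (norm_add_le _ _) n1).trans ?_)
      rw [norm_smul, norm_smul, Real.norm_eq_abs, Real.norm_eq_abs]
      nlinarith
    have nQy : ‖Qy‖ ≤ S * M := by
      have e0 : Qy = b • B₂x' - ρ.op (u' 2) := by rw [h.mom₂]; abel
      have e1 : ‖Qy‖ ^ 2 = b * inner ℝ B₂x' Qy - inner ℝ (ρ.op (u' 2)) Qy := by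
        rw [← real_inner_self_eq_norm_sq]
        nth_rewrite 1 [e0]
        rw [inner_sub_left, real_inner_smul_left]
      -- The swap of derivatives, followed by `∇·B = 0`.
      have e2 : inner ℝ B₂x' Qy = -inner ℝ B₁x Qx := by
        rw [inner_dX_dY_comm (h.periodic hb).2.2 h.mag₂Y h.pressX h.pressY, inner_neg_left]
      have e3 : b * inner ℝ B₂x' Qy ≤ |b| * (M * (A * M)) := by
        rw [e2]
        refine (le_abs_self _).trans ?_
        rw [abs_mul, abs_neg]
        gcongr
        exact (abs_real_inner_le_norm _ _).trans (by gcongr)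
      have e4 : -inner ℝ (ρ.op (u' 2)) Qy ≤ ρ.bound * M * ‖Qy‖ :=
        (neg_le_abs _).trans ((abs_real_inner_le_norm _ _).trans (by gcongr))
      by_contra hcon
      push Not at hcon
      have hMy : M ≤ ‖Qy‖ := by nlinarith
      have hy0 := norm_nonneg Qy
      have c1 : |b| * A * (M * M) ≤ |b| * A * (M * ‖Qy‖) := by gcongr
      have c2 : S * M * ‖Qy‖ ≤ ‖Qy‖ * ‖Qy‖ := by gcongr
      have c3 : 0 < ‖Qy‖ := lt_of_le_of_lt (by positivity) hcon
      have c4 : S * M * ‖Qy‖ < ‖Qy‖ * ‖Qy‖ := by gcongr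
      have c5 : 0 ≤ M * ‖Qy‖ := by positivity
      rw [hS] at c4
      nlinarith
    have e : B₂x' = b⁻¹ • (ρ.op (u' 2) + Qy) := by
      rw [h.mom₂, sub_add_cancel, smul_smul, inv_mul_cancel₀ hb, one_smul]
    change ‖B₂x'‖ ≤ _
    rw [e, norm_smul, norm_inv, Real.norm_eq_abs, mul_assoc]
    gcongr
    exact (norm_add_le _ _).trans (by linarith)
  | succ n ih =>
    obtain ⟨C, hC0, hC⟩ := ih
    have p1 := ρ.opConst_nonneg n
    have p2 := ρ.d.opConst_nonneg n
    set D := |b⁻¹| * (ρ.d.opConst n + ρ.opConst n + ρ.opConst n + |b| + |g|) with hD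
    have D0 : 0 ≤ D := by positivity
    refine ⟨C + D, by positivity, fun u t ht hu M u' h hd hM hy hM' B₂x hB₂x => ?_⟩
    have hR := isGenerator_incompressible g b ρ β
    have hu' : IsEvolution (Incompressible g b ρ β) (n + 1) u := hu.of_le (by omega)
    have hM0 : 0 ≤ M := (hM 0).nonneg
    have k0 := hC u t ht hu' M u' h hd (fun j => (hM j).of_succ)
      (fun j => (hy j).imp fun uy h => ⟨h.1, h.2.of_succ⟩) (fun j => (hM' j).of_succ) B₂x hB₂x
    obtain ⟨B₂xy, k1, k2⟩ := SobolevBound.exists_WY_of_quotY fun a =>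
      hC _ t ht (hu'.quotY hR a) M (fun j => quotY a (u' j)) (hR.diff a⁻¹ (hR.trans a h) h)
        ((hd.map (transY a).toContinuousLinearMap).diff a⁻¹ hd) (fun j => (hM j).quotY a)
        (fun j => by
          obtain ⟨uy, h1, h2⟩ := hy j
          exact ⟨_, h1.quotY a, h2.quotY a⟩) (fun j => (hM' j).quotY a) _ (hB₂x.quotY a)
    obtain ⟨Q, Qx, Qy, v₁x, v₂x, B₁x, B₂x', h⟩ := h
    obtain rfl := hB₂x.unique h.mag₂X
    -- The regularity of the solution supplies only the existence of `∂ₓ²B₂`; the bound `N` is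
    -- discarded, and the estimate comes from the equation.
    obtain ⟨N, hN⟩ := hu.mem t ht 5
    obtain ⟨-, B₂xx, -, k3, -⟩ := hN.exists_WX hB₂x
    obtain ⟨-, -, a₁y, -, q1, -, r1⟩ := hM' 1
    obtain ⟨-, a₂x, -, q2, -, r2, -⟩ := hM' 2
    obtain ⟨-, -, σy, -, q3, -, r3⟩ := hM 0
    have hB₁x : SobolevBound (n + 1) B₁x M := by
      obtain ⟨uy, h1, h2⟩ := hy 5
      have := h2.neg
      rwa [h1.unique h.mag₂Y, neg_neg] at this
    obtain ⟨-, -, B₁xy, -, q4, -, r4⟩ := hB₁x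
    -- The normal derivative of the momentum is computed by the curl equation and by the product
    -- rule; equating the two isolates `b ∂ₓ²B₂`.
    have e := (h.wx_momentum₂ q1 q3 q4 k3).unique (q2.op ρ)
    have e' : B₂xx = b⁻¹ • (ρ.d.op (u' 2) + ρ.op a₂x - ρ.op a₁y + b • B₁xy + g • σy) := by
      rw [← e]
      have : ρ.op a₁y + b • B₂xx - b • B₁xy - g • σy - ρ.op a₁y + b • B₁xy + g • σy = b • B₂xx := by
        abel
      rw [this, smul_smul, inv_mul_cancel₀ hb, one_smul]
    refine (k0.mono_mul (by linarith) hM0).of_derivs k3 k1 ?_ (k2.mono_mul (by linarith) hM0)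
    rw [e']
    refine ((((((hM' 2).of_succ.op ρ.d).add (r2.op ρ)).sub (r1.op ρ)).add (r4.smul b)).add
      (r3.smul g)).smul b⁻¹ |>.mono ?_
    have : 0 ≤ C * M := by positivity
    rw [add_mul, hD]
    linarith

/-- For `v₁` and `B₁` the divergence constraints trade `∂ₓ` for `∂ᵧ`. The fields `σ`, `v₃`, `B₃`
follow by integrating their equations in time. For `v₂`, Faraday's law gives `∂ₓv₂ = ∂ₜB₂ / b` if `b
≠ 0`, and the vorticity equation serves if `b = 0`. For `B₂`, the previous bound is used if `b ≠ 0`;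
otherwise `B₂` is constant in time. -/
theorem controlsNormalDerivative_incompressible (hρ : ρ.Pos) (hΛ : 0 < Λ) (g b : ℝ) (β : Coef) :
    ControlsNormalDerivative (Incompressible g b ρ β) Λ := fun n => by
  obtain ⟨C₁, C₁0, hC₁⟩ := curl_momentum_bound hρ hΛ g n
  obtain ⟨C₂, C₂0, hC₂⟩ : ∃ C, 0 ≤ C ∧ (b ≠ 0 → ∀ (u : ℝ → State) (t : ℝ), 0 ≤ t →
      IsEvolution (Incompressible g b ρ β) (n + 1) u → ∀ (M : ℝ) (u' : State),
      Incompressible g b ρ β (u t) u' → TimeDeriv u u' t → StateBound n (u t) M →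
      (∀ i, ∃ uy, WY (u t i) uy ∧ SobolevBound n uy M) → StateBound n u' M →
      ∀ B₂x, WX (u t 5) B₂x → SobolevBound n B₂x (C * M)) := by
    by_cases hb : b = 0
    · exact ⟨0, le_rfl, fun h => absurd hb h⟩
    · obtain ⟨C, h1, h2⟩ := incompressible_magnetic_bound hb g ρ β n
      exact ⟨C, h1, fun _ => h2⟩
  set i := ρ.inv hρ with hi
  have p1 := ρ.d.opConst_nonneg (n + 1)
  have p2 := β.d.opConst_nonneg (n + 1)
  have p3 := i.opConst_nonneg (n + 1)
  set L := 1 + 1 / Λ with hL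
  have L1 : 1 ≤ L := by rw [hL]; linarith [one_div_nonneg.2 hΛ.le]
  have q1 : 0 ≤ L * ρ.d.opConst (n + 1) := by positivity
  have q2 : 0 ≤ L * β.d.opConst (n + 1) := by positivity
  have q3 : 0 ≤ L * (i.opConst (n + 1) * β.d.opConst (n + 1)) := by positivity
  have q4 : 0 ≤ |b⁻¹| := abs_nonneg _
  refine ⟨L * (1 + ρ.d.opConst (n + 1)) + L * (1 + β.d.opConst (n + 1)) +
    L * (1 + i.opConst (n + 1) * β.d.opConst (n + 1)) + C₁ + C₂ + |b⁻¹| + 1 + L,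
    fun u hu M h0 hM hy hd t ht => ?_⟩
  have hM0 : 0 ≤ M := (h0 0).nonneg
  have hu' : IsEvolution (Incompressible g b ρ β) (n + 1) u := hu.of_le (by omega)
  have EE : ∀ t, 0 ≤ M * Real.exp (Λ * t) := fun t => by positivity
  have hv₁ : ∀ t, 0 ≤ t → SobolevBound (n + 1) (u t 1) (M * Real.exp (Λ * t)) := fun t ht => by
    obtain ⟨u', ⟨_, _, _, v₁x, _, _, _, h⟩, -, -⟩ := hd t ht
    obtain ⟨u1y, k1, k2⟩ := hy t ht 1
    obtain ⟨u2y, k3, k4⟩ := hy t ht 2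
    refine (hM t ht 1).of_derivs h.vel₁X.wx k1 ?_ k2
    have := k4.neg
    rwa [k3.unique h.vel₂Y, neg_neg] at this
  have hB₁ : ∀ t, 0 ≤ t → SobolevBound (n + 1) (u t 4) (M * Real.exp (Λ * t)) := fun t ht => by
    obtain ⟨u', ⟨_, _, _, _, _, B₁x, _, h⟩, -, -⟩ := hd t ht
    obtain ⟨u4y, k1, k2⟩ := hy t ht 4
    obtain ⟨u5y, k3, k4⟩ := hy t ht 5
    refine (hM t ht 4).of_derivs h.mag₁X k1 ?_ k2
    have := k4.neg
    rwa [k3.unique h.mag₂Y, neg_neg] at this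
  have fin : ∀ {f : CellL2} {c : ℝ}, SobolevBound (n + 1) f (c * (M * Real.exp (Λ * t))) →
      c ≤ L * (1 + ρ.d.opConst (n + 1)) + L * (1 + β.d.opConst (n + 1)) +
        L * (1 + i.opConst (n + 1) * β.d.opConst (n + 1)) + C₁ + C₂ + |b⁻¹| + 1 + L →
      SobolevBound (n + 1) f ((L * (1 + ρ.d.opConst (n + 1)) + L * (1 + β.d.opConst (n + 1)) +
        L * (1 + i.opConst (n + 1) * β.d.opConst (n + 1)) + C₁ + C₂ + |b⁻¹| + 1 + L) * M *
        Real.exp (Λ * t)) := fun h1 h2 => by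
    rw [mul_assoc _ M]
    exact h1.mono_mul h2 (EE t)
  intro j
  fin_cases j
  · refine fin (SobolevBound.of_timeDeriv_exp_mul (F := fun t => u t 0)
      (G := fun t => -(ρ.d.op (u t 1))) hΛ p1 (fun t ht => ?_) (h0 0) (fun t ht => ?_) ht)
      (by linarith)
    · obtain ⟨u', ⟨_, _, _, _, _, _, _, h⟩, hd', -⟩ := hd t ht
      have := hd' 0
      rwa [h.dens] at this
    · exact ((hv₁ t ht).op ρ.d).neg.mono (le_of_eq (by ring))
  · exact fin (c := 1) (by simpa using hv₁ t ht) (by linarith)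
  · by_cases hb : b = 0
    · refine fin (hC₁ (fun t => u t 1) (fun t => u t 2) (fun t => u t 0) M (h0 1) (h0 2)
        (fun t ht φ => ?_) (fun t ht => ?_) (fun t ht => hM t ht 2) (fun t ht => hy t ht 1)
        (fun t ht => hy t ht 2) (fun t ht => hy t ht 0) t ht) (by linarith)
      · obtain ⟨u', ⟨_, _, _, _, _, _, _, h⟩, hd', -⟩ := hd t ht
        have k1 := ρ.op.hasFDerivAt.comp_hasDerivWithinAt t (hd' 2)
        have k2 := ρ.op.hasFDerivAt.comp_hasDerivWithinAt t (hd' 1)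
        refine ((hasDerivWithinAt_inner_const k1 (testI (dXI φ))).sub
          (hasDerivWithinAt_inner_const k2 (testI (dYI φ)))).congr_deriv ?_
        rw [h.curl φ, hb]; ring
      · obtain ⟨u', ⟨_, _, _, _, v₂x, _, _, h⟩, -, -⟩ := hd t ht
        exact ⟨v₂x, h.vel₂X⟩
    · obtain ⟨u', ⟨_, _, _, _, v₂x, _, _, h⟩, -, hu'b⟩ := hd t ht
      obtain ⟨u2y, k1, k2⟩ := hy t ht 2
      have e : v₂x = b⁻¹ • u' 5 := by rw [h.far₂, smul_smul, inv_mul_cancel₀ hb, one_smul]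
      have one : ∀ {f}, SobolevBound n f (M * Real.exp (Λ * t)) →
          SobolevBound n f ((|b⁻¹| + 1) * (M * Real.exp (Λ * t))) := fun h =>
        SobolevBound.mono_mul (C := 1) (by simpa using h) (by linarith) (EE t)
      refine fin (c := |b⁻¹| + 1) ((one (hM t ht 2)).of_derivs h.vel₂X k1 ?_ (one k2)) (by linarith)
      rw [e]
      exact ((hu'b 5).smul b⁻¹).mono_mul (by linarith) (EE t)
  · refine fin (SobolevBound.of_timeDeriv_exp_mul (F := fun t => u t 3)
      (G := fun t => i.op (β.d.op (u t 4))) (c := i.opConst (n + 1) * β.d.opConst (n + 1)) hΛ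
      (by positivity) (fun t ht => ?_) (h0 3) (fun t ht => ?_) ht) (by linarith)
    · obtain ⟨u', ⟨_, _, _, _, _, _, _, h⟩, hd', -⟩ := hd t ht
      have := hd' 3
      rwa [← ρ.inv_op_op hρ (u' 3), h.mom₃] at this
    · exact (((hB₁ t ht).op β.d).op i).mono (le_of_eq (by ring))
  · exact fin (c := 1) (by simpa using hB₁ t ht) (by linarith)
  · by_cases hb : b = 0
    · refine fin (SobolevBound.of_timeDeriv_exp_mul (F := fun t => u t 5)
        (G := fun t => 0) (c := 0) hΛ le_rfl (fun t ht => ?_) (h0 5) (fun t ht => ?_) ht)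
        (by linarith)
      · obtain ⟨u', ⟨_, _, _, _, _, _, _, h⟩, hd', -⟩ := hd t ht
        have := hd' 5
        rwa [h.far₂, hb, zero_smul] at this
      · exact SobolevBound.zero (by simp)
    · obtain ⟨u', h, hd', hu'b⟩ := hd t ht
      have hR := h
      obtain ⟨_, _, _, _, _, _, B₂x, h⟩ := h
      obtain ⟨u5y, k1, k2⟩ := hy t ht 5
      have k3 := hC₂ hb u t ht hu' (M * Real.exp (Λ * t)) u' hR hd' (hM t ht) (hy t ht) hu'b _
        h.mag₂X
      have one : ∀ {f}, SobolevBound n f (M * Real.exp (Λ * t)) →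
          SobolevBound n f ((C₂ + 1) * (M * Real.exp (Λ * t))) := fun h =>
        SobolevBound.mono_mul (C := 1) (by simpa using h) (by linarith) (EE t)
      exact fin (c := C₂ + 1) ((one (hM t ht 5)).of_derivs h.mag₂X k1
        (k3.mono_mul (by linarith) (EE t)) (one k2)) (by linarith)
  · refine fin (SobolevBound.of_timeDeriv_exp_mul (F := fun t => u t 6)
      (G := fun t => -(β.d.op (u t 1))) hΛ p2 (fun t ht => ?_) (h0 6) (fun t ht => ?_) ht)
      (by linarith)
    · obtain ⟨u', ⟨_, _, _, _, _, _, _, h⟩, hd', -⟩ := hd t ht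
      have := hd' 6
      rwa [h.far₃] at this
    · exact ((hv₁ t ht).op β.d).neg.mono (le_of_eq (by ring))

end Normal

/-! ### The compressible system -/

/-- The version for combinations of several components, as needed for `η` and `ζ`. -/
theorem timeQuot_eq_of_hasDeriv {u Y : ℝ → State} (hY : ∀ t, 0 ≤ t → TimeDeriv Y (u t) t)
    (A B : State →L[ℝ] CellL2)
    (h : ∀ t, 0 ≤ t → HasDerivWithinAt (fun t => A (u t)) (B (u t)) (Ici 0) t) {r : ℝ}
    (hr : 0 ≤ r) {t : ℝ} (ht : 0 ≤ t) : A (timeQuot r u t) = B (timeQuot r Y t) := by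
  have hz : ∀ t, 0 ≤ t → HasDerivWithinAt (fun t => A (u t) - B (Y t)) 0 (Ici 0) t := fun t ht => by
    have h1 := (h t ht).sub
      (B.hasFDerivAt.comp_hasDerivWithinAt t (hasDerivWithinAt_pi.2 (hY t ht)))
    rw [sub_self] at h1
    exact h1
  have e1 := eq_of_hasDerivWithinAt_zero hz ht
  have e2 := eq_of_hasDerivWithinAt_zero hz (add_nonneg ht hr)
  rw [← e1] at e2
  have e3 : A (u (t + r)) - A (u t) = B (Y (t + r)) - B (Y t) := by
    have : A (u (t + r)) - B (Y (t + r)) = A (u t) - B (Y t) := e2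
    rw [sub_eq_sub_iff_add_eq_add] at this ⊢
    rw [this]; abel
  simp only [timeQuot, map_smul, map_sub, e3]

/-- The coefficients of the compressible system with magnetic field orthogonal to gravity: density
`ρ`, magnetic field `β`, squared speed of sound `c`, stiffness `a`. -/
structure Stratification (g : ℝ) where
  ρ : Coef
  β : Coef
  c : Coef
  a : Coef
  ρ_pos : ρ.Pos
  a_pos : a.Pos
  stiff : ∀ x ∈ Ioo 0 (2 * Real.pi), c x * ρ x + β x * β x = a x
  balance : ∀ x ∈ Ioo 0 (2 * Real.pi), c x * ρ.d x + β x * β.d x = g * ρ x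

namespace Stratification

variable {g : ℝ} (S : Stratification g)

/-- The coefficient `1 / a`. -/
def ι : Coef := S.a.inv S.a_pos

/-- The coefficient `1 / ρ`. -/
def vol : Coef := S.ρ.inv S.ρ_pos

/-- The coefficient `g ρ² / a - ρ'`. -/
def κ : Coef := (((S.ρ.mul (S.ι.mul S.ρ)).smul g).add (S.ρ.d.smul (-1)))

/-- The coefficient `g β ρ / a - β'`. -/
def μ : Coef := (((S.β.mul (S.ι.mul S.ρ)).smul g).add (S.β.d.smul (-1)))

theorem κ_op (F : CellL2) : S.κ.op F = g • S.ρ.op (S.ι.op (S.ρ.op F)) - S.ρ.d.op F := by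
  rw [κ, Coef.op_add, Coef.op_smul, Coef.op_smul, ← Coef.op_op, ← Coef.op_op, neg_smul, one_smul,
    sub_eq_add_neg]

theorem μ_op (F : CellL2) : S.μ.op F = g • S.β.op (S.ι.op (S.ρ.op F)) - S.β.d.op F := by
  rw [μ, Coef.op_add, Coef.op_smul, Coef.op_smul, ← Coef.op_op, ← Coef.op_op, neg_smul, one_smul,
    sub_eq_add_neg]

/-- Total pressure. -/
def total : State →L[ℝ] CellL2 :=
  S.c.op.comp (ContinuousLinearMap.proj 0) + S.β.op.comp (ContinuousLinearMap.proj 6)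

theorem total_apply (u : State) : S.total u = S.c.op (u 0) + S.β.op (u 6) := rfl

/-- The part of the density which is transported. -/
def η : State →L[ℝ] CellL2 := ContinuousLinearMap.proj 0 - (S.ρ.op.comp S.ι.op).comp S.total

theorem η_apply (u : State) : S.η u = u 0 - S.ρ.op (S.ι.op (S.total u)) := rfl

/-- The part of the magnetic field which is transported. -/
def ζ : State →L[ℝ] CellL2 := ContinuousLinearMap.proj 6 - (S.β.op.comp S.ι.op).comp S.total

theorem ζ_apply (u : State) : S.ζ u = u 6 - S.β.op (S.ι.op (S.total u)) := rfl

theorem op_stiff (F : CellL2) : S.c.op (S.ρ.op F) + S.β.op (S.β.op F) = S.a.op F := by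
  rw [Coef.op_op, Coef.op_op, ← Coef.op_add]
  exact Coef.op_congr S.stiff F

theorem op_balance (F : CellL2) :
    S.c.op (S.ρ.d.op F) + S.β.op (S.β.d.op F) = g • S.ρ.op F := by
  rw [Coef.op_op, Coef.op_op, ← Coef.op_add, ← Coef.op_smul]
  exact Coef.op_congr S.balance F

theorem ι_a (F : CellL2) : S.ι.op (S.a.op F) = F := S.a.inv_op_op S.a_pos F

theorem vol_ρ (F : CellL2) : S.vol.op (S.ρ.op F) = F := S.ρ.inv_op_op S.ρ_pos F

end Stratification

/-- The linearized compressible system for `u = (σ, v, B)`, with time derivative `u'`. -/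
structure CompressibleData {g : ℝ} (S : Stratification g) (u u' : State)
    (Qx Qy v₁x v₂x v₂y : CellL2) : Prop where
  pressX : TX (S.total u) Qx
  pressY : WY (S.total u) Qy
  vel₁X : TX (u 1) v₁x
  vel₂X : WX (u 2) v₂x
  vel₂Y : WY (u 2) v₂y
  dens : u' 0 = -(S.ρ.op (v₁x + v₂y) + S.ρ.d.op (u 1))
  mom₁ : S.ρ.op (u' 1) = g • u 0 - Qx
  mom₂ : S.ρ.op (u' 2) = -Qy
  mom₃ : S.ρ.op (u' 3) = S.β.d.op (u 4)
  far₁ : u' 4 = 0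
  far₂ : u' 5 = 0
  far₃ : u' 6 = -(S.β.op (v₁x + v₂y) + S.β.d.op (u 1))

/-- The linearized compressible system as a relation between states and their time derivatives. -/
def Compressible {g : ℝ} (S : Stratification g) (u u' : State) : Prop :=
  ∃ Qx Qy v₁x v₂x v₂y, CompressibleData S u u' Qx Qy v₁x v₂x v₂y

theorem isGenerator_compressible {g : ℝ} (S : Stratification g) :
    IsGenerator (Compressible S) where
  diff := by
    rintro u u' w w' c ⟨Qx, Qy, a, d, e, h⟩ ⟨Px, Py, i, j, k, h'⟩
    refine ⟨c • (Qx - Px), c • (Qy - Py), c • (a - i), c • (d - j), c • (e - k), ?_⟩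
    constructor
    · rw [map_smul, map_sub]; exact (h.pressX.sub h'.pressX).smul c
    · rw [map_smul, map_sub]; exact (h.pressY.sub h'.pressY).smul c
    · exact (h.vel₁X.sub h'.vel₁X).smul c
    · exact (h.vel₂X.sub h'.vel₂X).smul c
    · exact (h.vel₂Y.sub h'.vel₂Y).smul c
    all_goals simp only [Pi.smul_apply, Pi.sub_apply, map_smul, map_sub, map_add]
    · rw [h.dens, h'.dens]; simp only [map_add]; module
    · rw [h.mom₁, h'.mom₁]; module
    · rw [h.mom₂, h'.mom₂]; module
    · rw [h.mom₃, h'.mom₃]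
    · rw [h.far₁, h'.far₁]; module
    · rw [h.far₂, h'.far₂]; module
    · rw [h.far₃, h'.far₃]; simp only [map_add]; module
  trans := by
    rintro u u' s ⟨Qx, Qy, a, d, e, h⟩
    have ht : S.total (fun i => transY s (u i)) = transY s (S.total u) := by
      rw [S.total_apply, S.total_apply, map_add, transY_op, transY_op]
    refine ⟨transY s Qx, transY s Qy, transY s a, transY s d, transY s e, ?_⟩
    constructor
    · rw [ht]; exact h.pressX.transY s
    · rw [ht]; exact h.pressY.transY s
    · exact h.vel₁X.transY s
    · exact h.vel₂X.transY s
    · exact h.vel₂Y.transY s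
    all_goals try simp only [← transY_op, ← map_smul, ← map_sub, ← map_add]
    · rw [h.dens, map_neg]
    · rw [h.mom₁]
    · rw [h.mom₂, map_neg]
    · rw [h.mom₃]
    · rw [h.far₁, map_zero]
    · rw [h.far₂, map_zero]
    · rw [h.far₃, map_neg]

namespace CompressibleData

variable {g : ℝ} {S : Stratification g} {u u' : State} {Qx Qy v₁x v₂x v₂y : CellL2}

/-- Both `σ` and `B₃` respond to compression and to stratification. In the total pressure, `stiff`
collects the compression terms into `a` and `balance`, the hydrostatic equation, collects the others
into `g ρ`. -/
theorem total_deriv (h : CompressibleData S u u' Qx Qy v₁x v₂x v₂y) :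
    S.total u' = -(S.a.op (v₁x + v₂y) + g • S.ρ.op (u 1)) := by
  rw [S.total_apply, h.dens, h.far₃, ← S.op_stiff, ← S.op_balance]
  simp only [map_neg, map_add]
  abel

theorem ι_total_deriv (h : CompressibleData S u u' Qx Qy v₁x v₂x v₂y) :
    S.ι.op (S.total u') = -(v₁x + v₂y + g • S.ι.op (S.ρ.op (u 1))) := by
  rw [h.total_deriv, map_neg, map_add, map_smul, S.ι_a]

/-- Subtracting the multiple `ρ / a` of the total pressure cancels the divergence of `v`, so what
remains is transported without loss of derivatives. -/
theorem η_deriv (h : CompressibleData S u u' Qx Qy v₁x v₂x v₂y) : S.η u' = S.κ.op (u 1) := by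
  rw [S.η_apply, h.ι_total_deriv, h.dens, S.κ_op]
  simp only [map_neg, map_add, map_smul]
  abel

theorem ζ_deriv (h : CompressibleData S u u' Qx Qy v₁x v₂x v₂y) : S.ζ u' = S.μ.op (u 1) := by
  rw [S.ζ_apply, h.ι_total_deriv, h.far₃, S.μ_op]
  simp only [map_neg, map_add, map_smul]
  abel

theorem curl (h : CompressibleData S u u' Qx Qy v₁x v₂x v₂y) (φ : interiorTests) :
    inner ℝ (S.ρ.op (u' 2)) (testI (dXI φ)) - inner ℝ (S.ρ.op (u' 1)) (testI (dYI φ)) =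
      -(g * inner ℝ (u 0) (testI (dYI φ))) := by
  have h1 : inner ℝ Qy (testI (dXI φ)) = inner ℝ Qx (testI (dYI φ)) := by
    have e1 := h.pressY (dXI φ)
    have e2 := h.pressX.wx (dYI φ)
    rw [dXI_dYI] at e2
    linarith
  rw [h.mom₁, h.mom₂]
  simp only [inner_neg_left, inner_sub_left, real_inner_smul_left]
  linarith

end CompressibleData

/-! ### Compressible system: the time derivative loses one derivative. -/

section CompressibleLoss

variable {g : ℝ} (S : Stratification g)

theorem Stratification.total_bound {m : ℕ} {u : State} {M : ℝ} (h : StateBound m u M) :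
    SobolevBound m (S.total u) ((S.c.opConst m + S.β.opConst m) * M) := by
  rw [S.total_apply, add_mul]
  exact ((h 0).op S.c).add ((h 6).op S.β)

/-- The total pressure is a function of the state, so every component of the time derivative is
explicit and no pressure has to be eliminated. -/
theorem losesOneDerivative_compressible : LosesOneDerivative (Compressible S) := fun m => by
  have p1 := S.ρ.opConst_nonneg m
  have p2 := S.ρ.d.opConst_nonneg m
  have p3 := S.β.opConst_nonneg m
  have p4 := S.β.d.opConst_nonneg m
  have p5 := S.vol.opConst_nonneg m
  have p6 := S.c.opConst_nonneg (m + 1)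
  have p7 := S.β.opConst_nonneg (m + 1)
  set q := S.c.opConst (m + 1) + S.β.opConst (m + 1) with hq
  have q0 : 0 ≤ q := by positivity
  have g0 := abs_nonneg g
  set C₀ := S.ρ.opConst m * 2 + S.ρ.d.opConst m with hC₀
  set C₁ := S.vol.opConst m * (|g| + q) with hC₁
  set C₂ := S.vol.opConst m * q with hC₂
  set C₃ := S.vol.opConst m * S.β.d.opConst m with hC₃
  set C₆ := S.β.opConst m * 2 + S.β.d.opConst m with hC₆
  have c0 : 0 ≤ C₀ := by positivity
  have c1 : 0 ≤ C₁ := by positivity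
  have c2 : 0 ≤ C₂ := by positivity
  have c3 : 0 ≤ C₃ := by positivity
  have c6 : 0 ≤ C₆ := by positivity
  refine ⟨C₀ + C₁ + C₂ + C₃ + C₆, fun u t ht hu M hM u' h hd => ?_⟩
  obtain ⟨Qx, Qy, v₁x, v₂x, v₂y, h⟩ := h
  have hM0 : 0 ≤ M := (hM 0).nonneg
  have key : ∀ j, SobolevBound m (u t j) M := fun j => (hM j).of_succ
  have k1 := (hM 1).exists_WX h.vel₁X.wx
  have k2 := (hM 2).exists_WY h.vel₂Y
  have k3 := (S.total_bound hM).exists_WX h.pressX.wx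
  have k4 := (S.total_bound hM).exists_WY h.pressY
  intro j
  fin_cases j
  · change SobolevBound m (u' 0) _
    rw [h.dens]
    refine SobolevBound.mono_mul (C := C₀) ?_ (by linarith) hM0
    exact ((((k1.add k2).op S.ρ).add ((key 1).op S.ρ.d)).neg).mono (le_of_eq (by rw [hC₀]; ring))
  · change SobolevBound m (u' 1) _
    rw [← S.vol_ρ (u' 1), h.mom₁]
    refine SobolevBound.mono_mul (C := C₁) ?_ (by linarith) hM0
    exact ((((key 0).smul g).sub k3).op S.vol).mono (le_of_eq (by rw [hC₁]; ring))
  · change SobolevBound m (u' 2) _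
    rw [← S.vol_ρ (u' 2), h.mom₂]
    refine SobolevBound.mono_mul (C := C₂) ?_ (by linarith) hM0
    exact (k4.neg.op S.vol).mono (le_of_eq (by rw [hC₂]; ring))
  · change SobolevBound m (u' 3) _
    rw [← S.vol_ρ (u' 3), h.mom₃]
    refine SobolevBound.mono_mul (C := C₃) ?_ (by linarith) hM0
    exact (((key 4).op S.β.d).op S.vol).mono (le_of_eq (by rw [hC₃]; ring))
  · change SobolevBound m (u' 4) _
    rw [h.far₁]
    exact SobolevBound.zero (by positivity)
  · change SobolevBound m (u' 5) _
    rw [h.far₂]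
    exact SobolevBound.zero (by positivity)
  · change SobolevBound m (u' 6) _
    rw [h.far₃]
    refine SobolevBound.mono_mul (C := C₆) ?_ (by linarith) hM0
    exact ((((k1.add k2).op S.β).add ((key 1).op S.β.d)).neg).mono (le_of_eq (by rw [hC₆]; ring))

end CompressibleLoss

/-! ### Compressible system: conservation of energy and the rate `Λ`. -/

section CompressibleEnergy

variable {g : ℝ} {S : Stratification g} {Λ : ℝ} {u Y : ℝ → State} {r : ℝ}

/-- The quadratic form of the compressible system is bounded by `Λ²`. -/
def CompressibleForm (S : Stratification g) (Λ : ℝ) : Prop :=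
  ∀ w : CellL2, g * inner ℝ (S.κ.op w) w ≤ Λ ^ 2 * inner ℝ (S.ρ.op w) w

theorem TimeDeriv.clm {u' : State} {t : ℝ} (h : TimeDeriv u u' t) (A : State →L[ℝ] CellL2) :
    HasDerivWithinAt (fun t => A (u t)) (A u') (Ici 0) t :=
  A.hasFDerivAt.comp_hasDerivWithinAt t (hasDerivWithinAt_pi.2 h)

/-- The transported part of the density is a multiple of the displacement. It is the part
responsible for the potential energy. -/
theorem compressible_timeQuot_η (hu : IsEvolution (Compressible S) 2 u)
    (hY : ∀ t, 0 ≤ t → TimeDeriv Y (u t) t) (hr : 0 ≤ r) {t : ℝ} (ht : 0 ≤ t) :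
    S.η (timeQuot r u t) = S.κ.op (timeQuot r Y t 1) :=
  timeQuot_eq_of_hasDeriv hY S.η (S.κ.op.comp (ContinuousLinearMap.proj 1)) (fun t ht => by
    obtain ⟨u', ⟨_, _, _, _, _, h⟩, hd⟩ := hu.evol t ht
    have := hd.clm S.η
    rwa [h.η_deriv] at this) hr ht

theorem compressible_timeQuot_ζ (hu : IsEvolution (Compressible S) 2 u)
    (hY : ∀ t, 0 ≤ t → TimeDeriv Y (u t) t) (hr : 0 ≤ r) {t : ℝ} (ht : 0 ≤ t) :
    S.ζ (timeQuot r u t) = S.μ.op (timeQuot r Y t 1) :=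
  timeQuot_eq_of_hasDeriv hY S.ζ (S.μ.op.comp (ContinuousLinearMap.proj 1)) (fun t ht => by
    obtain ⟨u', ⟨_, _, _, _, _, h⟩, hd⟩ := hu.evol t ht
    have := hd.clm S.ζ
    rwa [h.ζ_deriv] at this) hr ht

theorem compressible_timeQuot_far₁ (hu : IsEvolution (Compressible S) 2 u)
    (hY : ∀ t, 0 ≤ t → TimeDeriv Y (u t) t) (hr : 0 ≤ r) {t : ℝ} (ht : 0 ≤ t) :
    timeQuot r u t 4 = 0 :=
  timeQuot_eq_op (i := 4) (j := 4) hY 0 (fun t ht => by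
    obtain ⟨u', ⟨_, _, _, _, _, h⟩, hd⟩ := hu.evol t ht
    have := hd 4
    rwa [h.far₁] at this) hr ht

theorem compressible_timeQuot_far₂ (hu : IsEvolution (Compressible S) 2 u)
    (hY : ∀ t, 0 ≤ t → TimeDeriv Y (u t) t) (hr : 0 ≤ r) {t : ℝ} (ht : 0 ≤ t) :
    timeQuot r u t 5 = 0 :=
  timeQuot_eq_op (i := 5) (j := 5) hY 0 (fun t ht => by
    obtain ⟨u', ⟨_, _, _, _, _, h⟩, hd⟩ := hu.evol t ht
    have := hd 5
    rwa [h.far₂] at this) hr ht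

theorem compressible_timeQuot_vel₃ (hu : IsEvolution (Compressible S) 2 u)
    (hY : ∀ t, 0 ≤ t → TimeDeriv Y (u t) t) (hr : 0 ≤ r) {t : ℝ} (ht : 0 ≤ t) :
    timeQuot r u t 3 = S.vol.op (S.β.d.op (timeQuot r Y t 4)) :=
  timeQuot_eq_op (i := 3) (j := 4) hY (S.vol.op.comp S.β.d.op) (fun t ht => by
    obtain ⟨u', ⟨_, _, _, _, _, h⟩, hd⟩ := hu.evol t ht
    have := hd 3
    rwa [← S.vol_ρ (u' 3), h.mom₃] at this) hr ht

/-- Conservation of energy for time difference quotients. -/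
theorem compressible_energy (hu : IsEvolution (Compressible S) 2 u)
    (hY : ∀ t, 0 ≤ t → TimeDeriv Y (u t) t) (hr : 0 ≤ r) {t : ℝ} (ht : 0 ≤ t) :
    let e := fun t => inner ℝ (S.ρ.op (timeQuot r u t 1)) (timeQuot r u t 1) +
      inner ℝ (S.ρ.op (timeQuot r u t 2)) (timeQuot r u t 2) +
      inner ℝ (S.ι.op (S.total (timeQuot r u t))) (S.total (timeQuot r u t)) -
      g * inner ℝ (S.κ.op (timeQuot r Y t 1)) (timeQuot r Y t 1)
    e t = e 0 := by
  intro e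
  refine eq_of_hasDerivWithinAt_zero (fun t ht => ?_) ht
  obtain ⟨w', ⟨Qx, Qy, v₁x, v₂x, v₂y, h⟩, hd⟩ :=
    (hu.timeQuot (isGenerator_compressible S) hr).evol t ht
  have hV := timeDeriv_timeQuot hY hr ht
  have hη := compressible_timeQuot_η hu hY hr ht
  set W := timeQuot r u
  set V := timeQuot r Y
  have key := (((S.ρ.hasDerivWithinAt_inner_op (hd 1)).add (S.ρ.hasDerivWithinAt_inner_op (hd 2))).add
    (S.ι.hasDerivWithinAt_inner_op (hd.clm S.total))).sub
    ((S.κ.hasDerivWithinAt_inner_op (hV 1)).const_mul g)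
  refine HasDerivWithinAt.congr_deriv key ?_
  -- The work of gravity splits along `σ = η + (ρ/a) Q`. The `η`-part cancels the change of
  -- potential energy, the `Q`-part cancels the gravity term of `Q_t`, and the work of the pressure
  -- gradient cancels the divergence in `Q_t`.
  have s1 : inner ℝ (S.κ.op (W t 1)) (V t 1) = inner ℝ (S.η (W t)) (W t 1) := by
    rw [hη, S.κ.inner_op, real_inner_comm]
  have s2 : inner ℝ (S.ι.op (S.ρ.op (W t 1))) (S.total (W t)) =
      inner ℝ (S.ρ.op (S.ι.op (S.total (W t)))) (W t 1) := by
    rw [S.ι.inner_op, S.ρ.inner_op, real_inner_comm]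
  have s3 := h.vel₁X.inner_eq h.pressX
  have s4 := h.vel₂Y.inner_eq h.pressY
  rw [s1, h.mom₁, h.mom₂, h.ι_total_deriv, S.η_apply]
  simp only [inner_add_left, inner_sub_left, real_inner_smul_left, inner_neg_left]
  rw [s2, real_inner_comm (W t 1) Qx, real_inner_comm (W t 2) Qy]
  linarith

theorem Coef.norm_op_le_of_le (c : Coef) {F : CellL2} {x : ℝ} (h : ‖F‖ ≤ x) :
    ‖c.op F‖ ≤ c.bound * x :=
  (c.norm_op_le F).trans (mul_le_mul_of_nonneg_left h c.bound_nonneg)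

-- The compressive energy `⟨Q/a, Q⟩` is nonnegative and can be dropped for the displacement
-- estimate. The remainder is the potential energy, bounded through `Λ`. Afterwards the energy
-- controls `Q`, and `σ`, `B₃` are rebuilt from the displacement and `Q`.
set_option maxHeartbeats 400000 in
theorem hasEnergyBound_compressible (hΛ : 0 < Λ) (hq : CompressibleForm S Λ) :
    HasEnergyBound (Compressible S) Λ := by
  obtain ⟨κ, hκ, hκρ⟩ := S.ρ_pos.exists_norm_sq_le
  have hι : S.ι.Pos := fun x hx => inv_pos.2 (S.a_pos x hx)
  obtain ⟨κ', hκ', hκι⟩ := hι.exists_norm_sq_le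
  set rb := (S.ρ.sqrt S.ρ_pos).bound with hrb
  have rb0 : 0 ≤ rb := Coef.bound_nonneg _
  have ρ0 := S.ρ.bound_nonneg
  have c0 := S.c.bound_nonneg
  have β0 := S.β.bound_nonneg
  have d0 := S.κ.bound_nonneg
  have μ0 := S.μ.bound_nonneg
  have β'0 := S.β.d.bound_nonneg
  have ι0 := S.ι.bound_nonneg
  have vol0 := S.vol.bound_nonneg
  have g0 := abs_nonneg g
  set q := S.c.bound + S.β.bound with hqdef
  have q0 : 0 ≤ q := by positivity
  obtain ⟨K, hK0, hKsq⟩ :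
      ∃ K, 0 ≤ K ∧ K ^ 2 = 2 * S.ρ.bound + S.ι.bound * q ^ 2 + |g| * S.κ.bound :=
    ⟨_, Real.sqrt_nonneg _, Real.sq_sqrt (by positivity)⟩
  obtain ⟨K₁, hK₁0, hK₁⟩ : ∃ K₁, 0 ≤ K₁ ∧ K₁ = 2 * rb + K / Λ := ⟨_, by positivity, rfl⟩
  obtain ⟨K₂, hK₂0, hK₂sq⟩ : ∃ K₂, 0 ≤ K₂ ∧ K₂ ^ 2 = K ^ 2 + |g| * S.κ.bound * κ * K₁ ^ 2 :=
    ⟨_, Real.sqrt_nonneg _, Real.sq_sqrt (by positivity)⟩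
  obtain ⟨L, L0, hL⟩ : ∃ L, 0 ≤ L ∧ L = (κ + 1) * K₁ := ⟨_, by positivity, rfl⟩
  obtain ⟨N, N0, hN⟩ : ∃ N, 0 ≤ N ∧ N = (κ + κ' + 1) * K₂ := ⟨_, by positivity, rfl⟩
  obtain ⟨C₀, C₀0, hC₀⟩ : ∃ C, 0 ≤ C ∧ C = S.κ.bound * L + S.ρ.bound * (S.ι.bound * N) :=
    ⟨_, by positivity, rfl⟩
  obtain ⟨C₃, C₃0, hC₃⟩ : ∃ C, 0 ≤ C ∧ C = S.vol.bound * S.β.d.bound :=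
    ⟨_, by positivity, rfl⟩
  obtain ⟨C₆, C₆0, hC₆⟩ : ∃ C, 0 ≤ C ∧ C = S.μ.bound * L + S.β.bound * (S.ι.bound * N) :=
    ⟨_, by positivity, rfl⟩
  refine ⟨C₀ + N + C₃ + C₆, fun u Y r hr hu hY M hW0 hV0 t ht => ?_⟩
  have hM : 0 ≤ M := (norm_nonneg _).trans (hW0 0)
  have hE := fun t ht => compressible_energy hu hY hr.le (t := t) ht
  have hV := fun t ht => timeDeriv_timeQuot hY hr.le (t := t) ht
  have eqη := compressible_timeQuot_η hu hY hr.le ht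
  have eqζ := compressible_timeQuot_ζ hu hY hr.le ht
  have eq4 := fun t ht => compressible_timeQuot_far₁ hu hY hr.le (t := t) ht
  have eq5 := compressible_timeQuot_far₂ hu hY hr.le ht
  have eq3 := compressible_timeQuot_vel₃ hu hY hr.le ht
  simp only at hE
  set W := timeQuot r u
  set V := timeQuot r Y
  have sqle : ∀ F : CellL2, ‖F‖ ≤ M → ‖F‖ ^ 2 ≤ M ^ 2 := fun F hF => by gcongr
  have hE0 : inner ℝ (S.ρ.op (W 0 1)) (W 0 1) + inner ℝ (S.ρ.op (W 0 2)) (W 0 2) +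
      inner ℝ (S.ι.op (S.total (W 0))) (S.total (W 0)) -
      g * inner ℝ (S.κ.op (V 0 1)) (V 0 1) ≤ (K * M) ^ 2 := by
    have q1 := (le_abs_self _).trans (S.ρ.abs_inner_op_le (W 0 1))
    have q2 := (le_abs_self _).trans (S.ρ.abs_inner_op_le (W 0 2))
    have q4 := (le_abs_self _).trans (S.ι.abs_inner_op_le (S.total (W 0)))
    have q5 : ‖S.total (W 0)‖ ≤ q * M := by
      rw [S.total_apply, hqdef, add_mul]
      exact (norm_add_le _ _).trans
        (add_le_add (S.c.norm_op_le_of_le (hW0 0)) (S.β.norm_op_le_of_le (hW0 6)))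
    have q6 : ‖S.total (W 0)‖ ^ 2 ≤ (q * M) ^ 2 := by gcongr
    have q3 : -(g * inner ℝ (S.κ.op (V 0 1)) (V 0 1)) ≤ |g| * (S.κ.bound * ‖V 0 1‖ ^ 2) :=
      (neg_le_abs _).trans (by rw [abs_mul]; gcongr; exact S.κ.abs_inner_op_le _)
    have r1 := mul_le_mul_of_nonneg_left (sqle _ (hW0 1)) ρ0
    have r2 := mul_le_mul_of_nonneg_left (sqle _ (hW0 2)) ρ0
    have r3 := mul_le_mul_of_nonneg_left (sqle _ (hV0 1)) (mul_nonneg g0 d0)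
    have r4 := mul_le_mul_of_nonneg_left q6 ι0
    rw [mul_pow, hKsq]
    linarith
  have nonneg3 : ∀ t, 0 ≤ inner ℝ (S.ι.op (S.total (W t))) (S.total (W t)) :=
    fun t => hι.inner_op_nonneg _
  have growth : ∀ t, 0 ≤ t → inner ℝ (S.ρ.op (V t 1)) (V t 1) + inner ℝ (S.ρ.op (V t 2)) (V t 2) ≤
      (K₁ * M * Real.exp (Λ * t)) ^ 2 := fun t ht => by
    have := energy_growth S.ρ_pos hΛ (K := K * M) (M := M) (by positivity) (fun t ht => hV t ht 1)
      (fun t ht => hV t ht 2) (fun t ht => ?_) (hV0 1) (hV0 2) ht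
    · refine this.trans (le_of_eq ?_)
      rw [hK₁]; ring
    -- The form inequality is used for the first component only; the second enters with a
    -- nonnegative term that is added.
    · have e1 := hE t ht
      have e2 := hq (V t 1)
      have e3 := nonneg3 t
      have e4 : 0 ≤ Λ ^ 2 * inner ℝ (S.ρ.op (V t 2)) (V t 2) :=
        mul_nonneg (sq_nonneg _) (S.ρ_pos.inner_op_nonneg _)
      linarith
  have hV1 : ∀ t, 0 ≤ t → ‖V t 1‖ ^ 2 ≤ κ * (K₁ * M * Real.exp (Λ * t)) ^ 2 := fun t ht =>
    (hκρ _).trans (by gcongr; linarith [growth t ht, S.ρ_pos.inner_op_nonneg (V t 2)])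
  have total : ∀ t, 0 ≤ t → inner ℝ (S.ρ.op (W t 1)) (W t 1) +
      inner ℝ (S.ρ.op (W t 2)) (W t 2) +
      inner ℝ (S.ι.op (S.total (W t))) (S.total (W t)) ≤ (K₂ * M * Real.exp (Λ * t)) ^ 2 :=
    fun t ht => by
    have e1 := hE t ht
    have q3 : g * inner ℝ (S.κ.op (V t 1)) (V t 1) ≤ |g| * (S.κ.bound * ‖V t 1‖ ^ 2) :=
      (le_abs_self _).trans (by rw [abs_mul]; gcongr; exact S.κ.abs_inner_op_le _)
    have q4 := mul_le_mul_of_nonneg_left (hV1 t ht) (mul_nonneg g0 d0)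
    have q5 : (K * M) ^ 2 * 1 ≤ (K * M) ^ 2 * Real.exp (Λ * t) ^ 2 := by
      gcongr
      exact one_le_pow₀ (Real.one_le_exp (by positivity))
    calc _ ≤ (K * M) ^ 2 * Real.exp (Λ * t) ^ 2 +
          |g| * S.κ.bound * (κ * (K₁ * M * Real.exp (Λ * t)) ^ 2) := by linarith
      _ = _ := by rw [mul_pow (K₂ * M), mul_pow K₂, hK₂sq]; ring
  have sqrt_le : ∀ {k x y : ℝ}, 0 ≤ k → 0 ≤ y → x ^ 2 ≤ k * y ^ 2 → x ≤ (k + 1) * y :=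
    fun {k x y} hk hy h => (abs_le_of_sq_le_sq'
      (by nlinarith [mul_nonneg hk (sq_nonneg y), sq_nonneg (k * y)]) (by positivity)).2
  have E0 := (Real.exp_pos (Λ * t)).le
  have E1 : 1 ≤ Real.exp (Λ * t) := Real.one_le_exp (by positivity)
  set E := Real.exp (Λ * t) with hEdef
  have ME : 0 ≤ M * E := by positivity
  have nV1 : ‖V t 1‖ ≤ L * (M * E) :=
    (sqrt_le hκ.le (by positivity) (hV1 t ht)).trans (le_of_eq (by rw [hL]; ring))
  have e0 := total t ht
  have e1 := S.ρ_pos.inner_op_nonneg (W t 1)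
  have e2 := S.ρ_pos.inner_op_nonneg (W t 2)
  have e3 := nonneg3 t
  have K₂ME : 0 ≤ K₂ * (M * E) := by positivity
  have toN : ∀ {k x}, k ≤ κ + κ' → x ≤ (k + 1) * (K₂ * M * E) → x ≤ N * (M * E) := fun hk hx => by
    refine hx.trans ?_
    rw [hN, mul_assoc (κ + κ' + 1), mul_assoc K₂]
    gcongr
  have n1 : ‖W t 1‖ ≤ N * (M * E) := toN (by linarith)
    (sqrt_le hκ.le (by positivity) ((hκρ _).trans (by gcongr; linarith)))
  have n2 : ‖W t 2‖ ≤ N * (M * E) := toN (by linarith)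
    (sqrt_le hκ.le (by positivity) ((hκρ _).trans (by gcongr; linarith)))
  have nQ : ‖S.total (W t)‖ ≤ N * (M * E) := toN (by linarith)
    (sqrt_le hκ'.le (by positivity) ((hκι _).trans (by gcongr; linarith)))
  have nιQ : ‖S.ι.op (S.total (W t))‖ ≤ S.ι.bound * (N * (M * E)) :=
    S.ι.norm_op_le_of_le nQ
  have nV4 : ‖V t 4‖ ≤ M * E := by
    have : V t 4 = V 0 4 := eq_of_hasDerivWithinAt_zero (F := fun t => V t 4)
      (fun s hs => by have := hV s hs 4; rwa [eq4 s hs] at this) ht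
    rw [this]
    exact (hV0 4).trans (le_mul_of_one_le_right hM E1)
  have fin : ∀ {x c : ℝ}, x ≤ c * (M * E) → c ≤ C₀ + N + C₃ + C₆ →
      x ≤ (C₀ + N + C₃ + C₆) * M * E := fun h1 h2 => by
    rw [mul_assoc _ M E]
    exact h1.trans (mul_le_mul_of_nonneg_right h2 ME)
  intro j
  fin_cases j
  · change ‖W t 0‖ ≤ _
    have e : W t 0 = S.κ.op (V t 1) + S.ρ.op (S.ι.op (S.total (W t))) := by
      rw [← eqη, S.η_apply, sub_add_cancel]
    rw [e]
    refine fin (c := C₀) ?_ (by linarith)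
    rw [hC₀, add_mul, mul_assoc _ L, mul_assoc S.ρ.bound, mul_assoc S.ι.bound]
    exact (norm_add_le _ _).trans (add_le_add (S.κ.norm_op_le_of_le nV1) (S.ρ.norm_op_le_of_le nιQ))
  · exact fin n1 (by linarith)
  · exact fin n2 (by linarith)
  · change ‖W t 3‖ ≤ _
    rw [eq3]
    refine fin (c := C₃) ?_ (by linarith)
    rw [hC₃, mul_assoc]
    exact S.vol.norm_op_le_of_le (S.β.d.norm_op_le_of_le nV4)
  · change ‖W t 4‖ ≤ _
    rw [eq4 t ht, norm_zero]; positivity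
  · change ‖W t 5‖ ≤ _
    rw [eq5, norm_zero]; positivity
  · change ‖W t 6‖ ≤ _
    have e : W t 6 = S.μ.op (V t 1) + S.β.op (S.ι.op (S.total (W t))) := by
      rw [← eqζ, S.ζ_apply, sub_add_cancel]
    rw [e]
    refine fin (c := C₆) ?_ (by linarith)
    rw [hC₆, add_mul, mul_assoc _ L, mul_assoc S.β.bound, mul_assoc S.ι.bound]
    exact (norm_add_le _ _).trans (add_le_add (S.μ.norm_op_le_of_le nV1) (S.β.norm_op_le_of_le nιQ))

end CompressibleEnergy

/-! ### Compressible system: recovery of the normal derivatives. -/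

section CompressibleNormal

variable {g : ℝ} {S : Stratification g} {Λ : ℝ}

/-- The bounds from which one more normal derivative of a solution is estimated. -/
structure TangentialBounds (S : Stratification g) (Λ : ℝ) (n : ℕ) (u : ℝ → State) (M : ℝ) :
    Prop where
  init : StateBound (n + 1) (u 0) M
  bound : ∀ t, 0 ≤ t → StateBound n (u t) (M * Real.exp (Λ * t))
  boundY : ∀ t, 0 ≤ t → ∀ i, ∃ uy, WY (u t i) uy ∧ SobolevBound n uy (M * Real.exp (Λ * t))
  evol : ∀ t, 0 ≤ t → ∃ u', Compressible S (u t) u' ∧ TimeDeriv u u' t ∧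
    StateBound n u' (M * Real.exp (Λ * t))

namespace TangentialBounds

theorem nonneg {n : ℕ} {u : ℝ → State} {M : ℝ} (H : TangentialBounds S Λ n u M) : 0 ≤ M :=
  (H.init 0).nonneg

/-- The pressure equation is solved for `∂ₓv₁` in terms of `Q_t`, `v₁` and `∂ᵧv₂`. -/
theorem velocity₁ (S : Stratification g) (Λ : ℝ) (n : ℕ) : ∃ C, 0 ≤ C ∧ ∀ u M,
    TangentialBounds S Λ n u M → ∀ t, 0 ≤ t →
      SobolevBound (n + 1) (u t 1) (C * (M * Real.exp (Λ * t))) := by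
  have p1 := S.ι.opConst_nonneg n
  have p2 := S.ρ.opConst_nonneg n
  have p3 := S.c.opConst_nonneg n
  have p4 := S.β.opConst_nonneg n
  have g0 := abs_nonneg g
  set C := S.ι.opConst n * (S.c.opConst n + S.β.opConst n) +
    |g| * (S.ι.opConst n * S.ρ.opConst n) + 1 with hC
  have C1 : 1 ≤ C := le_add_of_nonneg_left (by positivity)
  refine ⟨C, by positivity, fun u M H t ht => ?_⟩
  have E0 : 0 ≤ M * Real.exp (Λ * t) := mul_nonneg H.nonneg (Real.exp_pos _).le
  obtain ⟨u', ⟨Qx, Qy, v₁x, v₂x, v₂y, h⟩, -, hb⟩ := H.evol t ht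
  obtain ⟨v₁y, k1, k2⟩ := H.boundY t ht 1
  obtain ⟨v₂y', k3, k4⟩ := H.boundY t ht 2
  rw [k3.unique h.vel₂Y] at k4
  have one : ∀ {f}, SobolevBound n f (M * Real.exp (Λ * t)) →
      SobolevBound n f (C * (M * Real.exp (Λ * t))) := fun h =>
    SobolevBound.mono_mul (C := 1) (by simpa using h) C1 E0
  refine (one (H.bound t ht 1)).of_derivs h.vel₁X.wx k1 ?_ (one k2)
  have e : v₁x = -(S.ι.op (S.total u')) - g • S.ι.op (S.ρ.op (u t 1)) - v₂y := by
    rw [h.ι_total_deriv]; abel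
  rw [e]
  refine ((((S.total_bound hb).op S.ι).neg.sub
    ((((H.bound t ht 1).op S.ρ).op S.ι).smul g)).sub k4).mono (le_of_eq ?_)
  rw [hC]; ring

/-- The curl of the momentum equation contains only gravity, exactly as in the incompressible case
with `b = 0`. -/
theorem velocity₂ (hΛ : 0 < Λ) (n : ℕ) : ∃ C, 0 ≤ C ∧ ∀ u M,
    TangentialBounds S Λ n u M → ∀ t, 0 ≤ t →
      SobolevBound (n + 1) (u t 2) (C * (M * Real.exp (Λ * t))) := by
  obtain ⟨C, C0, hC⟩ := curl_momentum_bound S.ρ_pos hΛ g n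
  refine ⟨C, C0, fun u M H t ht => hC (fun t => u t 1) (fun t => u t 2) (fun t => u t 0) M
    (H.init 1) (H.init 2) (fun t ht φ => ?_) (fun t ht => ?_) (fun t ht => H.bound t ht 2)
    (fun t ht => H.boundY t ht 1) (fun t ht => H.boundY t ht 2) (fun t ht => H.boundY t ht 0) t ht⟩
  · obtain ⟨u', ⟨_, _, _, _, _, h⟩, hd', -⟩ := H.evol t ht
    have k1 := S.ρ.op.hasFDerivAt.comp_hasDerivWithinAt t (hd' 2)
    have k2 := S.ρ.op.hasFDerivAt.comp_hasDerivWithinAt t (hd' 1)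
    refine ((hasDerivWithinAt_inner_const k1 (testI (dXI φ))).sub
      (hasDerivWithinAt_inner_const k2 (testI (dYI φ)))).congr_deriv ?_
    rw [h.curl φ]
  · obtain ⟨u', ⟨_, _, _, v₂x, _, h⟩, -, -⟩ := H.evol t ht
    exact ⟨v₂x, h.vel₂X⟩

/-- The momentum equation expresses both derivatives of the total pressure by accelerations and
density. -/
theorem pressure (S : Stratification g) (Λ : ℝ) (n : ℕ) : ∃ C, 0 ≤ C ∧ ∀ u M,
    TangentialBounds S Λ n u M → ∀ t, 0 ≤ t →
      SobolevBound (n + 1) (S.total (u t)) (C * (M * Real.exp (Λ * t))) := by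
  have p2 := S.ρ.opConst_nonneg n
  have p3 := S.c.opConst_nonneg n
  have p4 := S.β.opConst_nonneg n
  have g0 := abs_nonneg g
  refine ⟨S.c.opConst n + S.β.opConst n + (|g| + S.ρ.opConst n), by positivity,
    fun u M H t ht => ?_⟩
  have E0 : 0 ≤ M * Real.exp (Λ * t) := mul_nonneg H.nonneg (Real.exp_pos _).le
  obtain ⟨u', ⟨Qx, Qy, v₁x, v₂x, v₂y, h⟩, -, hb⟩ := H.evol t ht
  have e1 : Qx = g • u t 0 - S.ρ.op (u' 1) := by rw [h.mom₁]; abel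
  have e2 : Qy = -S.ρ.op (u' 2) := by rw [h.mom₂, neg_neg]
  refine SobolevBound.of_derivs ((S.total_bound (H.bound t ht)).mono_mul ?_ E0) h.pressX.wx h.pressY
    (SobolevBound.mono_mul (C := |g| + S.ρ.opConst n) ?_ ?_ E0)
    (SobolevBound.mono_mul (C := S.ρ.opConst n) ?_ ?_ E0)
  · linarith
  · rw [e1, add_mul]
    exact ((H.bound t ht 0).smul g).sub ((hb 1).op S.ρ)
  · linarith
  · rw [e2]
    exact ((hb 2).op S.ρ).neg
  · linarith

/-- Components which are the sum of a transported quantity and a multiple of the total pressure. -/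
theorem transported (hΛ : 0 < Λ) (n : ℕ) (j : Fin 7) (A : State →L[ℝ] CellL2) (k r : Coef)
    (hA : ∀ u, u j = A u + r.op (S.ι.op (S.total u)))
    (hk : ∀ u u', Compressible S u u' → A u' = k.op (u 1)) : ∃ C, 0 ≤ C ∧ ∀ u M,
    TangentialBounds S Λ n u M → ∀ t, 0 ≤ t →
      SobolevBound (n + 1) (u t j) (C * (M * Real.exp (Λ * t))) := by
  obtain ⟨C₁, C₁0, hC₁⟩ := velocity₁ S Λ n
  obtain ⟨C₂, C₂0, hC₂⟩ := pressure S Λ n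
  have p1 := r.opConst_nonneg (n + 1)
  have p2 := S.ι.opConst_nonneg (n + 1)
  have p3 := k.opConst_nonneg (n + 1)
  -- Bounds the initial value of the transported part, which is the component minus its multiple of
  -- the total pressure.
  set C₃ := 1 + r.opConst (n + 1) * (S.ι.opConst (n + 1) * C₂) with hC₃
  have C₃1 : 1 ≤ C₃ := le_add_of_nonneg_right (by positivity)
  refine ⟨(1 + 1 / Λ) * (1 + k.opConst (n + 1) * C₁) * C₃ +
    r.opConst (n + 1) * (S.ι.opConst (n + 1) * C₂), by positivity, fun u M H t ht => ?_⟩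
  have M0 := H.nonneg
  have e : ∀ u, A u = u j - r.op (S.ι.op (S.total u)) := fun u => by rw [hA u]; abel
  have h0 : SobolevBound (n + 1) (A (u 0)) (C₃ * M) := by
    have := hC₂ u M H 0 le_rfl
    rw [mul_zero, Real.exp_zero, mul_one] at this
    rw [e]
    exact ((H.init j).sub ((this.op S.ι).op r)).mono (le_of_eq (by rw [hC₃]; ring))
  have h1 := SobolevBound.of_timeDeriv_exp_mul (F := fun t => A (u t))
    (G := fun t => k.op (u t 1)) (c := k.opConst (n + 1) * C₁) hΛ (by positivity) (fun t ht => by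
      obtain ⟨u', h, hd, -⟩ := H.evol t ht
      have := hd.clm A
      rwa [hk _ _ h] at this) h0 (fun t ht => ((hC₁ u M H t ht).op k).mono (by
        have : M ≤ C₃ * M := le_mul_of_one_le_left M0 C₃1
        rw [← mul_assoc, ← mul_assoc]
        gcongr)) ht
  rw [hA (u t)]
  refine (h1.add (((hC₂ u M H t ht).op S.ι).op r)).mono (le_of_eq ?_)
  ring

theorem constant (hΛ : 0 < Λ) (n : ℕ) (j : Fin 7)
    (hj : ∀ u u', Compressible S u u' → u' j = 0) : ∃ C, 0 ≤ C ∧ ∀ u M,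
    TangentialBounds S Λ n u M → ∀ t, 0 ≤ t →
      SobolevBound (n + 1) (u t j) (C * (M * Real.exp (Λ * t))) := by
  refine ⟨(1 + 1 / Λ) * (1 + 0), by positivity, fun u M H t ht => ?_⟩
  refine SobolevBound.of_timeDeriv_exp_mul (F := fun t => u t j) (G := fun _ => 0) hΛ le_rfl
    (fun t ht => ?_) (H.init j) (fun t ht => SobolevBound.zero (by simp)) ht
  obtain ⟨u', h, hd, -⟩ := H.evol t ht
  have := hd j
  rwa [hj _ _ h] at this

theorem velocity₃ (hΛ : 0 < Λ) (n : ℕ) : ∃ C, 0 ≤ C ∧ ∀ u M,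
    TangentialBounds S Λ n u M → ∀ t, 0 ≤ t →
      SobolevBound (n + 1) (u t 3) (C * (M * Real.exp (Λ * t))) := by
  obtain ⟨C, C0, hC⟩ := constant (S := S) hΛ n 4 fun u u' ⟨_, _, _, _, _, h⟩ => h.far₁
  have p1 := S.vol.opConst_nonneg (n + 1)
  have p2 := S.β.d.opConst_nonneg (n + 1)
  refine ⟨(1 + 1 / Λ) * (1 + S.vol.opConst (n + 1) * (S.β.d.opConst (n + 1) * C)), by positivity,
    fun u M H t ht => ?_⟩
  refine SobolevBound.of_timeDeriv_exp_mul (F := fun t => u t 3)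
    (G := fun t => S.vol.op (S.β.d.op (u t 4))) hΛ (by positivity)
    (fun t ht => ?_) (H.init 3) (fun t ht => ?_) ht
  · obtain ⟨u', ⟨_, _, _, _, _, h⟩, hd', -⟩ := H.evol t ht
    have := hd' 3
    rwa [← S.vol_ρ (u' 3), h.mom₃] at this
  · exact (((hC u M H t ht).op S.β.d).op S.vol).mono (le_of_eq (by ring))

end TangentialBounds

theorem controlsNormalDerivative_compressible (S : Stratification g) (hΛ : 0 < Λ) :
    ControlsNormalDerivative (Compressible S) Λ := fun n => by
  have key : ∀ j : Fin 7, ∃ C, 0 ≤ C ∧ ∀ u M, TangentialBounds S Λ n u M → ∀ t, 0 ≤ t →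
      SobolevBound (n + 1) (u t j) (C * (M * Real.exp (Λ * t))) := fun j => by
    fin_cases j
    · exact TangentialBounds.transported hΛ n 0 S.η S.κ S.ρ
        (fun u => by rw [S.η_apply, sub_add_cancel]) fun u u' ⟨_, _, _, _, _, h⟩ => h.η_deriv
    · exact TangentialBounds.velocity₁ S Λ n
    · exact TangentialBounds.velocity₂ hΛ n
    · exact TangentialBounds.velocity₃ hΛ n
    · exact TangentialBounds.constant hΛ n 4 fun u u' ⟨_, _, _, _, _, h⟩ => h.far₁
    · exact TangentialBounds.constant hΛ n 5 fun u u' ⟨_, _, _, _, _, h⟩ => h.far₂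
    · exact TangentialBounds.transported hΛ n 6 S.ζ S.μ S.β
        (fun u => by rw [S.ζ_apply, sub_add_cancel]) fun u u' ⟨_, _, _, _, _, h⟩ => h.ζ_deriv
  choose C hC0 hC using key
  refine ⟨∑ j, C j, fun u _ M h0 hM hy hd t ht j => ?_⟩
  have H : TangentialBounds S Λ n u M := ⟨h0, hM, hy, hd⟩
  rw [mul_assoc]
  exact (hC j u M H t ht).mono_mul (Finset.single_le_sum (fun i _ => hC0 i) (Finset.mem_univ j))
    (mul_nonneg H.nonneg (Real.exp_pos _).le)

end CompressibleNormal

/-! ### Rayleigh quotients -/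

/-- Density of torus tests in the graph norm of the periodic derivative. -/
theorem TX.of_isClosed {p : CellL2 × CellL2 → Prop} (hp : IsClosed {z | p z})
    (ht : ∀ φ, p (testT φ, testT (dXT φ))) {w wx : CellL2} (h : TX w wx) : p (w, wx) := by
  set L : torusTests →ₗ[ℝ] WithLp 2 (CellL2 × CellL2) :=
    (WithLp.linearEquiv 2 ℝ (CellL2 × CellL2)).symm.toLinearMap ∘ₗ (testT.prod (testT ∘ₗ dXT))
  set V := (LinearMap.range L).topologicalClosure
  have hV : ∀ {q : CellL2 × CellL2 → Prop}, IsClosed {z | q z} →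
      (∀ φ, q (testT φ, testT (dXT φ))) → ∀ x ∈ V, q x.ofLp := fun {q} hq hqt x hx => by
    have h1 : IsClosed {x : WithLp 2 (CellL2 × CellL2) | q x.ofLp} :=
      hq.preimage (WithLp.prod_continuous_ofLp 2 CellL2 CellL2)
    refine closure_minimal ?_ h1 hx
    rintro _ ⟨φ, rfl⟩
    exact hqt φ
  have hTX : ∀ x ∈ V, TX x.ofLp.1 x.ofLp.2 := hV (q := fun z => TX z.1 z.2)
    (by
      simp only [TX, ofPred_forall]
      exact isClosed_iInter fun φ => isClosed_eq (by fun_prop) (by fun_prop)) TX_testT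
  obtain ⟨y, hy, z, hz, e⟩ := V.exists_add_mem_mem_orthogonal (WithLp.toLp 2 (w, wx))
  have e1 : w = y.ofLp.1 + z.ofLp.1 := congrArg (fun x => x.ofLp.1) e
  have e2 : wx = y.ofLp.2 + z.ofLp.2 := congrArg (fun x => x.ofLp.2) e
  have h1 : TX z.ofLp.1 z.ofLp.2 := by
    have := h.sub (hTX y hy)
    rwa [e1, e2, add_sub_cancel_left, add_sub_cancel_left] at this
  -- Orthogonality to the graph says that `z₂` has derivative `z₁`, whereas `z₁` has derivative
  -- `z₂`. Integration by parts gives `‖z₂‖² = -‖z₁‖²`, so both vanish.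
  have h2 : TX z.ofLp.2 z.ofLp.1 := fun φ => by
    have : inner ℝ z (L φ) = 0 := Submodule.inner_left_of_mem_orthogonal
      (Submodule.le_topologicalClosure _ (LinearMap.mem_range_self L φ)) hz
    rw [WithLp.prod_inner_apply] at this
    change inner ℝ z.ofLp.1 (testT φ) + inner ℝ z.ofLp.2 (testT (dXT φ)) = 0 at this
    linarith
  have h3 := h1.inner_eq h2
  have h4 := real_inner_self_nonneg (F := CellL2) (x := z.ofLp.1)
  have h5 := real_inner_self_nonneg (F := CellL2) (x := z.ofLp.2)
  have h6 : z.ofLp.1 = 0 := inner_self_eq_zero (𝕜 := ℝ).1 (by linarith)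
  have h7 : z.ofLp.2 = 0 := inner_self_eq_zero (𝕜 := ℝ).1 (by linarith)
  have := hV hp ht y hy
  rwa [e1, e2, h6, h7, add_zero, add_zero]

instance : IsFiniteMeasure intervalMeasure := by
  rw [intervalMeasure]; infer_instance

/-! ### Functions of `x` alone and slices of functions on the cell. -/

section Slices

theorem memLp_fst {u : ℝ → ℝ} (hu : MemLp u 2 intervalMeasure) :
    MemLp (fun z : ℝ × ℝ => u z.1) 2 cellMeasure := by
  rw [cellMeasure_eq_prod]
  exact hu.comp_fst intervalMeasure

theorem intervalMeasure_real_univ : intervalMeasure.real univ = 2 * Real.pi := by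
  rw [intervalMeasure, measureReal_restrict_apply MeasurableSet.univ, univ_inter,
    Real.volume_real_Ioo_of_le Real.two_pi_pos.le, sub_zero]

theorem integral_fst (f : ℝ → ℝ) :
    ∫ z, f z.1 ∂cellMeasure = 2 * Real.pi * ∫ x, f x ∂intervalMeasure := by
  rw [cellMeasure_eq_prod, integral_fun_fst, intervalMeasure_real_univ, smul_eq_mul]

theorem Coef.integrable_mul_sq (c : Coef) {u : ℝ → ℝ} (hu : MemLp u 2 intervalMeasure) :
    Integrable (fun x => c x * u x ^ 2) intervalMeasure := by
  refine hu.integrable_sq.bdd_mul (c := c.bound)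
    ((c.2.continuousOn.mono Ioo_subset_Icc_self).aestronglyMeasurable measurableSet_Ioo)
    ((ae_restrict_iff' measurableSet_Ioo).2 (Eventually.of_forall fun x hx => ?_))
  exact c.abs_le_bound (Ioo_subset_Icc_self hx)

theorem memLp_interval_of_continuous {u : ℝ → ℝ} (hu : Continuous u) :
    MemLp u 2 intervalMeasure := by
  obtain ⟨C, hC⟩ := isCompact_Icc (a := (0 : ℝ)) (b := 2 * Real.pi).exists_bound_of_continuousOn
    hu.continuousOn
  exact MemLp.of_bound hu.aestronglyMeasurable C ((ae_restrict_iff' measurableSet_Ioo).2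
    (Eventually.of_forall fun x hx => hC x (Ioo_subset_Icc_self hx)))

theorem inner_op_fst (c : Coef) {u : ℝ → ℝ} (hu : MemLp u 2 intervalMeasure) :
    inner ℝ (c.op (toL2 fun z => u z.1)) (toL2 fun z => u z.1) =
      2 * Real.pi * ∫ x, c x * u x ^ 2 ∂intervalMeasure := by
  rw [c.inner_op_self, ← integral_fst]
  refine integral_congr_ae ?_
  filter_upwards [coe_toL2 (memLp_fst hu)] with z hz
  rw [hz]

theorem norm_fst {u : ℝ → ℝ} (hu : MemLp u 2 intervalMeasure) :
    ‖toL2 fun z => u z.1‖ ^ 2 = 2 * Real.pi * ∫ x, u x ^ 2 ∂intervalMeasure := by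
  rw [norm_toL2_sq (memLp_fst hu), ← integral_fst fun x => u x ^ 2]

theorem IsTorusTest.slice {φ : ℝ × ℝ → ℝ} (h : IsTorusTest φ) (y : ℝ) :
    ContDiff ℝ ∞ (fun x => φ (x, y)) ∧ ∀ x, φ (x + 2 * Real.pi, y) = φ (x, y) :=
  ⟨h.1.comp (by fun_prop : ContDiff ℝ ∞ fun x : ℝ => (x, y)), fun x => h.2.1 x y⟩

/-- By Fubini the identity for a torus test reduces to the one-dimensional identity for its slice at
each `y`. -/
theorem TX_fst {u u' : ℝ → ℝ} (h : IsPeriodicWeakDeriv 1 u u') :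
    TX (toL2 fun z => u z.1) (toL2 fun z => u' z.1) := fun φ => by
  have hφ := φ.2
  have hu := memLp_fst h.1
  have hu' := memLp_fst h.2.1
  have e1 : testT (dXT φ) = toL2 (partialX φ.1) := rfl
  have e2 : testT φ = toL2 φ.1 := rfl
  rw [e1, e2, inner_toL2 hu hφ.partialX.memLp, inner_toL2 hu' hφ.memLp]
  have i1 : Integrable (fun z => u z.1 * partialX φ.1 z) cellMeasure :=
    hu.integrable_mul hφ.partialX.memLp
  have i2 : Integrable (fun z => u' z.1 * φ.1 z) cellMeasure := hu'.integrable_mul hφ.memLp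
  rw [cellMeasure_eq_prod] at i1 i2 ⊢
  rw [integral_prod_symm _ i1, integral_prod_symm _ i2, ← integral_neg]
  refine integral_congr_ae (Eventually.of_forall fun y => ?_)
  obtain ⟨k1, k2⟩ := hφ.slice y
  have := h.2.2 _ k1 k2
  rw [iteratedDeriv_one, pow_one, neg_one_mul] at this
  exact this

/-- A form inequality on the cell holds for functions of `x`. -/
theorem form_fst {H ρ : Coef} {B Λsq : ℝ}
    (hf : ∀ w wx, TX w wx →
      inner ℝ (H.op w) w - B * ‖wx‖ ^ 2 ≤ Λsq * inner ℝ (ρ.op w) w)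
    {u u' : ℝ → ℝ} (h : IsPeriodicWeakDeriv 1 u u') :
    ∫ x, H x * u x ^ 2 ∂intervalMeasure - B * ∫ x, u' x ^ 2 ∂intervalMeasure ≤
      Λsq * ∫ x, ρ x * u x ^ 2 ∂intervalMeasure := by
  have := hf _ _ (TX_fst h)
  rw [inner_op_fst H h.1, inner_op_fst ρ h.1, norm_fst h.2.1] at this
  refine le_of_mul_le_mul_left ?_ Real.two_pi_pos
  linarith

/-- A strict form inequality for a test function holds on one of its slices. -/
theorem exists_slice {H ρ : Coef} {B μ : ℝ} {φ : torusTests}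
    (h : μ * inner ℝ (ρ.op (testT φ)) (testT φ) <
      inner ℝ (H.op (testT φ)) (testT φ) - B * ‖testT (dXT φ)‖ ^ 2) :
    ∃ u : ℝ → ℝ, ContDiff ℝ ∞ u ∧ (∀ x, u (x + 2 * Real.pi) = u x) ∧
      μ * ∫ x, ρ x * u x ^ 2 ∂intervalMeasure <
        ∫ x, H x * u x ^ 2 ∂intervalMeasure - B * ∫ x, deriv u x ^ 2 ∂intervalMeasure := by
  have hφ := φ.2
  by_contra! hcon
  have hsq : ∀ c : Coef, inner ℝ (c.op (testT φ)) (testT φ) =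
      ∫ z, c z.1 * φ.1 z ^ 2 ∂cellMeasure := fun c => by
    rw [c.inner_op_self]
    refine integral_congr_ae ?_
    filter_upwards [coe_toL2 hφ.memLp] with z hz
    change c z.1 * (toL2 φ.1 : CellL2) z ^ 2 = _
    rw [hz]
  have i1 := H.integrable_op_sq hφ.memLp
  have i2 := ρ.integrable_op_sq hφ.memLp
  have i3 := hφ.partialX.memLp.integrable_sq
  have e3 : ‖testT (dXT φ)‖ ^ 2 = ∫ z, partialX φ.1 z ^ 2 ∂cellMeasure :=
    norm_toL2_sq hφ.partialX.memLp
  rw [hsq, hsq, e3, ← integral_const_mul, ← integral_const_mul,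
    ← integral_sub i1 (i3.const_mul B), cellMeasure_eq_prod, integral_prod_symm, integral_prod_symm]
    at h
  rotate_left
  · rw [← cellMeasure_eq_prod]; exact i1.sub (i3.const_mul B)
  · rw [← cellMeasure_eq_prod]; exact i2.const_mul μ
  -- If the inequality failed on every slice, integrating over `y` would contradict it on the cell;
  -- no `y`-derivative occurs.
  refine absurd h (not_lt.2 (integral_mono_ae ?_ ?_ (Eventually.of_forall fun y => ?_)))
  · rw [cellMeasure_eq_prod] at i1 i3
    exact (i1.sub (i3.const_mul B)).integral_prod_right
  · rw [cellMeasure_eq_prod] at i2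
    exact (i2.const_mul μ).integral_prod_right
  · obtain ⟨k1, k2⟩ := hφ.slice y
    have := hcon _ k1 k2
    have m1 := memLp_interval_of_continuous k1.continuous
    have m2 := memLp_interval_of_continuous (k1.continuous_deriv (by simp))
    change ∫ x, (H x * φ.1 (x, y) ^ 2 - B * deriv (fun x => φ.1 (x, y)) x ^ 2) ∂intervalMeasure ≤
      ∫ x, μ * (ρ x * φ.1 (x, y) ^ 2) ∂intervalMeasure
    rw [integral_const_mul, integral_sub (H.integrable_mul_sq m1) (m2.integrable_sq.const_mul B),
      integral_const_mul]
    exact this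

theorem isPeriodicWeakDeriv_deriv {u : ℝ → ℝ} (hu : ContDiff ℝ ∞ u)
    (hp : ∀ x, u (x + 2 * Real.pi) = u x) {ψ : ℝ → ℝ} (hψ : ContDiff ℝ ∞ ψ)
    (hψp : ∀ x, ψ (x + 2 * Real.pi) = ψ x) :
    ∫ x, u x * deriv ψ x ∂intervalMeasure = -∫ x, deriv u x * ψ x ∂intervalMeasure := by
  have h1 : ∀ f : ℝ → ℝ, ∫ x, f x ∂intervalMeasure = ∫ x in (0)..(2 * Real.pi), f x := fun f => by
    rw [intervalIntegral.integral_of_le Real.two_pi_pos.le, integral_Ioc_eq_integral_Ioo,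
      intervalMeasure]
  have d1 := hu.continuous_deriv (by simp)
  have d2 := hψ.continuous_deriv (by simp)
  rw [h1, h1, intervalIntegral.integral_mul_deriv_eq_deriv_mul
    (fun x _ => (hu.differentiable (by simp) x).hasDerivAt)
    (fun x _ => (hψ.differentiable (by simp) x).hasDerivAt) (d1.intervalIntegrable _ _)
    (d2.intervalIntegrable _ _)]
  have e1 := hp 0
  have e2 := hψp 0
  rw [zero_add] at e1 e2
  rw [e1, e2]; ring

theorem deriv_periodic {u : ℝ → ℝ} (hp : ∀ x, u (x + 2 * Real.pi) = u x) (x : ℝ) :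
    deriv u (x + 2 * Real.pi) = deriv u x := by
  rw [← deriv_comp_add_const]
  congr 1
  exact funext hp

theorem ContDiff.isPeriodicWeakDeriv_one {u : ℝ → ℝ} (hu : ContDiff ℝ ∞ u)
    (hp : ∀ x, u (x + 2 * Real.pi) = u x) : IsPeriodicWeakDeriv 1 u (deriv u) := by
  refine ⟨memLp_interval_of_continuous hu.continuous,
    memLp_interval_of_continuous (hu.continuous_deriv (by simp)), fun ψ h1 h2 => ?_⟩
  rw [iteratedDeriv_one, isPeriodicWeakDeriv_deriv hu hp h1 h2]; ring

theorem ContDiff.isPeriodicWeakDeriv_two {u : ℝ → ℝ} (hu : ContDiff ℝ ∞ u)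
    (hp : ∀ x, u (x + 2 * Real.pi) = u x) : IsPeriodicWeakDeriv 2 u (deriv (deriv u)) := by
  have hd : ∀ {f : ℝ → ℝ}, ContDiff ℝ ∞ f → ContDiff ℝ ∞ (deriv f) := fun h =>
    (contDiff_infty_iff_deriv.1 h).2
  refine ⟨memLp_interval_of_continuous hu.continuous,
    memLp_interval_of_continuous (hd (hd hu)).continuous, fun ψ h1 h2 => ?_⟩
  rw [iteratedDeriv_succ, iteratedDeriv_one,
    isPeriodicWeakDeriv_deriv hu hp (hd h1) (deriv_periodic h2),
    isPeriodicWeakDeriv_deriv (hd hu) (deriv_periodic hp) h1 h2]; ring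

end Slices

/-! ### Limits of the discrete rates. -/

section Modes

theorem isSupremumOfModes_of {lam : ℕ → ℝ} {Λsq : ℝ} (h1 : ∀ k, 1 ≤ k → lam k ≤ Λsq)
    (h2 : ∀ μ < Λsq, ∀ᶠ k in atTop, μ < lam k) : IsSupremumOfModes lam Λsq := by
  have ht : Tendsto lam atTop (𝓝 Λsq) := tendsto_order.2 ⟨h2, fun c hc => by
    filter_upwards [eventually_ge_atTop 1] with k hk using (h1 k hk).trans_lt hc⟩
  refine ⟨⟨?_, fun c hc => ?_⟩, ht⟩
  · rintro _ ⟨k, hk, rfl⟩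
    exact h1 k hk
  · refine le_of_tendsto ht ?_
    filter_upwards [eventually_ge_atTop 1] with k hk using hc ⟨k, hk, rfl⟩

/-- One trial function serves for all `k`. Its quotient tends to `n / A`, which lies above `μ`, so
the suprema eventually do too. -/
theorem eventually_lt_sSup {S : ℕ → Set ℝ} (hS : ∀ k, 1 ≤ k → BddAbove (S k)) {n E A D μ : ℝ}
    (hA : 0 < A) (h : ∀ k : ℕ, 1 ≤ k → (n - E / k ^ 2) / (A + D / k ^ 2) ∈ S k) (hμ : μ * A < n) :
    ∀ᶠ k in atTop, μ < sSup (S k) := by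
  have h0 : ∀ c : ℝ, Tendsto (fun k : ℕ => c / (k : ℝ) ^ 2) atTop (𝓝 0) := fun c =>
    tendsto_const_nhds.div_atTop ((tendsto_pow_atTop two_ne_zero).comp tendsto_natCast_atTop_atTop)
  have h1 : Tendsto (fun k : ℕ => (n - E / (k : ℝ) ^ 2) / (A + D / (k : ℝ) ^ 2)) atTop
      (𝓝 ((n - 0) / (A + 0))) :=
    (tendsto_const_nhds.sub (h0 E)).div (tendsto_const_nhds.add (h0 D)) (by simpa using hA.ne')
  have h2 : μ < (n - 0) / (A + 0) := by
    rwa [sub_zero, add_zero, lt_div_iff₀ hA]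
  filter_upwards [h1.eventually_const_lt h2, eventually_ge_atTop 1] with k hk1 hk2
  exact hk1.trans_le (le_csSup (hS k hk2) (h k hk2))

end Modes

/-! ### Weak derivatives as elements of `L²` -/

theorem isWeakDeriv_weakDeriv {i j : ℕ} {f : ℝ × ℝ → ℝ} (h : ∃ k, IsWeakDeriv i j f k) :
    IsWeakDeriv i j f (weakDeriv i j f) := by
  rw [weakDeriv, dif_pos h]
  exact Classical.choose_spec h

theorem memLp_weakDeriv (i j : ℕ) (f : ℝ × ℝ → ℝ) : MemLp (weakDeriv i j f) 2 cellMeasure := by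
  by_cases h : ∃ k, IsWeakDeriv i j f k
  · exact (isWeakDeriv_weakDeriv h).2.1
  · rw [weakDeriv, dif_neg h]
    exact MemLp.zero

namespace IsWeakDeriv

variable {i j : ℕ} {f f' h h' : ℝ × ℝ → ℝ}

theorem inner_eq (H : IsWeakDeriv i j f h) (φ : interiorTests) :
    ∫ z, f z * (partialX^[i] (partialY^[j] φ.1)) z ∂cellMeasure =
      (-1) ^ (i + j) * inner ℝ (toL2 h) (testI φ) := by
  rw [H.2.2 φ.1 φ.2, ← inner_toL2 H.2.1 φ.2.memLp]
  rfl

theorem toL2_unique (H : IsWeakDeriv i j f h) (H' : IsWeakDeriv i j f h') : toL2 h = toL2 h' :=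
  ext_testI fun φ => mul_left_cancel₀ (pow_ne_zero (i + j) (neg_ne_zero.2 one_ne_zero))
    ((H.inner_eq φ).symm.trans (H'.inner_eq φ))

theorem ae_unique (H : IsWeakDeriv i j f h) (H' : IsWeakDeriv i j f h') :
    h =ᵐ[cellMeasure] h' := ae_eq_of_toL2_eq H.2.1 H'.2.1 (H.toL2_unique H')

theorem weakDeriv_ae_eq (H : IsWeakDeriv i j f h) : weakDeriv i j f =ᵐ[cellMeasure] h :=
  (isWeakDeriv_weakDeriv ⟨h, H⟩).ae_unique H

theorem toL2_weakDeriv (H : IsWeakDeriv i j f h) : toL2 (weakDeriv i j f) = toL2 h :=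
  toL2_congr H.weakDeriv_ae_eq

theorem self (hf : MemLp f 2 cellMeasure) : IsWeakDeriv 0 0 f f := ⟨hf, hf, fun φ _ => by simp⟩

theorem sub (H : IsWeakDeriv i j f h) (H' : IsWeakDeriv i j f' h') :
    IsWeakDeriv i j (f - f') (h - h') := by
  refine ⟨H.1.sub H'.1, H.2.1.sub H'.2.1, fun φ hφ => ?_⟩
  have k1 := (hφ.iterate i j).memLp
  have i : ∀ {f ψ : ℝ × ℝ → ℝ}, MemLp f 2 cellMeasure → MemLp ψ 2 cellMeasure →
      Integrable (fun z => f z * ψ z) cellMeasure := fun hf hψ => hf.integrable_mul hψ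
  simp only [Pi.sub_apply, sub_mul]
  rw [integral_sub (i H.1 k1) (i H'.1 k1), integral_sub (i H.2.1 hφ.memLp) (i H'.2.1 hφ.memLp),
    H.2.2 φ hφ, H'.2.2 φ hφ]
  ring

theorem wx (H : IsWeakDeriv 1 0 f h) : WX (toL2 f) (toL2 h) := fun φ => by
  have := H.inner_eq φ
  rw [pow_one, neg_one_mul] at this
  rw [← this]
  exact inner_toL2 H.1 φ.2.partialX.memLp

theorem wy (H : IsWeakDeriv 0 1 f h) : WY (toL2 f) (toL2 h) := fun φ => by
  have := H.inner_eq φ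
  rw [zero_add, pow_one, neg_one_mul] at this
  rw [← this]
  exact inner_toL2 H.1 φ.2.partialY.memLp

theorem of_wx (hf : MemLp f 2 cellMeasure) (hh : MemLp h 2 cellMeasure)
    (H : WX (toL2 f) (toL2 h)) : IsWeakDeriv 1 0 f h := ⟨hf, hh, fun φ hφ => by
  have := H ⟨φ, hφ⟩
  change inner ℝ (toL2 f) (toL2 (MHD.partialX φ)) = -inner ℝ (toL2 h) (toL2 φ) at this
  rw [inner_toL2 hf hφ.partialX.memLp, inner_toL2 hh hφ.memLp] at this
  rw [pow_one, neg_one_mul]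
  exact this⟩

theorem of_wy (hf : MemLp f 2 cellMeasure) (hh : MemLp h 2 cellMeasure)
    (H : WY (toL2 f) (toL2 h)) : IsWeakDeriv 0 1 f h := ⟨hf, hh, fun φ hφ => by
  have := H ⟨φ, hφ⟩
  change inner ℝ (toL2 f) (toL2 (MHD.partialY φ)) = -inner ℝ (toL2 h) (toL2 φ) at this
  rw [inner_toL2 hf hφ.partialY.memLp, inner_toL2 hh hφ.memLp] at this
  rw [zero_add, pow_one, neg_one_mul]
  exact this⟩

end IsWeakDeriv

theorem IsInteriorTest.partialY_iterate_partialX {φ : ℝ × ℝ → ℝ} (h : IsInteriorTest φ) (i : ℕ) :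
    MHD.partialY (MHD.partialX^[i] φ) = MHD.partialX^[i] (MHD.partialY φ) := by
  induction i with
  | zero => rfl
  | succ i ih =>
    rw [Function.iterate_succ_apply', Function.iterate_succ_apply', ← ih]
    exact (partialX_partialY_comm (h.iterate i 0).1).symm

namespace IsWeakDeriv

variable {i j : ℕ} {f h k : ℝ × ℝ → ℝ}

/-- A derivative of a test is again a test, so the defining identity of the first derivative can be
applied to it. -/
theorem of_succ_left (H : IsWeakDeriv (i + 1) j f k) (Hx : IsWeakDeriv 1 0 f h) :
    IsWeakDeriv i j h k := ⟨Hx.2.1, H.2.1, fun φ hφ => by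
  have h1 := Hx.2.2 _ (hφ.iterate i j)
  have h2 := H.2.2 φ hφ
  rw [Function.iterate_succ_apply'] at h2
  simp only [Function.iterate_one, Function.iterate_zero, id_eq] at h1
  rw [h2] at h1
  rw [pow_one, neg_one_mul] at h1
  rw [← neg_eq_iff_eq_neg.2 h1]
  ring⟩

theorem of_succ_right (H : IsWeakDeriv i (j + 1) f k) (Hy : IsWeakDeriv 0 1 f h) :
    IsWeakDeriv i j h k := ⟨Hy.2.1, H.2.1, fun φ hφ => by
  have h1 := Hy.2.2 _ (hφ.iterate i j)
  have h2 := H.2.2 φ hφ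
  have hj : IsInteriorTest (partialY^[j] φ) := hφ.iterate 0 j
  rw [Function.iterate_succ_apply', ← hj.partialY_iterate_partialX] at h2
  simp only [Function.iterate_one, Function.iterate_zero, id_eq] at h1 h2
  rw [h2] at h1
  rw [zero_add, pow_one, neg_one_mul] at h1
  rw [← neg_eq_iff_eq_neg.2 h1]
  ring⟩

end IsWeakDeriv

namespace MemH

variable {m : ℕ} {f f' : ℝ × ℝ → ℝ}

theorem isWeakDeriv (hf : MemH m f) {i j : ℕ} (hij : i + j ≤ m) :
    IsWeakDeriv i j f (weakDeriv i j f) := isWeakDeriv_weakDeriv (hf i j hij)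

theorem memLp (hf : MemH m f) : MemLp f 2 cellMeasure := (hf.isWeakDeriv (i := 0) (j := 0) (by simp)).1

theorem of_le {n : ℕ} (hf : MemH n f) (h : m ≤ n) : MemH m f := fun i j hij => hf i j (hij.trans h)

theorem wx (hf : MemH (m + 1) f) : WX (toL2 f) (toL2 (weakDeriv 1 0 f)) :=
  (hf.isWeakDeriv (by omega)).wx

theorem wy (hf : MemH (m + 1) f) : WY (toL2 f) (toL2 (weakDeriv 0 1 f)) :=
  (hf.isWeakDeriv (by omega)).wy

theorem partialX (hf : MemH (m + 1) f) : MemH m (weakDeriv 1 0 f) := fun i j hij =>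
  ⟨_, (hf.isWeakDeriv (i := i + 1) (j := j) (by omega)).of_succ_left (hf.isWeakDeriv (by omega))⟩

theorem partialY (hf : MemH (m + 1) f) : MemH m (weakDeriv 0 1 f) := fun i j hij =>
  ⟨_, (hf.isWeakDeriv (i := i) (j := j + 1) (by omega)).of_succ_right (hf.isWeakDeriv (by omega))⟩

theorem toL2_partialX (hf : MemH (m + 1) f) {i j : ℕ} (hij : i + j ≤ m) :
    toL2 (weakDeriv i j (weakDeriv 1 0 f)) = toL2 (weakDeriv (i + 1) j f) :=
  ((hf.isWeakDeriv (i := i + 1) (j := j) (by omega)).of_succ_left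
    (hf.isWeakDeriv (by omega))).toL2_weakDeriv

theorem toL2_partialY (hf : MemH (m + 1) f) {i j : ℕ} (hij : i + j ≤ m) :
    toL2 (weakDeriv i j (weakDeriv 0 1 f)) = toL2 (weakDeriv i (j + 1) f) :=
  ((hf.isWeakDeriv (i := i) (j := j + 1) (by omega)).of_succ_right
    (hf.isWeakDeriv (by omega))).toL2_weakDeriv

theorem toL2_zero (hf : MemH m f) : toL2 (weakDeriv 0 0 f) = toL2 f :=
  (IsWeakDeriv.self hf.memLp).toL2_weakDeriv

theorem sub (hf : MemH m f) (hf' : MemH m f') : MemH m (f - f') := fun _ _ hij =>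
  ⟨_, (hf.isWeakDeriv hij).sub (hf'.isWeakDeriv hij)⟩

/-- Peeling off one derivative at a time, the recursive bound agrees with a bound on all mixed
derivatives. -/
theorem sobolevBound {M : ℝ} (hf : MemH m f)
    (h : ∀ i j, i + j ≤ m → ‖toL2 (weakDeriv i j f)‖ ≤ M) : SobolevBound m (toL2 f) M := by
  induction m generalizing f with
  | zero =>
    have := h 0 0 le_rfl
    rwa [hf.toL2_zero] at this
  | succ m ih =>
    have h0 := h 0 0 (by omega)
    rw [hf.toL2_zero] at h0
    refine ⟨h0, _, _, hf.wx, hf.wy, ih hf.partialX fun i j hij => ?_, ih hf.partialY fun i j hij => ?_⟩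
    · rw [hf.toL2_partialX hij]
      exact h _ _ (by omega)
    · rw [hf.toL2_partialY hij]
      exact h _ _ (by omega)

theorem norm_weakDeriv_le {M : ℝ} (hf : MemH m f) (h : SobolevBound m (toL2 f) M) {i j : ℕ}
    (hij : i + j ≤ m) : ‖toL2 (weakDeriv i j f)‖ ≤ M := by
  induction m generalizing f i j with
  | zero =>
    obtain ⟨rfl, rfl⟩ : i = 0 ∧ j = 0 := by omega
    rw [hf.toL2_zero]
    exact h
  | succ m ih =>
    rcases i with _ | i
    · rcases j with _ | j
      · rw [hf.toL2_zero]
        exact h.norm_le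
      · rw [← hf.toL2_partialY (by omega)]
        exact ih hf.partialY (h.exists_WY hf.wy) (by omega)
    · rw [← hf.toL2_partialX (by omega)]
      exact ih hf.partialX (h.exists_WX hf.wx) (by omega)

end MemH

theorem IsPeriodicX.tx {f : ℝ × ℝ → ℝ} (h : IsPeriodicX f) (hf : MemLp f 2 cellMeasure) :
    TX (toL2 f) (toL2 (weakDeriv 1 0 f)) := fun φ => by
  have := h φ.1 φ.2
  change inner ℝ (toL2 f) (toL2 (partialX φ.1)) = -inner ℝ (toL2 (weakDeriv 1 0 f)) (toL2 φ.1)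
  rwa [inner_toL2 hf φ.2.partialX.memLp, inner_toL2 (memLp_weakDeriv _ _ _) φ.2.memLp]

section TorusTests

variable {φ : ℝ × ℝ → ℝ}

theorem IsTorusTest.isWeakDeriv_partialX (h : IsTorusTest φ) :
    IsWeakDeriv 1 0 φ (MHD.partialX φ) :=
  IsWeakDeriv.of_wx h.memLp h.partialX.memLp (TX_testT ⟨φ, h⟩).wx

theorem IsTorusTest.isWeakDeriv_partialY (h : IsTorusTest φ) :
    IsWeakDeriv 0 1 φ (MHD.partialY φ) := by
  have m1 : MemLp (MHD.partialY φ) 2 cellMeasure :=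
    memLp_of_continuous (contDiff_partialY h.1).continuous 2
  refine ⟨h.memLp, m1, fun ψ hψ => ?_⟩
  have i1 : Integrable (fun z => φ z * MHD.partialY ψ z) cellMeasure :=
    h.memLp.integrable_mul hψ.partialY.memLp
  have i2 : Integrable (fun z => MHD.partialY φ z * ψ z) cellMeasure := m1.integrable_mul hψ.memLp
  simp only [Function.iterate_one, Function.iterate_zero, id_eq]
  rw [cellMeasure_eq_prod] at i1 i2 ⊢
  rw [integral_prod _ i1, integral_prod _ i2, zero_add, pow_one, neg_one_mul, ← integral_neg]
  refine integral_congr_ae (Eventually.of_forall fun x => ?_)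
  exact isPeriodicWeakDeriv_deriv (u := fun y => φ (x, y)) (ψ := fun y => ψ (x, y))
    (h.1.comp (by fun_prop : ContDiff ℝ ∞ fun y : ℝ => (x, y))) (h.2.2 x)
    (hψ.1.comp (by fun_prop : ContDiff ℝ ∞ fun y : ℝ => (x, y))) (hψ.2.1 x)

theorem IsTorusTest.memH_one (h : IsTorusTest φ) : MemH 1 φ := fun i j hij => by
  have : (i = 0 ∧ j = 0) ∨ (i = 1 ∧ j = 0) ∨ (i = 0 ∧ j = 1) := by omega
  obtain ⟨rfl, rfl⟩ | ⟨rfl, rfl⟩ | ⟨rfl, rfl⟩ := this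
  · exact ⟨_, IsWeakDeriv.self h.memLp⟩
  · exact ⟨_, h.isWeakDeriv_partialX⟩
  · exact ⟨_, h.isWeakDeriv_partialY⟩

theorem IsTorusTest.isPeriodicX (h : IsTorusTest φ) : IsPeriodicX φ := fun ψ hψ => by
  have := TX_testT ⟨φ, h⟩ ⟨ψ, hψ⟩
  change inner ℝ (toL2 φ) (toL2 (MHD.partialX ψ)) = -inner ℝ (toL2 (MHD.partialX φ)) (toL2 ψ) at this
  rwa [← h.isWeakDeriv_partialX.toL2_weakDeriv, inner_toL2 h.memLp hψ.partialX.memLp,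
    inner_toL2 (memLp_weakDeriv _ _ _) hψ.memLp] at this

end TorusTests

/-! ### The growth rate as a supremum over the cell and over normal modes -/

section Suprema

/-- The constant `K` serves twice: it makes the set of ratios bounded, and it gives the inequality
when the denominator vanishes. -/
theorem le_sSup_ratio_mul {ι : Type*} {P : ι → Prop} {N D : ι → ℝ} {K : ℝ}
    (hK : ∀ w, P w → N w ≤ K * D w) (hD : ∀ w, P w → 0 ≤ D w) {w : ι} (hw : P w) :
    N w ≤ sSup {r | ∃ w, P w ∧ 0 < D w ∧ r = N w / D w} * D w := by
  rcases (hD w hw).eq_or_lt with h | h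
  · have := hK w hw
    rwa [← h, mul_zero] at this ⊢
  · rw [← div_le_iff₀ h]
    refine le_csSup ⟨K, ?_⟩ ⟨w, hw, h, rfl⟩
    rintro _ ⟨w, hw, h, rfl⟩
    exact (div_le_iff₀ h).2 (hK w hw)

/-- Positivity of the supremum excludes the empty set of ratios, whose supremum is `0` by
convention. -/
theorem exists_lt_of_lt_sSup_ratio {ι : Type*} {P : ι → Prop} {N D : ι → ℝ} {μ : ℝ}
    (h0 : 0 < sSup {r | ∃ w, P w ∧ 0 < D w ∧ r = N w / D w})
    (h : μ < sSup {r | ∃ w, P w ∧ 0 < D w ∧ r = N w / D w}) :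
    ∃ w, P w ∧ μ * D w < N w := by
  have hne : {r | ∃ w, P w ∧ 0 < D w ∧ r = N w / D w}.Nonempty := by
    by_contra hne
    rw [not_nonempty_iff_eq_empty.1 hne, Real.sSup_empty] at h0
    exact lt_irrefl _ h0
  obtain ⟨_, ⟨w, hw, hD, rfl⟩, hr⟩ := exists_lt_of_lt_csSup hne h
  exact ⟨w, hw, (lt_div_iff₀ hD).1 hr⟩

/-- Nonnegativity of `c` covers the empty set of ratios. -/
theorem sSup_ratio_le {ι : Type*} {P : ι → Prop} {N D : ι → ℝ} {c : ℝ} (hc : 0 ≤ c)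
    (h : ∀ w, P w → N w ≤ c * D w) :
    sSup {r | ∃ w, P w ∧ 0 < D w ∧ r = N w / D w} ≤ c ∧
      BddAbove {r | ∃ w, P w ∧ 0 < D w ∧ r = N w / D w} := by
  have : ∀ r ∈ {r | ∃ w, P w ∧ 0 < D w ∧ r = N w / D w}, r ≤ c := by
    rintro _ ⟨w, hw, hD, rfl⟩
    exact (div_le_iff₀ hD).2 (h w hw)
  exact ⟨Real.sSup_le this hc, c, this⟩

end Suprema

/-! ### Rayleigh quotients as quadratic forms on `L²(D)`. -/

section Rates

variable {ρ H : Coef} {h : ℝ → ℝ}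

theorem Coef.integral_mul_sq_toL2 (c : Coef) {e : ℝ → ℝ}
    (he : ∀ x ∈ Ioo 0 (2 * Real.pi), e x = c x) {w : ℝ × ℝ → ℝ} (hw : MemLp w 2 cellMeasure) :
    ∫ z, e z.1 * w z ^ 2 ∂cellMeasure = inner ℝ (c.op (toL2 w)) (toL2 w) := by
  rw [c.inner_op_self]
  refine integral_congr_ae ?_
  filter_upwards [coe_toL2 hw, ae_mem_cell] with z hz hz'
  rw [hz, he _ hz'.1]

theorem Coef.integral_mul_sq_congr (c : Coef) {e u : ℝ → ℝ}
    (he : ∀ x ∈ Ioo 0 (2 * Real.pi), e x = c x) :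
    ∫ x, e x * u x ^ 2 ∂intervalMeasure = ∫ x, c x * u x ^ 2 ∂intervalMeasure :=
  setIntegral_congr_fun measurableSet_Ioo fun x hx => by simp only [he x hx]

theorem Coef.inner_op_le_mul (hρ : ρ.Pos) (H : Coef) :
    ∃ K, ∀ w : CellL2, inner ℝ (H.op w) w ≤ K * inner ℝ (ρ.op w) w := by
  obtain ⟨κ, hκ, h⟩ := hρ.exists_norm_sq_le
  refine ⟨H.bound * κ, fun w => (le_abs_self _).trans ((H.abs_inner_op_le w).trans ?_)⟩
  rw [mul_assoc]
  exact mul_le_mul_of_nonneg_left (h w) H.bound_nonneg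

theorem LambdaSqL2.form_le (hρ : ρ.Pos) (he : ∀ x ∈ Ioo 0 (2 * Real.pi), h x = H x) (w : CellL2) :
    inner ℝ (H.op w) w ≤ LambdaSqL2 ρ h * inner ℝ (ρ.op w) w := by
  obtain ⟨K, hK⟩ := Coef.inner_op_le_mul hρ H
  have hw := Lp.memLp w
  have := le_sSup_ratio_mul (P := fun w : ℝ × ℝ → ℝ => MemLp w 2 cellMeasure)
    (N := fun w => ∫ z, h z.1 * w z ^ 2 ∂cellMeasure)
    (D := fun w => ∫ z, ρ z.1 * w z ^ 2 ∂cellMeasure) (K := K) (fun w hw => by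
      rw [H.integral_mul_sq_toL2 he hw, ρ.integral_mul_sq_toL2 (fun _ _ => rfl) hw]
      exact hK _) (fun w hw => by
      rw [ρ.integral_mul_sq_toL2 (fun _ _ => rfl) hw]
      exact hρ.inner_op_nonneg _) hw
  rwa [H.integral_mul_sq_toL2 he hw, ρ.integral_mul_sq_toL2 (fun _ _ => rfl) hw, toL2_coe] at this

/-- A strict inequality between forms continuous on `L²` holds on an open set, which contains a
torus test by density. -/
theorem LambdaSqL2.exists_test (he : ∀ x ∈ Ioo 0 (2 * Real.pi), h x = H x)
    (h0 : 0 < LambdaSqL2 ρ h) {μ : ℝ} (hμ : μ < LambdaSqL2 ρ h) :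
    ∃ φ : torusTests, μ * inner ℝ (ρ.op (testT φ)) (testT φ) <
      inner ℝ (H.op (testT φ)) (testT φ) := by
  obtain ⟨w, hw, hlt⟩ := exists_lt_of_lt_sSup_ratio
    (P := fun w : ℝ × ℝ → ℝ => MemLp w 2 cellMeasure)
    (N := fun w => ∫ z, h z.1 * w z ^ 2 ∂cellMeasure)
    (D := fun w => ∫ z, ρ z.1 * w z ^ 2 ∂cellMeasure) h0 hμ
  rw [H.integral_mul_sq_toL2 he hw, ρ.integral_mul_sq_toL2 (fun _ _ => rfl) hw] at hlt
  exact dense_testT.exists_mem_open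
    (isOpen_lt (f := fun w : CellL2 => μ * inner ℝ (ρ.op w) w)
      (g := fun w : CellL2 => inner ℝ (H.op w) w) (by fun_prop) (by fun_prop)) ⟨_, hlt⟩

/-- A test function on which a Rayleigh quotient exceeds `μ` provides a smooth periodic function on
the interval with this property. -/
theorem exists_mode {B μ Λsq : ℝ}
    (hf : ∀ w wx, TX w wx → inner ℝ (H.op w) w - B * ‖wx‖ ^ 2 ≤ Λsq * inner ℝ (ρ.op w) w)
    (hρ : ρ.Pos) {φ : torusTests} (h : μ * inner ℝ (ρ.op (testT φ)) (testT φ) <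
      inner ℝ (H.op (testT φ)) (testT φ) - B * ‖testT (dXT φ)‖ ^ 2) :
    ∃ u : ℝ → ℝ, ContDiff ℝ ∞ u ∧ (∀ x, u (x + 2 * Real.pi) = u x) ∧
      0 < ∫ x, ρ x * u x ^ 2 ∂intervalMeasure ∧
      μ * ∫ x, ρ x * u x ^ 2 ∂intervalMeasure <
        ∫ x, H x * u x ^ 2 ∂intervalMeasure - B * ∫ x, deriv u x ^ 2 ∂intervalMeasure := by
  obtain ⟨u, h1, h2, h3⟩ := exists_slice h
  refine ⟨u, h1, h2, ?_, h3⟩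
  have h4 : 0 ≤ ∫ x, ρ x * u x ^ 2 ∂intervalMeasure :=
    setIntegral_nonneg measurableSet_Ioo fun x hx =>
      mul_nonneg (hρ x (Ioo_subset_Icc_self hx)).le (sq_nonneg _)
  -- If the weighted norm of `u` vanished, the form inequality would make its numerator nonpositive,
  -- against the strict inequality on the slice.
  refine h4.lt_of_ne fun h5 => ?_
  have h6 := form_fst hf (ContDiff.isPeriodicWeakDeriv_one h1 h2)
  rw [← h5, mul_zero] at h3 h6
  linarith

theorem integral_weight_add (hρ : ρ.Pos) {u v : ℝ → ℝ} (hu : MemLp u 2 intervalMeasure)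
    (hv : MemLp v 2 intervalMeasure) (c : ℝ) :
    ∫ x, ρ x * (u x ^ 2 + v x ^ 2 / c ^ 2) ∂intervalMeasure =
      ∫ x, ρ x * u x ^ 2 ∂intervalMeasure + (∫ x, ρ x * v x ^ 2 ∂intervalMeasure) / c ^ 2 ∧
    0 ≤ ∫ x, ρ x * v x ^ 2 ∂intervalMeasure := by
  refine ⟨?_, setIntegral_nonneg measurableSet_Ioo fun x hx =>
      mul_nonneg (hρ x (Ioo_subset_Icc_self hx)).le (sq_nonneg _)⟩
  rw [← integral_div, ← integral_add (ρ.integrable_mul_sq hu) ((ρ.integrable_mul_sq hv).div_const _)]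
  congr 1 with x
  ring

theorem div_mem_ratio {ι : Type*} {P : ι → Prop} {N D : ι → ℝ} {n d : ℝ} (w : ι) (hw : P w)
    (hn : N w = n) (hd : D w = d) (h : 0 < d) :
    n / d ∈ {r | ∃ w, P w ∧ 0 < D w ∧ r = N w / D w} :=
  ⟨w, hw, hd ▸ h, by rw [hn, hd]⟩

/-- The rates of the normal modes of the incompressible systems, as suprema of ratios. -/
theorem modes_incompressible {b Λsq : ℝ} (hρ : ρ.Pos) (hΛ : 0 ≤ Λsq)
    (hf : ∀ w wx, TX w wx → inner ℝ (H.op w) w - b ^ 2 * ‖wx‖ ^ 2 ≤ Λsq * inner ℝ (ρ.op w) w)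
    (htest : ∀ μ < Λsq, ∃ φ : torusTests, μ * inner ℝ (ρ.op (testT φ)) (testT φ) <
      inner ℝ (H.op (testT φ)) (testT φ) - b ^ 2 * ‖testT (dXT φ)‖ ^ 2)
    {lam : ℕ → ℝ} {P : (ℝ → ℝ) × (ℝ → ℝ) × (ℝ → ℝ) → Prop}
    (hP : ∀ w, P w → IsPeriodicWeakDeriv 1 w.1 w.2.1 ∧ MemLp w.2.2 2 intervalMeasure)
    (hP' : ∀ u : ℝ → ℝ, ContDiff ℝ ∞ u → (∀ x, u (x + 2 * Real.pi) = u x) →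
      ∃ u'', MemLp u'' 2 intervalMeasure ∧ P (u, deriv u, u''))
    (hlam : ∀ k, lam k = sSup {r | ∃ w : (ℝ → ℝ) × (ℝ → ℝ) × (ℝ → ℝ), P w ∧
      0 < ∫ x, ρ x * (w.1 x ^ 2 + w.2.1 x ^ 2 / k ^ 2) ∂intervalMeasure ∧
      r = (∫ x, H x * w.1 x ^ 2 ∂intervalMeasure - b ^ 2 * ∫ x, w.2.1 x ^ 2 ∂intervalMeasure -
        (b ^ 2 * ∫ x, w.2.2 x ^ 2 ∂intervalMeasure) / k ^ 2) /
        ∫ x, ρ x * (w.1 x ^ 2 + w.2.1 x ^ 2 / k ^ 2) ∂intervalMeasure}) :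
    IsSupremumOfModes lam Λsq := by
  have key : ∀ k : ℕ, ∀ w : (ℝ → ℝ) × (ℝ → ℝ) × (ℝ → ℝ), P w →
      ∫ x, H x * w.1 x ^ 2 ∂intervalMeasure - b ^ 2 * ∫ x, w.2.1 x ^ 2 ∂intervalMeasure -
        (b ^ 2 * ∫ x, w.2.2 x ^ 2 ∂intervalMeasure) / k ^ 2 ≤
      Λsq * ∫ x, ρ x * (w.1 x ^ 2 + w.2.1 x ^ 2 / k ^ 2) ∂intervalMeasure := fun k w hw => by
    obtain ⟨h1, h2⟩ := hP w hw
    obtain ⟨e1, e2⟩ := integral_weight_add hρ h1.1 h1.2.1 k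
    have e3 := form_fst hf h1
    have e4 : 0 ≤ (b ^ 2 * ∫ x, w.2.2 x ^ 2 ∂intervalMeasure) / (k : ℝ) ^ 2 :=
      div_nonneg (mul_nonneg (sq_nonneg _) (integral_nonneg fun x => sq_nonneg _)) (sq_nonneg _)
    rw [e1, mul_add]
    have e5 : 0 ≤ Λsq * ((∫ x, ρ x * w.2.1 x ^ 2 ∂intervalMeasure) / (k : ℝ) ^ 2) :=
      mul_nonneg hΛ (div_nonneg e2 (sq_nonneg _))
    linarith
  refine isSupremumOfModes_of (fun k _ => ?_) fun μ hμ => ?_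
  · rw [hlam]
    exact (sSup_ratio_le hΛ (key k)).1
  · obtain ⟨φ, hφ⟩ := htest μ hμ
    obtain ⟨u, h1, h2, h3, h4⟩ := exists_mode hf hρ hφ
    obtain ⟨u'', h5, h6⟩ := hP' u h1 h2
    simp only [hlam]
    -- The same slice `u` is tried for every `k`; `E` and `D` collect the terms with `1/k²` in
    -- numerator and denominator.
    refine eventually_lt_sSup (fun k _ => (sSup_ratio_le hΛ (key k)).2)
      (E := b ^ 2 * ∫ x, u'' x ^ 2 ∂intervalMeasure)
      (D := ∫ x, ρ x * deriv u x ^ 2 ∂intervalMeasure) h3 (fun k hk => ?_) h4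
    obtain ⟨e1, e2⟩ := integral_weight_add hρ (hP _ h6).1.1 (hP _ h6).1.2.1 k
    exact div_mem_ratio (P := P) (u, deriv u, u'') h6 rfl e1
      (add_pos_of_pos_of_nonneg h3 (div_nonneg e2 (sq_nonneg _)))

end Rates

/-! ### Modes, case 1: incompressible, field orthogonal to gravity. -/

section PerpIncompressible

variable {ρ : Coef} {g : ℝ}

/-- The potential `-g ρ'`. -/
def Coef.buoyancy (ρ : Coef) (g : ℝ) : Coef := ρ.d.smul (-g)

theorem Coef.buoyancy_eq (ρ : Coef) (g : ℝ) {x : ℝ} (hx : x ∈ Ioo 0 (2 * Real.pi)) :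
    -g * deriv ρ x = ρ.buoyancy g x := by
  rw [ρ.deriv_eq hx]
  rfl

theorem Coef.inner_buoyancy (ρ : Coef) (g : ℝ) (w : CellL2) :
    inner ℝ ((ρ.buoyancy g).op w) w = -g * inner ℝ (ρ.d.op w) w := by
  rw [buoyancy, Coef.op_smul, real_inner_smul_left]

theorem incompressibleForm_iff {b Λ : ℝ} : IncompressibleForm g b ρ Λ ↔ ∀ w wx, TX w wx →
    inner ℝ ((ρ.buoyancy g).op w) w - b ^ 2 * ‖wx‖ ^ 2 ≤ Λ ^ 2 * inner ℝ (ρ.op w) w := by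
  simp only [IncompressibleForm, Coef.inner_buoyancy]

theorem LambdaSqPerpIncompressible.form_le (hρ : ρ.Pos) (w wx : CellL2) (_ : TX w wx) :
    inner ℝ ((ρ.buoyancy g).op w) w - (0 : ℝ) ^ 2 * ‖wx‖ ^ 2 ≤
      LambdaSqPerpIncompressible g ρ * inner ℝ (ρ.op w) w := by
  rw [zero_pow two_ne_zero, zero_mul, sub_zero]
  exact LambdaSqL2.form_le hρ (fun x hx => ρ.buoyancy_eq g hx) w

theorem modes_perpIncompressible (hρ : ρ.Pos) (h0 : 0 < LambdaSqPerpIncompressible g ρ) :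
    IsSupremumOfModes (lambdaSqPerpIncompressible g ρ) (LambdaSqPerpIncompressible g ρ) := by
  -- With `b = 0` the second derivative carries no weight, and the zero function stands in for it.
  refine modes_incompressible (H := ρ.buoyancy g) (b := 0) hρ h0.le
    (LambdaSqPerpIncompressible.form_le hρ) (fun μ hμ => ?_)
    (P := fun w => IsPeriodicWeakDeriv 1 w.1 w.2.1 ∧ MemLp w.2.2 2 intervalMeasure)
    (fun w hw => hw) (fun u h1 h2 => ⟨0, MemLp.zero, ContDiff.isPeriodicWeakDeriv_one h1 h2,
      MemLp.zero⟩) (fun k => congrArg sSup (Set.ext fun r => ?_))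
  · obtain ⟨φ, hφ⟩ := LambdaSqL2.exists_test (fun x hx => ρ.buoyancy_eq g hx) h0 hμ
    exact ⟨φ, by rwa [zero_pow two_ne_zero, zero_mul, sub_zero]⟩
  · have e : ∀ u : ℝ → ℝ, ∫ x, -g * deriv ρ x * u x ^ 2 ∂intervalMeasure =
        ∫ x, ρ.buoyancy g x * u x ^ 2 ∂intervalMeasure := fun u =>
      Coef.integral_mul_sq_congr _ fun x hx => ρ.buoyancy_eq g hx
    constructor
    · rintro ⟨u, u', h1, h2, h3⟩
      refine ⟨(u, u', 0), ⟨h1, MemLp.zero⟩, h2, ?_⟩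
      rw [h3, e]
      simp
    · rintro ⟨⟨u, u', u''⟩, ⟨h1, -⟩, h2, h3⟩
      refine ⟨u, u', h1, h2, ?_⟩
      rw [h3, e]
      simp

end PerpIncompressible

/-! ### Modes, case 3: incompressible, field parallel to gravity. -/

section ParIncompressible

variable {ρ : Coef} {g b : ℝ}

theorem par_numerator {w : ℝ × ℝ → ℝ} (hw : MemLp w 2 cellMeasure) :
    ∫ z, (-g * deriv ρ z.1 * w z ^ 2 - b ^ 2 * weakDeriv 1 0 w z ^ 2) ∂cellMeasure =
      inner ℝ ((ρ.buoyancy g).op (toL2 w)) (toL2 w) - b ^ 2 * ‖toL2 (weakDeriv 1 0 w)‖ ^ 2 := by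
  have m := memLp_weakDeriv 1 0 w
  rw [norm_toL2_sq m, ← (ρ.buoyancy g).integral_mul_sq_toL2 (fun _ _ => rfl) hw,
    ← integral_const_mul, ← integral_sub ((ρ.buoyancy g).integrable_op_sq hw)
      (m.integrable_sq.const_mul _)]
  refine integral_congr_ae ?_
  filter_upwards [ae_mem_cell] with z hz
  rw [ρ.buoyancy_eq g hz.1]

theorem lambdaSqPar_eq : LambdaSqParIncompressible g b ρ =
    sSup {r | ∃ w : ℝ × ℝ → ℝ, (MemH 1 w ∧ IsPeriodicX w) ∧
      0 < ∫ z, ρ z.1 * w z ^ 2 ∂cellMeasure ∧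
      r = (∫ z, (-g * deriv ρ z.1 * w z ^ 2 - b ^ 2 * weakDeriv 1 0 w z ^ 2) ∂cellMeasure) /
        ∫ z, ρ z.1 * w z ^ 2 ∂cellMeasure} := by
  simp only [LambdaSqParIncompressible, and_assoc]

/-- The supremum runs over `H¹` functions, whereas the displacement is only known to have an
`x`-derivative. The inequality for tests extends to it by density in the graph norm of `∂ₓ`. -/
theorem LambdaSqParIncompressible.form_le (hρ : ρ.Pos) (w wx : CellL2) (h : TX w wx) :
    inner ℝ ((ρ.buoyancy g).op w) w - b ^ 2 * ‖wx‖ ^ 2 ≤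
      LambdaSqParIncompressible g b ρ * inner ℝ (ρ.op w) w := by
  refine TX.of_isClosed (p := fun z : CellL2 × CellL2 => inner ℝ ((ρ.buoyancy g).op z.1) z.1 -
    b ^ 2 * ‖z.2‖ ^ 2 ≤ LambdaSqParIncompressible g b ρ * inner ℝ (ρ.op z.1) z.1)
    (isClosed_le (by fun_prop) (by fun_prop)) (fun φ => ?_) h
  obtain ⟨K, hK⟩ := Coef.inner_op_le_mul hρ (ρ.buoyancy g)
  have hφ := φ.2
  have := le_sSup_ratio_mul (P := fun w : ℝ × ℝ → ℝ => MemH 1 w ∧ IsPeriodicX w)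
    (N := fun w => ∫ z, (-g * deriv ρ z.1 * w z ^ 2 - b ^ 2 * weakDeriv 1 0 w z ^ 2) ∂cellMeasure)
    (D := fun w => ∫ z, ρ z.1 * w z ^ 2 ∂cellMeasure) (K := K) (fun w hw => by
      rw [par_numerator hw.1.memLp, ρ.integral_mul_sq_toL2 (fun _ _ => rfl) hw.1.memLp]
      have h1 : 0 ≤ b ^ 2 * ‖toL2 (weakDeriv 1 0 w)‖ ^ 2 := by positivity
      linarith [hK (toL2 w)]) (fun w hw => by
      rw [ρ.integral_mul_sq_toL2 (fun _ _ => rfl) hw.1.memLp]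
      exact hρ.inner_op_nonneg _) ⟨hφ.memH_one, hφ.isPeriodicX⟩
  rwa [par_numerator hφ.memLp, ρ.integral_mul_sq_toL2 (fun _ _ => rfl) hφ.memLp,
    hφ.isWeakDeriv_partialX.toL2_weakDeriv, ← lambdaSqPar_eq] at this

/-- If every test satisfied the reverse inequality, graph density would pass it on to the
near-maximizer `w`. -/
theorem LambdaSqParIncompressible.exists_test (h0 : 0 < LambdaSqParIncompressible g b ρ) {μ : ℝ}
    (hμ : μ < LambdaSqParIncompressible g b ρ) :
    ∃ φ : torusTests, μ * inner ℝ (ρ.op (testT φ)) (testT φ) <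
      inner ℝ ((ρ.buoyancy g).op (testT φ)) (testT φ) - b ^ 2 * ‖testT (dXT φ)‖ ^ 2 := by
  rw [lambdaSqPar_eq] at h0 hμ
  obtain ⟨w, hw, hlt⟩ := exists_lt_of_lt_sSup_ratio
    (P := fun w : ℝ × ℝ → ℝ => MemH 1 w ∧ IsPeriodicX w)
    (N := fun w => ∫ z, (-g * deriv ρ z.1 * w z ^ 2 - b ^ 2 * weakDeriv 1 0 w z ^ 2) ∂cellMeasure)
    (D := fun w => ∫ z, ρ z.1 * w z ^ 2 ∂cellMeasure) h0 hμ
  rw [par_numerator hw.1.memLp, ρ.integral_mul_sq_toL2 (fun _ _ => rfl) hw.1.memLp] at hlt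
  by_contra! hcon
  exact absurd hlt (not_lt.2 (TX.of_isClosed (p := fun z : CellL2 × CellL2 =>
    inner ℝ ((ρ.buoyancy g).op z.1) z.1 - b ^ 2 * ‖z.2‖ ^ 2 ≤ μ * inner ℝ (ρ.op z.1) z.1)
    (isClosed_le (by fun_prop) (by fun_prop)) hcon (hw.2.tx hw.1.memLp)))

theorem modes_parIncompressible (hρ : ρ.Pos) (h0 : 0 < LambdaSqParIncompressible g b ρ) :
    IsSupremumOfModes (lambdaSqParIncompressible g b ρ) (LambdaSqParIncompressible g b ρ) := by
  refine modes_incompressible (H := ρ.buoyancy g) (b := b) hρ h0.le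
    (LambdaSqParIncompressible.form_le hρ) (fun μ hμ => LambdaSqParIncompressible.exists_test h0 hμ)
    (P := fun w => IsPeriodicWeakDeriv 1 w.1 w.2.1 ∧ IsPeriodicWeakDeriv 2 w.1 w.2.2)
    (fun w hw => ⟨hw.1, hw.2.2.1⟩) (fun u h1 h2 => ⟨_, (ContDiff.isPeriodicWeakDeriv_two h1 h2).2.1,
      ContDiff.isPeriodicWeakDeriv_one h1 h2, ContDiff.isPeriodicWeakDeriv_two h1 h2⟩)
    (fun k => congrArg sSup (Set.ext fun r => ?_))
  have e : ∀ u u' u'' : ℝ → ℝ, MemLp u 2 intervalMeasure → MemLp u' 2 intervalMeasure →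
      MemLp u'' 2 intervalMeasure →
      ∫ x, (-b ^ 2 * (u'' x ^ 2 / k ^ 2) - g * deriv ρ x * u x ^ 2 - b ^ 2 * u' x ^ 2)
        ∂intervalMeasure = ∫ x, ρ.buoyancy g x * u x ^ 2 ∂intervalMeasure -
        b ^ 2 * ∫ x, u' x ^ 2 ∂intervalMeasure -
        (b ^ 2 * ∫ x, u'' x ^ 2 ∂intervalMeasure) / k ^ 2 := fun u u' u'' m m' m'' => by
    have i1 := (ρ.buoyancy g).integrable_mul_sq m
    have i2 := m'.integrable_sq.const_mul (b ^ 2)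
    have i3 := (m''.integrable_sq.const_mul (b ^ 2)).div_const ((k : ℝ) ^ 2)
    have i4 : Integrable (fun x => ρ.buoyancy g x * u x ^ 2 - b ^ 2 * u' x ^ 2) intervalMeasure :=
      i1.sub i2
    rw [← integral_const_mul, ← integral_const_mul, ← integral_div, ← integral_sub i1 i2,
      ← integral_sub i4 i3]
    refine setIntegral_congr_fun measurableSet_Ioo fun x hx => ?_
    rw [← ρ.buoyancy_eq g hx]
    ring
  constructor
  · rintro ⟨u, u', u'', h1, h2, h3, h4⟩
    refine ⟨(u, u', u''), ⟨h1, h2⟩, h3, ?_⟩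
    rw [h4, e u u' u'' h1.1 h1.2.1 h2.2.1]
  · rintro ⟨⟨u, u', u''⟩, ⟨h1, h2⟩, h3, h4⟩
    refine ⟨u, u', u'', h1, h2, h3, ?_⟩
    rw [h4, e u u' u'' h1.1 h1.2.1 h2.2.1]

end ParIncompressible

/-! ### Modes, case 2: compressible, field orthogonal to gravity. -/

section PerpCompressible

variable {ρ a H : Coef} {g : ℝ}

/-- The rates of the normal modes of the compressible system. -/
theorem modes_compressible {Λsq : ℝ} (hρ : ρ.Pos) (ha : a.Pos) (hΛ : 0 ≤ Λsq)
    (hf : ∀ w, inner ℝ (H.op w) w ≤ Λsq * inner ℝ (ρ.op w) w)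
    (htest : ∀ μ < Λsq, ∃ φ : torusTests, μ * inner ℝ (ρ.op (testT φ)) (testT φ) <
      inner ℝ (H.op (testT φ)) (testT φ))
    {lam : ℕ → ℝ} (hlam : ∀ k, lam k = sSup {r | ∃ w : (ℝ → ℝ) × (ℝ → ℝ) × (ℝ → ℝ),
      (IsPeriodicWeakDeriv 1 w.1 w.2.1 ∧ MemLp w.2.2 2 intervalMeasure) ∧
      0 < ∫ x, ρ x * (w.1 x ^ 2 + w.2.2 x ^ 2) ∂intervalMeasure ∧
      r = (∫ x, (-a x * (w.2.1 x + k * w.2.2 x + g * ρ x / a x * w.1 x) ^ 2 + H x * w.1 x ^ 2)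
        ∂intervalMeasure) / ∫ x, ρ x * (w.1 x ^ 2 + w.2.2 x ^ 2) ∂intervalMeasure}) :
    IsSupremumOfModes lam Λsq := by
  have hf' : ∀ w wx, TX w wx →
      inner ℝ (H.op w) w - 0 * ‖wx‖ ^ 2 ≤ Λsq * inner ℝ (ρ.op w) w := fun w wx _ => by
    rw [zero_mul, sub_zero]; exact hf w
  set e := (ρ.smul g).mul (a.inv ha) with he
  have memLp_mul : ∀ {u : ℝ → ℝ}, MemLp u 2 intervalMeasure →
      MemLp (fun x => g * ρ x / a x * u x) 2 intervalMeasure := fun hu => by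
    refine hu.of_le_mul (c := e.bound) (AEStronglyMeasurable.mul ?_ hu.1)
      ((ae_restrict_iff' measurableSet_Ioo).2 (Eventually.of_forall fun x hx => ?_))
    · exact (e.2.continuousOn.mono Ioo_subset_Icc_self).aestronglyMeasurable measurableSet_Ioo
    · rw [norm_mul]
      gcongr
      exact e.abs_le_bound (Ioo_subset_Icc_self hx)
  have weight : ∀ {u v : ℝ → ℝ}, MemLp u 2 intervalMeasure → MemLp v 2 intervalMeasure →
      ∫ x, ρ x * (u x ^ 2 + v x ^ 2) ∂intervalMeasure = ∫ x, ρ x * u x ^ 2 ∂intervalMeasure +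
        ∫ x, ρ x * v x ^ 2 ∂intervalMeasure ∧ 0 ≤ ∫ x, ρ x * v x ^ 2 ∂intervalMeasure :=
    fun hu hv => by simpa using integral_weight_add hρ hu hv 1
  have key : ∀ k : ℕ, ∀ w : (ℝ → ℝ) × (ℝ → ℝ) × (ℝ → ℝ),
      (IsPeriodicWeakDeriv 1 w.1 w.2.1 ∧ MemLp w.2.2 2 intervalMeasure) →
      ∫ x, (-a x * (w.2.1 x + k * w.2.2 x + g * ρ x / a x * w.1 x) ^ 2 + H x * w.1 x ^ 2)
        ∂intervalMeasure ≤ Λsq * ∫ x, ρ x * (w.1 x ^ 2 + w.2.2 x ^ 2) ∂intervalMeasure :=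
    fun k w ⟨h1, h2⟩ => by
    obtain ⟨e1, e2⟩ := weight h1.1 h2
    have e3 := form_fst hf' h1
    rw [zero_mul, sub_zero] at e3
    have m : MemLp (fun x => w.2.1 x + k * w.2.2 x + g * ρ x / a x * w.1 x) 2 intervalMeasure :=
      (h1.2.1.add (h2.const_mul _)).add (memLp_mul h1.1)
    have i1 := (a.smul (-1)).integrable_mul_sq m
    have i2 := H.integrable_mul_sq h1.1
    -- The square enters with a negative sign and is dropped, which leaves the form on the cell.
    have e4 : ∫ x, (-a x * (w.2.1 x + k * w.2.2 x + g * ρ x / a x * w.1 x) ^ 2 + H x * w.1 x ^ 2)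
        ∂intervalMeasure ≤ ∫ x, H x * w.1 x ^ 2 ∂intervalMeasure := by
      refine setIntegral_mono_on ?_ i2 measurableSet_Ioo fun x hx => ?_
      · refine (i1.add i2).congr (Eventually.of_forall fun x => ?_)
        change -1 * a x * _ + _ = _
        ring
      · have := mul_nonneg (ha x (Ioo_subset_Icc_self hx)).le
          (sq_nonneg (w.2.1 x + k * w.2.2 x + g * ρ x / a x * w.1 x))
        linarith
    rw [e1, mul_add]
    linarith [mul_nonneg hΛ e2]
  refine isSupremumOfModes_of (fun k _ => ?_) fun μ hμ => ?_
  · rw [hlam]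
    exact (sSup_ratio_le hΛ (key k)).1
  · obtain ⟨φ, hφ⟩ := htest μ hμ
    obtain ⟨u, h1, h2, h3, h4⟩ := exists_mode (μ := μ) (φ := φ) hf' hρ (by rwa [zero_mul, sub_zero])
    rw [zero_mul, sub_zero] at h4
    simp only [hlam]
    have hu := ContDiff.isPeriodicWeakDeriv_one h1 h2
    have mv : MemLp (fun x => deriv u x + g * ρ x / a x * u x) 2 intervalMeasure :=
      hu.2.1.add (memLp_mul hu.1)
    refine eventually_lt_sSup (fun k _ => (sSup_ratio_le hΛ (key k)).2) (E := 0)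
      (D := ∫ x, ρ x * (deriv u x + g * ρ x / a x * u x) ^ 2 ∂intervalMeasure) h3
      (fun k hk => ?_) h4
    have hk0 : (k : ℝ) ≠ 0 := by exact_mod_cast (by omega : k ≠ 0)
    obtain ⟨e1, e2⟩ := integral_weight_add hρ hu.1 mv k
    -- The second component is chosen to annihilate the square. It is of size `1/k`, so it adds only
    -- `D / k²` to the denominator.
    refine div_mem_ratio (P := fun w : (ℝ → ℝ) × (ℝ → ℝ) × (ℝ → ℝ) =>
      IsPeriodicWeakDeriv 1 w.1 w.2.1 ∧ MemLp w.2.2 2 intervalMeasure)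
      (u, deriv u, fun x => (-1 / k) * (deriv u x + g * ρ x / a x * u x)) ⟨hu, mv.const_mul _⟩ ?_ ?_
      (add_pos_of_pos_of_nonneg h3 (div_nonneg e2 (sq_nonneg _)))
    · rw [zero_div, sub_zero]
      congr 1 with x
      have : deriv u x + k * (-1 / k * (deriv u x + g * ρ x / a x * u x)) +
          g * ρ x / a x * u x = 0 := by
        field_simp
        ring
      simp only
      rw [this]
      ring
    · rw [← e1]
      congr 1 with x
      simp only
      ring

end PerpCompressible

/-! ### Perturbations as states -/

section Translation

/-- The components `(σ, v, B)` of a perturbation. -/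
def Perturbation.field (U : Perturbation) : Fin 7 → ℝ × ℝ → ℝ :=
  ![U.σ, fun z => U.v z 0, fun z => U.v z 1, fun z => U.v z 2, fun z => U.B z 0, fun z => U.B z 1,
    fun z => U.B z 2]

/-- The components of a perturbation as elements of `L²(D)`. -/
def Perturbation.toState (U : Perturbation) : State := fun i => toL2 (U.field i)

theorem HasTimeDeriv.hasDerivWithinAt {f : ℝ → ℝ × ℝ → ℝ} {h : ℝ × ℝ → ℝ} {t : ℝ}
    (H : HasTimeDeriv f h t) (ht : 0 ≤ t) (hf : ∀ τ, 0 ≤ τ → MemLp (f τ) 2 cellMeasure)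
    (hh : MemLp h 2 cellMeasure) :
    HasDerivWithinAt (fun τ => toL2 (f τ)) (toL2 h) (Ici 0) t := by
  rw [hasDerivWithinAt_iff_tendsto_slope, tendsto_iff_norm_sub_tendsto_zero]
  have h1 := (ENNReal.tendsto_toReal ENNReal.zero_ne_top).comp H
  refine h1.congr' ?_
  filter_upwards [self_mem_nhdsWithin] with τ hτ
  have m1 : MemLp (fun z => f τ z - f t z) 2 cellMeasure := (hf τ hτ.1).sub (hf t ht)
  have e1 : slope (fun τ => toL2 (f τ)) t τ - toL2 h =
      toL2 fun z => (f τ z - f t z) / (τ - t) - h z := by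
    have : (fun z => (f τ z - f t z) / (τ - t) - h z) =
        fun z => (τ - t)⁻¹ * (f τ z - f t z) - h z := by
      funext z; ring
    rw [this, toL2_sub (m1.const_mul _) hh, toL2_const_mul m1, toL2_sub (hf τ hτ.1) (hf t ht)]
    rfl
  have m2 : MemLp (fun z => (f τ z - f t z) / (τ - t) - h z) 2 cellMeasure := by
    simp only [div_eq_mul_inv]
    exact (m1.mul_const _).sub hh
  rw [e1, norm_toL2 m2]
  rfl

theorem ContInH.eventually {m : ℕ} {f : ℝ → ℝ × ℝ → ℝ} (H : ContInH m f) {t : ℝ} (ht : 0 ≤ t)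
    {ε : ℝ} (hε : 0 < ε) :
    ∀ᶠ s in 𝓝[Ici 0] t, SobolevBound m (toL2 (f s) - toL2 (f t)) ε := by
  have h1 : ∀ i j, i + j ≤ m → ∀ᶠ s in 𝓝[Ici 0] t,
      ‖toL2 (weakDeriv i j (f s)) - toL2 (weakDeriv i j (f t))‖ ≤ ε := fun i j hij => by
    have h2 := (ENNReal.tendsto_toReal ENNReal.zero_ne_top).comp (H.2 i j hij t ht)
    filter_upwards [h2.eventually_lt_const hε] with s hs
    have m1 := memLp_weakDeriv i j (f s)
    have m2 := memLp_weakDeriv i j (f t)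
    rw [← toL2_sub m1 m2]
    exact (norm_toL2 (m1.sub m2)).trans_le hs.le
  have h2 : ∀ᶠ s in 𝓝[Ici 0] t, ∀ i ∈ Finset.range (m + 1), ∀ j ∈ Finset.range (m + 1), i + j ≤ m →
      ‖toL2 (weakDeriv i j (f s)) - toL2 (weakDeriv i j (f t))‖ ≤ ε :=
    (Finset.eventually_all _).2 fun i _ => (Finset.eventually_all _).2 fun j _ => by
      by_cases hij : i + j ≤ m
      · exact (h1 i j hij).mono fun s hs _ => hs
      · exact Eventually.of_forall fun s h => absurd h hij
  filter_upwards [h2, self_mem_nhdsWithin] with s hs hs0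
  have k1 := H.1 s hs0
  have k2 := H.1 t ht
  have := (k1.sub k2).sobolevBound (M := ε) fun i j hij => by
    have e := ((k1.isWeakDeriv hij).sub (k2.isWeakDeriv hij)).toL2_weakDeriv
    have e' := toL2_sub (memLp_weakDeriv i j (f s)) (memLp_weakDeriv i j (f t))
    have := hs i (by simp; omega) j (by simp; omega) hij
    rw [e]
    exact (congrArg norm e').trans_le this
  have e' : toL2 (f s - f t) = toL2 (f s) - toL2 (f t) := toL2_sub k1.memLp k2.memLp
  rwa [e'] at this

theorem MemH.exists_sobolevBound {m : ℕ} {f : ℝ × ℝ → ℝ} (hf : MemH m f) :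
    ∃ M, SobolevBound m (toL2 f) M :=
  ⟨∑ i ∈ Finset.range (m + 1), ∑ j ∈ Finset.range (m + 1), ‖toL2 (weakDeriv i j f)‖,
    hf.sobolevBound fun i j hij => by
      refine le_trans ?_ (Finset.single_le_sum
        (f := fun i => ∑ j ∈ Finset.range (m + 1), ‖toL2 (weakDeriv i j f)‖)
        (fun i _ => Finset.sum_nonneg fun j _ => norm_nonneg _)
        (Finset.mem_range.2 (by omega : i < m + 1)))
      exact Finset.single_le_sum (f := fun j => ‖toL2 (weakDeriv i j f)‖)
        (fun j _ => norm_nonneg _) (Finset.mem_range.2 (by omega : j < m + 1))⟩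

theorem isEvolution_of_contInH {R : State → State → Prop} {m : ℕ} {U : ℝ → Perturbation}
    (hc : ∀ i, ContInH m fun t => (U t).field i)
    (he : ∀ t, 0 ≤ t → ∃ u', R (U t).toState u' ∧ TimeDeriv (fun t => (U t).toState) u' t) :
    IsEvolution R m fun t => (U t).toState where
  mem _ ht i := ((hc i).1 _ ht).exists_sobolevBound
  cont _ ht i _ hε := (hc i).eventually ht hε
  evol := he

theorem sobolevSq_eq (ρ : Coef) (s : ℕ) (f : ℝ × ℝ → ℝ) : sobolevSq ρ s f =
    ∑ n ∈ Finset.range (s + 1), ∑ α ∈ Finset.HasAntidiagonal.antidiagonal n,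
      inner ℝ (ρ.op (toL2 (weakDeriv α.1 α.2 f))) (toL2 (weakDeriv α.1 α.2 f)) :=
  Finset.sum_congr rfl fun _ _ => Finset.sum_congr rfl fun _ _ =>
    ρ.integral_mul_sq_toL2 (fun _ _ => rfl) (memLp_weakDeriv _ _ _)

theorem norm_sq_eq (ρ : Coef) (s : ℕ) (U : Perturbation) :
    U.norm ρ s = Real.sqrt (∑ i, sobolevSq ρ s (U.field i)) := by
  rw [Perturbation.norm]
  congr 1
  simp [Fin.sum_univ_succ, Perturbation.field]
  ring

theorem inner_le_sobolevSq {ρ : Coef} (hρ : ρ.Pos) {s i j : ℕ} (hij : i + j ≤ s)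
    (f : ℝ × ℝ → ℝ) :
    inner ℝ (ρ.op (toL2 (weakDeriv i j f))) (toL2 (weakDeriv i j f)) ≤ sobolevSq ρ s f := by
  rw [sobolevSq_eq]
  obtain ⟨q, hq⟩ : ∃ q : ℕ × ℕ → ℝ, ∀ α, q α =
      inner ℝ (ρ.op (toL2 (weakDeriv α.1 α.2 f))) (toL2 (weakDeriv α.1 α.2 f)) := ⟨_, fun _ => rfl⟩
  have hq0 : ∀ α, 0 ≤ q α := fun α => by rw [hq]; exact hρ.inner_op_nonneg _
  simp only [← hq]
  refine (hq (i, j)).symm.trans_le ?_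
  have hmem : (i, j) ∈ Finset.HasAntidiagonal.antidiagonal (i + j) :=
    Finset.HasAntidiagonal.mem_antidiagonal.2 rfl
  exact (Finset.single_le_sum (fun α _ => hq0 α) hmem).trans
    (Finset.single_le_sum (f := fun n => ∑ α ∈ Finset.HasAntidiagonal.antidiagonal n, q α)
      (fun n _ => Finset.sum_nonneg fun α _ => hq0 α) (Finset.mem_range.2 (by omega)))

theorem sobolevSq_nonneg {ρ : Coef} (hρ : ρ.Pos) (s : ℕ) (f : ℝ × ℝ → ℝ) : 0 ≤ sobolevSq ρ s f :=
  (hρ.inner_op_nonneg _).trans (inner_le_sobolevSq hρ (i := 0) (j := 0) (by simp) f)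

theorem exists_stateBound_of_norm {ρ : Coef} (hρ : ρ.Pos) (s : ℕ) :
    ∃ C, 0 ≤ C ∧ ∀ U : Perturbation, (∀ i, MemH s (U.field i)) →
      StateBound s U.toState (C * U.norm ρ s) := by
  obtain ⟨κ, hκ, h⟩ := hρ.exists_norm_sq_le
  refine ⟨Real.sqrt κ, Real.sqrt_nonneg _, fun U hU k => (hU k).sobolevBound fun i j hij => ?_⟩
  rw [norm_sq_eq, ← Real.sqrt_mul hκ.le]
  refine Real.le_sqrt_of_sq_le ((h _).trans (mul_le_mul_of_nonneg_left ?_ hκ.le))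
  refine (inner_le_sobolevSq hρ hij _).trans ?_
  exact Finset.single_le_sum (f := fun k => sobolevSq ρ s (U.field k))
    (fun k _ => sobolevSq_nonneg hρ _ _) (Finset.mem_univ k)

theorem exists_norm_le_of_stateBound (ρ : Coef) (s : ℕ) :
    ∃ C, 0 ≤ C ∧ ∀ U : Perturbation, (∀ i, MemH s (U.field i)) → ∀ M,
      StateBound s U.toState M → U.norm ρ s ≤ C * M := by
  set N : ℝ := ∑ _k : Fin 7, ∑ n ∈ Finset.range (s + 1),
    ∑ _α ∈ Finset.HasAntidiagonal.antidiagonal n, ρ.bound with hN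
  have hN0 : 0 ≤ N := Finset.sum_nonneg fun _ _ => Finset.sum_nonneg fun _ _ =>
    Finset.sum_nonneg fun _ _ => ρ.bound_nonneg
  refine ⟨Real.sqrt N, Real.sqrt_nonneg _, fun U hU M hM => ?_⟩
  have hM0 : 0 ≤ M := (hM 0).nonneg
  rw [norm_sq_eq]
  refine Real.sqrt_le_iff.2 ⟨by positivity, ?_⟩
  rw [mul_pow, Real.sq_sqrt hN0, hN, Finset.sum_mul]
  refine Finset.sum_le_sum fun k _ => ?_
  rw [sobolevSq_eq, Finset.sum_mul]
  refine Finset.sum_le_sum fun n hn => ?_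
  rw [Finset.sum_mul]
  refine Finset.sum_le_sum fun α hα => ?_
  have h1 : α.1 + α.2 ≤ s := by
    rw [Finset.HasAntidiagonal.mem_antidiagonal] at hα
    rw [Finset.mem_range] at hn
    omega
  have h2 := (hU k).norm_weakDeriv_le (hM k) h1
  refine (le_abs_self _).trans ((ρ.abs_inner_op_le _).trans ?_)
  have := ρ.bound_nonneg
  gcongr

/-- The growth estimate for evolution equations, for the weighted Sobolev norms. -/
theorem norm_growth {R : State → State → Prop} {Λ : ℝ} {ρ : Coef} (hρ : ρ.Pos)
    (hR : IsGenerator R) (hΛ : 0 < Λ) (hloss : LosesOneDerivative R)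
    (henergy : HasEnergyBound R Λ) (hnormal : ControlsNormalDerivative R Λ) (s : ℕ) :
    ∃ C : ℝ, ∀ U : ℝ → Perturbation, (∀ i, ContInH (s + 2) fun t => (U t).field i) →
      (∀ t, 0 ≤ t → ∃ u', R (U t).toState u' ∧ TimeDeriv (fun t => (U t).toState) u' t) →
      ∀ t, 0 ≤ t → (U t).norm ρ s ≤ C * Real.exp (Λ * t) * (U 0).norm ρ (s + 2) := by
  obtain ⟨C₁, h₁⟩ := IsEvolution.growth hR hΛ hloss henergy hnormal s
  obtain ⟨C₂, hC₂, h₂⟩ := exists_stateBound_of_norm hρ (s + 2)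
  obtain ⟨C₃, hC₃, h₃⟩ := exists_norm_le_of_stateBound ρ s
  refine ⟨C₃ * C₁ * C₂, fun U hc he t ht => ?_⟩
  have hu := isEvolution_of_contInH hc he
  have h0 := h₂ (U 0) fun i => (hc i).1 0 le_rfl
  have hn : 0 ≤ (U 0).norm ρ (s + 2) := Real.sqrt_nonneg _
  -- The growth estimate requires a positive bound for the data; `δ` covers vanishing data and tends
  -- to zero afterwards. Of the `s + 2` derivatives of the data only `s + 1` enter here.
  have key : ∀ δ > 0, (U t).norm ρ s ≤
      C₃ * (C₁ * (C₂ * (U 0).norm ρ (s + 2) + δ) * Real.exp (Λ * t)) := fun δ hδ =>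
    h₃ (U t) (fun i => ((hc i).1 t ht).of_le (by omega)) _
      (h₁ _ hu _ (by positivity) (fun i => ((h0 i).of_le (by omega)).mono (by linarith)) t ht)
  have hlim : Tendsto (fun δ => C₃ * (C₁ * (C₂ * (U 0).norm ρ (s + 2) + δ) * Real.exp (Λ * t)))
      (𝓝[>] 0) (𝓝 (C₃ * (C₁ * (C₂ * (U 0).norm ρ (s + 2) + 0) * Real.exp (Λ * t)))) :=
    (Continuous.tendsto (by fun_prop) 0).mono_left nhdsWithin_le_nhds
  refine (ge_of_tendsto hlim (eventually_nhdsWithin_of_forall key)).trans (le_of_eq ?_)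
  ring

end Translation

/-! ### From weak derivatives on the cell to operator identities. -/

section Reduction

variable {f f' h : ℝ × ℝ → ℝ} {ρ β : Coef} {g b : ℝ}

theorem toL2_fun_zero : toL2 (fun _ => 0) = 0 := (toL2_eq MemLp.zero).trans (MemLp.toLp_zero _)

theorem toL2_of_ae_zero (h : ∀ᵐ z ∂cellMeasure, f z = 0) : toL2 f = 0 :=
  (toL2_congr h).trans toL2_fun_zero

theorem isWeakDeriv_one_zero_of_wx {F : CellL2} (hf : MemLp f 2 cellMeasure)
    (h : WX (toL2 f) F) : IsWeakDeriv 1 0 f F :=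
  IsWeakDeriv.of_wx hf (Lp.memLp F) (by rwa [toL2_coe])

theorem isWeakDeriv_zero_one_of_wy {F : CellL2} (hf : MemLp f 2 cellMeasure)
    (h : WY (toL2 f) F) : IsWeakDeriv 0 1 f F :=
  IsWeakDeriv.of_wy hf (Lp.memLp F) (by rwa [toL2_coe])

theorem toL2_weakDeriv_of_wx {F : CellL2} (hf : MemLp f 2 cellMeasure) (h : WX (toL2 f) F) :
    toL2 (weakDeriv 1 0 f) = F :=
  (isWeakDeriv_one_zero_of_wx hf h).toL2_weakDeriv.trans (toL2_coe F)

theorem toL2_weakDeriv_of_wy {F : CellL2} (hf : MemLp f 2 cellMeasure) (h : WY (toL2 f) F) :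
    toL2 (weakDeriv 0 1 f) = F :=
  (isWeakDeriv_zero_one_of_wy hf h).toL2_weakDeriv.trans (toL2_coe F)

theorem toL2_coef_mul (c : Coef) (hf : MemLp f 2 cellMeasure) :
    toL2 (fun z => c z.1 * f z) = c.op (toL2 f) := (c.op_toL2 hf).symm

theorem toL2_weakDeriv_coef_mul (c : Coef) (hf : MemH 1 f) :
    toL2 (weakDeriv 1 0 fun z => c z.1 * f z) =
      c.d.op (toL2 f) + c.op (toL2 (weakDeriv 1 0 f)) :=
  toL2_weakDeriv_of_wx (c.memLp_mul hf.memLp) (by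
    rw [toL2_coef_mul c hf.memLp]
    exact (hf.wx (m := 0)).op c)

theorem toL2_weakDeriv_coef_mul' (c : Coef) (hf : MemH 1 f) :
    toL2 (weakDeriv 0 1 fun z => c z.1 * f z) = c.op (toL2 (weakDeriv 0 1 f)) :=
  toL2_weakDeriv_of_wy (c.memLp_mul hf.memLp) (by
    rw [toL2_coef_mul c hf.memLp]
    exact (hf.wy (m := 0)).op c)

theorem wx_const (r : ℝ) : WX (toL2 fun _ => r) 0 := by
  have h : IsTorusTest fun _ => r := ⟨contDiff_const, fun _ _ => rfl, fun _ _ => rfl⟩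
  have e : toL2 (partialX fun _ : ℝ × ℝ => r) = 0 :=
    toL2_of_ae_zero (Eventually.of_forall fun z => deriv_const _ _)
  have := h.isWeakDeriv_partialX.wx
  rwa [e] at this

theorem wy_const (r : ℝ) : WY (toL2 fun _ => r) 0 := by
  have h : IsTorusTest fun _ => r := ⟨contDiff_const, fun _ _ => rfl, fun _ _ => rfl⟩
  have e : toL2 (partialY fun _ : ℝ × ℝ => r) = 0 :=
    toL2_of_ae_zero (Eventually.of_forall fun z => deriv_const _ _)
  have := h.isWeakDeriv_partialY.wy
  rwa [e] at this

theorem memH_one_const (r : ℝ) : MemH 1 fun _ => r :=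
  IsTorusTest.memH_one ⟨contDiff_const, fun _ _ => rfl, fun _ _ => rfl⟩

theorem toL2_weakDeriv_of_ae_zero (h : ∀ᵐ z ∂cellMeasure, f z = 0) :
    toL2 (weakDeriv 1 0 f) = 0 ∧ toL2 (weakDeriv 0 1 f) = 0 := by
  have hf : MemLp f 2 cellMeasure :=
    (memLp_congr_ae (h : f =ᵐ[cellMeasure] fun _ => 0)).2 MemLp.zero
  have e : toL2 f = toL2 fun _ => 0 := toL2_congr h
  exact ⟨toL2_weakDeriv_of_wx hf (e ▸ wx_const 0), toL2_weakDeriv_of_wy hf (e ▸ wy_const 0)⟩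

theorem weakDeriv_const_ae (r : ℝ) : (∀ᵐ z ∂cellMeasure, weakDeriv 1 0 (fun _ => r) z = 0) ∧
    ∀ᵐ z ∂cellMeasure, weakDeriv 0 1 (fun _ => r) z = 0 := by
  have hr := (memH_one_const r).memLp
  exact ⟨ae_eq_of_toL2_eq (memLp_weakDeriv _ _ _) MemLp.zero
      ((toL2_weakDeriv_of_wx hr (wx_const r)).trans toL2_fun_zero.symm),
    ae_eq_of_toL2_eq (memLp_weakDeriv _ _ _) MemLp.zero
      ((toL2_weakDeriv_of_wy hr (wy_const r)).trans toL2_fun_zero.symm)⟩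

theorem weakDeriv_coef_ae (c : Coef) :
    (∀ᵐ z ∂cellMeasure, weakDeriv 1 0 (fun z => c z.1) z = c.d z.1) ∧
      ∀ᵐ z ∂cellMeasure, weakDeriv 0 1 (fun z => c z.1) z = 0 := by
  have h1 := (memH_one_const 1)
  have e : (fun z : ℝ × ℝ => c z.1) = fun z => c z.1 * 1 := funext fun z => (mul_one _).symm
  constructor
  · refine ae_eq_of_toL2_eq (memLp_weakDeriv _ _ _) c.d.memLp ?_
    rw [e, toL2_weakDeriv_coef_mul c h1, toL2_weakDeriv_of_wx h1.memLp (wx_const 1), map_zero,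
      add_zero, ← toL2_coef_mul c.d h1.memLp]
    simp only [mul_one]
  · refine ae_eq_of_toL2_eq (memLp_weakDeriv _ _ _) MemLp.zero ?_
    rw [e, toL2_weakDeriv_coef_mul' c h1, toL2_weakDeriv_of_wy h1.memLp (wy_const 1), map_zero]
    exact toL2_fun_zero.symm

/-- The weak derivatives of a total pressure. -/
theorem weakDeriv_add_coef_mul_ae (c : Coef) (hf : MemH 1 f) (hh : MemH 1 h) :
    (∀ᵐ z ∂cellMeasure, weakDeriv 1 0 (fun z => h z + c z.1 * f z) z =
      weakDeriv 1 0 h z + (c.d z.1 * f z + c z.1 * weakDeriv 1 0 f z)) ∧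
    ∀ᵐ z ∂cellMeasure, weakDeriv 0 1 (fun z => h z + c z.1 * f z) z =
      weakDeriv 0 1 h z + c z.1 * weakDeriv 0 1 f z := by
  have m1 := memLp_weakDeriv 1 0 f
  have m2 := memLp_weakDeriv 0 1 f
  have m3 : MemLp (fun z => c z.1 * f z) 2 cellMeasure := c.memLp_mul hf.memLp
  have m4 : MemLp (fun z => h z + c z.1 * f z) 2 cellMeasure := hh.memLp.add m3
  have m5 : MemLp (fun z => c.d z.1 * f z + c z.1 * weakDeriv 1 0 f z) 2 cellMeasure :=
    (c.d.memLp_mul hf.memLp).add (c.memLp_mul m1)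
  constructor
  · refine (IsWeakDeriv.of_wx m4 ((memLp_weakDeriv 1 0 h).add m5) ?_).weakDeriv_ae_eq
    have e1 : toL2 (weakDeriv 1 0 h + fun z => c.d z.1 * f z + c z.1 * weakDeriv 1 0 f z) = _ :=
      toL2_add (memLp_weakDeriv 1 0 h) m5
    rw [toL2_add hh.memLp m3, e1, toL2_add (c.d.memLp_mul hf.memLp) (c.memLp_mul m1),
      toL2_coef_mul c hf.memLp, toL2_coef_mul c m1, toL2_coef_mul c.d hf.memLp]
    exact (hh.wx (m := 0)).add ((hf.wx (m := 0)).op c)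
  · refine (IsWeakDeriv.of_wy m4 ((memLp_weakDeriv 0 1 h).add (c.memLp_mul m2)) ?_).weakDeriv_ae_eq
    have e1 : toL2 (weakDeriv 0 1 h + fun z => c z.1 * weakDeriv 0 1 f z) = _ :=
      toL2_add (memLp_weakDeriv 0 1 h) (c.memLp_mul m2)
    rw [toL2_add hh.memLp m3, e1, toL2_coef_mul c hf.memLp, toL2_coef_mul c m2]
    exact (hh.wy (m := 0)).add ((hf.wy (m := 0)).op c)

/-- The acceleration in the momentum equation is not assumed square integrable; dividing the
equation by `ρ` shows that it is. -/
theorem exists_toL2_of_mul_ae (hρ : ρ.Pos) {a R : ℝ × ℝ → ℝ}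
    (h : ∀ᵐ z ∂cellMeasure, ρ z.1 * a z = R z) (hR : MemLp R 2 cellMeasure) :
    MemLp a 2 cellMeasure ∧ ρ.op (toL2 a) = toL2 R := by
  have h1 : MemLp a 2 cellMeasure := by
    refine ((ρ.inv hρ).memLp_mul hR).ae_eq ?_
    filter_upwards [h, ae_mem_cell] with z hz hz'
    have := (hρ z.1 (Ioo_subset_Icc_self hz'.1)).ne'
    rw [← hz]
    change (ρ z.1)⁻¹ * _ = _
    field_simp
  exact ⟨h1, (ρ.op_toL2 h1).trans (toL2_congr h)⟩

variable {m : ℕ} {B₀ : ℝ × ℝ → Fin 3 → ℝ} {U : ℝ → Perturbation} {p : ℝ → ℝ × ℝ → ℝ} {t : ℝ}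

theorem LinearizedMHD.contInH (H : LinearizedMHD g ρ B₀ m U p) (i : Fin 7) :
    ContInH m fun t => (U t).field i := by
  fin_cases i
  · exact H.contσ
  · exact H.contv 0
  · exact H.contv 1
  · exact H.contv 2
  · exact H.contB 0
  · exact H.contB 1
  · exact H.contB 2

/-- The time derivative of a solution, with the right-hand sides `R` of the momentum equation. -/
theorem LinearizedMHD.exists_timeDeriv (H : LinearizedMHD g ρ B₀ m U p) (hρ : ρ.Pos) (ht : 0 ≤ t)
    {R : Fin 3 → ℝ × ℝ → ℝ} (hR : ∀ i, MemLp (R i) 2 cellMeasure)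
    (hRH : ∀ i, ∀ᵐ z ∂cellMeasure, ((curl B₀ z) ⨯₃ ((U t).B z) + (curl (U t).B z) ⨯₃ (B₀ z) -
      gradient (p t) z + (U t).σ z • ![g, 0, 0]) i = R i z) :
    ∃ u' : State, TimeDeriv (fun t => (U t).toState) u' t ∧
      u' 0 = -(toL2 (weakDeriv 1 0 fun z => ρ z.1 * (U t).v z 0) +
        toL2 (weakDeriv 0 1 fun z => ρ z.1 * (U t).v z 1)) ∧
      ρ.op (u' 1) = toL2 (R 0) ∧ ρ.op (u' 2) = toL2 (R 1) ∧ ρ.op (u' 3) = toL2 (R 2) ∧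
      u' 4 = toL2 (weakDeriv 0 1 fun w => ((U t).v w ⨯₃ B₀ w) 2) ∧
      u' 5 = -toL2 (weakDeriv 1 0 fun w => ((U t).v w ⨯₃ B₀ w) 2) ∧
      u' 6 = toL2 (weakDeriv 1 0 fun w => ((U t).v w ⨯₃ B₀ w) 1) -
        toL2 (weakDeriv 0 1 fun w => ((U t).v w ⨯₃ B₀ w) 0) := by
  obtain ⟨a, ha, hm⟩ := H.momentum t ht
  have hk : ∀ i, MemLp (fun z => a z i) 2 cellMeasure ∧ ρ.op (toL2 fun z => a z i) = toL2 (R i) :=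
    fun i => exists_toL2_of_mul_ae hρ (by
      filter_upwards [hm, hRH i] with z h1 h2
      rw [← h2, ← h1]
      rfl) (hR i)
  have hmem : ∀ i τ, 0 ≤ τ → MemLp ((U τ).field i) 2 cellMeasure := fun i τ hτ =>
    ((H.contInH i).1 τ hτ).memLp
  have d1 := memLp_weakDeriv 1 0 fun z => ρ z.1 * (U t).v z 0
  have d2 := memLp_weakDeriv 0 1 fun z => ρ z.1 * (U t).v z 1
  have f1 := memLp_weakDeriv 0 1 fun w => ((U t).v w ⨯₃ B₀ w) 2
  have f2 := memLp_weakDeriv 1 0 fun w => ((U t).v w ⨯₃ B₀ w) 2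
  have f3 := memLp_weakDeriv 1 0 fun w => ((U t).v w ⨯₃ B₀ w) 1
  have f4 := memLp_weakDeriv 0 1 fun w => ((U t).v w ⨯₃ B₀ w) 0
  refine ⟨![toL2 fun z => -divergence (fun w => ρ w.1 • (U t).v w) z, toL2 fun z => a z 0,
    toL2 fun z => a z 1, toL2 fun z => a z 2, toL2 fun z => curl (fun w => (U t).v w ⨯₃ B₀ w) z 0,
    toL2 fun z => curl (fun w => (U t).v w ⨯₃ B₀ w) z 1,
    toL2 fun z => curl (fun w => (U t).v w ⨯₃ B₀ w) z 2], fun i => ?_, ?_, (hk 0).2, (hk 1).2,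
    (hk 2).2, rfl, toL2_neg f2, toL2_sub f3 f4⟩
  · fin_cases i
    · exact (H.mass t ht).hasDerivWithinAt ht (hmem 0) (d1.add d2).neg
    · exact (ha 0).hasDerivWithinAt ht (hmem 1) (hk 0).1
    · exact (ha 1).hasDerivWithinAt ht (hmem 2) (hk 1).1
    · exact (ha 2).hasDerivWithinAt ht (hmem 3) (hk 2).1
    · exact (H.faraday t ht 0).hasDerivWithinAt ht (hmem 4) f1
    · exact (H.faraday t ht 1).hasDerivWithinAt ht (hmem 5) f2.neg
    · exact (H.faraday t ht 2).hasDerivWithinAt ht (hmem 6) (f3.sub f4)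
  · exact (toL2_neg (d1.add d2)).trans (congrArg Neg.neg (toL2_add d1 d2))

end Reduction

/-! ### Magnetic field orthogonal to gravity: reduction, and growth in the incompressible case. -/

section Perp

variable {ρ β : Coef} {g : ℝ} {m : ℕ} {U : ℝ → Perturbation} {p : ℝ → ℝ × ℝ → ℝ} {t : ℝ}

/-- In the plane, the Lorentz force of this field is the gradient of `-β B₃`, so it merges with the
pressure into the total pressure. Only the third component keeps the force `β' B₁`. -/
theorem perp_momentum (β : Coef) (g : ℝ) {V : Perturbation} {q : ℝ × ℝ → ℝ}
    (hB : MemH 1 fun z => V.B z 2) (hq : MemH 1 q) (i : Fin 3) :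
    ∀ᵐ z ∂cellMeasure, ((curl (perpField β) z) ⨯₃ (V.B z) + (curl V.B z) ⨯₃ (perpField β z) -
      gradient q z + V.σ z • ![g, 0, 0]) i =
      (![fun z => g * V.σ z - weakDeriv 1 0 (fun z => q z + β z.1 * V.B z 2) z,
        fun z => -weakDeriv 0 1 (fun z => q z + β z.1 * V.B z 2) z,
        fun z => β.d z.1 * V.B z 0] : Fin 3 → ℝ × ℝ → ℝ) i z := by
  filter_upwards [(weakDeriv_const_ae 0).1, (weakDeriv_const_ae 0).2, (weakDeriv_coef_ae β).1,
    (weakDeriv_coef_ae β).2, (weakDeriv_add_coef_mul_ae β hB hq).1,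
    (weakDeriv_add_coef_mul_ae β hB hq).2] with z h1 h2 h3 h4 h5 h6
  have e : curl (perpField β) z = ![0, -β.d z.1, 0] := by
    change ![weakDeriv 0 1 (fun z : ℝ × ℝ => β z.1) z, -weakDeriv 1 0 (fun z : ℝ × ℝ => β z.1) z,
      weakDeriv 1 0 (fun _ => 0) z - weakDeriv 0 1 (fun _ => 0) z] = _
    rw [h1, h2, h3, h4, sub_zero]
  rw [e]
  fin_cases i
  · simp [cross_apply, curl, perpField, gradient, h5]
    ring
  · simp [cross_apply, curl, perpField, gradient, h6]
    ring
  · simp [cross_apply, curl, perpField, gradient]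

/-- The time derivative of a solution, for a magnetic field orthogonal to gravity. -/
theorem LinearizedMHD.exists_timeDeriv_perp (H : LinearizedMHD g ρ (perpField β) m U p)
    (hρ : ρ.Pos) (hm : 1 ≤ m) (ht : 0 ≤ t) :
    ∃ u' : State, TimeDeriv (fun t => (U t).toState) u' t ∧
      u' 0 = -(ρ.op (toL2 (weakDeriv 1 0 fun z => (U t).v z 0) +
        toL2 (weakDeriv 0 1 fun z => (U t).v z 1)) + ρ.d.op ((U t).toState 1)) ∧
      ρ.op (u' 1) = g • (U t).toState 0 -
        toL2 (weakDeriv 1 0 fun z => p t z + β z.1 * (U t).B z 2) ∧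
      ρ.op (u' 2) = -toL2 (weakDeriv 0 1 fun z => p t z + β z.1 * (U t).B z 2) ∧
      ρ.op (u' 3) = β.d.op ((U t).toState 4) ∧ u' 4 = 0 ∧ u' 5 = 0 ∧
      u' 6 = -(β.op (toL2 (weakDeriv 1 0 fun z => (U t).v z 0) +
        toL2 (weakDeriv 0 1 fun z => (U t).v z 1)) + β.d.op ((U t).toState 1)) := by
  have hσ := ((H.contσ).1 t ht).memLp
  have hv := fun i => ((H.contv i).1 t ht).of_le hm
  have hB := fun i => ((H.contB i).1 t ht).of_le hm
  have mx := memLp_weakDeriv 1 0 fun z => p t z + β z.1 * (U t).B z 2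
  have my := memLp_weakDeriv 0 1 fun z => p t z + β z.1 * (U t).B z 2
  have hR := perp_momentum β g (V := U t) (hB 2) (H.memp t ht)
  obtain ⟨u', h, h0, h1, h2, h3, h4, h5, h6⟩ := H.exists_timeDeriv hρ ht (fun i => by
    fin_cases i
    · exact (hσ.const_mul g).sub mx
    · exact my.neg
    · exact β.d.memLp_mul (hB 0).memLp) hR
  have e0 : (fun w => ((U t).v w ⨯₃ perpField β w) 0) = fun z => β z.1 * (U t).v z 1 := by
    funext z
    simp [cross_apply, perpField, mul_comm]
  have e1 : (fun w => ((U t).v w ⨯₃ perpField β w) 1) =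
      fun z => (β.smul (-1)) z.1 * (U t).v z 0 := by
    funext z
    change _ = -1 * β z.1 * _
    simp [cross_apply, perpField, mul_comm]
  have e2 : ∀ᵐ z ∂cellMeasure, ((U t).v z ⨯₃ perpField β z) 2 = 0 :=
    Eventually.of_forall fun z => by simp [cross_apply, perpField]
  obtain ⟨k1, k2⟩ := toL2_weakDeriv_of_ae_zero e2
  refine ⟨u', h, ?_, h1.trans ?_, h2.trans (toL2_neg my), h3.trans ?_, h4.trans k2, ?_, ?_⟩
  · rw [h0, toL2_weakDeriv_coef_mul ρ (hv 0), toL2_weakDeriv_coef_mul' ρ (hv 1), map_add]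
    change -(ρ.d.op ((U t).toState 1) + _ + _) = _
    abel
  · exact (toL2_sub (hσ.const_mul g) mx).trans (by rw [toL2_const_mul hσ]; rfl)
  · exact toL2_coef_mul β.d (hB 0).memLp
  · rw [h5, k1, neg_zero]
  · rw [h6, e0, e1, toL2_weakDeriv_coef_mul _ (hv 0), toL2_weakDeriv_coef_mul' β (hv 1), map_add]
    have e : (β.smul (-1)).d.op (toL2 fun z => (U t).v z 0) = -β.d.op ((U t).toState 1) := by
      have : ∀ x ∈ Ioo 0 (2 * Real.pi), (β.smul (-1)).d x = (β.d.smul (-1)) x := fun x hx =>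
        Coef.d_eq _ hx ((β.hasDerivAt hx).const_mul (-1))
      rw [Coef.op_congr this, Coef.op_smul, neg_one_smul]
      rfl
    rw [e, Coef.op_smul]
    module

theorem LinearizedMHD.totalPressure (H : LinearizedMHD g ρ (perpField β) m U p) (hm : 1 ≤ m)
    (ht : 0 ≤ t) : MemLp (fun z => p t z + β z.1 * (U t).B z 2) 2 cellMeasure ∧
      WY (toL2 fun z => p t z + β z.1 * (U t).B z 2)
        (toL2 (weakDeriv 0 1 fun z => p t z + β z.1 * (U t).B z 2)) := by
  have hB := ((H.contB 2).1 t ht).of_le hm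
  have hQ : MemLp (fun z => p t z + β z.1 * (U t).B z 2) 2 cellMeasure :=
    (H.memp t ht).memLp.add (β.memLp_mul hB.memLp)
  have := (((H.memp t ht).wy (m := 0)).add ((hB.wy (m := 0)).op β))
  rw [← toL2_coef_mul β hB.memLp, ← toL2_add (H.memp t ht).memLp (β.memLp_mul hB.memLp)] at this
  exact ⟨hQ, by rwa [toL2_weakDeriv_of_wy hQ this]⟩

theorem divergence_toL2 {F : ℝ × ℝ → Fin 3 → ℝ} (h : ∀ᵐ z ∂cellMeasure, divergence F z = 0) :
    toL2 (weakDeriv 0 1 fun z => F z 1) = -toL2 (weakDeriv 1 0 fun z => F z 0) := by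
  refine eq_neg_of_add_eq_zero_right ?_
  rw [← toL2_add (memLp_weakDeriv _ _ _) (memLp_weakDeriv _ _ _)]
  exact toL2_of_ae_zero h

theorem IsSolutionPerpIncompressible.exists_timeDeriv
    (H : IsSolutionPerpIncompressible g ρ β m U) (hρ : ρ.Pos) (hm : 1 ≤ m) (ht : 0 ≤ t) :
    ∃ u', Incompressible g 0 ρ β (U t).toState u' ∧ TimeDeriv (fun t => (U t).toState) u' t := by
  obtain ⟨p, H, hb, hdiv⟩ := H
  have hv := fun i => ((H.contv i).1 t ht).of_le hm
  have hB := fun i => ((H.contB i).1 t ht).of_le hm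
  have hdv := divergence_toL2 (hdiv t ht)
  obtain ⟨u', h, h0, h1, h2, h3, h4, h5, h6⟩ := H.exists_timeDeriv_perp hρ hm ht
  obtain ⟨bv, bq⟩ := hb t ht
  obtain ⟨hQ, hQy⟩ := H.totalPressure hm ht
  refine ⟨u', ⟨_, _, toL2 (weakDeriv 0 1 fun z => p t z + β z.1 * (U t).B z 2), _, _,
    toL2 (weakDeriv 1 0 fun z => (U t).B z 0), _, {
    pressX := bq.tx hQ
    pressY := hQy
    vel₁X := bv.tx (hv 0).memLp
    vel₂X := (hv 1).wx (m := 0)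
    vel₂Y := hdv ▸ (hv 1).wy (m := 0)
    mag₁X := (hB 0).wx (m := 0)
    mag₂X := (hB 1).wx (m := 0)
    mag₂Y := divergence_toL2 (H.solenoidal t ht) ▸ (hB 1).wy (m := 0)
    periodic := fun h => absurd rfl h
    dens := ?_
    mom₁ := ?_
    mom₂ := ?_
    mom₃ := h3
    far₁ := ?_
    far₂ := ?_
    far₃ := ?_ }⟩, h⟩
  · rw [h0, hdv, add_neg_cancel, map_zero, zero_add]
  · rw [h1, zero_smul, zero_sub, neg_add_eq_sub]
  · rw [h2, zero_smul, zero_sub]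
  · rw [h4, zero_smul]
  · rw [h5, zero_smul]
  · rw [h6, hdv, add_neg_cancel, map_zero, zero_add]

theorem IsSolutionPerpIncompressible.contInH (H : IsSolutionPerpIncompressible g ρ β m U)
    (i : Fin 7) : ContInH m fun t => (U t).field i := by
  obtain ⟨p, H, -⟩ := H
  exact H.contInH i

theorem growth_perpIncompressible (hρ : ρ.Pos) (h0 : 0 < LambdaSqPerpIncompressible g ρ) (β : Coef)
    (s : ℕ) : ∃ C : ℝ, ∀ U : ℝ → Perturbation, IsSolutionPerpIncompressible g ρ β (s + 2) U →
      ∀ t, 0 ≤ t → (U t).norm ρ s ≤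
        C * Real.exp (Real.sqrt (LambdaSqPerpIncompressible g ρ) * t) * (U 0).norm ρ (s + 2) := by
  have hΛ := Real.sqrt_pos.2 h0
  have hq : IncompressibleForm g 0 ρ (Real.sqrt (LambdaSqPerpIncompressible g ρ)) :=
    incompressibleForm_iff.2 fun w wx h => by
      rw [Real.sq_sqrt h0.le]
      exact LambdaSqPerpIncompressible.form_le hρ w wx h
  obtain ⟨C, hC⟩ := norm_growth hρ (isGenerator_incompressible g 0 ρ β) hΛ
    (losesOneDerivative_incompressible g 0 β hρ) (hasEnergyBound_incompressible hρ hΛ hq β)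
    (controlsNormalDerivative_incompressible hρ hΛ g 0 β) s
  exact ⟨C, fun U hU => hC U hU.contInH fun t ht => hU.exists_timeDeriv hρ (by omega) ht⟩

end Perp

/-! ### Incompressible fluid, field parallel to gravity: reduction and growth. -/

section Par

variable {ρ : Coef} {g b : ℝ} {m : ℕ} {U : ℝ → Perturbation} {p : ℝ → ℝ × ℝ → ℝ} {t : ℝ}

/-- The coefficient `0`. -/
def Coef.null : Coef := ⟨fun _ => 0, contDiffOn_const⟩

theorem Coef.null_d_op (F : CellL2) : Coef.null.d.op F = 0 := by
  rw [Coef.op_apply]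
  refine toL2_of_ae_zero ?_
  filter_upwards [ae_mem_cell] with z hz
  rw [← Coef.null.deriv_eq hz.1]
  change deriv (fun _ => (0 : ℝ)) z.1 * _ = 0
  rw [deriv_const, zero_mul]

theorem par_momentum (b g : ℝ) {V : Perturbation} {q : ℝ × ℝ → ℝ}
    (hB : ∀ᵐ z ∂cellMeasure, V.B z 2 = 0) (i : Fin 3) :
    ∀ᵐ z ∂cellMeasure, ((curl (parField b) z) ⨯₃ (V.B z) + (curl V.B z) ⨯₃ (parField b z) -
      gradient q z + V.σ z • ![g, 0, 0]) i =
      (![fun z => g * V.σ z - weakDeriv 1 0 q z,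
        fun z => b * (weakDeriv 1 0 (fun z => V.B z 1) z - weakDeriv 0 1 (fun z => V.B z 0) z) -
          weakDeriv 0 1 q z,
        fun _ => 0] : Fin 3 → ℝ × ℝ → ℝ) i z := by
  have e : ∀ᵐ z ∂cellMeasure, weakDeriv 1 0 (fun z => V.B z 2) z = 0 :=
    ae_eq_of_toL2_eq (memLp_weakDeriv _ _ _) MemLp.zero
      ((toL2_weakDeriv_of_ae_zero hB).1.trans toL2_fun_zero.symm)
  filter_upwards [(weakDeriv_const_ae 0).1, (weakDeriv_const_ae 0).2, (weakDeriv_const_ae b).2, e]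
    with z h1 h2 h3 h4
  have e : curl (parField b) z = 0 := by
    change ![weakDeriv 0 1 (fun _ => 0) z, -weakDeriv 1 0 (fun _ => 0) z,
      weakDeriv 1 0 (fun _ => 0) z - weakDeriv 0 1 (fun _ => b) z] = _
    rw [h1, h2, h3, neg_zero, sub_zero]
    ext i
    fin_cases i <;> rfl
  rw [e]
  fin_cases i
  · simp [cross_apply, curl, parField, gradient]
    ring
  · simp [cross_apply, curl, parField, gradient]
    ring
  · simp [cross_apply, curl, parField, gradient, h4]

theorem IsSolutionParIncompressible.exists_timeDeriv
    (H : IsSolutionParIncompressible g b ρ m U) (hρ : ρ.Pos) (hm : 1 ≤ m) (ht : 0 ≤ t) :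
    ∃ u', Incompressible g b ρ Coef.null (U t).toState u' ∧
      TimeDeriv (fun t => (U t).toState) u' t := by
  obtain ⟨p, H, hb, hdiv, h2d⟩ := H
  obtain ⟨bv, bB, bp⟩ := hb t ht
  have hv := fun i => ((H.contv i).1 t ht).of_le hm
  have hB := fun i => ((H.contB i).1 t ht).of_le hm
  have hσ := ((H.contσ).1 t ht).memLp
  have hdv := divergence_toL2 (hdiv t ht)
  have hdB := divergence_toL2 (H.solenoidal t ht)
  have mB := memLp_weakDeriv 1 0 fun z => (U t).B z 1
  have mB' := memLp_weakDeriv 0 1 fun z => (U t).B z 0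
  have mx := memLp_weakDeriv 1 0 (p t)
  have my := memLp_weakDeriv 0 1 (p t)
  have mc : MemLp (fun z => b * (weakDeriv 1 0 (fun z => (U t).B z 1) z -
      weakDeriv 0 1 (fun z => (U t).B z 0) z)) 2 cellMeasure := (mB.sub mB').const_mul b
  obtain ⟨u', h, h0, h1, h2, h3, h4, h5, h6⟩ := H.exists_timeDeriv hρ ht (fun i => by
    fin_cases i
    · exact (hσ.const_mul g).sub mx
    · exact mc.sub my
    · exact MemLp.zero) (par_momentum b g ((h2d t ht).mono fun z h => h.2))
  have e0 : ∀ᵐ z ∂cellMeasure, ((U t).v z ⨯₃ parField b z) 0 = 0 :=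
    Eventually.of_forall fun z => by simp [cross_apply, parField]
  have e1 : ∀ᵐ z ∂cellMeasure, ((U t).v z ⨯₃ parField b z) 1 = 0 := by
    filter_upwards [h2d t ht] with z hz
    simp [cross_apply, parField, hz.1]
  have e2 : (fun w => ((U t).v w ⨯₃ parField b w) 2) =
      fun z => -b * (U t).v z 1 := by
    funext z
    simp [cross_apply, parField, mul_comm]
  have m1 : MemLp (fun z => -b * (U t).v z 1) 2 cellMeasure := (hv 1).memLp.const_mul _
  have k1 : toL2 (weakDeriv 1 0 fun z => -b * (U t).v z 1) =
      -b • toL2 (weakDeriv 1 0 fun z => (U t).v z 1) := toL2_weakDeriv_of_wx m1 (by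
    rw [toL2_const_mul (hv 1).memLp]
    exact ((hv 1).wx (m := 0)).smul _)
  have k2 : toL2 (weakDeriv 0 1 fun z => -b * (U t).v z 1) =
      -b • toL2 (weakDeriv 0 1 fun z => (U t).v z 1) := toL2_weakDeriv_of_wy m1 (by
    rw [toL2_const_mul (hv 1).memLp]
    exact ((hv 1).wy (m := 0)).smul _)
  -- The total pressure is `p + b B₁`. Its `y`-derivative absorbs the term `-b ∂ᵧB₁` of the Lorentz
  -- force, and its `x`-derivative is compensated by `b ∂ₓB₁` in the first equation.
  refine ⟨u', ⟨toL2 (p t) + b • toL2 (fun z => (U t).B z 0), _, _,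
    toL2 (weakDeriv 1 0 fun z => (U t).v z 0), toL2 (weakDeriv 1 0 fun z => (U t).v z 1),
    toL2 (weakDeriv 1 0 fun z => (U t).B z 0), toL2 (weakDeriv 1 0 fun z => (U t).B z 1), {
    pressX := (bp.tx (H.memp t ht).memLp).add (((bB 0).tx (hB 0).memLp).smul b)
    pressY := ((H.memp t ht).wy (m := 0)).add (((hB 0).wy (m := 0)).smul b)
    vel₁X := (bv 0).tx (hv 0).memLp
    vel₂X := (hv 1).wx (m := 0)
    vel₂Y := hdv ▸ (hv 1).wy (m := 0)
    mag₁X := (hB 0).wx (m := 0)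
    mag₂X := (hB 1).wx (m := 0)
    mag₂Y := hdB ▸ (hB 1).wy (m := 0)
    periodic := fun _ => ⟨(bv 1).tx (hv 1).memLp, (bB 0).tx (hB 0).memLp, (bB 1).tx (hB 1).memLp⟩
    dens := ?_
    mom₁ := ?_
    mom₂ := ?_
    mom₃ := ?_
    far₁ := ?_
    far₂ := ?_
    far₃ := ?_ }⟩, h⟩
  · rw [h0, toL2_weakDeriv_coef_mul ρ (hv 0), toL2_weakDeriv_coef_mul' ρ (hv 1), hdv, map_neg,
      add_neg_cancel_right]
    rfl
  · refine h1.trans ((toL2_sub (hσ.const_mul g) mx).trans ?_)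
    rw [toL2_const_mul hσ]
    change g • (U t).toState 0 - _ = _
    module
  · refine h2.trans ((toL2_sub mc my).trans ?_)
    have ec := toL2_const_mul (f := fun z => weakDeriv 1 0 (fun z => (U t).B z 1) z -
      weakDeriv 0 1 (fun z => (U t).B z 0) z) (mB.sub mB') b
    rw [ec, toL2_sub mB mB']
    module
  · rw [Coef.null_d_op]
    exact h3.trans toL2_fun_zero
  · rw [h4, e2, k2, hdv, neg_smul_neg]
  · rw [h5, e2, k1, neg_smul, neg_neg]
  · rw [h6, (toL2_weakDeriv_of_ae_zero e0).2, (toL2_weakDeriv_of_ae_zero e1).1, Coef.null_d_op,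
      sub_zero, neg_zero]

theorem IsSolutionParIncompressible.contInH (H : IsSolutionParIncompressible g b ρ m U)
    (i : Fin 7) : ContInH m fun t => (U t).field i := by
  obtain ⟨p, H, -⟩ := H
  exact H.contInH i

theorem growth_parIncompressible (hρ : ρ.Pos) (h0 : 0 < LambdaSqParIncompressible g b ρ)
    (s : ℕ) : ∃ C : ℝ, ∀ U : ℝ → Perturbation, IsSolutionParIncompressible g b ρ (s + 2) U →
      ∀ t, 0 ≤ t → (U t).norm ρ s ≤
        C * Real.exp (Real.sqrt (LambdaSqParIncompressible g b ρ) * t) * (U 0).norm ρ (s + 2) := by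
  have hΛ := Real.sqrt_pos.2 h0
  have hq : IncompressibleForm g b ρ (Real.sqrt (LambdaSqParIncompressible g b ρ)) :=
    incompressibleForm_iff.2 fun w wx h => by
      rw [Real.sq_sqrt h0.le]
      exact LambdaSqParIncompressible.form_le hρ w wx h
  obtain ⟨C, hC⟩ := norm_growth hρ (isGenerator_incompressible g b ρ Coef.null) hΛ
    (losesOneDerivative_incompressible g b Coef.null hρ)
    (hasEnergyBound_incompressible hρ hΛ hq Coef.null)
    (controlsNormalDerivative_incompressible hρ hΛ g b Coef.null) s
  exact ⟨C, fun U hU => hC U hU.contInH fun t ht => hU.exists_timeDeriv hρ (by omega) ht⟩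

end Par

/-! ### Compressible fluid, field orthogonal to gravity: reduction and growth. -/

section PerpCompressible

variable {ρ β : Coef} {g K γ : ℝ} {m : ℕ} {U : ℝ → Perturbation} {t : ℝ}

/-- The coefficient `r ρ ^ q`. -/
def Coef.rpow (ρ : Coef) (hρ : ρ.Pos) (r q : ℝ) : Coef :=
  ⟨fun x => r * ρ x ^ q, contDiffOn_const.mul
    (ρ.2.rpow_const_of_ne fun x hx => (hρ x hx).ne')⟩

/-- The stratification of a polytropic fluid in a magnetic field orthogonal to gravity. -/
def polytropic (hρ : ρ.Pos) (hK : 0 < K) (hγ : 0 < γ) (β : Coef)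
    (hbal : ∀ x ∈ Ioo 0 (2 * Real.pi),
      HasDerivAt (fun x => K * ρ x ^ γ + 1 / 2 * β x ^ 2) (ρ x * g) x) : Stratification g where
  ρ := ρ
  β := β
  c := ρ.rpow hρ (K * γ) (γ - 1)
  a := ((ρ.rpow hρ K γ).smul γ).add (β.mul β)
  ρ_pos := hρ
  a_pos x hx := by
    have := Real.rpow_pos_of_pos (hρ x hx) γ
    change 0 < γ * (K * ρ x ^ γ) + β x * β x
    have := mul_self_nonneg (β x)
    positivity
  -- With `c = P'(ρ)` the power law gives `c ρ = γ p₀`. The next field is the hydrostatic equation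
  -- with its derivative carried out.
  stiff x hx := by
    have := hρ x (Ioo_subset_Icc_self hx)
    change K * γ * ρ x ^ (γ - 1) * ρ x + β x * β x = γ * (K * ρ x ^ γ) + β x * β x
    rw [Real.rpow_sub_one this.ne']
    field_simp
  balance x hx := by
    have h1 := hρ x (Ioo_subset_Icc_self hx)
    have h2 := (((ρ.hasDerivAt hx).rpow_const (p := γ) (Or.inl h1.ne')).const_mul K).add
      (((β.hasDerivAt hx).pow 2).const_mul (1 / 2))
    have h3 := h2.unique (hbal x hx)
    change K * γ * ρ x ^ (γ - 1) * ρ.d x + β x * β.d x = g * ρ x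
    rw [mul_comm g, ← h3]
    push_cast
    ring

theorem polytropic_a (hρ : ρ.Pos) (hK : 0 < K) (hγ : 0 < γ)
    (hbal : ∀ x ∈ Ioo 0 (2 * Real.pi),
      HasDerivAt (fun x => K * ρ x ^ γ + 1 / 2 * β x ^ 2) (ρ x * g) x) (x : ℝ) :
    (polytropic hρ hK hγ β hbal).a x = stiffness K γ ρ β x := by
  change γ * (K * ρ x ^ γ) + β x * β x = γ * (K * ρ x ^ γ) + β x ^ 2
  rw [sq]

theorem polytropic_κ (hρ : ρ.Pos) (hK : 0 < K) (hγ : 0 < γ)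
    (hbal : ∀ x ∈ Ioo 0 (2 * Real.pi),
      HasDerivAt (fun x => K * ρ x ^ γ + 1 / 2 * β x ^ 2) (ρ x * g) x) {x : ℝ}
    (hx : x ∈ Ioo 0 (2 * Real.pi)) :
    potentialCompressible g K γ ρ β x = ((polytropic hρ hK hγ β hbal).κ.smul g) x := by
  change _ = g * (g * (ρ x * (((polytropic hρ hK hγ β hbal).a x)⁻¹ * ρ x)) + -1 * ρ.d x)
  rw [polytropic_a, potentialCompressible, ρ.deriv_eq hx]
  ring

theorem IsSolutionPerpCompressible.exists_timeDeriv
    (hρ : ρ.Pos) (hK : 0 < K) (hγ : 0 < γ) (hbal : ∀ x ∈ Ioo 0 (2 * Real.pi),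
      HasDerivAt (fun x => K * ρ x ^ γ + 1 / 2 * β x ^ 2) (ρ x * g) x)
    (H : IsSolutionPerpCompressible g K γ ρ β m U) (hm : 1 ≤ m) (ht : 0 ≤ t) :
    ∃ u', Compressible (polytropic hρ hK hγ β hbal) (U t).toState u' ∧
      TimeDeriv (fun t => (U t).toState) u' t := by
  obtain ⟨p, H, hb, hp⟩ := H
  have hv := fun i => ((H.contv i).1 t ht).of_le hm
  have hB := fun i => ((H.contB i).1 t ht).of_le hm
  have hσ := ((H.contσ).1 t ht).memLp
  obtain ⟨u', h, h0, h1, h2, h3, h4, h5, h6⟩ := H.exists_timeDeriv_perp hρ hm ht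
  obtain ⟨bv, bq⟩ := hb t ht
  obtain ⟨hQ, hQy⟩ := H.totalPressure hm ht
  have e : (polytropic hρ hK hγ β hbal).total (U t).toState =
      toL2 fun z => p t z + β z.1 * (U t).B z 2 := by
    rw [Stratification.total_apply, toL2_add (H.memp t ht).memLp (β.memLp_mul (hB 2).memLp),
      toL2_coef_mul β (hB 2).memLp, toL2_congr (hp t ht)]
    exact congrArg (· + _) ((ρ.rpow hρ (K * γ) (γ - 1)).op_toL2 hσ)
  exact ⟨u', ⟨_, _, _, _, _, {
    pressX := e ▸ bq.tx hQ
    pressY := e ▸ hQy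
    vel₁X := bv.tx (hv 0).memLp
    vel₂X := (hv 1).wx (m := 0)
    vel₂Y := (hv 1).wy (m := 0)
    dens := h0
    mom₁ := h1
    mom₂ := h2
    mom₃ := h3
    far₁ := h4
    far₂ := h5
    far₃ := h6 }⟩, h⟩

theorem IsSolutionPerpCompressible.contInH (H : IsSolutionPerpCompressible g K γ ρ β m U)
    (i : Fin 7) : ContInH m fun t => (U t).field i := by
  obtain ⟨p, H, -⟩ := H
  exact H.contInH i

theorem growth_perpCompressible (hρ : ρ.Pos) (hK : 0 < K) (hγ : 0 < γ)
    (hbal : ∀ x ∈ Ioo 0 (2 * Real.pi),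
      HasDerivAt (fun x => K * ρ x ^ γ + 1 / 2 * β x ^ 2) (ρ x * g) x)
    (h0 : 0 < LambdaSqPerpCompressible g K γ ρ β) (s : ℕ) :
    ∃ C : ℝ, ∀ U : ℝ → Perturbation, IsSolutionPerpCompressible g K γ ρ β (s + 2) U →
      ∀ t, 0 ≤ t → (U t).norm ρ s ≤
        C * Real.exp (Real.sqrt (LambdaSqPerpCompressible g K γ ρ β) * t) *
          (U 0).norm ρ (s + 2) := by
  have hΛ := Real.sqrt_pos.2 h0
  set S := polytropic hρ hK hγ β hbal
  have hq : CompressibleForm S (Real.sqrt (LambdaSqPerpCompressible g K γ ρ β)) := fun w => by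
    rw [Real.sq_sqrt h0.le, ← real_inner_smul_left, ← Coef.op_smul]
    exact LambdaSqL2.form_le hρ (fun x hx => polytropic_κ hρ hK hγ hbal hx) w
  obtain ⟨C, hC⟩ := norm_growth hρ (isGenerator_compressible S) hΛ
    (losesOneDerivative_compressible S) (hasEnergyBound_compressible hΛ hq)
    (controlsNormalDerivative_compressible S hΛ) s
  exact ⟨C, fun U hU => hC U hU.contInH fun t ht =>
    hU.exists_timeDeriv hρ hK hγ hbal (by omega) ht⟩

theorem modes_perpCompressible (hρ : ρ.Pos) (hK : 0 < K) (hγ : 0 < γ)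
    (hbal : ∀ x ∈ Ioo 0 (2 * Real.pi),
      HasDerivAt (fun x => K * ρ x ^ γ + 1 / 2 * β x ^ 2) (ρ x * g) x)
    (h0 : 0 < LambdaSqPerpCompressible g K γ ρ β) :
    IsSupremumOfModes (lambdaSqPerpCompressible g K γ ρ β)
      (LambdaSqPerpCompressible g K γ ρ β) := by
  set S := polytropic hρ hK hγ β hbal
  have he : ∀ x ∈ Ioo 0 (2 * Real.pi), potentialCompressible g K γ ρ β x = (S.κ.smul g) x :=
    fun x hx => polytropic_κ hρ hK hγ hbal hx
  refine modes_compressible (H := S.κ.smul g) (g := g) hρ S.a_pos h0.le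
    (LambdaSqL2.form_le hρ he) (fun μ hμ => LambdaSqL2.exists_test he h0 hμ)
    (fun k => congrArg sSup (Set.ext fun r => ?_))
  have e : ∀ u₁ u₁' u₂ : ℝ → ℝ, ∫ x, (-stiffness K γ ρ β x * (u₁' x + k * u₂ x +
        g * ρ x / stiffness K γ ρ β x * u₁ x) ^ 2 + potentialCompressible g K γ ρ β x * u₁ x ^ 2)
        ∂intervalMeasure =
      ∫ x, (-S.a x * (u₁' x + k * u₂ x + g * ρ x / S.a x * u₁ x) ^ 2 +
        (S.κ.smul g) x * u₁ x ^ 2) ∂intervalMeasure := fun u₁ u₁' u₂ =>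
    setIntegral_congr_fun measurableSet_Ioo fun x hx => by
      simp only [← he x hx, S, polytropic_a]
  constructor
  · rintro ⟨u₁, u₁', u₂, h1, h2, h3, h4⟩
    exact ⟨(u₁, u₁', u₂), ⟨h1, h2⟩, h3, by rw [h4, e]⟩
  · rintro ⟨⟨u₁, u₁', u₂⟩, ⟨h1, h2⟩, h3, h4⟩
    exact ⟨u₁, u₁', u₂, h1, h2, h3, by rw [h4, e]⟩

end PerpCompressible

end MHD

end

/-! ### The three cases together. -/

theorem theorem1 (g : ℝ) (ρ₀ : ℝ → ℝ)
    (hρ : ContDiffOn ℝ ∞ ρ₀ (Icc 0 (2 * Real.pi)))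
    (hρ_pos : ∃ c > 0, ∀ x ∈ Icc 0 (2 * Real.pi), c ≤ ρ₀ x) :
    -- incompressible fluid, magnetic field orthogonal to gravity
    (∀ β : ℝ → ℝ, ContDiffOn ℝ ∞ β (Icc 0 (2 * Real.pi)) →
      0 < MHD.LambdaSqPerpIncompressible g ρ₀ →
      MHD.IsSupremumOfModes (MHD.lambdaSqPerpIncompressible g ρ₀)
        (MHD.LambdaSqPerpIncompressible g ρ₀) ∧
      ∀ s : ℕ, ∃ C : ℝ, ∀ U : ℝ → MHD.Perturbation,
        MHD.IsSolutionPerpIncompressible g ρ₀ β (s + 2) U → ∀ t : ℝ, 0 ≤ t →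
          (U t).norm ρ₀ s ≤
            C * Real.exp (Real.sqrt (MHD.LambdaSqPerpIncompressible g ρ₀) * t) *
              (U 0).norm ρ₀ (s + 2)) ∧
    -- compressible fluid, magnetic field orthogonal to gravity
    (∀ (K γ : ℝ) (β : ℝ → ℝ), 0 < K → 0 < γ → ContDiffOn ℝ ∞ β (Icc 0 (2 * Real.pi)) →
      (∀ x ∈ Ioo 0 (2 * Real.pi),
        HasDerivAt (fun x => K * ρ₀ x ^ γ + 1 / 2 * β x ^ 2) (ρ₀ x * g) x) →
      0 < MHD.LambdaSqPerpCompressible g K γ ρ₀ β →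
      MHD.IsSupremumOfModes (MHD.lambdaSqPerpCompressible g K γ ρ₀ β)
        (MHD.LambdaSqPerpCompressible g K γ ρ₀ β) ∧
      ∀ s : ℕ, ∃ C : ℝ, ∀ U : ℝ → MHD.Perturbation,
        MHD.IsSolutionPerpCompressible g K γ ρ₀ β (s + 2) U → ∀ t : ℝ, 0 ≤ t →
          (U t).norm ρ₀ s ≤
            C * Real.exp (Real.sqrt (MHD.LambdaSqPerpCompressible g K γ ρ₀ β) * t) *
              (U 0).norm ρ₀ (s + 2)) ∧
    -- incompressible fluid, magnetic field parallel to gravity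
    (∀ b : ℝ, 0 < MHD.LambdaSqParIncompressible g b ρ₀ →
      MHD.IsSupremumOfModes (MHD.lambdaSqParIncompressible g b ρ₀)
        (MHD.LambdaSqParIncompressible g b ρ₀) ∧
      ∀ s : ℕ, ∃ C : ℝ, ∀ U : ℝ → MHD.Perturbation,
        MHD.IsSolutionParIncompressible g b ρ₀ (s + 2) U → ∀ t : ℝ, 0 ≤ t →
          (U t).norm ρ₀ s ≤
            C * Real.exp (Real.sqrt (MHD.LambdaSqParIncompressible g b ρ₀) * t) *
              (U 0).norm ρ₀ (s + 2)) := by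
  obtain ⟨c₀, hc₀, hle⟩ := hρ_pos
  obtain ⟨ρ, rfl⟩ : ∃ ρ : MHD.Coef, ρ.1 = ρ₀ := ⟨⟨ρ₀, hρ⟩, rfl⟩
  have hpos : ρ.Pos := fun x hx => hc₀.trans_le (hle x hx)
  refine ⟨fun β hβ h0 => ⟨MHD.modes_perpIncompressible hpos h0,
    MHD.growth_perpIncompressible hpos h0 ⟨β, hβ⟩⟩, fun K γ β hK hγ hβ hbal h0 => ?_,
    fun b h0 => ⟨MHD.modes_parIncompressible hpos h0, MHD.growth_parIncompressible hpos h0⟩⟩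
  obtain ⟨β, rfl⟩ : ∃ β' : MHD.Coef, β'.1 = β := ⟨⟨β, hβ⟩, rfl⟩
  exact ⟨MHD.modes_perpCompressible hpos hK hγ hbal h0,
    MHD.growth_perpCompressible hpos hK hγ hbal h0⟩
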